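/- Let $\mathbb F\in\{\mathbb R,\mathbb C,\mathbb K,\mathbb O\}$ (reals, complex numbers, quaternions, octonions), let $m\ge 1$ with $m=2$ if $\mathbb F=\mathbb O$, and put $n=m\dim_{\mathbb R}\mathbb F$; assume $n\ge 2$. Let $\mathbb H^m_{\mathbb F}$ be the hyperbolic space over $\mathbb F$: the unit ball of $\mathbb F^m$ with the Riemannian metric $$c\;\mathrm{Re}\sum_{i,j}\bar v_i\,(g_{ij}u_j),\qquad g_{ij}=\frac{\delta_{ij}}{1-|z|^2}+\frac{z_i\bar z_j}{(1-|z|^2)^2},$$ where $c>0$ is any fixed normalizing constant ($c=1$ for $\mathbb F=\mathbb R$ and $c=4$ otherwise give the usual normalizations, with sectional curvature $-1$ if $\mathbb F=\mathbb R$ or $m=1$, and in $[-1,-1/4]$ otherwise). Let $\mathbb H^m_{\mathbb F}\times\mathbb R$ carry the product metric and let $P_t=\mathbb H^m_{\mathbb F}\times\{t\}$ be its horizontal hyperplanes. A hypersurface $\Sigma$ is a smooth immersed $n$-manifold in $\mathbb H^m_{\mathbb F}\times\mathbb R$; it is complete if its induced metric is. It is $r$-minimal if the $r$-th elementary symmetric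 function of its principal curvatures vanishes identically. It is rotational with axis $\{o\}\times\mathbb R$ if, whenever $\Sigma$ is transversal to $P_t$, every connected component of the section $\Sigma\cap P_t$ (taken in $\Sigma$) lies in a geodesic sphere of $P_t$ centered at $(o,t)$. Let $S_\lambda(o)$ and $B_\lambda(o)$ be the geodesic sphere and the open geodesic ball of $\mathbb H^m_{\mathbb F}$ of center $o$ and radius $\lambda$. **Theorem.** Let $r\in\{1,\dots,n\}$ and $o\in\mathbb H^m_{\mathbb F}$. There is a one-parameter family $\mathscr S=\{\Sigma(\lambda):\lambda>0\}$ of complete embedded rotational $r$-minimal hypersurfaces of $\mathbb H^m_{\mathbb F}\times\mathbb R$ with axis $\{o\}\times\mathbb R$, all homeomorphic to the $n$-annulus $\mathbb S^{n-1}\times\mathbb R$, such that: (i) If $r=n$, then $\Sigma(\lambda)=S_\lambda(o)\times\mathbb R$ is the cylinder over the geodesic sphere of radius $\lambda$. (ii) If $r<n$, then $\Sigma(\lambda)$ is catenoid-type: it is symmetric with respect to $P_0$; $P_0\cap\Sigma(\lambda)=S_\lambda(o)\times\{0\}$; and its parts in $\{t\ge 0\}$ and $\{t\le 0\}$ are the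 rotational graphs of $\phi(\mathrm{dist}(o,\cdot))$ and $-\phi(\mathrm{dist}(o,\cdot))$ over $\mathbb H^m_{\mathbb F}\setminus B_\lambda(o)$, where $\phi=\phi_\lambda:[\lambda,\infty)\to\mathbb R$ is continuous with $\phi(\lambda)=0$ and is smooth with $\phi'>0$ on $(\lambda,\infty)$. Each horizontal hyperplane $P_t$ is also a complete embedded rotational $r$-minimal hypersurface, homeomorphic to $\mathbb R^n$. Conversely, if $\Sigma$ is any complete connected rotational $r$-minimal hypersurface of $\mathbb H^m_{\mathbb F}\times\mathbb R$ (with any axis), then either the image of $\Sigma$ is a horizontal hyperplane, or some isometry of $\mathbb H^m_{\mathbb F}\times\mathbb R$ maps the image of $\Sigma$ onto a member of $\mathscr S$. -/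

import Mathlib

open Set Filter Topology MeasureTheory
open scoped Manifold ContDiff ENNReal Quaternion

noncomputable section

/-! ### The four real normed division algebras -/

/-- The octonions, obtained from the quaternions by Cayley-Dickson doubling, with the Euclidean
inner product of `ℍ × ℍ`. -/
def Octonion : Type := WithLp 2 (ℍ[ℝ] × ℍ[ℝ])

namespace Octonion

instance : NormedAddCommGroup Octonion := inferInstanceAs (NormedAddCommGroup (WithLp 2 (ℍ[ℝ] × ℍ[ℝ])))

instance : InnerProductSpace ℝ Octonion :=
  inferInstanceAs (InnerProductSpace ℝ (WithLp 2 (ℍ[ℝ] × ℍ[ℝ])))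

/-- The octonion `a + b ℓ` with quaternions `a`, `b`. -/
def mk (a b : ℍ[ℝ]) : Octonion := WithLp.toLp 2 (a, b)

/-- The first quaternionic component of an octonion. -/
def fst (x : Octonion) : ℍ[ℝ] := (WithLp.ofLp x : ℍ[ℝ] × ℍ[ℝ]).1

/-- The second quaternionic component of an octonion. -/
def snd (x : Octonion) : ℍ[ℝ] := (WithLp.ofLp x : ℍ[ℝ] × ℍ[ℝ]).2

/-- `(a, b) (c, d) = (a c - d̄ b, d a + b c̄)`. -/
instance : Mul Octonion :=
  ⟨fun x y => mk (x.fst * y.fst - star y.snd * x.snd) (y.snd * x.fst + x.snd * star y.fst)⟩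

/-- Conjugation `(a, b) ↦ (ā, -b)`. -/
instance : Star Octonion := ⟨fun x => mk (star x.fst) (-x.snd)⟩

end Octonion

/-- Labels for the normed division algebras `ℝ`, `ℂ`, `ℍ` (quaternions), `𝕆` (octonions). -/
inductive DivAlg : Type
  | real
  | complex
  | quaternion
  | octonion

namespace DivAlg

/-- The algebra `𝔽` itself. -/
def Carrier : DivAlg → Type
  | real => ℝ
  | complex => ℂ
  | quaternion => ℍ[ℝ]
  | octonion => Octonion

/-- The real dimension of `𝔽`. -/
def dim : DivAlg → ℕ
  | real => 1
  | complex => 2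
  | quaternion => 4
  | octonion => 8

instance instNormedAddCommGroup : (F : DivAlg) → NormedAddCommGroup F.Carrier
  | real => inferInstanceAs (NormedAddCommGroup ℝ)
  | complex => inferInstanceAs (NormedAddCommGroup ℂ)
  | quaternion => inferInstanceAs (NormedAddCommGroup ℍ[ℝ])
  | octonion => inferInstanceAs (NormedAddCommGroup Octonion)

instance instInnerProductSpace : (F : DivAlg) → InnerProductSpace ℝ F.Carrier
  | real => inferInstanceAs (InnerProductSpace ℝ ℝ)
  | complex => inferInstanceAs (InnerProductSpace ℝ ℂ)
  | quaternion => inferInstanceAs (InnerProductSpace ℝ ℍ[ℝ])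
  | octonion => inferInstanceAs (InnerProductSpace ℝ Octonion)

instance instMul : (F : DivAlg) → Mul F.Carrier
  | real => inferInstanceAs (Mul ℝ)
  | complex => inferInstanceAs (Mul ℂ)
  | quaternion => inferInstanceAs (Mul ℍ[ℝ])
  | octonion => inferInstanceAs (Mul Octonion)

instance instStar : (F : DivAlg) → Star F.Carrier
  | real => inferInstanceAs (Star ℝ)
  | complex => inferInstanceAs (Star ℂ)
  | quaternion => inferInstanceAs (Star ℍ[ℝ])
  | octonion => inferInstanceAs (Star Octonion)

end DivAlg

/-! ### Riemannian metrics on open subsets of a normed space -/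

/-- A (candidate) Riemannian metric in a global chart: `g p X Y` is the inner product of the
tangent vectors `X`, `Y` at the point `p`. -/
abbrev MetricTensor (P : Type*) : Type _ := P → P → P → ℝ

section Riemannian

variable {P : Type*} [NormedAddCommGroup P] [NormedSpace ℝ P]

/-- Length of the curve `γ : [0, 1] → P` for the metric `g`. -/
def curveLength (g : MetricTensor P) (γ : ℝ → P) : ℝ≥0∞ :=
  ∫⁻ t in Icc (0 : ℝ) 1,
    ENNReal.ofReal (Real.sqrt
      (g (γ t) (derivWithin γ (Icc 0 1) t) (derivWithin γ (Icc 0 1) t)))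

/-- Riemannian distance on the open set `U` with the metric `g`: infimum of the lengths of the
`C¹` curves in `U` joining the two points. -/
def riemannDist (U : Set P) (g : MetricTensor P) (p q : P) : ℝ≥0∞ :=
  ⨅ (γ : ℝ → P) (_ : ContDiffOn ℝ 1 γ (Icc 0 1) ∧ MapsTo γ (Icc 0 1) U ∧ γ 0 = p ∧ γ 1 = q),
    curveLength g γ

/-- Christoffel symbols of the first kind (Koszul formula for constant vector fields):
`g (∇_X Y, Z)` at `p`, for the Levi-Civita connection `∇` and constant `X`, `Y`, `Z`. -/
def christoffel (g : MetricTensor P) (p X Y Z : P) : ℝ :=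
  (fderiv ℝ (fun q => g q Y Z) p X + fderiv ℝ (fun q => g q X Z) p Y
    - fderiv ℝ (fun q => g q X Y) p Z) / 2

/-- `Φ` restricts to an isometry of the Riemannian manifold `(U, g)` onto itself. -/
structure IsIsometryOf (U : Set P) (g : MetricTensor P) (Φ : P → P) : Prop where
  bijOn : BijOn Φ U U
  smooth : ContDiffOn ℝ ∞ Φ U
  pullback : ∀ p ∈ U, ∀ X Y : P, g (Φ p) (fderiv ℝ Φ p X) (fderiv ℝ Φ p Y) = g p X Y

/-! ### Immersed hypersurfaces -/

variable {n : ℕ} {N : Type*} [TopologicalSpace N] [ChartedSpace (EuclideanSpace ℝ (Fin n)) N]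

/-- The differential at `x` of a map from the `n`-manifold `N` to the vector space `P`. -/
def tangentMapAt (n : ℕ) [ChartedSpace (EuclideanSpace ℝ (Fin n)) N] (f : N → P) (x : N) :
    EuclideanSpace ℝ (Fin n) →L[ℝ] P :=
  mfderiv (𝓡 n) 𝓘(ℝ, P) f x

/-- `f` is a smooth immersion of the `n`-manifold `N` into the open set `U` of `P`. -/
structure IsImmersionInto (n : ℕ) [ChartedSpace (EuclideanSpace ℝ (Fin n)) N]
    (U : Set P) (f : N → P) : Prop where
  mem : ∀ x, f x ∈ U
  smooth : ContMDiff (𝓡 n) 𝓘(ℝ, P) ∞ f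
  immersive : ∀ x, Function.Injective (tangentMapAt n f x)

/-- `ν` is, on the open set `W` of `N`, a smooth unit normal field along the immersion `f`. -/
structure IsUnitNormalOn (n : ℕ) [ChartedSpace (EuclideanSpace ℝ (Fin n)) N]
    (g : MetricTensor P) (f ν : N → P) (W : Set N) : Prop where
  smooth : ContMDiffOn (𝓡 n) 𝓘(ℝ, P) ∞ ν W
  unit : ∀ y ∈ W, g (f y) (ν y) (ν y) = 1
  normal : ∀ y ∈ W, ∀ u, g (f y) (tangentMapAt n f y u) (ν y) = 0

/-- `A` is the shape operator of `f` at `x` with respect to the normal field `ν`, that is,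
`df (A u) = - ∇_u ν` for all `u`, where `∇` is the Levi-Civita connection of `g`. -/
def IsShapeOperatorAt (g : MetricTensor P) (f ν : N → P) (x : N)
    (A : Module.End ℝ (EuclideanSpace ℝ (Fin n))) : Prop :=
  ∀ (u : EuclideanSpace ℝ (Fin n)) (Z : P),
    g (f x) (tangentMapAt n f x (A u)) Z =
      -(g (f x) (tangentMapAt n ν x u) Z + christoffel g (f x) (tangentMapAt n f x u) (ν x) Z)

/-- The (non normalized) `r`-th mean curvature of a shape operator: the `r`-th elementary symmetric
function of the principal curvatures, i.e. of its eigenvalues counted with multiplicity. -/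
def rMeanCurvature (A : Module.End ℝ (EuclideanSpace ℝ (Fin n))) (r : ℕ) : ℝ :=
  A.charpoly.roots.esymm r

/-- The immersion `f` is `r`-minimal: its `r`-th mean curvature vanishes identically. (The vanishing
does not depend on the choice of the local unit normal field.) -/
def IsRMinimal (n : ℕ) [ChartedSpace (EuclideanSpace ℝ (Fin n)) N]
    (g : MetricTensor P) (f : N → P) (r : ℕ) : Prop :=
  ∀ x : N, ∃ (W : Set N) (ν : N → P) (A : Module.End ℝ (EuclideanSpace ℝ (Fin n))),
    IsOpen W ∧ x ∈ W ∧ IsUnitNormalOn n g f ν W ∧ IsShapeOperatorAt g f ν x A ∧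
      rMeanCurvature A r = 0

/-- The distance on `N` of the metric induced by the immersion `f`. -/
def inducedDist (n : ℕ) [ChartedSpace (EuclideanSpace ℝ (Fin n)) N]
    (g : MetricTensor P) (f : N → P) (x y : N) : ℝ≥0∞ :=
  ⨅ (γ : ℝ → N) (_ : ContMDiffOn 𝓘(ℝ, ℝ) (𝓡 n) 1 γ (Icc 0 1) ∧ γ 0 = x ∧ γ 1 = y),
    curveLength g (f ∘ γ)

/-- The metric induced on `N` by the immersion `f` is complete. -/
def IsCompleteImmersion (n : ℕ) [ChartedSpace (EuclideanSpace ℝ (Fin n)) N]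
    (g : MetricTensor P) (f : N → P) : Prop :=
  ∀ x : ℕ → N,
    (∀ ε : ℝ≥0∞, 0 < ε → ∃ K, ∀ i ≥ K, ∀ j ≥ K, inducedDist n g f (x i) (x j) < ε) →
      ∃ y, Tendsto x atTop (𝓝 y)

end Riemannian

/-! ### The hyperbolic spaces `ℍ_𝔽^m` and the products `ℍ_𝔽^m × ℝ` -/

section Hyperbolic

variable (F : DivAlg) (m : ℕ)

/-- The vector space `𝔽^m` with its Euclidean norm. -/
abbrev FSpace : Type := PiLp 2 (fun _ : Fin m => F.Carrier)

/-- The unit ball of `𝔽^m`, the underlying manifold of `ℍ_𝔽^m`. -/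
def hypBall : Set (FSpace F m) := Metric.ball 0 1

/-- The metric of `ℍ_𝔽^m` in the ball model, multiplied by the normalizing constant `c`: the real
part `Re ∑ v̄ᵢ gᵢⱼ uⱼ` of the Hermitian form with coefficients
`gᵢⱼ = δᵢⱼ / (1 - |z|²) + zᵢ z̄ⱼ / (1 - |z|²)²`, where `Re (v̄ w)` is the inner product
of `w` and `v` in `𝔽`. -/
def hypMetric (c : ℝ) : MetricTensor (FSpace F m) := fun z u v =>
  c * (inner ℝ u v / (1 - ‖z‖ ^ 2) +
    (∑ i, ∑ j, inner ℝ ((z i * star (z j)) * u j) (v i)) / (1 - ‖z‖ ^ 2) ^ 2)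

/-- The underlying open set of `ℍ_𝔽^m × ℝ`. -/
def hypProd : Set (FSpace F m × ℝ) := hypBall F m ×ˢ univ

/-- The product metric of `ℍ_𝔽^m × ℝ`. -/
def prodMetric (c : ℝ) : MetricTensor (FSpace F m × ℝ) := fun p X Y =>
  hypMetric F m c p.1 X.1 Y.1 + X.2 * Y.2

/-- The Riemannian distance of `ℍ_𝔽^m`. -/
def hypDist (c : ℝ) (p q : FSpace F m) : ℝ≥0∞ := riemannDist (hypBall F m) (hypMetric F m c) p q

/-- The geodesic sphere of `ℍ_𝔽^m` with center `o` and radius `s`. -/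
def hypSphere (c : ℝ) (o : FSpace F m) (s : ℝ) : Set (FSpace F m) :=
  {p | p ∈ hypBall F m ∧ hypDist F m c o p = ENNReal.ofReal s}

/-- The horizontal hyperplane `P_t = ℍ_𝔽^m × {t}`. -/
def horizontalHyperplane (t : ℝ) : Set (FSpace F m × ℝ) := hypBall F m ×ˢ {t}

variable {F m} {n : ℕ} {N : Type*} [TopologicalSpace N]

/-- `f` is rotational with axis `{o} × ℝ`: whenever `f` is transversal to `P_t`, each connected
component of the horizontal section `{y | f y ∈ P_t}` is mapped into a geodesic sphere of `P_t`
centered at `(o, t)`. Transversality at a point means that the tangent space is not horizontal. -/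
def IsRotationalAbout (n : ℕ) [ChartedSpace (EuclideanSpace ℝ (Fin n)) N]
    (c : ℝ) (o : FSpace F m) (f : N → FSpace F m × ℝ) : Prop :=
  ∀ t : ℝ, (∀ x, (f x).2 = t → ∃ u, (tangentMapAt n f x u).2 ≠ 0) →
    ∀ x, (f x).2 = t → ∃ s : ℝ, 0 < s ∧
      ∀ y ∈ connectedComponentIn {y | (f y).2 = t} x, (f y).1 ∈ hypSphere F m c o s

/-- `f` is a complete `r`-minimal immersed hypersurface of `ℍ_𝔽^m × ℝ` (with its metric normalized
by `c`) which is rotational with axis `{o} × ℝ`. -/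
structure IsCompleteRotationalRMinimal (n : ℕ) [ChartedSpace (EuclideanSpace ℝ (Fin n)) N]
    (c : ℝ) (o : FSpace F m) (r : ℕ) (f : N → FSpace F m × ℝ) : Prop where
  immersion : IsImmersionInto n (hypProd F m) f
  complete : IsCompleteImmersion n (prodMetric F m c) f
  rotational : IsRotationalAbout n c o f
  rMinimal : IsRMinimal n (prodMetric F m c) f r

/-- `S` is an embedded complete `r`-minimal rotational hypersurface with axis `{o} × ℝ` and
topological type `T`: the image of a smooth embedding, with these properties, of an `n`-manifold
homeomorphic to `T`. -/
def IsEmbeddedCompleteRotationalRMinimal (T : Type) [TopologicalSpace T] (n : ℕ) (c : ℝ)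
    (o : FSpace F m) (r : ℕ) (S : Set (FSpace F m × ℝ)) : Prop :=
  ∃ (N : Type) (_ : TopologicalSpace N) (_ : ChartedSpace (EuclideanSpace ℝ (Fin n)) N)
    (_ : IsManifold (𝓡 n) ∞ N) (f : N → FSpace F m × ℝ),
    Nonempty (N ≃ₜ T) ∧ IsEmbedding f ∧ IsCompleteRotationalRMinimal n c o r f ∧ range f = S

/-- The `n`-annulus `𝕊^{n-1} × ℝ`. -/
abbrev Annulus (n : ℕ) : Type := Metric.sphere (0 : EuclideanSpace ℝ (Fin n)) 1 × ℝ

/-- `S` is catenoid-type with axis `{o} × ℝ` and neck of radius `l`: it is symmetric with respect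
to `P_0`, it meets `P_0` in the geodesic sphere of radius `l` centered at `o`, and its parts above
and below `P_0` are the graphs of `φ (dist (o, p))` and `-φ (dist (o, p))` over the complement of
the open ball of radius `l`, for some radial profile `φ`, increasing and smooth away from the
neck. -/
structure IsCatenoidType (c : ℝ) (o : FSpace F m) (l : ℝ) (S : Set (FSpace F m × ℝ)) : Prop where
  symm : ∀ p t, (p, t) ∈ S ↔ (p, -t) ∈ S
  neck : S ∩ horizontalHyperplane F m 0 = hypSphere F m c o l ×ˢ {0}
  graph : ∃ φ : ℝ → ℝ, ContinuousOn φ (Ici l) ∧ ContDiffOn ℝ ∞ φ (Ioi l) ∧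
    (∀ s ∈ Ioi l, 0 < deriv φ s) ∧ φ l = 0 ∧
    {q ∈ S | 0 ≤ q.2} = {q | q.1 ∈ hypBall F m ∧ ENNReal.ofReal l ≤ hypDist F m c o q.1 ∧
      q.2 = φ (hypDist F m c o q.1).toReal} ∧
    {q ∈ S | q.2 ≤ 0} = {q | q.1 ∈ hypBall F m ∧ ENNReal.ofReal l ≤ hypDist F m c o q.1 ∧
      q.2 = -φ (hypDist F m c o q.1).toReal}

end Hyperbolic

end

/-!
Write `ρ` for the Euclidean distance of a point of the ball to the origin, and `h` for the height
in the product of the ball with the line. Both the existence and the classification come from an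
ordinary differential equation for the slope `v` of the profile curve, the derivative of the
hyperbolic distance to the axis with respect to `h`.

*Homogeneity.* It is enough to treat the axis through the origin. Points of the ball are moved to
the origin by unitary maps, which take them to the real half-line of the first coordinate, and by
the boosts `(x, y) ↦ ((x + r) (1 + r x)⁻¹, √(1 - r²) y (1 + r x)⁻¹)`. In the associative case,
Hermitian reflections give enough unitary maps; in the octonionic plane, the involutions
`(u, v) ↦ (ρ u + w v, w̄ u - ρ v)` do (`exists_isUnitary_eq_single`). That boosts are isometries
(`isIsometryPair_boost`) is a statement about pairs of coordinates; for the pairs which occur when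
`m = 2` it follows from the Moufang identities (`crossForm_boost`).

*Geometry of the ball.* All computations use only that the metric is given by a trilinear form `B`
for which `B z z` is `|z|²` times the orthogonal projection to a subspace of dimension `dim 𝔽`
containing `z` (`IsLineForm`). The distance to the origin is `√c / 2 * log ((1 + ρ) / (1 - ρ))`
(`riemannDist_zero`).

*The profile equation.* On a rotational hypersurface, `ρ` is constant on the components of the
regular horizontal sections. By Sard's theorem (`volume_criticalValues_eq_zero`) the regular heights
are dense, so that at all points with non-horizontal tangent space `ρ` is stationary along the
horizontal tangent vectors (`IsRadialRMinimal.inner_eq_zero`) and `dρ` is a multiple of `dh`. The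
principal curvatures are then those of the geodesic spheres, up to a factor, and that of the profile
curve, so `r`-minimality means `√c ρ dv = Q(ρ²) (1 + v²) dh` (`esymm_shape_eq_zero_iff`), where `Q`
is the quotient of two consecutive symmetric functions of the curvatures of the spheres. It is zero
for `r = n` and positive for `r < n`.

*Classification.* With a primitive `P` of `Q` in the variable `log (ρ² / (1 - ρ²))`, the energy
`exp P / (1 + v²)` is constant. Since `1 / (1 + v²) = 1 - ν₂²`, where `ν₂` is the vertical component
of the unit normal, the energy extends continuously by zero to the points with horizontal tangent
space. Therefore a connected hypersurface has either only horizontal tangent spaces or none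
(`horizontal_or_first_integral`). In the first case it covers a hyperplane (`range_of_horizontal`).
In the second case with `r < n`, the first integral gives `ρ` as a function of `v`, and the profile
equation gives `h`: the hypersurface covers a catenoid (`range_of_lt`). If `r = n`, the slope is
constant, and it is zero, for otherwise the hypersurface would be a piece of a cone, whose vertex is
at finite distance (`range_of_eq`). That the whole model surface is covered follows from
completeness, by lifting segments (`mem_range_of_segment`).

*Existence.* The slope is a global regular parameter of the profile of a catenoid (`IsProfile`,
`isProfile_catenoid`), from which the rotational hypersurface is generated as an embedding of the
punctured space. It is complete because it is properly embedded in the product, whose metric is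
complete (`isCompleteImmersion_of_tendsto`).
-/

noncomputable section

/-! ### Straightening a function and Sard's theorem for real functions -/

/-- The local inverse of a function which is smooth near `x` is smooth near its image. -/
theorem eventually_contDiffAt_symm {E F : Type*} [NormedAddCommGroup E] [NormedSpace ℝ E]
    [CompleteSpace E] [NormedAddCommGroup F] [NormedSpace ℝ F] (e : OpenPartialHomeomorph E F)
    {x : E} (hx : x ∈ e.source) (he : ∀ᶠ y in 𝓝 x, ContDiffAt ℝ ∞ e y) {L : E ≃L[ℝ] F}
    (hL : HasFDerivAt e (L : E →L[ℝ] F) x) : ∀ᶠ p in 𝓝 (e x), ContDiffAt ℝ ∞ e.symm p := by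
  have hc : ContinuousAt (fderiv ℝ e) x := by
    have h1 : ContDiffAt ℝ 1 e x := he.self_of_nhds.of_le (by simp)
    exact (h1.fderiv_right (m := 0) (by simp)).continuousAt
  have h2 : ∀ᶠ y in 𝓝 x, fderiv ℝ e y ∈ range ((↑) : (E ≃L[ℝ] F) → E →L[ℝ] F) :=
    hc.eventually (hL.fderiv ▸ ContinuousLinearEquiv.nhds L)
  have h3 := (e.continuousAt_symm (e.map_source hx))
  rw [ContinuousAt, e.left_inv hx] at h3
  filter_upwards [h3.eventually (he.and h2), e.open_target.mem_nhds (e.map_source hx)]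
    with p ⟨hp1, L', hL'⟩ hpt
  refine e.contDiffAt_symm (f₀' := L') hpt ?_ hp1
  rw [hL']
  exact (hp1.differentiableAt (by simp)).hasFDerivAt

/-- Near a point where `w` is not critical, `w` is the first coordinate of a smooth local
coordinate system, and the coordinate slice is tangent to the kernel of the differential. -/
theorem exists_straightening {E : Type*} [NormedAddCommGroup E] [NormedSpace ℝ E]
    [FiniteDimensional ℝ E] {w : E → ℝ} {x : E} (hw : ∀ᶠ y in 𝓝 x, ContDiffAt ℝ ∞ w y)
    (hx : fderiv ℝ w x ≠ 0) :
    ∃ e : OpenPartialHomeomorph E (ℝ × (fderiv ℝ w x).ker), x ∈ e.source ∧ e x = (w x, 0) ∧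
      (∀ y, (e y).1 = w y) ∧ (∀ᶠ p in 𝓝 (w x, 0), ContDiffAt ℝ ∞ e.symm p) ∧
      HasFDerivAt (fun q => e.symm (w x, q)) (fderiv ℝ w x).ker.subtypeL 0 := by
  set L := fderiv ℝ w x with hL
  obtain ⟨u0, hu0⟩ : ∃ u, L u ≠ 0 := by
    by_contra! h
    exact hx (ContinuousLinearMap.ext h)
  set u := (L u0)⁻¹ • u0
  have hu : L u = 1 := by simp [u, hu0]
  have hmem : ∀ y, y - L y • u ∈ L.ker := fun y => by simp [hu]
  let pl : E →ₗ[ℝ] L.ker := LinearMap.codRestrict L.ker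
    ((LinearMap.id : E →ₗ[ℝ] E) - (L : E →ₗ[ℝ] ℝ).smulRight u) (fun y => by simp [hu])
  let p : E →L[ℝ] L.ker := LinearMap.toContinuousLinearMap pl
  have hp : ∀ y, ((p y : L.ker) : E) = y - L y • u := fun y => rfl
  let Φ : E ≃L[ℝ] ℝ × L.ker := ContinuousLinearEquiv.equivOfInverse (L.prod p)
    ((ContinuousLinearMap.fst ℝ ℝ L.ker).smulRight u + L.ker.subtypeL.comp
      (ContinuousLinearMap.snd ℝ ℝ L.ker)) (fun y => by simp [hp]) (by
        rintro ⟨r, q⟩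
        have hq : L (q : E) = 0 := q.2
        ext
        · simp [hu, hq]
        · simp [hu, hq, hp])
  let g : E → ℝ × L.ker := fun y => (w y, p (y - x))
  have hg0 : ∀ᶠ y in 𝓝 x, ContDiffAt ℝ ∞ g y := hw.mono fun y hy => hy.prodMk (by fun_prop)
  have hg : ContDiffAt ℝ ∞ g x := hg0.self_of_nhds
  have hg' : HasFDerivAt g (Φ : E →L[ℝ] ℝ × L.ker) x := by
    have h1 : HasFDerivAt w L x := (hw.self_of_nhds.differentiableAt (by simp)).hasFDerivAt
    have h2 : HasFDerivAt (fun y => p (y - x)) p x :=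
      p.hasFDerivAt.comp x (hasFDerivAt_sub_const x)
    exact h1.prodMk h2
  have hgx : g x = (w x, 0) := by simp [g]
  let e := hg.toOpenPartialHomeomorph g hg' (by simp)
  have hxe : x ∈ e.source := hg.mem_toOpenPartialHomeomorph_source hg' (by simp)
  have hcoe : ∀ y, e y = g y := fun y => rfl
  have hsymm : ∀ᶠ p in 𝓝 (g x), ContDiffAt ℝ ∞ e.symm p :=
    eventually_contDiffAt_symm e hxe hg0 hg'
  refine ⟨e, hxe, by rw [hcoe, hgx], fun y => rfl, hgx ▸ hsymm, ?_⟩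
  have h3 : HasFDerivAt e.symm (Φ.symm : ℝ × L.ker →L[ℝ] E) (w x, (0 : L.ker)) := by
    rw [← hgx]
    refine e.hasFDerivAt_symm (e.map_source hxe) ?_
    have : e.symm (g x) = x := e.left_inv hxe
    rw [this]; exact hg'
  have h4 : HasFDerivAt (fun q : L.ker => (w x, q)) (ContinuousLinearMap.inr ℝ ℝ L.ker) 0 :=
    hasFDerivAt_prodMk_right (w x) 0
  have := h3.comp 0 h4
  refine this.congr_fderiv ?_
  ext q
  have : (Φ.symm : ℝ × L.ker →L[ℝ] E) (0, q) = (0 : ℝ) • u + q := rfl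
  simpa using this

/-- A function which is smooth near a point has the germ of a globally smooth function. -/
theorem exists_contDiff_eventuallyEq {E : Type*} [NormedAddCommGroup E] [NormedSpace ℝ E]
    [FiniteDimensional ℝ E] {g : E → ℝ} {x : E} (hg : ∀ᶠ y in 𝓝 x, ContDiffAt ℝ ∞ g y) :
    ∃ g' : E → ℝ, ContDiff ℝ ∞ g' ∧ g' =ᶠ[𝓝 x] g := by
  obtain ⟨ε, hε, hb⟩ := Metric.eventually_nhds_iff_ball.1 hg
  let φ : ContDiffBump x := ⟨ε / 4, ε / 2, by positivity, by linarith⟩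
  refine ⟨fun y => φ y * g y, ?_, ?_⟩
  · rw [contDiff_iff_contDiffAt]
    intro y
    by_cases hy : y ∈ Metric.ball x ε
    · exact φ.contDiffAt.mul (hb y hy)
    · have hcl : tsupport φ = Metric.closedBall x (ε / 2) := φ.tsupport_eq
      have : y ∉ tsupport φ := by
        rw [hcl, Metric.mem_closedBall]; rw [Metric.mem_ball] at hy; push Not at hy ⊢; linarith
      have h0 : (fun y => φ y * g y) =ᶠ[𝓝 y] fun _ => 0 := by
        filter_upwards [(isClosed_tsupport φ).isOpen_compl.mem_nhds this] with z hz
        rw [image_eq_zero_of_notMem_tsupport hz, zero_mul]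
      exact contDiffAt_const.congr_of_eventuallyEq h0
  · filter_upwards [φ.eventuallyEq_one] with y hy
    simp [hy]

theorem volume_image_eq_zero_of_locally {E : Type*} [TopologicalSpace E]
    [SecondCountableTopology E] {g : E → ℝ} {s : Set E}
    (h : ∀ x ∈ s, ∃ O ∈ 𝓝 x, volume (g '' (s ∩ O)) = 0) : volume (g '' s) = 0 := by
  choose! O hO hv using h
  obtain ⟨t, hts, htc, ht⟩ := TopologicalSpace.countable_cover_nhdsWithin
    (fun x hx => mem_nhdsWithin_of_mem_nhds (hO x hx))
  have : g '' s ⊆ ⋃ x ∈ t, g '' (s ∩ O x) := by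
    rintro _ ⟨y, hy, rfl⟩
    obtain ⟨x, hx, hyx⟩ := mem_iUnion₂.1 (ht hy)
    exact mem_iUnion₂.2 ⟨x, hx, y, ⟨hy, hyx⟩, rfl⟩
  exact measure_mono_null this ((measure_biUnion_null_iff htc).2 fun x hx => hv x (hts hx))

/-- A smooth function is Hölder with exponent `k + 1` on the set of the points at which its
derivatives of orders `1, …, k` vanish, locally. -/
theorem norm_sub_le_of_iteratedFDeriv_eq_zero {E : Type*} [NormedAddCommGroup E]
    [NormedSpace ℝ E] {g : E → ℝ} (hg : ContDiff ℝ ∞ g) {k : ℕ} {s : Set E} (hs : Convex ℝ s)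
    {K : ℝ} (hK : ∀ y ∈ s, ‖iteratedFDeriv ℝ (k + 1) g y‖ ≤ K) {x : E} (hxs : x ∈ s)
    (hx : ∀ j, 1 ≤ j → j ≤ k → iteratedFDeriv ℝ j g x = 0) {y : E} (hy : y ∈ s) :
    ‖g y - g x‖ ≤ K * ‖y - x‖ ^ (k + 1) := by
  have hK0 : 0 ≤ K := (norm_nonneg _).trans (hK x hxs)
  have hd : ∀ j, Differentiable ℝ (iteratedFDeriv ℝ j g) := fun j =>
    hg.differentiable_iteratedFDeriv (by exact_mod_cast ENat.natCast_lt_top j)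
  have key : ∀ i, i ≤ k → ∀ y ∈ s, ‖iteratedFDeriv ℝ (k + 1 - i) g y‖ ≤ K * ‖y - x‖ ^ i := by
    intro i
    induction i with
    | zero => intro _ y hy; simpa using hK y hy
    | succ i ih =>
      intro hi y hy
      have hj : k + 1 - i = (k + 1 - (i + 1)) + 1 := by omega
      have h1 := (hs.inter (convex_closedBall x ‖y - x‖)).norm_image_sub_le_of_norm_fderiv_le
        (f := iteratedFDeriv ℝ (k + 1 - (i + 1)) g) (𝕜 := ℝ) (C := K * ‖y - x‖ ^ i)
        (fun z _ => (hd _) z) (fun z hz => by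
          rw [norm_fderiv_iteratedFDeriv, ← hj]
          refine (ih (by omega) z hz.1).trans ?_
          have := hz.2
          rw [mem_closedBall_iff_norm] at this
          gcongr) ⟨hxs, by simp⟩ ⟨hy, by simp [dist_eq_norm]⟩
      rw [hx _ (by omega) (by omega), sub_zero] at h1
      rw [pow_succ, ← mul_assoc]; exact h1
  have h1 := (hs.inter (convex_closedBall x ‖y - x‖)).norm_image_sub_le_of_norm_fderiv_le
        (f := g) (𝕜 := ℝ) (C := K * ‖y - x‖ ^ k)
        (fun z _ => (hg.differentiable (by simp)) z) (fun z hz => by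
          have h2 := key k le_rfl z hz.1
          have h3 : k + 1 - k = 1 := by omega
          rw [h3, ← norm_fderiv_iteratedFDeriv (n := 0)] at h2
          have h4 : ‖fderiv ℝ g z‖ = ‖fderiv ℝ (iteratedFDeriv ℝ 0 g) z‖ := by
            rw [norm_fderiv_iteratedFDeriv, zero_add, norm_iteratedFDeriv_one]
          rw [h4]
          refine h2.trans ?_
          have := hz.2
          rw [mem_closedBall_iff_norm] at this
          gcongr) ⟨hxs, by simp⟩ ⟨hy, by simp [dist_eq_norm]⟩
  rw [pow_succ, ← mul_assoc]; exact h1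

/-- If the first `dim E` derivatives of `g` vanish on `s`, then by Taylor's formula `g` is locally
Hölder on `s` of exponent `dim E + 1`, so that the image has Hausdorff dimension less than one. -/
theorem volume_image_flat_eq_zero {E : Type*} [NormedAddCommGroup E] [NormedSpace ℝ E]
    [FiniteDimensional ℝ E] {g : E → ℝ} (hg : ContDiff ℝ ∞ g) {s : Set E}
    (hs : ∀ x ∈ s, ∀ j, 1 ≤ j → j ≤ Module.finrank ℝ E → iteratedFDeriv ℝ j g x = 0) :
    volume (g '' s) = 0 := by
  set k := Module.finrank ℝ E
  have hr : (0 : NNReal) < k + 1 := by positivity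
  have hdim : dimH (g '' s) ≤ dimH s / ((k + 1 : NNReal) : ℝ≥0∞) := by
    refine dimH_image_le_of_locally_holder_on hr fun x hx => ?_
    have hc : ContinuousOn (fun y => ‖iteratedFDeriv ℝ (k + 1) g y‖) (Metric.closedBall x 1) :=
      (hg.continuous_iteratedFDeriv (m := k + 1)
        (by exact_mod_cast le_top)).norm.continuousOn
    obtain ⟨K, hK⟩ := (isCompact_closedBall x 1).bddAbove_image hc
    refine ⟨K.toNNReal, s ∩ Metric.closedBall x 1,
      inter_mem_nhdsWithin s (Metric.closedBall_mem_nhds x one_pos), ?_⟩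
    intro a ha b hb
    have hKb : ∀ y ∈ Metric.closedBall x 1, ‖iteratedFDeriv ℝ (k + 1) g y‖ ≤ K :=
      fun y hy => hK (mem_image_of_mem _ hy)
    have hK0 : 0 ≤ K := (norm_nonneg _).trans (hKb b hb.2)
    have h1 := norm_sub_le_of_iteratedFDeriv_eq_zero hg (convex_closedBall x 1) hKb hb.2
      (hs b hb.1) ha.2
    rw [edist_dist, edist_dist, dist_eq_norm, dist_eq_norm]
    have h2 : ENNReal.ofReal ‖a - b‖ ^ (((k : NNReal) + 1 : NNReal) : ℝ) =
        ENNReal.ofReal (‖a - b‖ ^ (k + 1)) := by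
      rw [ENNReal.ofReal_pow (norm_nonneg _), ← ENNReal.rpow_natCast]; simp
    rw [h2, show ((K.toNNReal : NNReal) : ℝ≥0∞) = ENNReal.ofReal K from rfl,
      ← ENNReal.ofReal_mul hK0]
    exact ENNReal.ofReal_le_ofReal h1
  have h1 : dimH s ≤ k := by
    rw [← Real.dimH_univ_eq_finrank E]; exact dimH_mono (subset_univ s)
  have h2 : dimH (g '' s) < ((1 : NNReal) : ℝ≥0∞) := by
    refine hdim.trans_lt ?_
    refine (ENNReal.div_le_div_right h1 _).trans_lt ?_
    rw [ENNReal.div_lt_iff (by simp) (by simp)]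
    push_cast
    rw [one_mul]
    exact ENNReal.lt_add_right (by simp) (by simp)
  have := hausdorffMeasure_of_dimH_lt h2
  simpa [hausdorffMeasure_real] using this

/-- **Sard's theorem** for a smooth real function on a finite-dimensional space: the critical
values form a null set. By induction on the dimension: the points which are flat to high order are
treated by a Hölder estimate, and the other critical points lie, locally, on smooth hypersurfaces
along which the function is critical. -/
theorem volume_criticalValues_eq_zero (k : ℕ) : ∀ (E : Type*) [NormedAddCommGroup E]
    [NormedSpace ℝ E] [FiniteDimensional ℝ E], Module.finrank ℝ E = k → ∀ g : E → ℝ,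
    ContDiff ℝ ∞ g → volume (g '' {x | fderiv ℝ g x = 0}) = 0 := by
  induction k with
  | zero =>
    intro E _ _ _ hE g hg
    exact volume_image_flat_eq_zero hg fun x _ j h1 h2 => by omega
  | succ k ih =>
    intro E _ _ _ hE g hg
    have hD1 : ∀ x, fderiv ℝ g x = 0 → iteratedFDeriv ℝ 1 g x = 0 := fun x hx => by
      rw [← norm_eq_zero, norm_iteratedFDeriv_one, hx, norm_zero]
    let C : ℕ → Set E := fun i => {x | fderiv ℝ g x = 0 ∧ iteratedFDeriv ℝ i g x = 0 ∧
      iteratedFDeriv ℝ (i + 1) g x ≠ 0}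
    have hcover : {x | fderiv ℝ g x = 0} ⊆
        {x | ∀ j, 1 ≤ j → j ≤ Module.finrank ℝ E → iteratedFDeriv ℝ j g x = 0} ∪ ⋃ i, C i := by
      intro x hx
      by_cases h : ∀ j, 1 ≤ j → iteratedFDeriv ℝ j g x = 0
      · exact Or.inl fun j h1 _ => h j h1
      · right
        by_contra hne
        apply h
        intro j hj
        induction j, hj using Nat.le_induction with
        | base => exact hD1 x hx
        | succ j _ ihj =>
          by_contra h3
          exact hne (mem_iUnion.2 ⟨j, hx, ihj, h3⟩)
    refine measure_mono_null ((image_mono hcover).trans (image_union _ _ _).subset)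
      (measure_union_null (volume_image_flat_eq_zero hg fun x hx => hx) ?_)
    rw [image_iUnion]
    refine measure_iUnion_null fun i => volume_image_eq_zero_of_locally fun x hx => ?_
    have hdi : ContDiff ℝ ∞ (iteratedFDeriv ℝ i g) := hg.iteratedFDeriv_right (m := ∞) (by exact_mod_cast le_top)
    have h0 : fderiv ℝ (iteratedFDeriv ℝ i g) x ≠ 0 := by
      intro h
      apply hx.2.2
      rw [← norm_eq_zero, ← norm_fderiv_iteratedFDeriv, h]
      exact ContinuousLinearMap.opNorm_zero
    obtain ⟨u, hu⟩ : ∃ u, fderiv ℝ (iteratedFDeriv ℝ i g) x u ≠ 0 := by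
      by_contra! h
      exact h0 (ContinuousLinearMap.ext h)
    -- a component of the `i`-th derivative defines the hypersurface
    obtain ⟨l, hl⟩ := SeparatingDual.exists_ne_zero (R := ℝ) hu
    let w : E → ℝ := fun y => l (iteratedFDeriv ℝ i g y)
    have hw : ContDiff ℝ ∞ w := l.contDiff.comp hdi
    have hw' : fderiv ℝ w x ≠ 0 := by
      intro h
      apply hl
      have : fderiv ℝ w x = l.comp (fderiv ℝ (iteratedFDeriv ℝ i g) x) :=
        (l.hasFDerivAt.comp x (hdi.differentiable (by simp) x).hasFDerivAt).fderiv
      rw [this] at h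
      exact DFunLike.congr_fun h u
    obtain ⟨e, hxe, hex, he1, hsm, -⟩ := exists_straightening
      (Eventually.of_forall fun y => hw.contDiffAt) hw'
    have hwx : w x = 0 := by simp [w, hx.2.1]
    rw [hwx] at hex hsm
    have hsm' : ∀ᶠ q in 𝓝 (0 : (fderiv ℝ w x).ker),
        ContDiffAt ℝ ∞ (fun q => e.symm ((0 : ℝ), q)) q := by
      have hcont : Tendsto (fun q : (fderiv ℝ w x).ker => ((0 : ℝ), q)) (𝓝 0) (𝓝 (0, 0)) :=
        (Continuous.prodMk continuous_const continuous_id).tendsto' _ _ rfl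
      filter_upwards [hcont.eventually hsm] with q hq
      exact ContDiffAt.comp q hq (by fun_prop)
    obtain ⟨g', hg', hgg'⟩ := exists_contDiff_eventuallyEq
      (hsm'.mono fun q hq => hg.contDiffAt.comp q hq)
    have hfin : Module.finrank ℝ (fderiv ℝ w x).ker = k := by
      have := Module.Dual.finrank_ker_add_one_of_ne_zero (f := (fderiv ℝ w x : E →ₗ[ℝ] ℝ))
        (fun h => hw' (ContinuousLinearMap.coe_injective h))
      rw [hE] at this
      exact Nat.succ_injective this
    have hnull := ih (fderiv ℝ w x).ker hfin g' hg'
    have hev2 : ∀ᶠ p in 𝓝 (e x), g' =ᶠ[𝓝 p.2] fun q => g (e.symm ((0 : ℝ), q)) := by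
      rw [hex]
      exact (continuous_snd.tendsto ((0 : ℝ), (0 : (fderiv ℝ w x).ker))).eventually
        hgg'.eventually_nhds
    have hev3 : ∀ᶠ p in 𝓝 (e x), ContDiffAt ℝ ∞ (fun q => e.symm ((0 : ℝ), q)) p.2 := by
      rw [hex]
      exact (continuous_snd.tendsto ((0 : ℝ), (0 : (fderiv ℝ w x).ker))).eventually hsm'
    have hev4 := (e.continuousAt hxe).eventually (hev2.and hev3)
    refine ⟨_, (hev4.and (e.open_source.mem_nhds hxe)), measure_mono_null ?_ hnull⟩
    rintro _ ⟨y, ⟨hyC, ⟨hy2, hy3⟩, hys⟩, rfl⟩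
    have hey : e y = (0, (e y).2) := by
      ext
      · rw [he1]; simp [w, hyC.2.1]
      · rfl
    have hye : e.symm ((0 : ℝ), (e y).2) = y := by rw [← hey, e.left_inv hys]
    refine ⟨(e y).2, ?_, ?_⟩
    · have hgd : HasFDerivAt g (fderiv ℝ g y) (e.symm ((0 : ℝ), (e y).2)) := by
        rw [hye]; exact (hg.differentiable (by simp) y).hasFDerivAt
      have := (hgd.comp (e y).2 (hy3.differentiableAt (by simp)).hasFDerivAt).fderiv
      rw [hyC.1, ContinuousLinearMap.zero_comp] at this
      exact hy2.fderiv_eq.trans this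
    · exact hy2.self_of_nhds.trans (congrArg g hye)

/-! ### Differentials in charts -/

section Charts

variable {P : Type*} [NormedAddCommGroup P] [NormedSpace ℝ P]
variable {n : ℕ} {N : Type*} [TopologicalSpace N] [ChartedSpace (EuclideanSpace ℝ (Fin n)) N]

/-- The chart of the manifold at `x`. -/
abbrev chartE (n : ℕ) [ChartedSpace (EuclideanSpace ℝ (Fin n)) N] (x : N) :
    OpenPartialHomeomorph N (EuclideanSpace ℝ (Fin n)) :=
  chartAt (EuclideanSpace ℝ (Fin n)) x

theorem tangentMapAt_eq_fderiv {f : N → P} {x : N}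
    (hf : MDifferentiableAt (𝓡 n) 𝓘(ℝ, P) f x) :
    tangentMapAt n f x = fderiv ℝ (f ∘ (chartE n x).symm) (chartE n x x) := by
  simp only [tangentMapAt, mfderiv, hf, modelWithCornersSelf_coe, range_id,
    fderivWithin_univ]
  rfl

theorem HasMFDerivAt.tangentMapAt_eq {f : N → P} {x : N}
    {L : EuclideanSpace ℝ (Fin n) →L[ℝ] P} (hf : HasMFDerivAt (𝓡 n) 𝓘(ℝ, P) f x L) :
    tangentMapAt n f x = L := hf.mfderiv

theorem hasMFDerivAt_tangentMapAt {f : N → P} {x : N}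
    (hf : MDifferentiableAt (𝓡 n) 𝓘(ℝ, P) f x) :
    HasMFDerivAt (𝓡 n) 𝓘(ℝ, P) f x (tangentMapAt (P := P) n f x) := hf.hasMFDerivAt

theorem hasFDerivAt_comp_chart_symm {f : N → P} {x : N}
    (hf : MDifferentiableAt (𝓡 n) 𝓘(ℝ, P) f x) :
    HasFDerivAt (f ∘ (chartE n x).symm) (tangentMapAt n f x) (chartE n x x) := by
  have h := (hasMFDerivAt_tangentMapAt hf).2
  simp only [modelWithCornersSelf_coe, range_id] at h
  rw [← hasFDerivWithinAt_univ]
  exact h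

theorem ContMDiffAt.eventually_contDiffAt_chart [IsManifold (𝓡 n) ∞ N] {f : N → P} {W : Set N}
    (hW : IsOpen W) (hf : ContMDiffOn (𝓡 n) 𝓘(ℝ, P) ∞ f W) {x y : N}
    (hy : y ∈ W) (hyx : y ∈ (chartE n x).source) :
    ContDiffAt ℝ ∞ (f ∘ (chartE n x).symm) (chartE n x y) := by
  rw [← contMDiffAt_iff_contDiffAt]
  have h1 : ContMDiffAt (𝓡 n) (𝓡 n) ∞ (chartE n x).symm (chartE n x y) :=
    (contMDiffOn_chart_symm (n := ∞) (I := 𝓡 n) (x := x)).contMDiffAt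
      ((chartE n x).open_target.mem_nhds ((chartE n x).map_source hyx))
  have h2 : ContMDiffAt (𝓡 n) 𝓘(ℝ, P) ∞ f ((chartE n x).symm (chartE n x y)) := by
    rw [(chartE n x).left_inv hyx]; exact hf.contMDiffAt (hW.mem_nhds hy)
  exact h2.comp _ h1

theorem eventually_chart {x : N} {p : N → Prop} (h : ∀ᶠ y in 𝓝 x, p y) :
    ∀ᶠ w in 𝓝 (chartE n x x), w ∈ (chartE n x).target ∧ p ((chartE n x).symm w) := by
  have hx : x ∈ (chartE n x).source := mem_chart_source _ x
  have hc := (chartE n x).continuousAt_symm ((chartE n x).map_source hx)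
  rw [ContinuousAt, (chartE n x).left_inv hx] at hc
  exact Filter.Eventually.and ((chartE n x).open_target.mem_nhds ((chartE n x).map_source hx))
    (hc.eventually h)

/-- The differential read in the chart at `x` differs from the differential in the preferred chart
by an isomorphism which does not depend on the map. -/
theorem exists_equiv_fderiv_chart [IsManifold (𝓡 n) ∞ N] {x y : N}
    (hy : y ∈ (chartE n x).source) :
    ∃ J : EuclideanSpace ℝ (Fin n) ≃L[ℝ] EuclideanSpace ℝ (Fin n),
      ∀ {Q : Type _} [NormedAddCommGroup Q] [NormedSpace ℝ Q] (f : N → Q),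
        MDifferentiableAt (𝓡 n) 𝓘(ℝ, Q) f y →
        HasFDerivAt (f ∘ (chartE n x).symm) ((tangentMapAt n f y).comp
          (J : EuclideanSpace ℝ (Fin n) →L[ℝ] EuclideanSpace ℝ (Fin n))) (chartE n x y) := by
  have : IsManifold (𝓡 n) 1 N := IsManifold.of_le (n := ∞) (by simp)
  have hm := (mdifferentiable_chart (I := 𝓡 n) x).symm
  have hyt : chartE n x y ∈ (chartE n x).symm.source := (chartE n x).map_source hy
  refine ⟨hm.mfderiv hyt, fun {Q} _ _ f hf => ?_⟩
  have h1 := (hm.mdifferentiableAt hyt).hasMFDerivAt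
  have h2 : HasMFDerivAt (𝓡 n) 𝓘(ℝ, Q) f ((chartE n x).symm (chartE n x y))
      (tangentMapAt (P := Q) n f y) := by
    have := hasMFDerivAt_tangentMapAt hf
    rwa [(chartE n x).left_inv hy]
  have h3 := h2.comp (chartE n x y) h1
  rw [hasMFDerivAt_iff_hasFDerivAt] at h3
  exact h3

/-- A function with vanishing differential on an open set is locally constant there. -/
theorem eventually_eq_of_hasFDerivAt_chart_zero [IsManifold (𝓡 n) ∞ N] {Ω : Set N}
    (hΩ : IsOpen Ω) {G : N → ℝ} (hG : ContinuousOn G Ω)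
    (h : ∀ y ∈ Ω, HasFDerivAt (G ∘ (chartE n y).symm)
      (0 : EuclideanSpace ℝ (Fin n) →L[ℝ] ℝ) (chartE n y y)) {x : N} (hx : x ∈ Ω) :
    ∀ᶠ y in 𝓝 x, G y = G x := by
  have hmd : ∀ y ∈ Ω, HasMFDerivAt (𝓡 n) 𝓘(ℝ, ℝ) G y
      (0 : EuclideanSpace ℝ (Fin n) →L[ℝ] ℝ) := fun y hy => by
    refine ⟨hG.continuousAt (hΩ.mem_nhds hy), ?_⟩
    simp only [modelWithCornersSelf_coe, range_id]
    exact (hasFDerivWithinAt_univ.2 (h y hy) :)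
  have hxs : x ∈ (chartE n x).source := mem_chart_source _ x
  obtain ⟨ε, hε, hb⟩ := Metric.eventually_nhds_iff_ball.1
    (eventually_chart (n := n) (hΩ.mem_nhds hx))
  have hd : ∀ w ∈ Metric.ball (chartE n x x) ε,
      HasFDerivAt (G ∘ (chartE n x).symm) (0 : EuclideanSpace ℝ (Fin n) →L[ℝ] ℝ) w := by
    intro w hw
    obtain ⟨hw1, hw2⟩ := hb w hw
    obtain ⟨J, hJ⟩ := exists_equiv_fderiv_chart (n := n) ((chartE n x).map_target hw1)
    have := hJ G (hmd _ hw2).mdifferentiableAt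
    rw [(hmd _ hw2).tangentMapAt_eq, (chartE n x).right_inv hw1] at this
    simpa using this
  have hcst : ∀ w ∈ Metric.ball (chartE n x x) ε, G ((chartE n x).symm w) = G x := by
    intro w hw
    have := (convex_ball (chartE n x x) ε).norm_image_sub_le_of_norm_hasFDerivWithin_le (C := 0)
      (fun w hw => (hd w hw).hasFDerivWithinAt) (fun w _ => by simp)
      (Metric.mem_ball_self hε) hw
    rw [zero_mul, norm_le_zero_iff, sub_eq_zero] at this
    simpa [(chartE n x).left_inv hxs] using this
  filter_upwards [(chartE n x).open_source.mem_nhds hxs, ((chartE n x).continuousAt hxs).eventually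
    (Metric.ball_mem_nhds _ hε)] with y hy1 hy2
  rw [← hcst _ hy2, (chartE n x).left_inv hy1]

end Charts

/-! ### Horizontal sections of rotational hypersurfaces -/

section Sections

variable {n : ℕ} {N : Type*} [TopologicalSpace N] [ChartedSpace (EuclideanSpace ℝ (Fin n)) N]

/-- Sard's theorem for a smooth real function on a manifold, from the theorem in each chart. -/
theorem volume_criticalValues_manifold_eq_zero [IsManifold (𝓡 n) ∞ N]
    [SecondCountableTopology N] {h : N → ℝ} (hh : ContMDiff (𝓡 n) 𝓘(ℝ, ℝ) ∞ h) :
    volume (h '' {x | tangentMapAt n h x = 0}) = 0 := by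
  refine volume_image_eq_zero_of_locally fun x _ => ?_
  have hxs : x ∈ (chartE n x).source := mem_chart_source _ x
  have hsm : ∀ᶠ w in 𝓝 (chartE n x x), ContDiffAt ℝ ∞ (h ∘ (chartE n x).symm) w := by
    filter_upwards [eventually_chart (n := n) (x := x) (p := fun _ => True) (by simp)] with w hw
    rw [← (chartE n x).right_inv hw.1]
    exact ContMDiffAt.eventually_contDiffAt_chart isOpen_univ hh.contMDiffOn (mem_univ _)
      ((chartE n x).map_target hw.1)
  obtain ⟨g, hg, hgh⟩ := exists_contDiff_eventuallyEq hsm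
  have hnull := volume_criticalValues_eq_zero _ (EuclideanSpace ℝ (Fin n)) rfl g hg
  refine ⟨_, Filter.Eventually.and ((chartE n x).open_source.mem_nhds hxs)
    (((chartE n x).continuousAt hxs).eventually hgh.eventually_nhds), measure_mono_null ?_ hnull⟩
  rintro _ ⟨y, ⟨hy0, hy1, hy2⟩, rfl⟩
  refine ⟨chartE n x y, ?_, ?_⟩
  · obtain ⟨J, hJ⟩ := exists_equiv_fderiv_chart (n := n) (x := x) hy1
    have h1 := hJ h ((hh y).mdifferentiableAt (by simp))
    rw [show tangentMapAt n h y = 0 from hy0, ContinuousLinearMap.zero_comp] at h1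
    have h2 : g =ᶠ[𝓝 (chartE n x y)] h ∘ (chartE n x).symm := hy2
    rw [mem_ofPred_eq, h2.fderiv_eq, h1.fderiv]
  · have : g (chartE n x y) = (h ∘ (chartE n x).symm) (chartE n x y) := hy2.self_of_nhds
    rw [this, Function.comp_apply, (chartE n x).left_inv hy1]

/-- If `q` is constant on the connected components of the level sets of `h` at the regular values
of `h`, then the differential of `q` vanishes on the kernel of the differential of `h` wherever
the latter is not zero. By Sard's theorem the regular values are dense. -/
theorem tangentMapAt_eq_zero_of_constant_on_components [IsManifold (𝓡 n) ∞ N]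
    [SecondCountableTopology N] {h q : N → ℝ} (hh : ContMDiff (𝓡 n) 𝓘(ℝ, ℝ) ∞ h)
    (hq : ContMDiff (𝓡 n) 𝓘(ℝ, ℝ) ∞ q)
    (hc : ∀ t, (∀ x, h x = t → tangentMapAt n h x ≠ 0) → ∀ x, h x = t →
      ∀ y ∈ connectedComponentIn {y | h y = t} x, q y = q x)
    {x : N} (hx : tangentMapAt n h x ≠ 0) {u : EuclideanSpace ℝ (Fin n)}
    (hu : tangentMapAt n h x u = 0) : tangentMapAt n q x u = 0 := by
  have hxs : x ∈ (chartE n x).source := mem_chart_source _ x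
  set φ := chartE n x with hφ
  have hsm : ∀ {g : N → ℝ}, ContMDiff (𝓡 n) 𝓘(ℝ, ℝ) ∞ g → ∀ᶠ w in 𝓝 (φ x),
      ContDiffAt ℝ ∞ (g ∘ φ.symm) w := by
    intro g hg
    filter_upwards [eventually_chart (n := n) (x := x) (p := fun _ => True) (by simp)] with w hw
    rw [← φ.right_inv hw.1]
    exact ContMDiffAt.eventually_contDiffAt_chart isOpen_univ hg.contMDiffOn (mem_univ _)
      (φ.map_target hw.1)
  have hmh : MDifferentiableAt (𝓡 n) 𝓘(ℝ, ℝ) h x := (hh x).mdifferentiableAt (by simp)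
  have hmq : MDifferentiableAt (𝓡 n) 𝓘(ℝ, ℝ) q x := (hq x).mdifferentiableAt (by simp)
  have hdh := (hasFDerivAt_comp_chart_symm hmh)
  have hdq := (hasFDerivAt_comp_chart_symm hmq)
  have hφx : φ.symm (φ x) = x := φ.left_inv hxs
  have hstr := exists_straightening (hsm hh) (by rw [hdh.fderiv]; exact hx)
  set K := (fderiv ℝ (h ∘ φ.symm) (φ x)).ker with hK
  obtain ⟨e, hxe, hex, he1, hesm, hed⟩ := hstr
  have hw0 : (h ∘ φ.symm) (φ x) = h x := by simp [hφx]
  rw [hw0] at hex hesm hed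
  have hes : e.symm (h x, 0) = φ x := by rw [← hex, e.left_inv hxe]
  -- a product neighbourhood on which the coordinates are defined and continuous
  have hgood : ∀ᶠ p in 𝓝 (h x, (0 : K)), p ∈ e.target ∧ e.symm p ∈ φ.target := by
    have h1 : e.target ∈ 𝓝 (h x, (0 : K)) := e.open_target.mem_nhds (hex ▸ e.map_source hxe)
    have h2 : ContinuousAt e.symm (h x, (0 : K)) := hesm.self_of_nhds.continuousAt
    refine Filter.Eventually.and h1 (h2.eventually ?_)
    rw [hes]; exact φ.open_target.mem_nhds (φ.map_source hxs)
  rw [nhds_prod_eq] at hgood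
  obtain ⟨pa, ha, pb, hb, hab⟩ := eventually_prod_iff.1 hgood
  obtain ⟨ε, hε, hball⟩ := Metric.eventually_nhds_iff_ball.1 hb
  set ψ : ℝ × K → N := fun p => φ.symm (e.symm p) with hψ
  have hψc : ∀ p, pa p.1 → p.2 ∈ Metric.ball (0 : K) ε → ContinuousAt ψ p := by
    intro p h1 h2
    have h3 := hab h1 (hball _ h2)
    exact (φ.continuousAt_symm h3.2).comp (f := e.symm) (e.continuousAt_symm h3.1)
  have hψh : ∀ p, pa p.1 → p.2 ∈ Metric.ball (0 : K) ε → h (ψ p) = p.1 := by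
    intro p h1 h2
    have h3 := hab h1 (hball _ h2)
    have := he1 (e.symm p)
    rw [e.right_inv h3.1] at this
    exact this.symm
  -- at regular values the slices are connected, hence `q` is constant on them
  have hreg : ∀ t, pa t → (∀ x, h x = t → tangentMapAt n h x ≠ 0) →
      ∀ k ∈ Metric.ball (0 : K) ε, q (ψ (t, k)) = q (ψ (t, 0)) := by
    intro t ht hrt k hk
    have h0 : (0 : K) ∈ Metric.ball (0 : K) ε := Metric.mem_ball_self hε
    refine hc t hrt (ψ (t, 0)) (hψh (t, 0) ht h0) _ ?_
    have hpre : IsPreconnected ((fun k => ψ (t, k)) '' Metric.ball (0 : K) ε) := by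
      refine (convex_ball (0 : K) ε).isPreconnected.image _ fun k hk => ?_
      exact ((hψc (t, k) ht hk).comp (f := fun k => (t, k))
        (by fun_prop)).continuousWithinAt
    refine hpre.subset_connectedComponentIn (mem_image_of_mem _ h0) ?_ (mem_image_of_mem _ hk)
    rintro _ ⟨k, hk, rfl⟩
    exact hψh (t, k) ht hk
  have hdense : Dense {t : ℝ | ∀ x, h x = t → tangentMapAt n h x ≠ 0} := by
    have hnull := volume_criticalValues_manifold_eq_zero hh
    have : {t : ℝ | ∀ x, h x = t → tangentMapAt n h x ≠ 0} =
        (h '' {x | tangentMapAt n h x = 0})ᶜ := by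
      ext t
      simp only [mem_ofPred_eq, mem_compl_iff, mem_image, not_exists, not_and]
      exact ⟨fun H y h1 h2 => H y h2 h1, fun H y h1 h2 => H y h2 h1⟩
    rw [this]
    exact Measure.dense_of_ae (compl_mem_ae_iff.2 hnull)
  have hslice : ∀ k ∈ Metric.ball (0 : K) ε, q (ψ (h x, k)) = q (ψ (h x, 0)) := by
    intro k hk
    have h0 : (0 : K) ∈ Metric.ball (0 : K) ε := Metric.mem_ball_self hε
    have hcont : ∀ k ∈ Metric.ball (0 : K) ε, ContinuousAt (fun t => q (ψ (t, k))) (h x) :=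
      fun k hk => (hq.continuous.continuousAt).comp
        ((hψc (h x, k) ha.self_of_nhds hk).comp (f := fun t => (t, k)) (by fun_prop))
    have hfr : ∃ᶠ t in 𝓝 (h x), q (ψ (t, k)) = q (ψ (t, 0)) := by
      have h1 : ∃ᶠ t in 𝓝 (h x), ∀ x, h x = t → tangentMapAt n h x ≠ 0 :=
        mem_closure_iff_frequently.1 (hdense (h x))
      exact (h1.and_eventually ha).mono fun t ht => hreg t ht.2 ht.1 k hk
    have hlim := (hcont k hk).sub (hcont 0 h0)
    by_contra hne
    have := hlim.eventually_ne (sub_ne_zero.2 hne)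
    exact hfr (this.mono fun t ht => sub_ne_zero.1 ht)
  have hconst : HasFDerivAt (fun k : K => q (ψ (h x, k))) (0 : K →L[ℝ] ℝ) 0 := by
    refine (hasFDerivAt_const (q (ψ (h x, 0))) (0 : K)).congr_of_eventuallyEq ?_
    filter_upwards [Metric.ball_mem_nhds (0 : K) hε] with k hk using hslice k hk
  have hcomp : HasFDerivAt (fun k : K => q (ψ (h x, k)))
      ((tangentMapAt n q x).comp K.subtypeL) 0 := by
    have h1 : HasFDerivAt (q ∘ φ.symm) (tangentMapAt n q x) (e.symm (h x, (0 : K))) := by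
      rw [hes]; exact hdq
    exact h1.comp (0 : K) hed
  have huK : u ∈ K := by
    rw [hK, LinearMap.mem_ker, hdh.fderiv]; exact hu
  have := DFunLike.congr_fun (hcomp.unique hconst) (⟨u, huK⟩ : K)
  simpa using this

end Sections

/-! ### Metrics on the unit ball defined by a line form -/

theorem one_sub_norm_sq_pos {E : Type*} [NormedAddCommGroup E] {z : E} (hz : ‖z‖ < 1) :
    0 < 1 - ‖z‖ ^ 2 := by
  nlinarith [norm_nonneg z]

section LineForm

variable {E : Type*} [NormedAddCommGroup E] [InnerProductSpace ℝ E]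

/-- The algebraic properties of the trilinear form `B z w u = ∑ⱼ (zᵢ w̄ⱼ) uⱼ` of `𝔽^m` on which the
geometry of `ℍ_𝔽^m` depends: for `z ≠ 0` the operator `B z z` is `‖z‖²` times the orthogonal
projection onto a subspace of dimension `d` containing `z`, the `𝔽`-line of `z`. -/
structure IsLineForm (d : ℕ) (B : E →L[ℝ] E →L[ℝ] E →L[ℝ] E) : Prop where
  symm : ∀ z u v, inner ℝ (B z z u) v = inner ℝ u (B z z v)
  self : ∀ z, B z z z = ‖z‖ ^ 2 • z
  idem : ∀ z u, B z z (B z z u) = ‖z‖ ^ 2 • B z z u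
  rank : ∀ z, z ≠ 0 → Module.finrank ℝ (B z z).range = d

/-- The metric of the unit ball given by a line form, normalized by `c`. -/
def ballMetric (c : ℝ) (B : E →L[ℝ] E →L[ℝ] E →L[ℝ] E) : MetricTensor E := fun z u v =>
  c * (inner ℝ u v / (1 - ‖z‖ ^ 2) + inner ℝ (B z z u) v / (1 - ‖z‖ ^ 2) ^ 2)

/-- The product of a ball metric with the real line. -/
def cylMetric (c : ℝ) (B : E →L[ℝ] E →L[ℝ] E →L[ℝ] E) : MetricTensor (E × ℝ) := fun p X Y =>
  ballMetric c B p.1 X.1 Y.1 + X.2 * Y.2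

variable {d : ℕ} {B : E →L[ℝ] E →L[ℝ] E →L[ℝ] E} {c : ℝ}

namespace IsLineForm

theorem linearize (hB : IsLineForm d B) (z X : E) :
    B X z z + B z X z = (2 * inner ℝ z X) • z + ‖z‖ ^ 2 • X - B z z X := by
  have h1 := hB.self (z + X)
  have h2 := hB.self (z - X)
  have h3 := hB.self X
  rw [norm_add_sq_real] at h1
  rw [norm_sub_sq_real] at h2
  simp only [map_add, map_sub, add_apply, sub_apply,
    hB.self z, h3] at h1 h2
  have h4 : (2 : ℝ) • (B X z z + B z X z) =
      (2 : ℝ) • ((2 * inner ℝ z X) • z + ‖z‖ ^ 2 • X - B z z X) := by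
    linear_combination (norm := module) h1 - h2
  exact smul_right_injective E two_ne_zero h4

theorem symm_linearize (hB : IsLineForm d B) (z X u v : E) :
    inner ℝ (B X z u + B z X u) v = inner ℝ u (B X z v + B z X v) := by
  have h1 := hB.symm (z + X) u v
  have h2 := hB.symm z u v
  have h3 := hB.symm X u v
  simp only [map_add, add_apply, inner_add_left, inner_add_right] at h1 ⊢
  linarith

theorem inner_self_nonneg' (hB : IsLineForm d B) (z u : E) : 0 ≤ inner ℝ (B z z u) u := by
  by_cases hz : z = 0
  · simp [hz]
  · have h1 : inner ℝ (B z z u) (B z z u) = ‖z‖ ^ 2 * inner ℝ (B z z u) u := by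
      rw [← hB.symm, hB.idem, real_inner_smul_left]
    have h2 : 0 < ‖z‖ ^ 2 := by positivity
    have h3 := real_inner_self_nonneg (x := B z z u)
    rw [h1] at h3
    exact nonneg_of_mul_nonneg_right h3 h2

/-- The line form dominates the square of the radial component. -/
theorem inner_sq_le (hB : IsLineForm d B) (z u : E) : inner ℝ z u ^ 2 ≤ inner ℝ (B z z u) u := by
  by_cases hz : z = 0
  · simp [hz]
  · have h2 : 0 < ‖z‖ ^ 2 := by positivity
    have h1 : inner ℝ (B z z u) (B z z u) = ‖z‖ ^ 2 * inner ℝ (B z z u) u := by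
      rw [← hB.symm, hB.idem, real_inner_smul_left]
    have h3 : inner ℝ (B z z u) z = ‖z‖ ^ 2 * inner ℝ z u := by
      rw [hB.symm, hB.self, real_inner_smul_right, real_inner_comm]
    have h4 := real_inner_mul_inner_self_le (B z z u) z
    rw [h3, h1, real_inner_self_eq_norm_sq] at h4
    have h5 : (‖z‖ ^ 2) ^ 2 * inner ℝ z u ^ 2 ≤ (‖z‖ ^ 2) ^ 2 * inner ℝ (B z z u) u := by
      nlinarith
    exact le_of_mul_le_mul_left h5 (by positivity)

end IsLineForm

theorem ballMetric_symm (hB : IsLineForm d B) (z u v : E) :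
    ballMetric c B z u v = ballMetric c B z v u := by
  simp only [ballMetric]
  rw [hB.symm, real_inner_comm, real_inner_comm (B z z v)]

theorem cylMetric_symm (hB : IsLineForm d B) (p X Y : E × ℝ) :
    cylMetric c B p X Y = cylMetric c B p Y X := by
  simp only [cylMetric]
  rw [ballMetric_symm hB, mul_comm]

theorem ballMetric_self_ge (hc : 0 < c) (hB : IsLineForm d B) {z : E} (hz : ‖z‖ < 1) (u : E) :
    c * ‖u‖ ^ 2 ≤ ballMetric c B z u u := by
  have h1 := one_sub_norm_sq_pos hz
  have h2 := hB.inner_self_nonneg' z u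
  simp only [ballMetric]
  gcongr
  have h3 : ‖u‖ ^ 2 ≤ ‖u‖ ^ 2 / (1 - ‖z‖ ^ 2) := by
    rw [le_div_iff₀ h1]
    nlinarith [sq_nonneg ‖u‖, sq_nonneg ‖z‖, mul_nonneg (sq_nonneg ‖u‖) (sq_nonneg ‖z‖)]
  rw [real_inner_self_eq_norm_sq]
  have h4 : 0 ≤ inner ℝ (B z z u) u / (1 - ‖z‖ ^ 2) ^ 2 := by positivity
  linarith

theorem ballMetric_self_ge_radial (hc : 0 < c) (hB : IsLineForm d B) {z : E} (hz : ‖z‖ < 1)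
    (u : E) : c * (inner ℝ z u / (1 - ‖z‖ ^ 2)) ^ 2 ≤ ballMetric c B z u u := by
  have h1 := one_sub_norm_sq_pos hz
  have h2 := hB.inner_sq_le z u
  simp only [ballMetric]
  gcongr
  rw [div_pow, real_inner_self_eq_norm_sq]
  have h4 : 0 ≤ ‖u‖ ^ 2 / (1 - ‖z‖ ^ 2) := by positivity
  have h5 : inner ℝ z u ^ 2 / (1 - ‖z‖ ^ 2) ^ 2 ≤ inner ℝ (B z z u) u / (1 - ‖z‖ ^ 2) ^ 2 := by
    gcongr
  linarith

theorem ballMetric_zero_right (z u : E) : ballMetric c B z u 0 = 0 := by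
  simp [ballMetric]

theorem ballMetric_radial (hB : IsLineForm d B) {z : E} (hz : ‖z‖ < 1) (a : ℝ) (u : E) :
    ballMetric c B z u (a • z) = c * a * inner ℝ z u / (1 - ‖z‖ ^ 2) ^ 2 := by
  have h1 := one_sub_norm_sq_pos hz
  simp only [ballMetric]
  rw [real_inner_smul_right, real_inner_smul_right, hB.symm, hB.self, real_inner_smul_right,
    real_inner_comm]
  field_simp
  ring

/-- The derivative of the coefficients of the metric, from which the Christoffel symbols are
computed. -/
theorem hasFDerivAt_ballMetric {z : E} (hz : ‖z‖ < 1) (Y Z : E) :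
    ∃ L : E →L[ℝ] ℝ, HasFDerivAt (fun q => ballMetric c B q Y Z) L z ∧ ∀ X, L X =
      c * (2 * inner ℝ z X * inner ℝ Y Z / (1 - ‖z‖ ^ 2) ^ 2
        + 4 * inner ℝ z X * inner ℝ (B z z Y) Z / (1 - ‖z‖ ^ 2) ^ 3
        + inner ℝ (B X z Y + B z X Y) Z / (1 - ‖z‖ ^ 2) ^ 2) := by
  have h1 := one_sub_norm_sq_pos hz
  have hn : HasFDerivAt (fun q : E => 1 - ‖q‖ ^ 2) (-(2 • innerSL ℝ z)) z := by
    have := (hasStrictFDerivAt_norm_sq z).hasFDerivAt.const_sub 1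
    simpa using this
  have hi : HasFDerivAt (fun q : E => (1 - ‖q‖ ^ 2)⁻¹) _ z :=
    (hasDerivAt_inv h1.ne').comp_hasFDerivAt z hn
  have hT : HasFDerivAt (fun q : E => B q q Y) (((B z).flip Y) + ((B.flip z).flip Y)) z := by
    have h2 := (B.hasFDerivAt (x := z)).clm_apply (hasFDerivAt_id z)
    have h3 := h2.clm_apply (hasFDerivAt_const Y z)
    refine h3.congr_fderiv ?_
    ext X
    simp
  have hI := hT.inner ℝ (hasFDerivAt_const Z z)
  have hfin := ((hi.const_mul (inner ℝ Y Z)).add (hI.mul (hi.pow 2))).const_mul c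
  refine ⟨_, hfin.congr_of_eventuallyEq (Eventually.of_forall fun q => ?_), fun X => ?_⟩
  · simp only [ballMetric, div_eq_mul_inv, inv_pow, Pi.add_apply, Pi.mul_apply]
  · simp [fderivInnerCLM_apply, inner_add_left]
    field_simp
    ring

theorem fderiv_cylMetric {p : E × ℝ} (hz : ‖p.1‖ < 1) (X Y Z : E × ℝ) :
    fderiv ℝ (fun q => cylMetric c B q Y Z) p X =
      c * (2 * inner ℝ p.1 X.1 * inner ℝ Y.1 Z.1 / (1 - ‖p.1‖ ^ 2) ^ 2
        + 4 * inner ℝ p.1 X.1 * inner ℝ (B p.1 p.1 Y.1) Z.1 / (1 - ‖p.1‖ ^ 2) ^ 3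
        + inner ℝ (B X.1 p.1 Y.1 + B p.1 X.1 Y.1) Z.1 / (1 - ‖p.1‖ ^ 2) ^ 2) := by
  obtain ⟨L, hL, hLX⟩ := hasFDerivAt_ballMetric (B := B) (c := c) hz Y.1 Z.1
  have h : HasFDerivAt (fun q => cylMetric c B q Y Z) (L.comp (ContinuousLinearMap.fst ℝ E ℝ)) p :=
    (hL.comp p hasFDerivAt_fst).add_const _
  rw [h.fderiv]
  exact hLX X.1

/-- The Christoffel symbols vanish in the vertical direction. -/
theorem christoffel_cylMetric_vertical {p : E × ℝ} (hz : ‖p.1‖ < 1) (X Y : E × ℝ) (s : ℝ) :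
    christoffel (cylMetric c B) p X Y (0, s) = 0 := by
  simp [christoffel, fderiv_cylMetric hz]

/-- The Christoffel symbols for a vector field in the radial and vertical plane, along a
horizontal vector tangent to the geodesic sphere. -/
theorem christoffel_cylMetric_radial (hB : IsLineForm d B) {p : E × ℝ} (hz : ‖p.1‖ < 1)
    (X : E × ℝ) (hX : inner ℝ p.1 X.1 = 0) (a b : ℝ) (Z : E × ℝ) :
    christoffel (cylMetric c B) p X (a • p.1, b) Z =
      a * c * (‖p.1‖ ^ 2 * inner ℝ X.1 Z.1 / (1 - ‖p.1‖ ^ 2) ^ 2 +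
        (1 + ‖p.1‖ ^ 2) * inner ℝ (B p.1 p.1 X.1) Z.1 / (1 - ‖p.1‖ ^ 2) ^ 3) := by
  have h1 := one_sub_norm_sq_pos hz
  obtain ⟨z, s⟩ := p
  obtain ⟨X, x⟩ := X
  obtain ⟨Z, ζ⟩ := Z
  simp only at hX h1 hz
  have hXz : inner ℝ X z = 0 := by rw [real_inner_comm]; exact hX
  have e1 : inner ℝ (B X z (a • z) + B z X (a • z)) Z =
      a * (‖z‖ ^ 2 * inner ℝ X Z - inner ℝ (B z z X) Z) := by
    rw [map_smul, map_smul, ← smul_add, hB.linearize, hX, real_inner_smul_left, inner_sub_left,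
      inner_add_left, real_inner_smul_left, real_inner_smul_left]
    ring
  have e2 : inner ℝ (B Z z X + B z Z X) (a • z) =
      a * (‖z‖ ^ 2 * inner ℝ X Z - inner ℝ (B z z X) Z) := by
    rw [hB.symm_linearize, map_smul, map_smul, ← smul_add, hB.linearize, real_inner_smul_right,
      inner_sub_right, inner_add_right, real_inner_smul_right, real_inner_smul_right, hXz,
      ← hB.symm]
    ring
  have e3 : inner ℝ (B (a • z) z X + B z (a • z) X) Z = 2 * a * inner ℝ (B z z X) Z := by
    simp only [map_smul, smul_apply, inner_add_left, real_inner_smul_left]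
    ring
  have e4 : inner ℝ (B z z X) (a • z) = 0 := by
    rw [hB.symm, map_smul, hB.self, real_inner_smul_right, real_inner_smul_right, hXz]; ring
  have e5 : inner ℝ z (a • z) = a * ‖z‖ ^ 2 := by
    rw [real_inner_smul_right, real_inner_self_eq_norm_sq]
  have e6 : inner ℝ X (a • z) = 0 := by rw [real_inner_smul_right, hXz, mul_zero]
  simp only [christoffel, fderiv_cylMetric (p := (z, s)) hz, e1, e2, e3, e4, e5, e6, hX]
  field_simp
  ring

end LineForm

/-! ### Elementary symmetric functions of the curvatures of geodesic spheres -/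

theorem Multiset.esymm_cons_succ (a : ℝ) (s : Multiset ℝ) (r : ℕ) :
    (a ::ₘ s).esymm (r + 1) = s.esymm (r + 1) + a * s.esymm r := by
  simp only [Multiset.esymm, Multiset.powersetCard_cons, Multiset.map_add, Multiset.sum_add,
    Multiset.map_map]
  congr 1
  simp only [Function.comp_def, Multiset.prod_cons]
  exact Multiset.sum_map_mul_left

/-- The elementary symmetric functions of the principal curvatures, up to a common factor, of the
geodesic sphere through a point at square distance `x` from the origin: in the direction of the
`𝔽`-line they are `1 + x`, in the other directions `1`. -/
def sphereSymm (d k r : ℕ) (x : ℝ) : ℝ :=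
  ((Finset.univ : Finset (Fin k)).val.map fun i : Fin k => 1 + if (i : ℕ) + 1 < d then x else 0).esymm r

theorem sphereSymm_eq_sum (d k r : ℕ) (x : ℝ) : sphereSymm d k r x =
    ∑ t ∈ (Finset.univ : Finset (Fin k)).powersetCard r,
      ∏ i ∈ t, (1 + if (i : ℕ) + 1 < d then x else 0) := Finset.esymm_map_val _ _ _

section LinearAlgebra

variable {E : Type*} [NormedAddCommGroup E] [InnerProductSpace ℝ E] [FiniteDimensional ℝ E]
  {d : ℕ} {B : E →L[ℝ] E →L[ℝ] E →L[ℝ] E}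

/-- An orthonormal basis diagonalizing `B z z`, whose first vector is radial. -/
theorem IsLineForm.exists_basis (hB : IsLineForm d B) {k : ℕ} (hk : Module.finrank ℝ E = k + 1)
    {z : E} (hz : z ≠ 0) : ∃ b : OrthonormalBasis (Fin (k + 1)) ℝ E, b 0 = ‖z‖⁻¹ • z ∧
      ∀ i, B z z (b i) = (if (i : ℕ) < d then ‖z‖ ^ 2 else 0) • b i := by
  have hz0 : ‖z‖ ≠ 0 := norm_ne_zero_iff.2 hz
  set W := (B z z).range with hW
  have hWd : Module.finrank ℝ W = d := hB.rank z hz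
  have hzW : ‖z‖⁻¹ • z ∈ W := by
    refine W.smul_mem _ ⟨(‖z‖ ^ 2)⁻¹ • z, ?_⟩
    have := hB.self z
    change B z z ((‖z‖ ^ 2)⁻¹ • z) = z
    rw [map_smul, this, smul_smul, inv_mul_cancel₀ (by positivity), one_smul]
  have hd : 0 < d := by
    rw [← hWd]
    refine Module.finrank_pos_iff_exists_ne_zero.2 ⟨⟨_, hzW⟩, fun h => ?_⟩
    have := congrArg Subtype.val h
    simp [hz] at this
  obtain ⟨b1, hb1⟩ := Orthonormal.exists_orthonormalBasis_extension_of_card_eq (𝕜 := ℝ) (E := W)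
    (ι := Fin d) (by simpa using hWd) (v := fun _ => ⟨_, hzW⟩) (s := {⟨0, hd⟩}) (by
      rw [orthonormal_iff_ite]
      rintro ⟨i, hi⟩ ⟨j, hj⟩
      rw [mem_singleton_iff] at hi hj
      have h1 : ‖(⟨_, hzW⟩ : W)‖ = 1 := by
        rw [Submodule.coe_norm, norm_smul, norm_inv, norm_norm, inv_mul_cancel₀ hz0]
      subst hi hj
      change inner ℝ (⟨_, hzW⟩ : W) (⟨_, hzW⟩ : W) = _
      rw [real_inner_self_eq_norm_sq, h1]
      simp)
  have hdk : d ≤ k + 1 := by rw [← hWd, ← hk]; exact Submodule.finrank_le W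
  obtain ⟨b, hb⟩ := Orthonormal.exists_orthonormalBasis_extension_of_card_eq (𝕜 := ℝ) (E := E)
    (ι := Fin (k + 1)) (by simpa using hk)
    (v := fun i => if h : (i : ℕ) < d then (b1 ⟨i, h⟩ : E) else 0) (s := {i | (i : ℕ) < d}) (by
      rw [orthonormal_iff_ite]
      rintro ⟨i, hi⟩ ⟨j, hj⟩
      have hi' : (i : ℕ) < d := hi
      have hj' : (j : ℕ) < d := hj
      have := orthonormal_iff_ite.1 b1.orthonormal ⟨i, hi'⟩ ⟨j, hj'⟩
      rw [Submodule.coe_inner] at this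
      simp only [domRestrict_apply, hi', hj', dif_pos, this, Subtype.mk.injEq, Fin.ext_iff])
  refine ⟨b, ?_, fun i => ?_⟩
  · rw [hb 0 (by simpa using hd)]
    rw [dif_pos (show ((0 : Fin (k + 1)) : ℕ) < d from hd)]
    exact congrArg Subtype.val (hb1 ⟨0, hd⟩ rfl)
  · split_ifs with hi
    · have hbi := hb i hi
      simp only [hi, dif_pos] at hbi
      obtain ⟨y, hy⟩ := (b1 ⟨i, hi⟩).2
      have hy' : B z z y = b i := hy.trans hbi.symm
      rw [← hy', hB.idem]
    · rw [zero_smul]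
      refine ext_inner_right ℝ fun v => ?_
      rw [hB.symm, inner_zero_left]
      have hv : B z z v ∈ W := ⟨v, rfl⟩
      have hsum := b1.sum_repr ⟨_, hv⟩
      have hsum' := congrArg Subtype.val hsum
      rw [Submodule.coe_sum] at hsum'
      change inner ℝ (b i) ((⟨_, hv⟩ : W) : E) = 0
      rw [← hsum', inner_sum]
      refine Finset.sum_eq_zero fun j _ => ?_
      rw [Submodule.coe_smul, real_inner_smul_right]
      have hj : (⟨j, j.2.trans_le hdk⟩ : Fin (k + 1)) ∈ {i : Fin (k + 1) | (i : ℕ) < d} := j.2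
      have hbj := hb _ hj
      have hj2 : (j : ℕ) < d := j.2
      simp only [hj2, dif_pos] at hbj
      rw [show (b1 j : E) = b1 ⟨j, hj2⟩ from rfl, ← hbj, b.orthonormal.inner_eq_zero, mul_zero]
      intro h
      rw [h] at hi
      exact hi hj2

/-- The spectrum of an operator which acts as `β (1 + B z z)` on the orthogonal complement of `z`
and multiplies the radial component by `κ`. -/
theorem IsLineForm.charpoly_roots (hB : IsLineForm d B) {k : ℕ}
    (hk : Module.finrank ℝ E = k + 1) {z : E} (hz : z ≠ 0) (A : Module.End ℝ E) {β κ : ℝ}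
    (hA : ∀ X, inner ℝ z X = 0 → A X = β • (X + B z z X))
    (hAz : inner ℝ z (A z) = κ * ‖z‖ ^ 2) :
    A.charpoly.roots = κ ::ₘ (Finset.univ : Finset (Fin k)).val.map
      fun i : Fin k => β * (1 + if (i : ℕ) + 1 < d then ‖z‖ ^ 2 else 0) := by
  have hz0 : ‖z‖ ≠ 0 := norm_ne_zero_iff.2 hz
  obtain ⟨b, hb0, hb⟩ := hB.exists_basis hk hz
  have hzb : z = ‖z‖ • b 0 := by rw [hb0, smul_smul, mul_inv_cancel₀ hz0, one_smul]
  have hcol : ∀ j : Fin k, A (b j.succ) =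
      (β * (1 + if (j : ℕ) + 1 < d then ‖z‖ ^ 2 else 0)) • b j.succ := by
    intro j
    have h0 : inner ℝ z (b j.succ) = 0 := by
      rw [hzb, real_inner_smul_left, b.orthonormal.inner_eq_zero (Fin.succ_ne_zero j).symm,
        mul_zero]
    rw [hA _ h0, hb, Fin.val_succ]
    module
  set M := LinearMap.toMatrix b.toBasis b.toBasis A with hM
  have hMij : ∀ i j, M i j = inner ℝ (b i) (A (b j)) := by
    intro i j
    rw [hM, LinearMap.toMatrix_apply, b.coe_toBasis, OrthonormalBasis.coe_toBasis_repr_apply,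
      OrthonormalBasis.repr_apply_apply]
  have htri : M.transpose.BlockTriangular id := by
    intro i j hij
    rw [Matrix.transpose_apply, hMij]
    obtain ⟨i', rfl⟩ := Fin.exists_succ_eq.2 (Fin.ne_zero_of_lt hij)
    rw [hcol, real_inner_smul_right, b.orthonormal.inner_eq_zero (ne_of_lt (show j < i'.succ from hij)), mul_zero]
  have hchar : A.charpoly = ∏ i, (Polynomial.X - Polynomial.C (M i i)) := by
    rw [← LinearMap.charpoly_toMatrix A b.toBasis, ← hM, ← Matrix.charpoly_transpose,
      Matrix.charpoly_of_isUpperTriangular _ htri]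
    rfl
  have hdiag0 : M 0 0 = κ := by
    rw [hMij]
    have : inner ℝ z (A z) = ‖z‖ ^ 2 * inner ℝ (b 0) (A (b 0)) := by
      conv_lhs => rw [hzb, map_smul, real_inner_smul_left, real_inner_smul_right]
      ring
    rw [this, mul_comm] at hAz
    exact mul_right_cancel₀ (pow_ne_zero 2 hz0) hAz
  have hdiag : ∀ j : Fin k, M j.succ j.succ =
      β * (1 + if (j : ℕ) + 1 < d then ‖z‖ ^ 2 else 0) := by
    intro j
    rw [hMij, hcol, real_inner_smul_right, real_inner_self_eq_norm_sq, b.norm_eq_one]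
    ring
  have : A.charpoly = (Multiset.map (fun a => Polynomial.X - Polynomial.C a)
      (κ ::ₘ (Finset.univ : Finset (Fin k)).val.map
      fun i : Fin k => β * (1 + if (i : ℕ) + 1 < d then ‖z‖ ^ 2 else 0))).prod := by
    rw [hchar, Fin.prod_univ_succ, hdiag0, Multiset.map_cons, Multiset.prod_cons,
      Multiset.map_map]
    congr 1
    exact Finset.prod_congr rfl fun j _ => by rw [hdiag]; rfl
  rw [this, Polynomial.roots_multiset_prod_X_sub_C]

/-- The symmetric functions of the spectrum of such an operator. They are affine in `κ`, so that
their vanishing determines `κ`, the curvature of the profile curve. -/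
theorem IsLineForm.esymm_charpoly_roots (hB : IsLineForm d B) {k : ℕ}
    (hk : Module.finrank ℝ E = k + 1) {z : E} (hz : z ≠ 0) (A : Module.End ℝ E) {β κ : ℝ}
    (hA : ∀ X, inner ℝ z X = 0 → A X = β • (X + B z z X))
    (hAz : inner ℝ z (A z) = κ * ‖z‖ ^ 2) (r : ℕ) :
    A.charpoly.roots.esymm (r + 1) = β ^ r *
      (β * sphereSymm d k (r + 1) (‖z‖ ^ 2) + κ * sphereSymm d k r (‖z‖ ^ 2)) := by
  have hscale : ∀ j, ((Finset.univ : Finset (Fin k)).val.map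
      fun i : Fin k => β * (1 + if (i : ℕ) + 1 < d then ‖z‖ ^ 2 else 0)).esymm j =
      β ^ j * sphereSymm d k j (‖z‖ ^ 2) := by
    intro j
    rw [Finset.esymm_map_val, sphereSymm_eq_sum, Finset.mul_sum]
    refine Finset.sum_congr rfl fun t ht => ?_
    rw [Finset.prod_mul_distrib, Finset.prod_const, (Finset.mem_powersetCard.1 ht).2]
  rw [hB.charpoly_roots hk hz A hA hAz, Multiset.esymm_cons_succ, hscale, hscale]
  ring

end LinearAlgebra

/-! ### Shape operators of hypersurfaces with spherical sections -/

section Slices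

variable {E : Type*} [NormedAddCommGroup E] [InnerProductSpace ℝ E] [FiniteDimensional ℝ E]
  {V : Type*} [NormedAddCommGroup V] [NormedSpace ℝ V] [FiniteDimensional ℝ V]
  {d : ℕ} {B : E →L[ℝ] E →L[ℝ] E →L[ℝ] E} {c : ℝ}

omit [FiniteDimensional ℝ V] in
/-- If the horizontal vectors in the range of an injective linear map `L : V → E × ℝ` are
orthogonal to `z`, then `V` is identified with `E`, horizontal vectors being unchanged and the
height becoming the radial component. -/
theorem exists_sliceEquiv (hdim : Module.finrank ℝ V = Module.finrank ℝ E) {z : E} (hz : z ≠ 0)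
    {L : V →L[ℝ] E × ℝ} (hL : Function.Injective L)
    (hR : ∀ u, (L u).2 = 0 → inner ℝ z (L u).1 = 0) :
    ∃ D : V ≃ₗ[ℝ] E, (∀ u, inner ℝ z (D u) = ‖z‖ ^ 2 * (L u).2) ∧
      ∀ u, (L u).2 = 0 → D u = (L u).1 := by
  have hz0 : ‖z‖ ≠ 0 := norm_ne_zero_iff.2 hz
  let D0 : V →ₗ[ℝ] E :=
    { toFun := fun u => (L u).1 - ((‖z‖ ^ 2)⁻¹ * inner ℝ z (L u).1) • z + (L u).2 • z
      map_add' := fun u w => by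
        simp only [map_add, Prod.fst_add, Prod.snd_add, inner_add_right]; module
      map_smul' := fun s u => by
        simp only [map_smul, Prod.smul_fst, Prod.smul_snd, inner_smul_right, RingHom.id_apply,
          smul_eq_mul]
        module }
  have h1 : ∀ u, inner ℝ z (D0 u) = ‖z‖ ^ 2 * (L u).2 := fun u => by
    change inner ℝ z ((L u).1 - ((‖z‖ ^ 2)⁻¹ * inner ℝ z (L u).1) • z + (L u).2 • z) = _
    rw [inner_add_right, inner_sub_right, inner_smul_right, inner_smul_right,
      real_inner_self_eq_norm_sq]
    field_simp
    ring
  have h2 : ∀ u, (L u).2 = 0 → D0 u = (L u).1 := fun u hu => by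
    change (L u).1 - ((‖z‖ ^ 2)⁻¹ * inner ℝ z (L u).1) • z + (L u).2 • z = _
    rw [hu, hR u hu]; simp
  have hinj : Function.Injective D0 := by
    rw [← LinearMap.ker_eq_bot, LinearMap.ker_eq_bot']
    intro u hu
    have h3 : (L u).2 = 0 := by
      have := h1 u
      rw [hu, inner_zero_right] at this
      exact (mul_eq_zero.1 this.symm).resolve_left (by positivity)
    have h4 : (L u).1 = 0 := by rw [← h2 u h3, hu]
    exact hL ((Prod.ext h4 h3 : L u = 0).trans (map_zero L).symm)
  exact ⟨LinearEquiv.ofInjectiveOfFinrankEq D0 hinj hdim, h1, h2⟩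

omit [FiniteDimensional ℝ V] in
/-- The unit normals of such a hypersurface lie in the radial and vertical plane. -/
theorem exists_radial_normal (hc : 0 < c) (hB : IsLineForm d B)
    (hdim : Module.finrank ℝ V = Module.finrank ℝ E) {p : E × ℝ} (hp : ‖p.1‖ < 1) (hz : p.1 ≠ 0)
    {L : V →L[ℝ] E × ℝ} (hL : Function.Injective L)
    (hR : ∀ u, (L u).2 = 0 → inner ℝ p.1 (L u).1 = 0)
    {ν : E × ℝ} (hu : cylMetric c B p ν ν = 1) (hn : ∀ u, cylMetric c B p (L u) ν = 0) :
    ∃ a : ℝ, ν.1 = a • p.1 ∧ c * a ^ 2 * ‖p.1‖ ^ 2 / (1 - ‖p.1‖ ^ 2) ^ 2 + ν.2 ^ 2 = 1 ∧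
      ∀ u, c * a * inner ℝ p.1 (L u).1 / (1 - ‖p.1‖ ^ 2) ^ 2 + (L u).2 * ν.2 = 0 := by
  obtain ⟨z, s⟩ := p
  obtain ⟨w, b⟩ := ν
  simp only at hp hz hR hu hn ⊢
  have hz0 : ‖z‖ ≠ 0 := norm_ne_zero_iff.2 hz
  obtain ⟨D, hD1, hD2⟩ := exists_sliceEquiv hdim hz hL hR
  set a := (‖z‖ ^ 2)⁻¹ * inner ℝ z w with ha
  have hwz : inner ℝ z (w - a • z) = 0 := by
    rw [inner_sub_right, inner_smul_right, real_inner_self_eq_norm_sq, ha]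
    field_simp
    ring
  have hw : w = a • z := by
    have h1 := hD1 (D.symm (w - a • z))
    rw [D.apply_symm_apply, hwz] at h1
    have h2 : (L (D.symm (w - a • z))).2 = 0 :=
      (mul_eq_zero.1 h1.symm).resolve_left (by positivity)
    have h3 := hD2 _ h2
    rw [D.apply_symm_apply] at h3
    have h4 := hn (D.symm (w - a • z))
    simp only [cylMetric, h2, ← h3, zero_mul, add_zero] at h4
    have h5 : ballMetric c B z (w - a • z) (a • z) = 0 := by
      rw [ballMetric_radial hB hp, hwz]; simp
    have h6 : ballMetric c B z (w - a • z) (w - a • z) = 0 := by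
      have : ballMetric c B z (w - a • z) (w - a • z) = ballMetric c B z (w - a • z) w -
          ballMetric c B z (w - a • z) (a • z) := by
        simp only [ballMetric, inner_sub_right]; ring
      rw [this, h4, h5, sub_zero]
    have h7 := ballMetric_self_ge hc hB hp (w - a • z)
    rw [h6] at h7
    have h8 : ‖w - a • z‖ ^ 2 ≤ 0 := nonpos_of_mul_nonpos_right h7 hc
    have h9 : ‖w - a • z‖ = 0 := by nlinarith [norm_nonneg (w - a • z)]
    exact sub_eq_zero.1 (norm_eq_zero.1 h9)
  refine ⟨a, hw, ?_, fun u => ?_⟩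
  · simp only [cylMetric] at hu
    rw [hw, ballMetric_radial hB hp, inner_smul_right, real_inner_self_eq_norm_sq] at hu
    linear_combination hu
  · have := hn u
    simp only [cylMetric] at this
    rwa [hw, ballMetric_radial hB hp] at this

omit [FiniteDimensional ℝ V] in
/-- If `dq = μ dh` then `dμ ∧ dh = 0`. -/
theorem fderiv_wedge_eq_zero {q h μ : V → ℝ} {y : V} (hq : ContDiffAt ℝ ∞ q y)
    (hh : ContDiffAt ℝ ∞ h y) (hμ : DifferentiableAt ℝ μ y)
    (heq : ∀ᶠ w in 𝓝 y, fderiv ℝ q w = μ w • fderiv ℝ h w) (u w : V) :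
    fderiv ℝ μ y u * fderiv ℝ h y w = fderiv ℝ μ y w * fderiv ℝ h y u := by
  have hh1 : DifferentiableAt ℝ (fderiv ℝ h) y :=
    (hh.fderiv_right (m := 1) (by rw [one_add_one_eq_two]; exact ENat.LEInfty.out)).differentiableAt (by simp)
  have hd : HasFDerivAt (fderiv ℝ q) (μ y • fderiv ℝ (fderiv ℝ h) y +
      (fderiv ℝ μ y).smulRight (fderiv ℝ h y)) y :=
    (hμ.hasFDerivAt.smul hh1.hasFDerivAt).congr_of_eventuallyEq heq
  have hs1 := (hq.isSymmSndFDerivAt (by simpa using ENat.LEInfty.out)) u w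
  have hs2 := (hh.isSymmSndFDerivAt (by simpa using ENat.LEInfty.out)) u w
  rw [hd.fderiv] at hs1
  simp only [add_apply, smul_apply,
    ContinuousLinearMap.smulRight_apply, smul_eq_mul, hs2] at hs1
  linarith

omit [FiniteDimensional ℝ E] [FiniteDimensional ℝ V] in
theorem fderiv_norm_apply {f : V → E} {y : V} (hf : DifferentiableAt ℝ f y) (h0 : f y ≠ 0) (u : V) :
    fderiv ℝ (fun w => ‖f w‖) y u = inner ℝ (f y) (fderiv ℝ f y u) / ‖f y‖ := by
  have h1 : DifferentiableAt ℝ (fun w => ‖f w‖) y := hf.norm ℝ h0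
  have h2 : HasFDerivAt (fun w => ‖f w‖ ^ 2) (2 • (innerSL ℝ (f y)).comp (fderiv ℝ f y)) y :=
    hf.hasFDerivAt.norm_sq
  have h3 := h1.hasFDerivAt.pow 2
  have h4 := DFunLike.congr_fun (h2.unique h3) u
  have h5 : ‖f y‖ ≠ 0 := norm_ne_zero_iff.2 h0
  simp at h4
  field_simp
  linarith

/-- The slope of the profile curve, i.e. the derivative of the hyperbolic radius by the height,
controls the mean curvatures: for an immersion `F` with spherical sections and profile slope `v`,
the `(r + 1)`-th mean curvature vanishes at `y` if and only if the differential of `v` is the given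
multiple of the differential of the height. -/
theorem esymm_shape_eq_zero_iff (hc : 0 < c) (hB : IsLineForm d B) {k : ℕ}
    (hk : Module.finrank ℝ E = k + 1) (hdim : Module.finrank ℝ V = Module.finrank ℝ E)
    {F ν : V → E × ℝ} {v : V → ℝ} {y : V} (hF : ContDiffAt ℝ ∞ F y)
    (hball : ‖(F y).1‖ < 1) (hz : (F y).1 ≠ 0)
    (hinj : ∀ᶠ w in 𝓝 y, Function.Injective (fderiv ℝ F w))
    {e : V} (he : (fderiv ℝ F y e).2 ≠ 0) (hv : DifferentiableAt ℝ v y)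
    (hslope : ∀ᶠ w in 𝓝 y, ∀ u, inner ℝ (F w).1 (fderiv ℝ F w u).1 =
      ‖(F w).1‖ * (1 - ‖(F w).1‖ ^ 2) / √c * v w * (fderiv ℝ F w u).2)
    (hν : DifferentiableAt ℝ ν y)
    (hunit : ∀ᶠ w in 𝓝 y, cylMetric c B (F w) (ν w) (ν w) = 1)
    (hnormal : ∀ᶠ w in 𝓝 y, ∀ u, cylMetric c B (F w) (fderiv ℝ F w u) (ν w) = 0)
    {A : Module.End ℝ V} (hA : ∀ u Z, cylMetric c B (F y) (fderiv ℝ F y (A u)) Z =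
      -(cylMetric c B (F y) (fderiv ℝ ν y u) Z +
        christoffel (cylMetric c B) (F y) (fderiv ℝ F y u) (ν y) Z))
    (r : ℕ) (hr : sphereSymm d k r (‖(F y).1‖ ^ 2) ≠ 0) :
    A.charpoly.roots.esymm (r + 1) = 0 ↔ ∀ u, fderiv ℝ v y u =
      sphereSymm d k (r + 1) (‖(F y).1‖ ^ 2) / sphereSymm d k r (‖(F y).1‖ ^ 2) *
        (1 + v y ^ 2) / (√c * ‖(F y).1‖) * (fderiv ℝ F y u).2 := by
  have hsc : 0 < √c := Real.sqrt_pos.2 hc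
  have hcc : √c ^ 2 = c := Real.sq_sqrt hc.le
  have hFd : DifferentiableAt ℝ F y := hF.differentiableAt (by simp)
  have hF1 : ContDiffAt ℝ ∞ (fun w => (F w).1) y := hF.fst
  have hF2 : ContDiffAt ℝ ∞ (fun w => (F w).2) y := hF.snd
  have hFev : ∀ᶠ w in 𝓝 y, DifferentiableAt ℝ F w := by
    have h1 : ContDiffAt ℝ 1 F y := hF.of_le (by simp)
    filter_upwards [h1.eventually (by simp)] with w hw using hw.differentiableAt (by simp)
  have hd1 : ∀ {w}, DifferentiableAt ℝ F w → ∀ u,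
      fderiv ℝ (fun w => (F w).1) w u = (fderiv ℝ F w u).1 := fun h u => by
    rw [h.hasFDerivAt.fst.fderiv]; rfl
  have hd2 : ∀ {w}, DifferentiableAt ℝ F w → ∀ u,
      fderiv ℝ (fun w => (F w).2) w u = (fderiv ℝ F w u).2 := fun h u => by
    rw [h.hasFDerivAt.snd.fderiv]; rfl
  have hz0 : 0 < ‖(F y).1‖ := norm_pos_iff.2 hz
  have h1s := one_sub_norm_sq_pos hball
  have hballev : ∀ᶠ w in 𝓝 y, ‖(F w).1‖ < 1 :=
    hF1.continuousAt.norm.eventually_lt continuousAt_const hball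
  have hzev : ∀ᶠ w in 𝓝 y, (F w).1 ≠ 0 := hF1.continuousAt.eventually_ne hz
  set L := fderiv ℝ F y with hL
  have hR : ∀ u, (L u).2 = 0 → inner ℝ (F y).1 (L u).1 = 0 := fun u hu => by
    rw [hslope.self_of_nhds u, hu, mul_zero]
  obtain ⟨D, hD1, hD2⟩ := exists_sliceEquiv hdim hz hinj.self_of_nhds hR
  -- functions of the radius are stationary along horizontal vectors
  set ρ : V → ℝ := fun w => ‖(F w).1‖ with hρ
  have hρd : DifferentiableAt ℝ ρ y := (hF1.differentiableAt (by simp)).norm ℝ hz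
  have hρk : ∀ u, (L u).2 = 0 → fderiv ℝ ρ y u = 0 := fun u hu => by
    rw [fderiv_norm_apply (hF1.differentiableAt (by simp)) hz, hd1 hFd, hR u hu, zero_div]
  have hfun : ∀ G : ℝ → ℝ, DifferentiableAt ℝ G (ρ y) → DifferentiableAt ℝ (fun w => G (ρ w)) y ∧
      ∀ u, (L u).2 = 0 → fderiv ℝ (fun w => G (ρ w)) y u = 0 := fun G hG => by
    have h1 := hG.hasDerivAt.comp_hasFDerivAt y hρd.hasFDerivAt
    refine ⟨h1.differentiableAt, fun u hu => ?_⟩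
    have h2 := DFunLike.congr_fun h1.fderiv u
    rw [smul_apply, hρk u hu, smul_zero] at h2
    exact h2
  obtain ⟨hκd, hκk⟩ := hfun (fun x => x * (1 - x ^ 2) / √c) (by fun_prop)
  obtain ⟨hχd, hχk⟩ := hfun (fun x => √c * x / (1 - x ^ 2))
    (DifferentiableAt.fun_div (by fun_prop) (by fun_prop) h1s.ne')
  -- the slope is stationary along horizontal vectors
  have hvk : ∀ u, (L u).2 = 0 → fderiv ℝ v y u = 0 := by
    intro u hu
    have hμd := hκd.mul hv
    have hwedge := fderiv_wedge_eq_zero (q := fun w => ‖(F w).1‖ ^ 2 / 2)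
      (h := fun w => (F w).2) (hF1.norm_sq ℝ |>.div_const 2) hF2 hμd (by
        filter_upwards [hslope, hFev] with w hw1 hw2
        have h3 : HasFDerivAt (fun w => ‖(F w).1‖ ^ 2 / 2) _ w :=
          (hw2.hasFDerivAt.fst.norm_sq).mul_const 2⁻¹
        rw [h3.fderiv]
        ext u
        have := hw1 u
        simp [hd2 hw2]
        exact this) u e
    rw [hd2 hFd, hd2 hFd, show (fderiv ℝ F y u).2 = 0 from hu, mul_zero] at hwedge
    have h4 := (mul_eq_zero.1 hwedge).resolve_right he
    rw [(hκd.hasFDerivAt.mul hv.hasFDerivAt).fderiv] at h4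
    simp only [add_apply, smul_apply, hκk u hu, smul_eq_mul, mul_zero, add_zero] at h4
    refine (mul_eq_zero.1 h4).resolve_left ?_
    have : 0 < ρ y := hz0
    positivity
  -- the normal field
  set a : V → ℝ := fun w => (‖(F w).1‖ ^ 2)⁻¹ * inner ℝ (F w).1 (ν w).1 with ha
  set b : V → ℝ := fun w => (ν w).2 with hb
  have had : DifferentiableAt ℝ a y :=
    DifferentiableAt.fun_mul (((hF1.norm_sq ℝ).differentiableAt (by simp)).fun_inv (by positivity))
      ((hF1.differentiableAt (by simp)).inner ℝ hν.fst)
  have hbd : DifferentiableAt ℝ b y := hν.snd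
  have hnf : ∀ᶠ w in 𝓝 y, (ν w).1 = a w • (F w).1 ∧
      c * a w ^ 2 * ‖(F w).1‖ ^ 2 / (1 - ‖(F w).1‖ ^ 2) ^ 2 + b w ^ 2 = 1 ∧
      ∀ u, c * a w * inner ℝ (F w).1 (fderiv ℝ F w u).1 / (1 - ‖(F w).1‖ ^ 2) ^ 2 +
        (fderiv ℝ F w u).2 * b w = 0 := by
    filter_upwards [hballev, hzev, hinj, hslope, hunit, hnormal] with w h1 h2 h3 h4 h5 h6
    obtain ⟨a', h7, h8, h9⟩ := exists_radial_normal hc hB hdim h1 h2 h3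
      (fun u hu => by rw [h4 u, hu, mul_zero]) h5 h6
    have : a w = a' := by
      have : ‖(F w).1‖ ≠ 0 := norm_ne_zero_iff.2 h2
      simp only [ha]
      rw [h7, inner_smul_right, real_inner_self_eq_norm_sq]
      field_simp
    rw [this]
    exact ⟨h7, h8, h9⟩
  set p : V → ℝ := fun w => a w * (√c * ρ w / (1 - ρ w ^ 2)) with hp
  have hpd : DifferentiableAt ℝ p y := had.mul hχd
  have hdhev : ∀ᶠ w in 𝓝 y, (fderiv ℝ F w e).2 ≠ 0 := by
    have h1 : ContinuousAt (fun w => (fderiv ℝ F w e).2) y := by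
      have : ContinuousAt (fderiv ℝ F) y :=
        (hF.fderiv_right (m := 0) (by simp)).continuousAt
      fun_prop
    exact h1.eventually_ne he
  have hbp : ∀ᶠ w in 𝓝 y, b w = -(p w * v w) := by
    filter_upwards [hnf, hslope, hdhev, hballev] with w h1 h2 h3 h4
    have h5 := h1.2.2 e
    have h6 := one_sub_norm_sq_pos h4
    rw [h2 e] at h5
    have h7 : p w * v w + b w = 0 := by
      refine mul_right_cancel₀ h3 ?_
      rw [zero_mul, ← h5, ← hcc]
      simp only [hp, hρ, Real.sqrt_sq hsc.le]
      field_simp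
    linarith
  have hpv : ∀ᶠ w in 𝓝 y, p w ^ 2 * (1 + v w ^ 2) = 1 := by
    filter_upwards [hnf, hbp, hballev] with w h1 h2 h4
    have h5 := h1.2.1
    have h6 := one_sub_norm_sq_pos h4
    rw [h2] at h5
    have hp2 : p w ^ 2 = c * a w ^ 2 * ‖(F w).1‖ ^ 2 / (1 - ‖(F w).1‖ ^ 2) ^ 2 := by
      simp only [hp, hρ]
      rw [mul_pow, div_pow, mul_pow √c, hcc]
      ring
    linear_combination h5 + hp2
  have hpy := hpv.self_of_nhds
  have hp0 : p y ≠ 0 := fun h => by rw [h] at hpy; norm_num at hpy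
  have hdp : ∀ u, fderiv ℝ p y u * (1 + v y ^ 2) = -(p y * v y * fderiv ℝ v y u) := by
    intro u
    have h1 : HasFDerivAt (fun w => p w ^ 2 * (1 + v w ^ 2)) _ y :=
      (hpd.hasFDerivAt.pow 2).mul ((hv.hasFDerivAt.pow 2).const_add 1)
    have h2 : HasFDerivAt (fun w => p w ^ 2 * (1 + v w ^ 2)) (0 : V →L[ℝ] ℝ) y :=
      (hasFDerivAt_const (1 : ℝ) y).congr_of_eventuallyEq hpv
    have h3 := DFunLike.congr_fun (h1.unique h2) u
    simp at h3
    refine mul_left_cancel₀ hp0 ?_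
    linear_combination h3 / 2
  have hdb : ∀ u, fderiv ℝ b y u = -(p y ^ 3 * fderiv ℝ v y u) := by
    intro u
    have h1 : HasFDerivAt (fun w => -(p w * v w)) _ y := (hpd.hasFDerivAt.mul hv.hasFDerivAt).neg
    have h2 := DFunLike.congr_fun ((h1.congr_of_eventuallyEq hbp).fderiv) u
    simp at h2
    have h3 := hdp u
    have h4 : (1 + v y ^ 2) ≠ 0 := by positivity
    rw [h2]
    refine mul_right_cancel₀ h4 ?_
    linear_combination (-v y) * h3 + p y * fderiv ℝ v y u * hpy
  have hak : ∀ u, (L u).2 = 0 → fderiv ℝ a y u = 0 := by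
    intro u hu
    have h1 := DFunLike.congr_fun ((had.hasFDerivAt.mul hχd.hasFDerivAt).fderiv) u
    have h2 := hdp u
    rw [hvk u hu, mul_zero, neg_zero] at h2
    have h3 : fderiv ℝ p y u = 0 := (mul_eq_zero.1 h2).resolve_right (by positivity)
    have h4 : fderiv ℝ p y u = _ := h1
    rw [h3] at h4
    simp only [add_apply, smul_apply, hχk u hu, smul_eq_mul, mul_zero, zero_add] at h4
    refine (mul_eq_zero.1 h4.symm).resolve_left ?_
    have : 0 < ρ y := hz0
    have : 0 < 1 - ρ y ^ 2 := h1s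
    positivity
  have hdν : ∀ u, fderiv ℝ ν y u = (a y • (L u).1 + fderiv ℝ a y u • (F y).1,
      fderiv ℝ b y u) := by
    intro u
    have h1 : HasFDerivAt (fun w => (a w • (F w).1, b w)) _ y :=
      (had.hasFDerivAt.smul hFd.hasFDerivAt.fst).prodMk hbd.hasFDerivAt
    have h2 : ν =ᶠ[𝓝 y] fun w => (a w • (F w).1, b w) := by
      filter_upwards [hnf] with w hw
      exact Prod.ext hw.1 rfl
    rw [h2.fderiv_eq, h1.fderiv]
    simp [hL]
  have hνy : ν y = (a y • (F y).1, b y) := Prod.ext hnf.self_of_nhds.1 rfl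
  -- the vertical component of the shape operator
  have hA2 : ∀ u, (L (A u)).2 = p y ^ 3 * fderiv ℝ v y u := by
    intro u
    have h1 := hA u (0, 1)
    rw [christoffel_cylMetric_vertical hball, hdν] at h1
    simp only [cylMetric, ballMetric_zero_right, zero_add, mul_one, add_zero, hdb u, neg_neg] at h1
    exact h1
  -- the shape operator along horizontal vectors
  have hA1 : ∀ u, (L u).2 = 0 → (L (A u)).1 =
      (-(a y / (1 - ‖(F y).1‖ ^ 2))) • ((L u).1 + B (F y).1 (F y).1 (L u).1) := by
    intro u hu
    set Y := (L (A u)).1 - (-(a y / (1 - ‖(F y).1‖ ^ 2))) • ((L u).1 +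
      B (F y).1 (F y).1 (L u).1) with hY
    have hY0 : ∀ Z, ballMetric c B (F y).1 Y Z = 0 := by
      intro Z
      have h1 := hA u (Z, 0)
      rw [hνy, christoffel_cylMetric_radial hB hball _ (hR u hu), hdν, hak u hu] at h1
      simp only [cylMetric, mul_zero, add_zero, zero_smul] at h1
      have h2 : ballMetric c B (F y).1 Y Z = ballMetric c B (F y).1 (L (A u)).1 Z +
          (a y / (1 - ‖(F y).1‖ ^ 2)) * ballMetric c B (F y).1 ((L u).1 +
          B (F y).1 (F y).1 (L u).1) Z := by
        simp only [hY, ballMetric, inner_sub_left, map_sub, map_smul, inner_smul_left, neg_smul,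
          map_neg, inner_neg_left, RCLike.conj_to_real]
        ring
      rw [h2, h1]
      simp only [ballMetric, inner_add_left, map_add, map_smul, hB.idem, inner_smul_left,
        RCLike.conj_to_real]
      field_simp
      ring
    have h7 := ballMetric_self_ge hc hB hball Y
    rw [hY0] at h7
    have h8 : ‖Y‖ ^ 2 ≤ 0 := nonpos_of_mul_nonpos_right h7 hc
    have h9 : ‖Y‖ = 0 := by nlinarith [norm_nonneg Y]
    exact sub_eq_zero.1 (norm_eq_zero.1 h9)
  -- conjugation to the standard form
  set u0 := D.symm (F y).1 with hu0
  have hu02 : (L u0).2 = 1 := by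
    have := hD1 u0
    rw [hu0, D.apply_symm_apply, real_inner_self_eq_norm_sq] at this
    exact (mul_right_eq_self₀.1 this.symm).resolve_right (by positivity)
  have hconj := hB.esymm_charpoly_roots hk hz (D.conj A)
    (β := -(a y / (1 - ‖(F y).1‖ ^ 2))) (κ := p y ^ 3 * fderiv ℝ v y u0) (fun X hX => by
      have h1 := hD1 (D.symm X)
      rw [D.apply_symm_apply, hX] at h1
      have h2 : (L (D.symm X)).2 = 0 := (mul_eq_zero.1 h1.symm).resolve_left (by positivity)
      have h3 := hD2 _ h2
      rw [D.apply_symm_apply] at h3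
      rw [LinearEquiv.conj_apply_apply, hD2, hA1 _ h2, ← h3]
      rw [hA2, hvk _ h2, mul_zero]) (by
      rw [LinearEquiv.conj_apply_apply, hD1, hA2]; ring) r
  rw [LinearEquiv.charpoly_conj] at hconj
  have ha0 : a y ≠ 0 := fun h => hp0 (by simp [hp, h])
  have hdvu : ∀ u, fderiv ℝ v y u = fderiv ℝ v y u0 * (L u).2 := by
    intro u
    have := hvk (u - (L u).2 • u0) (by simp [hu02])
    rw [map_sub, map_smul, smul_eq_mul, sub_eq_zero] at this
    rw [this, mul_comm]
  have hay : a y / (1 - ‖(F y).1‖ ^ 2) = p y / (√c * ‖(F y).1‖) := by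
    simp only [hp, hρ]; field_simp
  have hiff : A.charpoly.roots.esymm (r + 1) = 0 ↔ fderiv ℝ v y u0 =
      sphereSymm d k (r + 1) (‖(F y).1‖ ^ 2) / sphereSymm d k r (‖(F y).1‖ ^ 2) *
        (1 + v y ^ 2) / (√c * ‖(F y).1‖) := by
    rw [hconj, mul_eq_zero, or_iff_right (pow_ne_zero _ (neg_ne_zero.2
      (div_ne_zero ha0 h1s.ne'))), hay]
    have h1 : 1 + v y ^ 2 = 1 / p y ^ 2 := by
      rw [eq_div_iff (pow_ne_zero 2 hp0), mul_comm]; exact hpy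
    rw [h1]
    field_simp
    constructor
    · intro h
      refine mul_left_cancel₀ hp0 ?_
      linear_combination h
    · intro h
      linear_combination (p y) * h
  rw [hiff]
  constructor
  · intro h u
    rw [hdvu u, h]
  · intro h
    rw [h u0, hu02, mul_one]

end Slices

/-! ### The profile curves of the catenoids -/

section Profile

theorem sphereSymm_pos {d k r : ℕ} (hr : r ≤ k) {x : ℝ} (hx : 0 ≤ x) : 0 < sphereSymm d k r x := by
  rw [sphereSymm_eq_sum]
  refine Finset.sum_pos (fun t _ => Finset.prod_pos fun i _ => ?_) ?_
  · split_ifs <;> linarith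
  · rw [Finset.powersetCard_nonempty]; simpa using hr

theorem sphereSymm_eq_zero {d k r : ℕ} (hr : k < r) (x : ℝ) : sphereSymm d k r x = 0 := by
  rw [sphereSymm_eq_sum, Finset.powersetCard_eq_empty.2 (by simpa using hr), Finset.sum_empty]

theorem contDiff_sphereSymm (d k r : ℕ) : ContDiff ℝ ∞ (sphereSymm d k r) := by
  have : sphereSymm d k r = fun x => ∑ t ∈ (Finset.univ : Finset (Fin k)).powersetCard r,
      ∏ i ∈ t, (1 + if (i : ℕ) + 1 < d then x else 0) := funext fun x => sphereSymm_eq_sum d k r x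
  rw [this]
  refine ContDiff.sum fun t _ => contDiff_prod fun i _ => ?_
  split_ifs <;> fun_prop

/-- The coefficient of the profile equation: the quotient of consecutive symmetric functions of the
curvatures of the geodesic sphere at square distance `x` from the origin. -/
def profileQ (d k r : ℕ) (x : ℝ) : ℝ := sphereSymm d k (r + 1) x / sphereSymm d k r x

theorem profileQ_eq_zero (d k : ℕ) (x : ℝ) : profileQ d k k x = 0 := by
  rw [profileQ, sphereSymm_eq_zero (Nat.lt_succ_self k), zero_div]

theorem profileQ_pos {d k r : ℕ} (hr : r + 1 ≤ k) {x : ℝ} (hx : 0 ≤ x) : 0 < profileQ d k r x :=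
  div_pos (sphereSymm_pos hr hx) (sphereSymm_pos (by omega) hx)

theorem exists_le_profileQ (d : ℕ) {k r : ℕ} (hr : r + 1 ≤ k) :
    ∃ κ > 0, ∀ x ∈ Icc (0 : ℝ) 1, κ ≤ profileQ d k r x := by
  have hc : ContinuousOn (profileQ d k r) (Icc 0 1) :=
    (contDiff_sphereSymm d k (r + 1)).continuous.continuousOn.div
      (contDiff_sphereSymm d k r).continuous.continuousOn
      fun x hx => (sphereSymm_pos (by omega) hx.1).ne'
  obtain ⟨x, hx, hmin⟩ := isCompact_Icc.exists_isMinOn ⟨0, by simp⟩ hc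
  exact ⟨_, profileQ_pos hr hx.1, fun y hy => hmin hy⟩

theorem sigmoid_mem (y : ℝ) : Real.sigmoid y ∈ Ioo (0 : ℝ) 1 :=
  ⟨Real.sigmoid_pos y, Real.sigmoid_lt_one y⟩

theorem contDiff_profileQ_sigmoid (d : ℕ) {k r : ℕ} (hr : r ≤ k) :
    ContDiff ℝ ∞ fun y => profileQ d k r (Real.sigmoid y) := by
  have hs : ContDiff ℝ ∞ Real.sigmoid := contDiff_sigmoid.of_le le_top
  exact ((contDiff_sphereSymm d k (r + 1)).comp hs).div ((contDiff_sphereSymm d k r).comp hs)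
    fun y => (sphereSymm_pos hr (sigmoid_mem y).1.le).ne'

/-- The inverse of the sigmoid function. -/
def logit (x : ℝ) : ℝ := Real.log (x / (1 - x))

theorem sigmoid_logit {x : ℝ} (hx : x ∈ Ioo (0 : ℝ) 1) : Real.sigmoid (logit x) = x := by
  have h1 : 0 < 1 - x := by linarith [hx.2]
  rw [Real.sigmoid_def, logit, ← Real.log_inv, Real.exp_log (inv_pos.2 (div_pos hx.1 h1))]
  have := hx.1.ne'
  field_simp
  ring

theorem logit_sigmoid (y : ℝ) : logit (Real.sigmoid y) = y :=
  Real.sigmoid_injective (sigmoid_logit (sigmoid_mem y))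

theorem hasDerivAt_logit {x : ℝ} (hx : x ∈ Ioo (0 : ℝ) 1) :
    HasDerivAt logit (1 / (x * (1 - x))) x := by
  have h1 : 0 < 1 - x := by linarith [hx.2]
  have h2 : HasDerivAt (fun x : ℝ => x / (1 - x)) _ x :=
    (hasDerivAt_id x).fun_div ((hasDerivAt_id x).const_sub 1) h1.ne'
  have h3 := h2.log (div_pos hx.1 h1).ne'
  refine h3.congr_deriv ?_
  have := hx.1.ne'
  simp only [id]
  field_simp
  ring

/-- The primitive, in the variable `logit (|z| ^ 2)`, of the coefficient of the profile equation. -/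
def profilePrimitive (d k r : ℕ) (y : ℝ) : ℝ := ∫ s in (0 : ℝ)..y, profileQ d k r (Real.sigmoid s)

variable {d k r : ℕ}

theorem hasDerivAt_profilePrimitive (hr : r ≤ k) (y : ℝ) :
    HasDerivAt (profilePrimitive d k r) (profileQ d k r (Real.sigmoid y)) y :=
  ((contDiff_profileQ_sigmoid d hr).continuous.integral_hasStrictDerivAt 0 y).hasDerivAt

theorem contDiff_profilePrimitive (hr : r ≤ k) : ContDiff ℝ ∞ (profilePrimitive d k r) := by
  rw [contDiff_infty_iff_deriv]
  refine ⟨fun y => (hasDerivAt_profilePrimitive hr y).differentiableAt, ?_⟩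
  rw [show deriv (profilePrimitive d k r) = fun y => profileQ d k r (Real.sigmoid y) from
    funext fun y => (hasDerivAt_profilePrimitive hr y).deriv]
  exact contDiff_profileQ_sigmoid d hr

/-- The primitive grows at least linearly: its derivative is a continuous positive function of
`|z| ^ 2 ∈ [0, 1]`. Hence it is a diffeomorphism of the real line. -/
theorem exists_profilePrimitive_growth (d : ℕ) (hr : r + 1 ≤ k) : ∃ κ > 0, ∀ a b, a ≤ b →
    κ * (b - a) ≤ profilePrimitive d k r b - profilePrimitive d k r a := by
  obtain ⟨κ, hκ, hle⟩ := exists_le_profileQ d hr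
  refine ⟨κ, hκ, fun a b hab => ?_⟩
  have hmono : Monotone fun y => profilePrimitive d k r y - κ * y := by
    have hd : ∀ y, HasDerivAt (fun y => profilePrimitive d k r y - κ * y)
        (profileQ d k r (Real.sigmoid y) - κ * 1) y := fun y =>
      (hasDerivAt_profilePrimitive (by omega) y).sub ((hasDerivAt_id y).const_mul κ)
    refine monotone_of_deriv_nonneg (fun y => (hd y).differentiableAt) fun y => ?_
    rw [(hd y).deriv]
    linarith [hle _ ⟨(sigmoid_mem y).1.le, (sigmoid_mem y).2.le⟩]
  have := hmono hab
  simp only at this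
  linarith

theorem tendsto_profilePrimitive_atBot (d : ℕ) (hr : r + 1 ≤ k) :
    Tendsto (profilePrimitive d k r) atBot atBot := by
  obtain ⟨κ, hκ, hle⟩ := exists_profilePrimitive_growth d hr
  refine tendsto_atBot_mono' _ ?_ ((tendsto_id.const_mul_atBot hκ).atBot_add
    (tendsto_const_nhds (x := profilePrimitive d k r 0)))
  filter_upwards [eventually_le_atBot 0] with y hy
  have := hle y 0 hy
  simp only [id]
  linarith

theorem tendsto_profilePrimitive_atTop (d : ℕ) (hr : r + 1 ≤ k) :
    Tendsto (profilePrimitive d k r) atTop atTop := by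
  obtain ⟨κ, hκ, hle⟩ := exists_profilePrimitive_growth d hr
  refine tendsto_atTop_mono' _ ?_ ((tendsto_id.const_mul_atTop hκ).atTop_add
    (tendsto_const_nhds (x := profilePrimitive d k r 0)))
  filter_upwards [eventually_ge_atTop 0] with y hy
  have := hle 0 y hy
  simp only [id]
  linarith

theorem strictMono_profilePrimitive (d : ℕ) (hr : r + 1 ≤ k) :
    StrictMono (profilePrimitive d k r) := by
  obtain ⟨κ, hκ, hle⟩ := exists_profilePrimitive_growth d hr
  intro a b hab
  have := hle a b hab.le
  nlinarith [mul_pos hκ (sub_pos.2 hab)]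

theorem surjective_profilePrimitive (d : ℕ) (hr : r + 1 ≤ k) :
    Function.Surjective (profilePrimitive d k r) :=
  (contDiff_profilePrimitive (by omega)).continuous.surjective
    (tendsto_profilePrimitive_atTop d hr) (tendsto_profilePrimitive_atBot d hr)

/-- The inverse function of `profilePrimitive`. -/
def profileInverse (d k r : ℕ) : ℝ → ℝ := Function.invFun (profilePrimitive d k r)

theorem profilePrimitive_profileInverse (hr : r + 1 ≤ k) (y : ℝ) :
    profilePrimitive d k r (profileInverse d k r y) = y :=
  Function.rightInverse_invFun (surjective_profilePrimitive d hr) y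

theorem profileInverse_profilePrimitive (hr : r + 1 ≤ k) (y : ℝ) :
    profileInverse d k r (profilePrimitive d k r y) = y :=
  Function.leftInverse_invFun (strictMono_profilePrimitive d hr).injective y

theorem contDiff_profileInverse (d : ℕ) (hr : r + 1 ≤ k) : ContDiff ℝ ∞ (profileInverse d k r) := by
  let e : ℝ ≃ₜ ℝ := ((strictMono_profilePrimitive d hr).orderIsoOfSurjective _
    (surjective_profilePrimitive d hr)).toHomeomorph
  have he : ⇑e = profilePrimitive d k r := rfl
  have h1 : ContDiff ℝ ∞ e.symm := e.contDiff_symm_deriv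
    (f' := fun y => profileQ d k r (Real.sigmoid y))
    (fun y => (profileQ_pos hr (sigmoid_mem y).1.le).ne')
    (fun y => hasDerivAt_profilePrimitive (by omega) y)
    (contDiff_profilePrimitive (by omega))
  have h2 : profileInverse d k r = e.symm := by
    funext y
    rw [Homeomorph.eq_symm_apply]
    exact profilePrimitive_profileInverse hr y
  rw [h2]; exact h1

theorem hasDerivAt_profileInverse (hr : r + 1 ≤ k) (y : ℝ) :
    HasDerivAt (profileInverse d k r)
      (profileQ d k r (Real.sigmoid (profileInverse d k r y)))⁻¹ y :=
  (hasDerivAt_profilePrimitive (by omega) _).of_local_left_inverse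
    (contDiff_profileInverse d hr).continuous.continuousAt
    (profileQ_pos hr (sigmoid_mem _).1.le).ne'
    (Eventually.of_forall fun y => profilePrimitive_profileInverse hr y)

/-- The square of the Euclidean radius of the catenoid with constant `C`, as a function of the
slope `v` of its profile. -/
def profileSq (d k r : ℕ) (C v : ℝ) : ℝ :=
  Real.sigmoid (profileInverse d k r (C + Real.log (1 + v ^ 2)))

theorem profileSq_mem (d k r : ℕ) (C v : ℝ) : profileSq d k r C v ∈ Ioo (0 : ℝ) 1 := sigmoid_mem _

theorem profileSq_neg (C v : ℝ) : profileSq d k r C (-v) = profileSq d k r C v := by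
  simp [profileSq]

theorem contDiff_profileSq (d : ℕ) (hr : r + 1 ≤ k) (C : ℝ) : ContDiff ℝ ∞ (profileSq d k r C) := by
  have hs : ContDiff ℝ ∞ Real.sigmoid := contDiff_sigmoid.of_le le_top
  refine hs.comp ((contDiff_profileInverse d hr).comp (contDiff_const.add
    (ContDiff.log (by fun_prop) fun v => by positivity)))

theorem hasDerivAt_profileSq (hr : r + 1 ≤ k) (C v : ℝ) : HasDerivAt (profileSq d k r C)
    (profileSq d k r C v * (1 - profileSq d k r C v) / profileQ d k r (profileSq d k r C v) *
      (2 * v / (1 + v ^ 2))) v := by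
  have h1 : HasDerivAt (fun v : ℝ => C + Real.log (1 + v ^ 2)) _ v :=
    (((hasDerivAt_pow 2 v).const_add 1).log (by positivity)).const_add C
  have h2 := (Real.hasDerivAt_sigmoid (profileInverse d k r (C + Real.log (1 + v ^ 2)))).comp v
    ((hasDerivAt_profileInverse hr (C + Real.log (1 + v ^ 2))).comp v h1)
  refine h2.congr_deriv ?_
  simp only [profileSq]
  norm_num
  ring

theorem logit_profileSq (hr : r + 1 ≤ k) (C v : ℝ) :
    profilePrimitive d k r (logit (profileSq d k r C v)) = C + Real.log (1 + v ^ 2) := by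
  rw [profileSq, logit_sigmoid, profilePrimitive_profileInverse hr]

theorem profileSq_le_iff (hr : r + 1 ≤ k) {C v x : ℝ} (hx : x ∈ Ioo (0 : ℝ) 1) :
    profileSq d k r C v ≤ x ↔ C + Real.log (1 + v ^ 2) ≤ profilePrimitive d k r (logit x) := by
  nth_rw 1 [← sigmoid_logit hx]
  rw [profileSq, Real.sigmoid_le_iff, ← (strictMono_profilePrimitive d hr).le_iff_le,
    profilePrimitive_profileInverse hr]

theorem eq_profileSq_iff (hr : r + 1 ≤ k) {C v x : ℝ} (hx : x ∈ Ioo (0 : ℝ) 1) :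
    x = profileSq d k r C v ↔ profilePrimitive d k r (logit x) = C + Real.log (1 + v ^ 2) := by
  constructor
  · intro h
    rw [h, logit_profileSq hr]
  · intro h
    rw [profileSq, ← h, profileInverse_profilePrimitive hr, sigmoid_logit hx]

/-- The height of the catenoid with constant `C`, as a function of the slope of its profile. -/
def profileHeight (c : ℝ) (d k r : ℕ) (C v : ℝ) : ℝ := ∫ s in (0 : ℝ)..v,
  √c * √(profileSq d k r C s) / (profileQ d k r (profileSq d k r C s) * (1 + s ^ 2))

variable {c : ℝ}

theorem contDiff_profileHeight_integrand (c : ℝ) (d : ℕ) (hr : r + 1 ≤ k) (C : ℝ) :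
    ContDiff ℝ ∞ fun s => √c * √(profileSq d k r C s) /
      (profileQ d k r (profileSq d k r C s) * (1 + s ^ 2)) := by
  have h1 := contDiff_profileSq d hr C
  have h2 : ContDiff ℝ ∞ fun s => profileQ d k r (profileSq d k r C s) :=
    ((contDiff_sphereSymm d k (r + 1)).comp h1).div ((contDiff_sphereSymm d k r).comp h1)
      fun y => (sphereSymm_pos (by omega) (sigmoid_mem _).1.le).ne'
  refine ContDiff.div (contDiff_const.mul (h1.sqrt fun v => (profileSq_mem d k r C v).1.ne'))
    (h2.mul (by fun_prop)) fun s => ?_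
  have := profileQ_pos (d := d) hr (profileSq_mem d k r C s).1.le
  positivity

theorem hasDerivAt_profileHeight (c : ℝ) (hr : r + 1 ≤ k) (C v : ℝ) :
    HasDerivAt (profileHeight c d k r C) (√c * √(profileSq d k r C v) /
      (profileQ d k r (profileSq d k r C v) * (1 + v ^ 2))) v :=
  ((contDiff_profileHeight_integrand c d hr C).continuous.integral_hasStrictDerivAt 0 v).hasDerivAt

theorem contDiff_profileHeight (c : ℝ) (d : ℕ) (hr : r + 1 ≤ k) (C : ℝ) :
    ContDiff ℝ ∞ (profileHeight c d k r C) := by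
  rw [contDiff_infty_iff_deriv]
  refine ⟨fun y => (hasDerivAt_profileHeight c hr C y).differentiableAt, ?_⟩
  rw [show deriv (profileHeight c d k r C) = _ from
    funext fun y => (hasDerivAt_profileHeight c hr C y).deriv]
  exact contDiff_profileHeight_integrand c d hr C

theorem profileHeight_zero (C : ℝ) : profileHeight c d k r C 0 = 0 := by
  simp [profileHeight]

theorem profileHeight_neg (C v : ℝ) :
    profileHeight c d k r C (-v) = -profileHeight c d k r C v := by
  unfold profileHeight
  rw [← intervalIntegral.integral_symm, ← neg_zero, ← intervalIntegral.integral_comp_neg]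
  simp only [profileSq_neg, neg_sq, neg_zero]

theorem deriv_profileHeight_pos (hc : 0 < c) (hr : r + 1 ≤ k) (C v : ℝ) :
    0 < √c * √(profileSq d k r C v) / (profileQ d k r (profileSq d k r C v) * (1 + v ^ 2)) := by
  have h1 := profileQ_pos (d := d) hr (profileSq_mem d k r C v).1.le
  have h2 := Real.sqrt_pos.2 (profileSq_mem d k r C v).1
  have h3 := Real.sqrt_pos.2 hc
  positivity

theorem strictMono_profileHeight (hc : 0 < c) (d : ℕ) (hr : r + 1 ≤ k) (C : ℝ) :
    StrictMono (profileHeight c d k r C) :=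
  strictMono_of_deriv_pos fun v => by
    rw [(hasDerivAt_profileHeight c hr C v).deriv]
    exact deriv_profileHeight_pos hc hr C v

end Profile

/-! ### Lifting of segments by local diffeomorphisms of complete hypersurfaces -/

section Lift

variable {n : ℕ} {N : Type*} [TopologicalSpace N] [ChartedSpace (EuclideanSpace ℝ (Fin n)) N]
  {E : Type*} [NormedAddCommGroup E] [NormedSpace ℝ E] [FiniteDimensional ℝ E]

/-- Inverse function theorem for a map from a manifold to a vector space of the same dimension. -/
theorem exists_local_inverse [IsManifold (𝓡 n) ∞ N] (hE : Module.finrank ℝ E = n) {k : N → E}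
    (hk : ContMDiff (𝓡 n) 𝓘(ℝ, E) ∞ k) (y : N) (hinj : Function.Injective (tangentMapAt n k y)) :
    ∃ (O : Set N) (O' : Set E) (κ : E → N), IsOpen O ∧ IsOpen O' ∧ y ∈ O ∧ k y ∈ O' ∧
      (∀ p ∈ O', κ p ∈ O ∧ k (κ p) = p) ∧ (∀ x ∈ O, k x ∈ O' → κ (k x) = x) ∧
      ∀ p ∈ O', ContMDiffAt 𝓘(ℝ, E) (𝓡 n) 1 κ p := by
  set φ := chartE n y with hφ
  have hys : y ∈ φ.source := mem_chart_source _ y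
  have hsm : ∀ᶠ w in 𝓝 (φ y), ContDiffAt ℝ ∞ (k ∘ φ.symm) w := by
    filter_upwards [eventually_chart (n := n) (x := y) (p := fun _ => True) (by simp)] with w hw
    rw [← φ.right_inv hw.1]
    exact ContMDiffAt.eventually_contDiffAt_chart isOpen_univ hk.contMDiffOn (mem_univ _)
      (φ.map_target hw.1)
  have hd := hasFDerivAt_comp_chart_symm ((hk y).mdifferentiableAt (by simp))
  let L : EuclideanSpace ℝ (Fin n) ≃L[ℝ] E := (LinearEquiv.ofInjectiveOfFinrankEq
    (tangentMapAt n k y : EuclideanSpace ℝ (Fin n) →ₗ[ℝ] E) hinj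
    (by simp [hE])).toContinuousLinearEquiv
  have hL : HasFDerivAt (k ∘ φ.symm) (L : EuclideanSpace ℝ (Fin n) →L[ℝ] E) (φ y) := hd
  let e := hsm.self_of_nhds.toOpenPartialHomeomorph _ hL (by simp)
  have hye : φ y ∈ e.source := hsm.self_of_nhds.mem_toOpenPartialHomeomorph_source hL (by simp)
  have hcoe : ∀ w, e w = k (φ.symm w) := fun w => rfl
  have hsymm : ∀ᶠ p in 𝓝 (e (φ y)), ContDiffAt ℝ ∞ e.symm p :=
    eventually_contDiffAt_symm e hye hsm hL
  have hey : e (φ y) = k y := by rw [hcoe, φ.left_inv hys]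
  have htgt : ∀ᶠ p in 𝓝 (e (φ y)), p ∈ e.target ∧ e.symm p ∈ φ.target := by
    have h2 := e.continuousAt_symm (e.map_source hye)
    rw [ContinuousAt, e.left_inv hye] at h2
    exact Filter.Eventually.and (e.open_target.mem_nhds (e.map_source hye))
      (h2.eventually (φ.open_target.mem_nhds (φ.map_source hys)))
  rw [hey] at hsymm htgt
  refine ⟨φ.source ∩ φ ⁻¹' e.source, interior {p | ContDiffAt ℝ ∞ e.symm p ∧
    p ∈ e.target ∧ e.symm p ∈ φ.target}, fun p => φ.symm (e.symm p),
    φ.isOpen_inter_preimage e.open_source, isOpen_interior, ⟨hys, hye⟩,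
    mem_interior_iff_mem_nhds.2 (hsymm.and htgt), fun p hp => ?_, fun x hx _ => ?_, fun p hp => ?_⟩
  · obtain ⟨h1, h2, h3⟩ := interior_subset hp
    refine ⟨⟨φ.map_target h3, ?_⟩, ?_⟩
    · rw [mem_preimage, φ.right_inv h3]; exact e.map_target h2
    · have := e.right_inv h2
      rwa [hcoe] at this
  · have h1 : e (φ x) = k x := by rw [hcoe, φ.left_inv hx.1]
    change φ.symm (e.symm (k x)) = x
    rw [← h1, e.left_inv hx.2, φ.left_inv hx.1]
  · obtain ⟨h1, h2, h3⟩ := interior_subset hp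
    have h4 : ContMDiffAt 𝓘(ℝ, E) (𝓡 n) ∞ e.symm p := h1.contMDiffAt
    have h5 : ContMDiffAt (𝓡 n) (𝓡 n) ∞ φ.symm (e.symm p) :=
      (contMDiffOn_chart_symm (n := ∞) (I := 𝓡 n) (x := y)).contMDiffAt
        (φ.open_target.mem_nhds h3)
    exact (h5.comp p h4).of_le (by simp)

/-- `γ` is a `C¹` lift through `k`, starting at `x`, of the path `l` on `[0, s]`. -/
structure IsLiftOn (n : ℕ) [ChartedSpace (EuclideanSpace ℝ (Fin n)) N] (k : N → E) (l : ℝ → E)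
    (x : N) (s : ℝ) (γ : ℝ → N) : Prop where
  start : γ 0 = x
  smooth : ContMDiffOn 𝓘(ℝ, ℝ) (𝓡 n) 1 γ (Icc 0 s)
  lifts : ∀ τ ∈ Icc 0 s, k (γ τ) = l τ

omit [FiniteDimensional ℝ E] in
/-- A lift whose endpoint lies in the domain of a local inverse of `k` is continued by the latter. -/
theorem IsLiftOn.extend {k : N → E} {l : ℝ → E} (hl : ContDiff ℝ 1 l) {x : N} {s s' : ℝ}
    {γ : ℝ → N} (h : IsLiftOn n k l x s γ) (hs : 0 ≤ s) {O : Set N} {O' : Set E} {κ : E → N}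
    (hO : IsOpen O) (hO' : IsOpen O') (h1 : ∀ p ∈ O', κ p ∈ O ∧ k (κ p) = p)
    (h2 : ∀ x ∈ O, k x ∈ O' → κ (k x) = x) (h3 : ∀ p ∈ O', ContMDiffAt 𝓘(ℝ, E) (𝓡 n) 1 κ p)
    (hγ : γ s ∈ O) (hss : s ≤ s') (hlO : ∀ τ ∈ Icc s s', l τ ∈ O') :
    ∃ γ', IsLiftOn n k l x s' γ' := by
  have hκl : ∀ τ, l τ ∈ O' → ContMDiffAt 𝓘(ℝ, ℝ) (𝓡 n) 1 (fun τ => κ (l τ)) τ := fun τ hτ =>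
    (h3 _ hτ).comp τ hl.contMDiff.contMDiffAt
  refine ⟨fun τ => if τ ≤ s then γ τ else κ (l τ), ⟨by simp [hs, h.start], ?_, fun τ hτ => ?_⟩⟩
  · intro τ hτ
    rcases lt_trichotomy τ s with hlt | heq | hgt
    · have h4 : ContMDiffWithinAt 𝓘(ℝ, ℝ) (𝓡 n) 1 γ (Icc 0 s') τ :=
        (h.smooth τ ⟨hτ.1, hlt.le⟩).mono_of_mem_nhdsWithin (by
          filter_upwards [self_mem_nhdsWithin, mem_nhdsWithin_of_mem_nhds (Iic_mem_nhds hlt)]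
            with w hw1 hw2 using ⟨hw1.1, hw2⟩)
      refine h4.congr_of_eventuallyEq ?_ (by simp [hlt.le])
      filter_upwards [mem_nhdsWithin_of_mem_nhds (Iic_mem_nhds hlt)] with w hw
      simp [mem_Iic.1 hw]
    · subst heq
      have hγc := (h.smooth τ ⟨hs, le_rfl⟩).continuousWithinAt.eventually (hO.mem_nhds hγ)
      have hlc := hl.continuous.continuousAt.eventually
        (hO'.mem_nhds (hlO τ ⟨le_rfl, hss⟩))
      have heq2 : ∀ w ∈ Icc 0 τ, γ w ∈ O → l w ∈ O' → γ w = κ (l w) := fun w hw hw1 hw2 => by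
        rw [← h.lifts w hw] at hw2 ⊢
        exact (h2 _ hw1 hw2).symm
      refine (hκl τ (hlO τ ⟨le_rfl, hss⟩)).contMDiffWithinAt.congr_of_eventuallyEq ?_ ?_
      · rw [eventually_nhdsWithin_iff] at hγc
        filter_upwards [self_mem_nhdsWithin, mem_nhdsWithin_of_mem_nhds hγc,
          mem_nhdsWithin_of_mem_nhds hlc] with w hw1 hw2 hw3
        split_ifs with hw
        · exact heq2 w ⟨hw1.1, hw⟩ (hw2 ⟨hw1.1, hw⟩) hw3
        · rfl
      · simp only [le_refl, if_true]
        exact heq2 τ ⟨hs, le_rfl⟩ hγ (hlO τ ⟨le_rfl, hss⟩)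
    · refine (hκl τ (hlO τ ⟨hgt.le, hτ.2⟩)).contMDiffWithinAt.congr_of_eventuallyEq ?_
        (by simp [hgt.not_ge])
      filter_upwards [mem_nhdsWithin_of_mem_nhds (Ioi_mem_nhds hgt)] with w hw
      simp [(mem_Ioi.1 hw).not_ge]
  · split_ifs with h4
    · exact h.lifts τ ⟨hτ.1, h4⟩
    · exact (h1 _ (hlO τ ⟨(not_le.1 h4).le, hτ.2⟩)).2

/-- Uniqueness of lifts: a local diffeomorphism is locally injective. -/
theorem IsLiftOn.eqOn [T2Space N] [IsManifold (𝓡 n) ∞ N] (hE : Module.finrank ℝ E = n) {k : N → E}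
    (hk : ContMDiff (𝓡 n) 𝓘(ℝ, E) ∞ k) (hinj : ∀ y, Function.Injective (tangentMapAt n k y))
    {l : ℝ → E} {x : N} {s s' : ℝ} {γ γ' : ℝ → N} (h : IsLiftOn n k l x s γ)
    (h' : IsLiftOn n k l x s' γ') (hs : 0 ≤ s) (hss : s ≤ s') : EqOn γ γ' (Icc 0 s) := by
  have hloc : IsLocallyInjective k := by
    intro y
    obtain ⟨O, O', κ, hO, hO', hy, hy', h1, h2, -⟩ := exists_local_inverse hE hk y (hinj y)
    refine ⟨O ∩ k ⁻¹' O', hO.inter (hO'.preimage hk.continuous), ⟨hy, hy'⟩, ?_⟩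
    intro a ha b hb hab
    rw [← h2 a ha.1 ha.2, ← h2 b hb.1 hb.2, hab]
  refine (T2Space.isSeparatedMap k).eqOn_of_comp_eqOn hloc isPreconnected_Icc
    h.smooth.continuousOn (h'.smooth.continuousOn.mono (Icc_subset_Icc_right hss))
    (fun τ hτ => ?_) (left_mem_Icc.2 hs) (h.start.trans h'.start.symm)
  simp only [Function.comp_apply]
  rw [h.lifts τ hτ, h'.lifts τ ⟨hτ.1, hτ.2.trans hss⟩]

variable {P : Type*} [NormedAddCommGroup P] [NormedSpace ℝ P]

omit [NormedAddCommGroup E] [NormedSpace ℝ E] [FiniteDimensional ℝ E] in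
/-- A lift is as Lipschitz, for the induced distance, as the path it lifts. -/
theorem IsLiftOn.inducedDist_le {g : MetricTensor P} {f : N → P} {k : N → E} {G : E → P}
    (hf : ∀ x, f x = G (k x)) {l : ℝ → E} {x : N} {s : ℝ} {γ : ℝ → N} (h : IsLiftOn n k l x s γ)
    {D : ℝ → P} {M : ℝ} (hM : 0 ≤ M) (hD : ∀ τ ∈ Icc 0 s, HasDerivAt (fun τ => G (l τ)) (D τ) τ)
    (hb : ∀ τ ∈ Icc 0 s, ∀ t : ℝ, g (G (l τ)) (t • D τ) (t • D τ) ≤ (M * t) ^ 2)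
    {a b : ℝ} (ha : a ∈ Icc 0 s) (hbs : b ∈ Icc 0 s) :
    inducedDist n g f (γ a) (γ b) ≤ ENNReal.ofReal (M * |b - a|) := by
  have hmaps : ∀ τ ∈ Icc (0 : ℝ) 1, a + τ * (b - a) ∈ Icc 0 s := by
    intro τ hτ
    have := (convex_Icc (0 : ℝ) s).add_smul_sub_mem ha hbs hτ
    simpa using this
  have haff : ContDiff ℝ 1 fun τ : ℝ => a + τ * (b - a) := by fun_prop
  have hη : ContMDiffOn 𝓘(ℝ, ℝ) (𝓡 n) 1 (fun τ => γ (a + τ * (b - a))) (Icc 0 1) :=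
    h.smooth.comp haff.contMDiff.contMDiffOn hmaps
  refine (iInf₂_le (fun τ => γ (a + τ * (b - a))) ⟨hη, by simp, by simp⟩).trans ?_
  have hfη : ∀ τ ∈ Icc (0 : ℝ) 1, (f ∘ fun τ => γ (a + τ * (b - a))) τ =
      G (l (a + τ * (b - a))) := fun τ hτ => by
    rw [Function.comp_apply, hf, h.lifts _ (hmaps τ hτ)]
  rw [curveLength]
  calc _ ≤ ∫⁻ _ in Icc (0 : ℝ) 1, ENNReal.ofReal (M * |b - a|) := by
        refine setLIntegral_mono' measurableSet_Icc fun τ hτ => ENNReal.ofReal_le_ofReal ?_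
        have hd : HasDerivWithinAt (fun τ => G (l (a + τ * (b - a))))
            ((b - a) • D (a + τ * (b - a))) (Icc 0 1) τ := by
          have h1 : HasDerivAt (fun τ : ℝ => a + τ * (b - a)) (b - a) τ := by
            simpa using ((hasDerivAt_id τ).mul_const (b - a)).const_add a
          exact ((hD _ (hmaps τ hτ)).scomp τ h1).hasDerivWithinAt
        rw [derivWithin_congr hfη (hfη τ hτ), hfη τ hτ,
          hd.derivWithin (uniqueDiffOn_Icc_zero_one τ hτ)]
        refine Real.sqrt_le_iff.2 ⟨by positivity, ?_⟩
        rw [mul_pow, sq_abs, ← mul_pow]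
        exact hb _ (hmaps τ hτ) (b - a)
    _ = ENNReal.ofReal (M * |b - a|) := by simp

/-- Let `f = G ∘ k` be a complete immersion, where `k` is a local diffeomorphism. If the image by
`G` of a segment starting in the range of `k` has bounded speed, possibly except at its endpoint,
then this endpoint belongs to the range of `k`. -/
theorem mem_range_of_segment [T2Space N] [IsManifold (𝓡 n) ∞ N] (hE : Module.finrank ℝ E = n)
    {g : MetricTensor P} {f : N → P} (hcomp : IsCompleteImmersion n g f) {k : N → E} {G : E → P}
    (hf : ∀ x, f x = G (k x)) (hk : ContMDiff (𝓡 n) 𝓘(ℝ, E) ∞ k)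
    (hinj : ∀ y, Function.Injective (tangentMapAt n k y)) (x : N) (p : E) {D : ℝ → P} {M : ℝ}
    (hM : 0 ≤ M) (hD : ∀ τ ∈ Ico (0 : ℝ) 1,
      HasDerivAt (fun τ => G (k x + τ • (p - k x))) (D τ) τ)
    (hb : ∀ τ ∈ Ico (0 : ℝ) 1, ∀ t : ℝ,
      g (G (k x + τ • (p - k x))) (t • D τ) (t • D τ) ≤ (M * t) ^ 2) : p ∈ range k := by
  set l : ℝ → E := fun τ => k x + τ • (p - k x) with hl
  have hlc : ContDiff ℝ 1 l := by fun_prop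
  set S : Set ℝ := {s | s ∈ Icc (0 : ℝ) 1 ∧ ∃ γ, IsLiftOn n k l x s γ} with hS
  suffices h : (1 : ℝ) ∈ S by
    obtain ⟨-, γ, hγ⟩ := h
    refine ⟨γ 1, ?_⟩
    rw [hγ.lifts 1 (by simp)]
    simp [hl]
  -- otherwise the supremum of `S` is attained, by completeness, and the lift goes on beyond it
  by_contra h1S
  have h0S : (0 : ℝ) ∈ S := by
    refine ⟨by simp, fun _ => x, rfl, contMDiffOn_const, fun τ hτ => ?_⟩
    have : τ = 0 := le_antisymm hτ.2 hτ.1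
    simp [hl, this]
  have hbdd : BddAbove S := ⟨1, fun s hs => hs.1.2⟩
  have hlt : ∀ s ∈ S, s < 1 := fun s hs => lt_of_le_of_ne hs.1.2 fun h => h1S (h ▸ hs)
  obtain ⟨s, hsmono, hslim, hsS⟩ := exists_seq_tendsto_sSup ⟨0, h0S⟩ hbdd
  choose γ hγ using fun i => (hsS i).2
  have hsub : ∀ i, Icc 0 (s i) ⊆ Ico (0 : ℝ) 1 := fun i τ hτ =>
    ⟨hτ.1, hτ.2.trans_lt (hlt _ (hsS i))⟩
  have hdist : ∀ i j, inducedDist n g f (γ i (s i)) (γ j (s j)) ≤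
      ENNReal.ofReal (M * |s j - s i|) := by
    intro i j
    rcases le_total i j with hij | hij
    · have hs := hsmono hij
      rw [(hγ i).eqOn hE hk hinj (hγ j) (hsS i).1.1 hs (right_mem_Icc.2 (hsS i).1.1)]
      exact (hγ j).inducedDist_le hf hM (fun τ hτ => hD τ (hsub j hτ))
        (fun τ hτ => hb τ (hsub j hτ)) ⟨(hsS i).1.1, hs⟩ ⟨(hsS j).1.1, le_rfl⟩
    · have hs := hsmono hij
      rw [(hγ j).eqOn hE hk hinj (hγ i) (hsS j).1.1 hs (right_mem_Icc.2 (hsS j).1.1)]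
      exact (hγ i).inducedDist_le hf hM (fun τ hτ => hD τ (hsub i hτ))
        (fun τ hτ => hb τ (hsub i hτ)) ⟨(hsS i).1.1, le_rfl⟩ ⟨(hsS j).1.1, hs⟩
  obtain ⟨y, hy⟩ := hcomp (fun i => γ i (s i)) (by
    intro ε hε
    have hcs := hslim.cauchySeq
    obtain ⟨δ, hδ, hδε⟩ : ∃ δ : ℝ, 0 < δ ∧ ENNReal.ofReal δ < ε := by
      obtain ⟨δ, h1, h2⟩ := ENNReal.lt_iff_exists_nnreal_btwn.1 hε
      exact ⟨δ, by exact_mod_cast h1, by simpa using h2⟩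
    obtain ⟨K, hK⟩ := Metric.cauchySeq_iff.1 hcs (δ / (M + 1)) (by positivity)
    refine ⟨K, fun i hi j hj => (hdist i j).trans_lt (lt_of_le_of_lt ?_ hδε)⟩
    refine ENNReal.ofReal_le_ofReal ?_
    have h1 := hK j hj i hi
    rw [Real.dist_eq, lt_div_iff₀ (by positivity)] at h1
    nlinarith [abs_nonneg (s j - s i)])
  -- the limit of the lifts lies above the point of the segment with parameter `sSup S`
  have hky : k y = l (sSup S) := by
    have h1 : Tendsto (fun i => k (γ i (s i))) atTop (𝓝 (k y)) :=
      (hk.continuous.tendsto y).comp hy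
    have h2 : Tendsto (fun i => l (s i)) atTop (𝓝 (l (sSup S))) :=
      (hlc.continuous.tendsto _).comp hslim
    have h3 : (fun i => k (γ i (s i))) = fun i => l (s i) := funext fun i =>
      (hγ i).lifts _ (right_mem_Icc.2 (hsS i).1.1)
    rw [h3] at h1
    exact tendsto_nhds_unique h1 h2
  obtain ⟨O, O', κ, hO, hO', hyO, hyO', h1, h2, h3⟩ := exists_local_inverse hE hk y (hinj y)
  rw [hky] at hyO'
  obtain ⟨ε, hε, hball⟩ := Metric.eventually_nhds_iff_ball.1
    (hlc.continuous.continuousAt.eventually (hO'.mem_nhds hyO'))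
  obtain ⟨i, hiO, hiε⟩ := ((hy.eventually (hO.mem_nhds hyO)).and
    (hslim.eventually (Metric.ball_mem_nhds _ hε))).exists
  have hsi : s i ≤ sSup S := le_csSup hbdd (hsS i)
  have hs1 : sSup S ≤ 1 := csSup_le ⟨0, h0S⟩ fun s hs => hs.1.2
  rw [Real.dist_eq, abs_lt] at hiε
  rw [Real.ball_eq_Ioo] at hball
  have hnew : min 1 (sSup S + ε / 2) ∈ S := by
    refine ⟨⟨le_min zero_le_one (by linarith [(hsS i).1.1]), min_le_left _ _⟩, ?_⟩
    refine (hγ i).extend hlc (hsS i).1.1 hO hO' h1 h2 h3 hiO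
      (le_min (hsS i).1.2 (by linarith)) fun τ hτ => hball τ ⟨?_, ?_⟩
    · linarith [hτ.1, hiε.1]
    · linarith [hτ.2.trans (min_le_right 1 (sSup S + ε / 2))]
  have h4 := le_csSup hbdd hnew
  rcases min_choice 1 (sSup S + ε / 2) with h5 | h5
  · exact h1S (h5 ▸ hnew)
  · rw [h5] at h4
    linarith

end Lift

/-! ### The slope of a rotational hypersurface -/

section Slope

variable {E : Type*} [NormedAddCommGroup E] [InnerProductSpace ℝ E]
  {n : ℕ} {N : Type*} [TopologicalSpace N] [ChartedSpace (EuclideanSpace ℝ (Fin n)) N]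
  {d k r : ℕ} {B : E →L[ℝ] E →L[ℝ] E →L[ℝ] E} {c : ℝ} {f : N → E × ℝ}

/-- `f` is a complete `r`-minimal hypersurface of the product of the unit ball with a line, and the
components of its regular horizontal sections lie in Euclidean spheres centred at the origin. -/
structure IsRadialRMinimal (n : ℕ) [ChartedSpace (EuclideanSpace ℝ (Fin n)) N] (c : ℝ)
    (B : E →L[ℝ] E →L[ℝ] E →L[ℝ] E) (r : ℕ) (f : N → E × ℝ) : Prop where
  immersion : IsImmersionInto n (Metric.ball 0 1 ×ˢ univ) f
  complete : IsCompleteImmersion n (cylMetric c B) f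
  radial : ∀ t : ℝ, (∀ x, (f x).2 = t → ∃ u, (tangentMapAt n f x u).2 ≠ 0) →
    ∀ x, (f x).2 = t → ∀ y ∈ connectedComponentIn {y | (f y).2 = t} x, ‖(f y).1‖ = ‖(f x).1‖
  rMinimal : IsRMinimal n (cylMetric c B) f r

theorem tangentMapAt_comp {P Q : Type*} [NormedAddCommGroup P] [NormedSpace ℝ P]
    [NormedAddCommGroup Q] [NormedSpace ℝ Q] {g : N → P} {ψ : P → Q} {x : N} {L : P →L[ℝ] Q}
    (hψ : HasFDerivAt ψ L (g x)) (hg : MDifferentiableAt (𝓡 n) 𝓘(ℝ, P) g x) :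
    tangentMapAt n (fun y => ψ (g y)) x = L.comp (tangentMapAt n g x) :=
  HasMFDerivAt.tangentMapAt_eq
    ((hψ.hasMFDerivAt).comp x (hasMFDerivAt_tangentMapAt hg))

/-- The points where the tangent space is not horizontal. -/
def nonhorizontal (n : ℕ) [ChartedSpace (EuclideanSpace ℝ (Fin n)) N] (f : N → E × ℝ) : Set N :=
  {x | ∃ u, (tangentMapAt n f x u).2 ≠ 0}

open Classical in
/-- The derivative of the hyperbolic distance to the axis with respect to the height, along a
rotational hypersurface; zero, by convention, where the tangent space is horizontal. -/
def profileSlope (n : ℕ) [ChartedSpace (EuclideanSpace ℝ (Fin n)) N] (c : ℝ) (f : N → E × ℝ)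
    (x : N) : ℝ :=
  if h : x ∈ nonhorizontal n f then
    √c * inner ℝ (f x).1 (tangentMapAt n f x h.choose).1 /
      (‖(f x).1‖ * (1 - ‖(f x).1‖ ^ 2) * (tangentMapAt n f x h.choose).2)
  else 0

namespace IsRadialRMinimal

theorem norm_lt_one (hf : IsRadialRMinimal n c B r f) (x : N) : ‖(f x).1‖ < 1 := by
  simpa using (hf.immersion.mem x).1

theorem mdiff (hf : IsRadialRMinimal n c B r f) (x : N) :
    MDifferentiableAt (𝓡 n) 𝓘(ℝ, E × ℝ) f x :=
  (hf.immersion.smooth x).mdifferentiableAt (by simp)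

theorem tangentMapAt_snd (hf : IsRadialRMinimal n c B r f) (x : N)
    (u : EuclideanSpace ℝ (Fin n)) :
    tangentMapAt n (fun y => (f y).2) x u = (tangentMapAt n f x u).2 := by
  rw [tangentMapAt_comp (ψ := Prod.snd) (hasFDerivAt_snd) (hf.mdiff x)]; rfl

theorem tangentMapAt_fst (hf : IsRadialRMinimal n c B r f) (x : N)
    (u : EuclideanSpace ℝ (Fin n)) :
    tangentMapAt n (fun y => (f y).1) x u = (tangentMapAt n f x u).1 := by
  rw [tangentMapAt_comp (ψ := Prod.fst) (hasFDerivAt_fst) (hf.mdiff x)]; rfl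

theorem hasFDerivAt_norm_fst_sq (p : E × ℝ) : HasFDerivAt (fun q : E × ℝ => ‖q.1‖ ^ 2)
    ((2 • innerSL ℝ p.1).comp (ContinuousLinearMap.fst ℝ E ℝ)) p :=
  (hasStrictFDerivAt_norm_sq p.1).hasFDerivAt.comp p hasFDerivAt_fst

theorem tangentMapAt_normSq (hf : IsRadialRMinimal n c B r f) (x : N)
    (u : EuclideanSpace ℝ (Fin n)) :
    tangentMapAt n (fun y => ‖(f y).1‖ ^ 2) x u = 2 * inner ℝ (f x).1 (tangentMapAt n f x u).1 := by
  rw [tangentMapAt_comp (ψ := fun q : E × ℝ => ‖q.1‖ ^ 2) (hasFDerivAt_norm_fst_sq _) (hf.mdiff x)]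
  simp

theorem contMDiff_fst (hf : IsRadialRMinimal n c B r f) :
    ContMDiff (𝓡 n) 𝓘(ℝ, E) ∞ fun y => (f y).1 :=
  (contDiff_fst.contMDiff (E := E × ℝ)).comp hf.immersion.smooth

theorem contMDiff_snd (hf : IsRadialRMinimal n c B r f) :
    ContMDiff (𝓡 n) 𝓘(ℝ, ℝ) ∞ fun y => (f y).2 :=
  (contDiff_snd.contMDiff (E := E × ℝ)).comp hf.immersion.smooth

variable [IsManifold (𝓡 n) ∞ N] [SecondCountableTopology N]

/-- Where the tangent space is not horizontal, the distance to the axis is stationary along horizontal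
tangent vectors. By hypothesis it is constant on the components of the regular sections, and by
Sard's theorem these are dense. -/
theorem inner_eq_zero (hf : IsRadialRMinimal n c B r f) {x : N} (hx : x ∈ nonhorizontal n f)
    {u : EuclideanSpace ℝ (Fin n)} (hu : (tangentMapAt n f x u).2 = 0) :
    inner ℝ (f x).1 (tangentMapAt n f x u).1 = 0 := by
  have hne : ∀ y, tangentMapAt n (fun y => (f y).2) y ≠ 0 ↔ y ∈ nonhorizontal n f := by
    intro y
    rw [← not_iff_not, not_not]
    constructor
    · rintro h ⟨u, hu⟩
      rw [← hf.tangentMapAt_snd, h] at hu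
      exact hu rfl
    · intro h
      ext u
      by_contra hu
      exact h ⟨u, by rw [← hf.tangentMapAt_snd]; exact hu⟩
  have hq : ContMDiff (𝓡 n) 𝓘(ℝ, ℝ) ∞ fun y => ‖(f y).1‖ ^ 2 :=
    ((contDiff_norm_sq ℝ).contMDiff (E := E)).comp hf.contMDiff_fst
  have h := tangentMapAt_eq_zero_of_constant_on_components hf.contMDiff_snd hq
    (fun t ht x hx y hy => ?_) ((hne x).2 hx) (u := u) (by rw [hf.tangentMapAt_snd, hu])
  · rw [hf.tangentMapAt_normSq] at h
    linarith
  · rw [hf.radial t (fun x hx => (hne x).1 (ht x hx)) x hx y hy]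

/-- The differentials of the distance to the axis and of the height are proportional. -/
theorem wedge (hf : IsRadialRMinimal n c B r f) {x : N} (hx : x ∈ nonhorizontal n f)
    (u w : EuclideanSpace ℝ (Fin n)) :
    (tangentMapAt n f x w).2 * inner ℝ (f x).1 (tangentMapAt n f x u).1 =
      (tangentMapAt n f x u).2 * inner ℝ (f x).1 (tangentMapAt n f x w).1 := by
  have h := hf.inner_eq_zero hx
    (u := (tangentMapAt n f x w).2 • u - (tangentMapAt n f x u).2 • w) (by
      simp only [map_sub, map_smul, Prod.snd_sub, Prod.smul_snd, smul_eq_mul]; ring)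
  simp only [map_sub, map_smul, Prod.fst_sub, Prod.smul_fst, inner_sub_right,
    real_inner_smul_right] at h
  linarith

omit [SecondCountableTopology N] in
theorem eventually_contDiffAt (hf : IsRadialRMinimal n c B r f) (x : N) :
    ∀ᶠ w in 𝓝 (chartE n x x), ContDiffAt ℝ ∞ (f ∘ (chartE n x).symm) w := by
  filter_upwards [eventually_chart (n := n) (x := x) (p := fun _ => True) (by simp)] with w hw
  rw [← (chartE n x).right_inv hw.1]
  exact ContMDiffAt.eventually_contDiffAt_chart isOpen_univ hf.immersion.smooth.contMDiffOn
    (mem_univ _) ((chartE n x).map_target hw.1)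

omit [SecondCountableTopology N] in
/-- At points near `x`, the differential read in the chart at `x` is the intrinsic one, up to an
isomorphism. -/
theorem eventually_fderiv (hf : IsRadialRMinimal n c B r f) (x : N) :
    ∀ᶠ w in 𝓝 (chartE n x x), ∃ J : EuclideanSpace ℝ (Fin n) ≃L[ℝ] EuclideanSpace ℝ (Fin n),
      ∀ u, fderiv ℝ (f ∘ (chartE n x).symm) w u =
        tangentMapAt n f ((chartE n x).symm w) (J u) := by
  filter_upwards [eventually_chart (n := n) (x := x) (p := fun _ => True) (by simp)] with w hw
  obtain ⟨J, hJ⟩ := exists_equiv_fderiv_chart (n := n) (x := x) ((chartE n x).map_target hw.1)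
  refine ⟨J, fun u => ?_⟩
  have h := hJ f (hf.mdiff _)
  rw [(chartE n x).right_inv hw.1] at h
  rw [h.fderiv]
  rfl

omit [SecondCountableTopology N] [IsManifold (𝓡 n) ∞ N] in
theorem fderiv_chart (hf : IsRadialRMinimal n c B r f) (x : N) :
    fderiv ℝ (f ∘ (chartE n x).symm) (chartE n x x) = tangentMapAt n f x :=
  (hasFDerivAt_comp_chart_symm (hf.mdiff x)).fderiv

omit [SecondCountableTopology N] in
theorem eventually_snd_ne_zero (hf : IsRadialRMinimal n c B r f) {x : N}
    {e : EuclideanSpace ℝ (Fin n)} (he : (tangentMapAt n f x e).2 ≠ 0) :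
    ∀ᶠ w in 𝓝 (chartE n x x), (fderiv ℝ (f ∘ (chartE n x).symm) w e).2 ≠ 0 ∧
      (chartE n x).symm w ∈ nonhorizontal n f := by
  have hc : ContinuousAt (fun w => (fderiv ℝ (f ∘ (chartE n x).symm) w e).2) (chartE n x x) := by
    have h1 := ((hf.eventually_contDiffAt x).self_of_nhds.fderiv_right (m := 0)
      (by simp)).continuousAt
    exact (h1.clm_apply continuousAt_const).snd
  have h2 : (fderiv ℝ (f ∘ (chartE n x).symm) (chartE n x x) e).2 ≠ 0 := by
    rwa [hf.fderiv_chart]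
  filter_upwards [hc.eventually_ne h2, hf.eventually_fderiv x] with w hw ⟨J, hJ⟩
  exact ⟨hw, J e, by rwa [← hJ]⟩

omit [SecondCountableTopology N] in
theorem isOpen_nonhorizontal (hf : IsRadialRMinimal n c B r f) :
    IsOpen (nonhorizontal n f) := by
  rw [isOpen_iff_mem_nhds]
  rintro x ⟨e, he⟩
  have hxs : x ∈ (chartE n x).source := mem_chart_source _ x
  have h := ((chartE n x).continuousAt hxs).eventually (hf.eventually_snd_ne_zero he)
  filter_upwards [h, (chartE n x).open_source.mem_nhds hxs] with y hy hys
  rw [(chartE n x).left_inv hys] at hy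
  exact hy.2

/-- The hypersurface meets the axis only at points with horizontal tangent space. -/
theorem ne_zero (hf : IsRadialRMinimal n c B r f) (hn : 2 ≤ n) {x : N}
    (hx : x ∈ nonhorizontal n f) : (f x).1 ≠ 0 := by
  intro h0
  obtain ⟨e, he⟩ := hx
  have hxs : x ∈ (chartE n x).source := mem_chart_source _ x
  set F := f ∘ (chartE n x).symm with hF
  have hF0 : (F (chartE n x x)).1 = 0 := by simp [hF, (chartE n x).left_inv hxs, h0]
  have hcd : ContDiffAt ℝ ∞ F (chartE n x x) := (hf.eventually_contDiffAt x).self_of_nhds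
  have hd : DifferentiableAt ℝ F (chartE n x x) := hcd.differentiableAt (by simp)
  -- a nonzero vector with horizontal image
  obtain ⟨u, hu0, hu⟩ : ∃ u, u ≠ 0 ∧ (tangentMapAt n f x u).2 = 0 := by
    let l : EuclideanSpace ℝ (Fin n) →ₗ[ℝ] ℝ :=
      (ContinuousLinearMap.snd ℝ E ℝ).comp (tangentMapAt n f x)
    have h1 := l.finrank_range_add_finrank_ker
    have h2 : Module.finrank ℝ l.range ≤ 1 := by
      simpa using Submodule.finrank_le l.range
    rw [finrank_euclideanSpace_fin] at h1
    have h3 : 0 < Module.finrank ℝ l.ker := by omega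
    obtain ⟨⟨u, hu⟩, hu0⟩ := Module.finrank_pos_iff_exists_ne_zero.1 h3
    exact ⟨u, fun h => hu0 (Subtype.ext h), hu⟩
  have hfd : DifferentiableAt ℝ (fderiv ℝ F) (chartE n x x) :=
    (hcd.fderiv_right (m := 1)
      (by rw [one_add_one_eq_two]; exact ENat.LEInfty.out)).differentiableAt (by simp)
  set X := fun w => (fderiv ℝ F w e).2 • (fderiv ℝ F w u).1 -
    (fderiv ℝ F w u).2 • (fderiv ℝ F w e).1 with hX
  have hXd : DifferentiableAt ℝ X (chartE n x x) := by
    have h1 : ∀ a, DifferentiableAt ℝ (fun w => fderiv ℝ F w a) (chartE n x x) := fun a =>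
      hfd.clm_apply (differentiableAt_const a)
    exact ((h1 e).snd.smul (h1 u).fst).sub ((h1 u).snd.smul (h1 e).fst)
  have hzero : (fun w => inner ℝ (F w).1 (X w)) =ᶠ[𝓝 (chartE n x x)] fun _ => (0 : ℝ) := by
    filter_upwards [hf.eventually_snd_ne_zero he, hf.eventually_fderiv x] with w hw ⟨J, hJ⟩
    have h1 := hf.wedge hw.2 (J u) (J e)
    rw [← hJ, ← hJ] at h1
    simp only [hX, inner_sub_right, real_inner_smul_right]
    exact sub_eq_zero.2 h1
  have h1 := (hd.fst.hasFDerivAt.inner ℝ hXd.hasFDerivAt).congr_of_eventuallyEq hzero.symm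
  have h2 := DFunLike.congr_fun ((hasFDerivAt_const (0 : ℝ) (chartE n x x)).unique h1) u
  have h3 : fderiv ℝ (fun w => (F w).1) (chartE n x x) u = (tangentMapAt n f x u).1 := by
    have h4 := hd.hasFDerivAt.fst.fderiv
    rw [hf.fderiv_chart] at h4
    rw [h4]; rfl
  have hX0 : X (chartE n x x) = (tangentMapAt n f x e).2 • (tangentMapAt n f x u).1 := by
    simp only [hX]
    rw [hf.fderiv_chart, hu]; simp
  simp only [zero_apply, ContinuousLinearMap.comp_apply, fderivInnerCLM_apply,
    ContinuousLinearMap.prod_apply, hF0, inner_zero_left, h3, hX0, real_inner_smul_right,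
    zero_add] at h2
  have h4 : (tangentMapAt n f x u).1 = 0 := by
    rcases mul_eq_zero.1 h2.symm with h | h
    · exact absurd h he
    · exact inner_self_eq_zero.1 h
  exact hu0 (hf.immersion.immersive x (by rw [map_zero]; exact Prod.ext h4 hu))

theorem profileSlope_spec (hf : IsRadialRMinimal n c B r f) (hn : 2 ≤ n) (hc : 0 < c) {x : N}
    (hx : x ∈ nonhorizontal n f) (u : EuclideanSpace ℝ (Fin n)) :
    inner ℝ (f x).1 (tangentMapAt n f x u).1 =
      ‖(f x).1‖ * (1 - ‖(f x).1‖ ^ 2) / √c * profileSlope n c f x * (tangentMapAt n f x u).2 := by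
  have hsc : 0 < √c := Real.sqrt_pos.2 hc
  have h1 := one_sub_norm_sq_pos (hf.norm_lt_one x)
  have h2 : 0 < ‖(f x).1‖ := norm_pos_iff.2 (hf.ne_zero hn hx)
  rw [profileSlope, dif_pos hx]
  have h3 := hx.choose_spec
  have h4 := hf.wedge hx u hx.choose
  field_simp
  linarith

theorem eventually_slope (hf : IsRadialRMinimal n c B r f) (hn : 2 ≤ n) (hc : 0 < c) {x : N}
    {e : EuclideanSpace ℝ (Fin n)} (he : (tangentMapAt n f x e).2 ≠ 0) :
    ∀ᶠ w in 𝓝 (chartE n x x), ∀ u,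
      inner ℝ ((f ∘ (chartE n x).symm) w).1 (fderiv ℝ (f ∘ (chartE n x).symm) w u).1 =
      ‖((f ∘ (chartE n x).symm) w).1‖ * (1 - ‖((f ∘ (chartE n x).symm) w).1‖ ^ 2) / √c *
        (profileSlope n c f ∘ (chartE n x).symm) w * (fderiv ℝ (f ∘ (chartE n x).symm) w u).2 := by
  filter_upwards [hf.eventually_snd_ne_zero he, hf.eventually_fderiv x] with w hw ⟨J, hJ⟩ u
  rw [hJ]
  exact hf.profileSlope_spec hn hc hw.2 (J u)

theorem contDiffAt_slope (hf : IsRadialRMinimal n c B r f) (hn : 2 ≤ n) (hc : 0 < c) {x : N}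
    (hx : x ∈ nonhorizontal n f) :
    ContDiffAt ℝ ∞ (profileSlope n c f ∘ (chartE n x).symm) (chartE n x x) := by
  obtain ⟨e, he⟩ := id hx
  have hxs : x ∈ (chartE n x).source := mem_chart_source _ x
  have hsc : 0 < √c := Real.sqrt_pos.2 hc
  set F := f ∘ (chartE n x).symm with hF
  have hF0 : F (chartE n x x) = f x := by simp [hF, (chartE n x).left_inv hxs]
  have hcd : ContDiffAt ℝ ∞ F (chartE n x x) := (hf.eventually_contDiffAt x).self_of_nhds
  have hfd : ContDiffAt ℝ ∞ (fun w => fderiv ℝ F w e) (chartE n x x) :=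
    (hcd.fderiv_right (m := ∞) (by simp)).clm_apply contDiffAt_const
  have h1 := one_sub_norm_sq_pos (hf.norm_lt_one x)
  have h2 : 0 < ‖(f x).1‖ := norm_pos_iff.2 (hf.ne_zero hn hx)
  have hcF : ContDiffAt ℝ ∞ (fun w => √c * inner ℝ (F w).1 (fderiv ℝ F w e).1 /
      (‖(F w).1‖ * (1 - ‖(F w).1‖ ^ 2) * (fderiv ℝ F w e).2)) (chartE n x x) := by
    refine ContDiffAt.div (contDiffAt_const.mul (hcd.fst.inner ℝ hfd.fst))
      (((hcd.fst.norm ℝ ?_).mul (contDiffAt_const.sub (hcd.fst.norm_sq ℝ))).mul hfd.snd) ?_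
    · rw [hF0]; exact hf.ne_zero hn hx
    · rw [hF0, hf.fderiv_chart]
      positivity
  refine hcF.congr_of_eventuallyEq ?_
  filter_upwards [hf.eventually_slope hn hc he, hf.eventually_snd_ne_zero he] with w hw1 hw2
  rw [hw1 e]
  have h3 := one_sub_norm_sq_pos (hf.norm_lt_one ((chartE n x).symm w))
  have h4 : 0 < ‖(f ((chartE n x).symm w)).1‖ := norm_pos_iff.2 (hf.ne_zero hn hw2.2)
  have h5 := hw2.1
  simp only [hF, Function.comp_apply]
  field_simp

/-- The slope is a smooth function on the set of points with non-horizontal tangent space. -/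
theorem contMDiffAt_slope (hf : IsRadialRMinimal n c B r f) (hn : 2 ≤ n) (hc : 0 < c) {x : N}
    (hx : x ∈ nonhorizontal n f) : ContMDiffAt (𝓡 n) 𝓘(ℝ, ℝ) ∞ (profileSlope n c f) x := by
  have hxs : x ∈ (chartE n x).source := mem_chart_source _ x
  have h1 : ContMDiffAt (𝓡 n) (𝓡 n) ∞ (chartE n x) x := contMDiffAt_of_mem_maximalAtlas
    (IsManifold.chart_mem_maximalAtlas x) hxs
  have h2 := (hf.contDiffAt_slope hn hc hx).contMDiffAt.comp x h1
  refine h2.congr_of_eventuallyEq ?_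
  filter_upwards [(chartE n x).open_source.mem_nhds hxs] with y hy
  simp [(chartE n x).left_inv hy]

end IsRadialRMinimal

end Slope

/-! ### The first integral of the profile equation -/

section FirstIntegral

variable {E : Type*} [NormedAddCommGroup E] [InnerProductSpace ℝ E] [FiniteDimensional ℝ E]
  {n : ℕ} {N : Type*} [TopologicalSpace N] [ChartedSpace (EuclideanSpace ℝ (Fin n)) N]
  {d k r : ℕ} {B : E →L[ℝ] E →L[ℝ] E →L[ℝ] E} {c : ℝ} {f : N → E × ℝ}

open Classical in
/-- The exponential of the first integral of the profile equation, extended by zero to the points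
with horizontal tangent space. -/
def profileEnergy (n : ℕ) [ChartedSpace (EuclideanSpace ℝ (Fin n)) N] (d k r : ℕ) (c : ℝ)
    (f : N → E × ℝ) (x : N) : ℝ :=
  if x ∈ nonhorizontal n f then
    Real.exp (profilePrimitive d k r (logit (‖(f x).1‖ ^ 2))) / (1 + profileSlope n c f x ^ 2)
  else 0

theorem monotone_profilePrimitive (d : ℕ) (hr : r ≤ k) : Monotone (profilePrimitive d k r) := by
  refine monotone_of_deriv_nonneg
    (fun y => (hasDerivAt_profilePrimitive hr y).differentiableAt) fun y => ?_
  rw [(hasDerivAt_profilePrimitive hr y).deriv]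
  rcases hr.eq_or_lt with rfl | hr
  · rw [profileQ_eq_zero]
  · exact (profileQ_pos hr (sigmoid_mem y).1.le).le

theorem logit_le_logit {x y : ℝ} (hx : 0 < x) (hxy : x ≤ y) (hy : y < 1) : logit x ≤ logit y := by
  have h1 : 0 < 1 - y := by linarith
  have h2 : 0 < 1 - x := by linarith
  refine Real.log_le_log (by positivity) ?_
  rw [div_le_div_iff₀ h2 h1]
  nlinarith

namespace IsRadialRMinimal

omit [FiniteDimensional ℝ E] in
theorem normSq_mem (hf : IsRadialRMinimal n c B (r + 1) f) {x : N} (h0 : (f x).1 ≠ 0) :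
    ‖(f x).1‖ ^ 2 ∈ Ioo (0 : ℝ) 1 :=
  ⟨by positivity, by linarith [one_sub_norm_sq_pos (hf.norm_lt_one x)]⟩

variable [IsManifold (𝓡 n) ∞ N] [SecondCountableTopology N]

/-- The profile equation: the differential of the slope. -/
theorem hasFDerivAt_slope (hf : IsRadialRMinimal n c B (r + 1) f) (hB : IsLineForm d B)
    (hn : 2 ≤ n) (hc : 0 < c) (hk : Module.finrank ℝ E = k + 1) (hnk : n = k + 1) (hr : r ≤ k)
    {x : N} (hx : x ∈ nonhorizontal n f) :
    HasFDerivAt (profileSlope n c f ∘ (chartE n x).symm)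
      ((profileQ d k r (‖(f x).1‖ ^ 2) * (1 + profileSlope n c f x ^ 2) / (√c * ‖(f x).1‖)) •
        (ContinuousLinearMap.snd ℝ E ℝ).comp (tangentMapAt n f x)) (chartE n x x) := by
  obtain ⟨e, he⟩ := id hx
  have hxs : x ∈ (chartE n x).source := mem_chart_source _ x
  obtain ⟨W, ν, A, hW, hxW, hν, hA, hH⟩ := hf.rMinimal x
  have hF0 : (f ∘ (chartE n x).symm) (chartE n x x) = f x := by simp [(chartE n x).left_inv hxs]
  have hν0 : (ν ∘ (chartE n x).symm) (chartE n x x) = ν x := by simp [(chartE n x).left_inv hxs]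
  have hv0 : (profileSlope n c f ∘ (chartE n x).symm) (chartE n x x) = profileSlope n c f x := by
    simp [(chartE n x).left_inv hxs]
  have hvd := (hf.contDiffAt_slope hn hc hx).differentiableAt (by simp)
  have hνd : MDifferentiableAt (𝓡 n) 𝓘(ℝ, E × ℝ) ν x :=
    (hν.smooth.contMDiffAt (hW.mem_nhds hxW)).mdifferentiableAt (by simp)
  have hWc := eventually_chart (n := n) (hW.mem_nhds hxW)
  have key := (esymm_shape_eq_zero_iff (V := EuclideanSpace ℝ (Fin n)) hc hB hk
    (by rw [finrank_euclideanSpace_fin, hnk, hk]) (F := f ∘ (chartE n x).symm)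
    (ν := ν ∘ (chartE n x).symm) (v := profileSlope n c f ∘ (chartE n x).symm)
    (y := chartE n x x) (hf.eventually_contDiffAt x).self_of_nhds
    (by rw [hF0]; exact hf.norm_lt_one x) (by rw [hF0]; exact hf.ne_zero hn hx) ?_ (e := e)
    (by rwa [hf.fderiv_chart]) hvd (hf.eventually_slope hn hc he)
    (hasFDerivAt_comp_chart_symm hνd).differentiableAt ?_ ?_ (A := A) ?_ r ?_).1 hH
  · rw [hvd.hasFDerivAt.fderiv.symm] at *
    refine hvd.hasFDerivAt.congr_fderiv ?_
    ext u
    rw [key u, hF0, hv0, hf.fderiv_chart]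
    simp [profileQ]
  · filter_upwards [hf.eventually_fderiv x] with w ⟨J, hJ⟩
    have : ⇑(fderiv ℝ (f ∘ (chartE n x).symm) w) =
      tangentMapAt n f ((chartE n x).symm w) ∘ J := funext hJ
    rw [this]
    exact (hf.immersion.immersive _).comp J.injective
  · filter_upwards [hWc] with w hw using hν.unit _ hw.2
  · filter_upwards [hWc, hf.eventually_fderiv x] with w hw ⟨J, hJ⟩ u
    rw [hJ]
    exact hν.normal _ hw.2 _
  · intro u Z
    rw [hF0, hν0, hf.fderiv_chart, (hasFDerivAt_comp_chart_symm hνd).fderiv]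
    exact hA u Z
  · exact (sphereSymm_pos hr (by positivity)).ne'

omit [FiniteDimensional ℝ E] in
theorem continuousAt_slope (hf : IsRadialRMinimal n c B (r + 1) f) (hn : 2 ≤ n) (hc : 0 < c)
    {x : N} (hx : x ∈ nonhorizontal n f) : ContinuousAt (profileSlope n c f) x :=
  (hf.contMDiffAt_slope hn hc hx).continuousAt

omit [SecondCountableTopology N] [FiniteDimensional ℝ E] [IsManifold (𝓡 n) ∞ N] in
theorem hasFDerivAt_normSq (hf : IsRadialRMinimal n c B r f) (x : N) :
    HasFDerivAt ((fun y => ‖(f y).1‖ ^ 2) ∘ (chartE n x).symm)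
      ((2 • innerSL ℝ (f x).1).comp
        ((ContinuousLinearMap.fst ℝ E ℝ).comp (tangentMapAt n f x))) (chartE n x x) := by
  have hxs : x ∈ (chartE n x).source := mem_chart_source _ x
  have h1 := hasFDerivAt_norm_fst_sq ((f ∘ (chartE n x).symm) (chartE n x x))
  have h2 := h1.comp _ (hasFDerivAt_comp_chart_symm (hf.mdiff x))
  refine h2.congr_fderiv ?_
  rw [Function.comp_apply, (chartE n x).left_inv hxs]
  rfl

/-- Where the tangent space is not horizontal, the profile equation says that the energy is
stationary. -/
theorem hasFDerivAt_profileEnergy (hf : IsRadialRMinimal n c B (r + 1) f) (hB : IsLineForm d B)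
    (hn : 2 ≤ n) (hc : 0 < c) (hk : Module.finrank ℝ E = k + 1) (hnk : n = k + 1) (hr : r ≤ k)
    {x : N} (hx : x ∈ nonhorizontal n f) :
    HasFDerivAt (profileEnergy n d k r c f ∘ (chartE n x).symm)
      (0 : EuclideanSpace ℝ (Fin n) →L[ℝ] ℝ) (chartE n x x) := by
  obtain ⟨e, he⟩ := id hx
  have hxs : x ∈ (chartE n x).source := mem_chart_source _ x
  have hsc : 0 < √c := Real.sqrt_pos.2 hc
  have hz := hf.ne_zero hn hx
  have hq := hf.normSq_mem hz
  have h1 := hf.hasFDerivAt_slope hB hn hc hk hnk hr hx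
  have h2 := hf.hasFDerivAt_normSq x
  have hq0 : ((fun y => ‖(f y).1‖ ^ 2) ∘ (chartE n x).symm) (chartE n x x) = ‖(f x).1‖ ^ 2 := by
    simp [(chartE n x).left_inv hxs]
  have hv0 : (profileSlope n c f ∘ (chartE n x).symm) (chartE n x x) = profileSlope n c f x := by
    simp [(chartE n x).left_inv hxs]
  have h3 : HasDerivAt (fun q => Real.exp (profilePrimitive d k r (logit q)))
      (Real.exp (profilePrimitive d k r (logit (‖(f x).1‖ ^ 2))) *
        (profileQ d k r (‖(f x).1‖ ^ 2) * (1 / (‖(f x).1‖ ^ 2 * (1 - ‖(f x).1‖ ^ 2)))))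
      (‖(f x).1‖ ^ 2) := by
    have h4 := hasDerivAt_profilePrimitive (d := d) hr (logit (‖(f x).1‖ ^ 2))
    rw [sigmoid_logit hq] at h4
    exact (h4.comp _ (hasDerivAt_logit hq)).exp
  have h4 := (hq0 ▸ h3).comp_hasFDerivAt (chartE n x x) h2
  have h5 : HasDerivAt (fun v : ℝ => (1 + v ^ 2)⁻¹)
      (-(2 * profileSlope n c f x) / (1 + profileSlope n c f x ^ 2) ^ 2) (profileSlope n c f x) := by
    have h6 : HasDerivAt (fun v : ℝ => 1 + v ^ 2) (2 * profileSlope n c f x)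
      (profileSlope n c f x) := by
      simpa using (hasDerivAt_pow 2 (profileSlope n c f x)).const_add 1
    exact h6.fun_inv (by positivity)
  have h6 := (hv0 ▸ h5).comp_hasFDerivAt (chartE n x x) h1
  have h7 := h4.mul h6
  refine (h7.congr_fderiv ?_).congr_of_eventuallyEq ?_
  · ext u
    have h8 := hf.profileSlope_spec hn hc hx u
    have h9 := one_sub_norm_sq_pos (hf.norm_lt_one x)
    have h10 : 0 < ‖(f x).1‖ := norm_pos_iff.2 hz
    have h11 : 0 < 1 + profileSlope n c f x ^ 2 := by positivity
    simp [(chartE n x).left_inv hxs, h8]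
    field_simp
    ring
  · filter_upwards [hf.eventually_snd_ne_zero he] with w hw
    simp only [Function.comp_apply, profileEnergy, if_pos hw.2, Pi.mul_apply, div_eq_mul_inv]

/-- The vertical component of the unit normal, in terms of the slope. -/
theorem one_sub_normal_sq (hf : IsRadialRMinimal n c B (r + 1) f) (hB : IsLineForm d B)
    (hn : 2 ≤ n) (hc : 0 < c) (hk : Module.finrank ℝ E = n) {x : N} {ν : E × ℝ}
    (hu : cylMetric c B (f x) ν ν = 1)
    (hν : ∀ u, cylMetric c B (f x) (tangentMapAt n f x u) ν = 0) (hx : x ∈ nonhorizontal n f) :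
    1 - ν.2 ^ 2 = (1 + profileSlope n c f x ^ 2)⁻¹ := by
  have hz := hf.ne_zero hn hx
  have hsc : 0 < √c := Real.sqrt_pos.2 hc
  have hcc : √c ^ 2 = c := Real.sq_sqrt hc.le
  obtain ⟨a, -, h1, h2⟩ := exists_radial_normal hc hB (by simp [hk]) (hf.norm_lt_one x) hz
    (hf.immersion.immersive x) (fun u hu => hf.inner_eq_zero hx hu) hu hν
  obtain ⟨e, he⟩ := id hx
  have h3 := h2 e
  rw [hf.profileSlope_spec hn hc hx e] at h3
  have h9 := one_sub_norm_sq_pos (hf.norm_lt_one x)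
  have h10 : 0 < ‖(f x).1‖ := norm_pos_iff.2 hz
  set v := profileSlope n c f x
  set ρ := ‖(f x).1‖
  set b := ν.2
  set s := √c
  have h4 : b = -(s * a * ρ / (1 - ρ ^ 2)) * v := by
    rw [← hcc] at h3
    field_simp at h3 ⊢
    rw [mul_zero] at h3
    linarith [(mul_eq_zero.1 h3).resolve_left he]
  have h5 : c * a ^ 2 * ρ ^ 2 / (1 - ρ ^ 2) ^ 2 = (s * a * ρ / (1 - ρ ^ 2)) ^ 2 := by
    rw [div_pow, mul_pow, mul_pow, hcc]
  rw [h5] at h1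
  have h6 : 0 < 1 + v ^ 2 := by positivity
  refine eq_inv_of_mul_eq_one_left ?_
  rw [h4] at h1 ⊢
  linear_combination (-v ^ 2) * h1

omit [SecondCountableTopology N] [IsManifold (𝓡 n) ∞ N] in
/-- The unit normal is vertical where the tangent space is horizontal. -/
theorem normal_sq_of_horizontal (hf : IsRadialRMinimal n c B (r + 1) f) (hB : IsLineForm d B)
    (hc : 0 < c) (hk : Module.finrank ℝ E = n) {x : N} {ν : E × ℝ}
    (hu : cylMetric c B (f x) ν ν = 1)
    (hν : ∀ u, cylMetric c B (f x) (tangentMapAt n f x u) ν = 0) (hx : x ∉ nonhorizontal n f) :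
    1 - ν.2 ^ 2 = 0 := by
  have h1 : ∀ u, (tangentMapAt n f x u).2 = 0 := fun u => by
    by_contra h; exact hx ⟨u, h⟩
  have hinj : Function.Injective
      ((ContinuousLinearMap.fst ℝ E ℝ).comp (tangentMapAt n f x)) := by
    intro u w h
    exact hf.immersion.immersive x (Prod.ext h (by rw [h1, h1]))
  obtain ⟨u, hu1⟩ := (LinearMap.injective_iff_surjective_of_finrank_eq_finrank
    (f := (((ContinuousLinearMap.fst ℝ E ℝ).comp (tangentMapAt n f x) :
      EuclideanSpace ℝ (Fin n) →L[ℝ] E) : EuclideanSpace ℝ (Fin n) →ₗ[ℝ] E)) (by simp [hk])).1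
      hinj ν.1
  replace hu1 : (tangentMapAt n f x u).1 = ν.1 := hu1
  have h2 := hν u
  have h3 := ballMetric_self_ge hc hB (hf.norm_lt_one x) ν.1
  simp only [cylMetric, hu1, h1, zero_mul, add_zero] at h2 hu
  rw [h2, zero_add] at hu
  linarith [pow_two ν.2]

/-- The energy tends to zero at the points with horizontal tangent space, since `1 / (1 + v ^ 2)` is
`1 - ν₂ ^ 2`, where `ν₂` is the vertical component of the unit normal, which is defined and
continuous across these points. -/
theorem continuous_profileEnergy (hf : IsRadialRMinimal n c B (r + 1) f) (hB : IsLineForm d B)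
    (hn : 2 ≤ n) (hc : 0 < c) (hk : Module.finrank ℝ E = k + 1) (hnk : n = k + 1) (hr : r ≤ k) :
    Continuous (profileEnergy n d k r c f) := by
  rw [continuous_iff_continuousAt]
  intro x
  have hxs : x ∈ (chartE n x).source := mem_chart_source _ x
  by_cases hx : x ∈ nonhorizontal n f
  · have h1 := (hf.hasFDerivAt_profileEnergy hB hn hc hk hnk hr hx).continuousAt
    have h2 := ContinuousAt.comp (x := x) h1 ((chartE n x).continuousAt hxs)
    refine h2.congr ?_
    filter_upwards [(chartE n x).open_source.mem_nhds hxs] with y hy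
    simp [(chartE n x).left_inv hy]
  · obtain ⟨W, ν, -, hW, hxW, hν, -, -⟩ := hf.rMinimal x
    have hq1 : ‖(f x).1‖ ^ 2 < 1 := by linarith [one_sub_norm_sq_pos (hf.norm_lt_one x)]
    obtain ⟨q1, hq2, hq3⟩ := exists_between hq1
    -- the exponential factor of the energy is bounded by `C` near `x`
    set C := Real.exp (profilePrimitive d k r (logit q1))
    have hνc : ContinuousAt ν x := (hν.smooth.continuousOn).continuousAt (hW.mem_nhds hxW)
    have hlim : Tendsto (fun y => C * (1 - (ν y).2 ^ 2)) (𝓝 x) (𝓝 0) := by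
      have h1 : ContinuousAt (fun y => C * (1 - (ν y).2 ^ 2)) x :=
        continuousAt_const.mul (continuousAt_const.sub (hνc.snd.pow 2))
      have h2 := h1.tendsto
      rwa [hf.normal_sq_of_horizontal hB hc (hk.trans hnk.symm) (hν.unit x hxW) (hν.normal x hxW) hx,
        mul_zero] at h2
    have hqc : ∀ᶠ y in 𝓝 x, ‖(f y).1‖ ^ 2 < q1 := by
      have : Continuous fun y => ‖(f y).1‖ ^ 2 := hf.contMDiff_fst.continuous.norm.pow 2
      exact this.continuousAt.eventually_lt continuousAt_const hq2
    have h0 : profileEnergy n d k r c f x = 0 := if_neg hx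
    rw [ContinuousAt, h0]
    refine tendsto_of_tendsto_of_tendsto_of_le_of_le' tendsto_const_nhds hlim ?_ ?_
    · refine Eventually.of_forall fun y => ?_
      rw [profileEnergy]
      split_ifs
      · positivity
      · exact le_rfl
    · filter_upwards [hqc, hW.mem_nhds hxW] with y hy hyW
      rw [profileEnergy]
      split_ifs with h
      · rw [hf.one_sub_normal_sq hB hn hc (hk.trans hnk.symm) (hν.unit y hyW) (hν.normal y hyW) h,
          div_eq_mul_inv]
        gcongr
        exact Real.exp_le_exp.2 <| monotone_profilePrimitive d hr
          (logit_le_logit (hf.normSq_mem (hf.ne_zero hn h)).1 hy.le hq3)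
      · rw [hf.normal_sq_of_horizontal hB hc (hk.trans hnk.symm) (hν.unit y hyW) (hν.normal y hyW) h,
          mul_zero]

/-- Either all tangent spaces are horizontal, or none is and the first integral is constant. -/
theorem horizontal_or_first_integral [ConnectedSpace N] (hf : IsRadialRMinimal n c B (r + 1) f)
    (hB : IsLineForm d B) (hn : 2 ≤ n) (hc : 0 < c) (hk : Module.finrank ℝ E = k + 1)
    (hnk : n = k + 1) (hr : r ≤ k) :
    nonhorizontal n f = ∅ ∨ nonhorizontal n f = univ ∧ ∃ C, ∀ x,
      profilePrimitive d k r (logit (‖(f x).1‖ ^ 2)) =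
        C + Real.log (1 + profileSlope n c f x ^ 2) := by
  rcases eq_empty_or_nonempty (nonhorizontal n f) with h | ⟨x₀, hx₀⟩
  · exact Or.inl h
  right
  set J := profileEnergy n d k r c f with hJ
  have hJc : Continuous J := hf.continuous_profileEnergy hB hn hc hk hnk hr
  have hpos : ∀ x ∈ nonhorizontal n f, 0 < J x := fun x hx => by
    rw [hJ, profileEnergy, if_pos hx]; positivity
  have hzero : ∀ x, 0 < J x → x ∈ nonhorizontal n f := fun x hx => by
    by_contra h
    rw [hJ, profileEnergy, if_neg h] at hx
    exact lt_irrefl _ hx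
  -- `J` is continuous, and locally constant where it is positive
  have hS : {y | J y = J x₀} = univ := by
    refine IsClopen.eq_univ ⟨isClosed_eq hJc continuous_const, ?_⟩ ⟨x₀, rfl⟩
    rw [isOpen_iff_mem_nhds]
    intro y hy
    have hyn : y ∈ nonhorizontal n f := hzero y (by rw [mem_ofPred_eq] at hy; rw [hy]; exact hpos _ hx₀)
    have := eventually_eq_of_hasFDerivAt_chart_zero hf.isOpen_nonhorizontal hJc.continuousOn
      (fun y hy => hf.hasFDerivAt_profileEnergy hB hn hc hk hnk hr hy) hyn
    filter_upwards [this] with w hw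
    exact hw.trans hy
  have hall : ∀ x, J x = J x₀ := fun x => by
    have : x ∈ {y | J y = J x₀} := hS ▸ mem_univ x
    exact this
  have huniv : nonhorizontal n f = univ :=
    eq_univ_of_forall fun x => hzero x (by rw [hall]; exact hpos _ hx₀)
  refine ⟨huniv, Real.log (J x₀), fun x => ?_⟩
  have hx : x ∈ nonhorizontal n f := huniv ▸ mem_univ x
  rw [← hall x, hJ, profileEnergy, if_pos hx, Real.log_div (by positivity) (by positivity),
    Real.log_exp]
  ring

end IsRadialRMinimal

end FirstIntegral

/-! ### Classification of the hypersurfaces with vertical axis through the origin -/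

section Classification

variable {E : Type*} [NormedAddCommGroup E] [InnerProductSpace ℝ E]
  {n : ℕ} {N : Type*} [TopologicalSpace N] [ChartedSpace (EuclideanSpace ℝ (Fin n)) N]
  {d k r : ℕ} {B : E →L[ℝ] E →L[ℝ] E →L[ℝ] E} {c : ℝ} {f : N → E × ℝ}

/-- Parametrization by the punctured space of the rotational hypersurface generated by the curve
`(R, H)`; the parameter of the curve is the logarithm of the norm. -/
def rotMap (R H : ℝ → ℝ) (y : E) : E × ℝ := ((R (Real.log ‖y‖) * ‖y‖⁻¹) • y, H (Real.log ‖y‖))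

theorem contDiffAt_rotMap {R H : ℝ → ℝ} (hR : ContDiff ℝ ∞ R) (hH : ContDiff ℝ ∞ H) {y : E}
    (hy : y ≠ 0) : ContDiffAt ℝ ∞ (rotMap R H) y := by
  have h0 : ‖y‖ ≠ 0 := norm_ne_zero_iff.2 hy
  have h1 : ContDiffAt ℝ ∞ (fun y : E => ‖y‖) y := contDiffAt_norm ℝ hy
  have h2 : ContDiffAt ℝ ∞ (fun y : E => Real.log ‖y‖) y := h1.log h0
  exact ContDiffAt.prodMk (((hR.contDiffAt.comp y h2).mul (h1.inv h0)).smul contDiffAt_id)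
    (hH.contDiffAt.comp y h2)

theorem norm_rotMap_fst {R H : ℝ → ℝ} {y : E} (hR : 0 ≤ R (Real.log ‖y‖)) (hy : y ≠ 0) :
    ‖(rotMap R H y).1‖ = R (Real.log ‖y‖) := by
  have h0 : ‖y‖ ≠ 0 := norm_ne_zero_iff.2 hy
  rw [rotMap, norm_smul, norm_mul, Real.norm_of_nonneg hR, norm_inv, norm_norm]
  field_simp

theorem rotMap_exp {R H : ℝ → ℝ} {z : E} {a : ℝ} (hz : z ≠ 0) (hR : ‖z‖ = R a) :
    rotMap R H ((Real.exp a * ‖z‖⁻¹) • z) = (z, H a) := by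
  have h0 : ‖z‖ ≠ 0 := norm_ne_zero_iff.2 hz
  have h1 : ‖(Real.exp a * ‖z‖⁻¹) • z‖ = Real.exp a := by
    rw [norm_smul, norm_mul, Real.norm_of_nonneg (Real.exp_pos a).le, norm_inv, norm_norm]
    field_simp
  rw [rotMap, h1, Real.log_exp, ← hR, smul_smul]
  have : ‖z‖ * (Real.exp a)⁻¹ * (Real.exp a * ‖z‖⁻¹) = 1 := by
    have := Real.exp_ne_zero a
    field_simp
  rw [this, one_smul]

theorem cylMetric_smul_smul (p X : E × ℝ) (t : ℝ) :
    cylMetric c B p (t • X) (t • X) = t ^ 2 * cylMetric c B p X X := by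
  simp only [cylMetric, ballMetric, Prod.smul_fst, Prod.smul_snd, map_smul, real_inner_smul_left,
    real_inner_smul_right, smul_eq_mul]
  ring

theorem continuousOn_cylMetric_comp {S : Set ℝ} {P D : ℝ → E × ℝ} (hP : ContinuousOn P S)
    (hD : ContinuousOn D S) (hb : ∀ τ ∈ S, ‖(P τ).1‖ < 1) :
    ContinuousOn (fun τ => cylMetric c B (P τ) (D τ) (D τ)) S := by
  have h1 : ContinuousOn (fun τ => 1 - ‖(P τ).1‖ ^ 2) S :=
    continuousOn_const.sub (hP.fst.norm.pow 2)
  have h2 : ∀ τ ∈ S, 1 - ‖(P τ).1‖ ^ 2 ≠ 0 := fun τ hτ => (one_sub_norm_sq_pos (hb τ hτ)).ne'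
  have h3 : ContinuousOn (fun τ => B (P τ).1 (P τ).1 (D τ).1) S :=
    ((B.continuous.comp_continuousOn hP.fst).clm_apply hP.fst).clm_apply hD.fst
  exact (continuousOn_const.mul (((hD.fst.inner hD.fst).div h1 h2).add
    ((h3.inner hD.fst).div (h1.pow 2) fun τ hτ => pow_ne_zero 2 (h2 τ hτ)))).add
    (hD.snd.mul hD.snd)

/-- A curve of class `C¹` on a compact interval has bounded speed. -/
theorem exists_speed_bound {P D : ℝ → E × ℝ} (hP : ContinuousOn P (Icc 0 1))
    (hD : ContinuousOn D (Icc 0 1)) (hb : ∀ τ ∈ Icc (0 : ℝ) 1, ‖(P τ).1‖ < 1) :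
    ∃ M, 0 ≤ M ∧ ∀ τ ∈ Icc (0 : ℝ) 1, ∀ t : ℝ,
      cylMetric c B (P τ) (t • D τ) (t • D τ) ≤ (M * t) ^ 2 := by
  obtain ⟨M, hM⟩ := isCompact_Icc.bddAbove_image
    (continuousOn_cylMetric_comp (c := c) (B := B) hP hD hb)
  refine ⟨√(max M 0), Real.sqrt_nonneg _, fun τ hτ t => ?_⟩
  rw [cylMetric_smul_smul, mul_pow, Real.sq_sqrt (le_max_right _ _), mul_comm]
  gcongr
  exact (hM (mem_image_of_mem _ hτ)).trans (le_max_left _ _)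

theorem injective_tangentMapAt_of_comp {P Q : Type*} [NormedAddCommGroup P] [NormedSpace ℝ P]
    [NormedAddCommGroup Q] [NormedSpace ℝ Q] {g : N → Q} {κ : N → P} {G : P → Q} {x : N}
    (h : ∀ y, g y = G (κ y)) (hG : DifferentiableAt ℝ G (κ x))
    (hκ : MDifferentiableAt (𝓡 n) 𝓘(ℝ, P) κ x) (hg : Function.Injective (tangentMapAt n g x)) :
    Function.Injective (tangentMapAt n κ x) := by
  have h1 : tangentMapAt n g x = (fderiv ℝ G (κ x)).comp (tangentMapAt n κ x) := by
    rw [← tangentMapAt_comp hG.hasFDerivAt hκ]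
    congr 1
    exact funext h
  rw [h1, ContinuousLinearMap.coe_comp] at hg
  exact hg.of_comp

variable [FiniteDimensional ℝ E] [IsManifold (𝓡 n) ∞ N]

/-- A function on a connected manifold whose differential vanishes is constant. -/
theorem eq_of_hasFDerivAt_zero [PreconnectedSpace N] {g : N → ℝ} (hg : Continuous g)
    (h : ∀ y, HasFDerivAt (g ∘ (chartE n y).symm)
      (0 : EuclideanSpace ℝ (Fin n) →L[ℝ] ℝ) (chartE n y y)) (x y : N) : g x = g y := by
  have h1 : IsLocallyConstant g := by
    rw [IsLocallyConstant.iff_eventually_eq]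
    intro x
    exact eventually_eq_of_hasFDerivAt_chart_zero isOpen_univ hg.continuousOn
      (fun y _ => h y) (mem_univ x)
  exact h1.apply_eq_of_preconnectedSpace x y

namespace IsRadialRMinimal

variable [T2Space N] [ConnectedSpace N]

/-- A hypersurface which factors through the parametrization of a rotational hypersurface by a
smooth function on its whole profile curve covers the latter. -/
theorem range_eq_image_rotMap (hf : IsRadialRMinimal n c B r f) (hn : 2 ≤ n)
    (hk : Module.finrank ℝ E = n) {R H : ℝ → ℝ} (hR : ContDiff ℝ ∞ R) (hH : ContDiff ℝ ∞ H)
    (hR0 : ∀ v, R v ∈ Ioo (0 : ℝ) 1) {a : N → ℝ} (ha : ContMDiff (𝓡 n) 𝓘(ℝ, ℝ) ∞ a)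
    (h1 : ∀ y, ‖(f y).1‖ = R (a y)) (h2 : ∀ y, (f y).2 = H (a y)) :
    range f = rotMap R H '' {0}ᶜ := by
  have hz : ∀ y, (f y).1 ≠ 0 := fun y h => by
    have := h1 y
    rw [h, norm_zero] at this
    exact (hR0 (a y)).1.ne this
  set κ : N → E := fun y => (Real.exp (a y) * ‖(f y).1‖⁻¹) • (f y).1 with hκ
  have hκ0 : ∀ y, κ y ≠ 0 := fun y => by
    have := hz y
    have h3 : ‖(f y).1‖ ≠ 0 := norm_ne_zero_iff.2 this
    exact smul_ne_zero (mul_ne_zero (Real.exp_ne_zero _) (inv_ne_zero h3)) this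
  have hfG : ∀ y, f y = rotMap R H (κ y) := fun y => by
    rw [hκ, rotMap_exp (hz y) (h1 y), ← h2]
  have hκs : ContMDiff (𝓡 n) 𝓘(ℝ, E) ∞ κ := by
    intro y
    have h3 : ContDiffAt ℝ ∞ (fun p : E × ℝ => (Real.exp p.2 * ‖p.1‖⁻¹) • p.1) ((f y).1, a y) :=
      ((Real.contDiff_exp.contDiffAt.comp _ contDiffAt_snd).mul
        ((contDiffAt_fst.norm ℝ (show ((f y).1, a y).1 ≠ 0 from hz y)).inv
          (norm_ne_zero_iff.2 (hz y)))).smul contDiffAt_fst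
    exact h3.contMDiffAt.comp y ((hf.contMDiff_fst y).prodMk_space (ha y))
  have hinj : ∀ y, Function.Injective (tangentMapAt n κ y) := fun y =>
    injective_tangentMapAt_of_comp hfG
      ((contDiffAt_rotMap hR hH (hκ0 y)).differentiableAt (by simp))
      ((hκs y).mdifferentiableAt (by simp)) (hf.immersion.immersive y)
  -- the range is stable by segments avoiding the origin
  have hseg : ∀ x p, (∀ τ ∈ Icc (0 : ℝ) 1, κ x + τ • (p - κ x) ≠ 0) → p ∈ range κ := by
    intro x p hp
    have hG : ∀ τ ∈ Icc (0 : ℝ) 1, ContDiffAt ℝ ∞ (rotMap R H) (κ x + τ • (p - κ x)) :=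
      fun τ hτ => contDiffAt_rotMap hR hH (hp τ hτ)
    have hl : ∀ τ : ℝ, HasDerivAt (fun τ : ℝ => κ x + τ • (p - κ x)) (p - κ x) τ := fun τ => by
      simpa using ((hasDerivAt_id τ).smul_const (p - κ x)).const_add (κ x)
    have hlc : Continuous fun τ : ℝ => κ x + τ • (p - κ x) := by fun_prop
    obtain ⟨M, hM, hb⟩ := exists_speed_bound (c := c) (B := B)
      (P := fun τ => rotMap R H (κ x + τ • (p - κ x)))
      (D := fun τ => fderiv ℝ (rotMap R H) (κ x + τ • (p - κ x)) (p - κ x))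
      (fun τ hτ => ((hG τ hτ).continuousAt.comp (f := fun τ : ℝ => κ x + τ • (p - κ x))
        hlc.continuousAt).continuousWithinAt)
      (fun τ hτ => ((((hG τ hτ).fderiv_right (m := 0) (by simp)).continuousAt.comp
        (f := fun τ : ℝ => κ x + τ • (p - κ x))
        hlc.continuousAt).clm_apply continuousAt_const).continuousWithinAt)
      (fun τ hτ => by rw [norm_rotMap_fst (hR0 _).1.le (hp τ hτ)]; exact (hR0 _).2)
    refine mem_range_of_segment hk hf.complete hfG hκs hinj x p hM (fun τ hτ => ?_)
      fun τ hτ => hb τ (Ico_subset_Icc_self hτ)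
    exact ((hG τ (Ico_subset_Icc_self hτ)).differentiableAt
      (by simp)).hasFDerivAt.comp_hasDerivAt τ (hl τ)
  -- hence open, as it contains a ball around each of its points
  have hnear : ∀ x p, ‖p - κ x‖ < ‖κ x‖ → p ∈ range κ := fun x p hp => hseg x p fun τ hτ h => by
    have h3 : κ x = -(τ • (p - κ x)) := eq_neg_of_add_eq_zero_left h
    have h4 : ‖κ x‖ ≤ ‖p - κ x‖ := by
      nth_rw 1 [h3]
      rw [norm_neg, norm_smul, Real.norm_of_nonneg hτ.1]
      exact mul_le_of_le_one_left (norm_nonneg _) hτ.2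
    exact absurd hp h4.not_gt
  -- and closed in the punctured space, as it contains the points close to its closure
  have hfar : ∀ x p, ‖p - κ x‖ < ‖p‖ → p ∈ range κ := fun x p hp => hseg x p fun τ hτ h => by
    have h3 : p = (1 - τ) • (p - κ x) := by
      have : p - (1 - τ) • (p - κ x) = κ x + τ • (p - κ x) := by module
      rw [← sub_eq_zero, this, h]
    have h4 : ‖p‖ ≤ ‖p - κ x‖ := by
      nth_rw 1 [h3]
      rw [norm_smul, Real.norm_of_nonneg (by linarith [hτ.2])]
      exact mul_le_of_le_one_left (norm_nonneg _) (by linarith [hτ.1])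
    exact absurd hp h4.not_gt
  have hrange : range κ = {0}ᶜ := by
    refine Subset.antisymm (by rintro _ ⟨y, rfl⟩; exact hκ0 y) ?_
    have hrank : 1 < Module.rank ℝ E := by
      rw [← Module.finrank_eq_rank, hk]; exact_mod_cast hn
    have hpre := (isConnected_compl_singleton_of_one_lt_rank hrank (0 : E)).isPreconnected
    have hopen : IsOpen (range κ) := by
      rw [Metric.isOpen_iff]
      rintro _ ⟨x, rfl⟩
      exact ⟨‖κ x‖, norm_pos_iff.2 (hκ0 x), fun p hp => hnear x p (by rwa [← dist_eq_norm])⟩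
    refine hpre.subset_left_of_subset_union hopen
      (v := interior (range κ)ᶜ) isOpen_interior ?_ ?_ ?_
    · exact Set.disjoint_left.2 fun p hp hp' => interior_subset hp' hp
    · intro p hp
      by_cases hpr : p ∈ range κ
      · exact Or.inl hpr
      · refine Or.inr (mem_interior_iff_mem_nhds.2 ?_)
        filter_upwards [Metric.ball_mem_nhds p (norm_pos_iff.2 hp)] with w hw hwr
        obtain ⟨x, rfl⟩ := hwr
        exact hpr (hfar x p (by rwa [← dist_eq_norm, dist_comm]))
    · obtain ⟨x⟩ := (inferInstance : Nonempty N)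
      exact ⟨κ x, hκ0 x, x, rfl⟩
  rw [← hrange, ← range_comp]
  congr 1
  exact funext hfG

/-- A complete hypersurface with horizontal tangent spaces covers a hyperplane: segments lift to it. -/
theorem range_of_horizontal (hf : IsRadialRMinimal n c B r f)
    (hk : Module.finrank ℝ E = n) (hΩ : nonhorizontal n f = ∅) :
    ∃ t, range f = Metric.ball 0 1 ×ˢ {t} := by
  have h0 : ∀ x u, (tangentMapAt n f x u).2 = 0 := fun x u => by
    by_contra h
    have : x ∈ nonhorizontal n f := ⟨u, h⟩
    rw [hΩ] at this
    exact this
  obtain ⟨x₀⟩ := (inferInstance : Nonempty N)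
  have hconst : ∀ x, (f x).2 = (f x₀).2 := fun x => by
    refine eq_of_hasFDerivAt_zero (n := n) hf.contMDiff_snd.continuous (fun y => ?_) x x₀
    have h1 := hasFDerivAt_comp_chart_symm (hf.contMDiff_snd.mdifferentiableAt (x := y) (by simp))
    refine h1.congr_fderiv ?_
    ext u
    rw [hf.tangentMapAt_snd, h0]
    rfl
  set t := (f x₀).2
  have hfG : ∀ y, f y = ((f y).1, t) := fun y => Prod.ext rfl (hconst y)
  have hinj : ∀ y, Function.Injective (tangentMapAt n (fun y => (f y).1) y) := fun y =>
    injective_tangentMapAt_of_comp (G := fun z : E => (z, t)) hfG (by fun_prop)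
      (hf.contMDiff_fst.mdifferentiableAt (by simp)) (hf.immersion.immersive y)
  refine ⟨t, Subset.antisymm ?_ ?_⟩
  · rintro _ ⟨y, rfl⟩
    exact ⟨(hf.immersion.mem y).1, hconst y⟩
  · rintro ⟨p, s⟩ ⟨hp, hs⟩
    obtain rfl : s = t := hs
    replace hp : ‖p‖ < 1 := by simpa using hp
    set z₀ := (f x₀).1
    have hball : ∀ τ ∈ Icc (0 : ℝ) 1, ‖z₀ + τ • (p - z₀)‖ < 1 := by
      intro τ hτ
      have h1 := (convex_ball (0 : E) 1).add_smul_sub_mem (x := z₀) (y := p)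
        (by simpa using hf.norm_lt_one x₀) (by simpa using hp) hτ
      simpa using h1
    have hlc : Continuous fun τ : ℝ => ((z₀ + τ • (p - z₀), t) : E × ℝ) := by fun_prop
    obtain ⟨M, hM, hb⟩ := exists_speed_bound (c := c) (B := B)
      (P := fun τ : ℝ => (z₀ + τ • (p - z₀), t)) (D := fun _ => (p - z₀, 0))
      hlc.continuousOn continuousOn_const hball
    obtain ⟨y, hy⟩ := mem_range_of_segment hk hf.complete
      (G := fun z : E => (z, t)) hfG hf.contMDiff_fst hinj x₀ p (D := fun _ => (p - z₀, 0)) hM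
      (fun τ hτ => by
        have hl : HasDerivAt (fun τ : ℝ => z₀ + τ • (p - z₀)) (p - z₀) τ := by
          simpa using ((hasDerivAt_id τ).smul_const (p - z₀)).const_add z₀
        exact hl.prodMk (hasDerivAt_const τ t))
      (fun τ hτ => hb τ (Ico_subset_Icc_self hτ))
    exact ⟨y, (hfG y).trans (Prod.ext hy rfl)⟩

variable [SecondCountableTopology N]

/-- If the slope is a parameter of the profile curve, that is if `r < n`, the first integral gives the
distance to the axis as a function of the slope; the profile equation gives the height, up to an
additive constant. So the hypersurface is a catenoid. -/
theorem range_of_lt (hf : IsRadialRMinimal n c B (r + 1) f) (hB : IsLineForm d B) (hn : 2 ≤ n)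
    (hc : 0 < c) (hk : Module.finrank ℝ E = k + 1) (hnk : n = k + 1) (hr : r + 1 ≤ k)
    (hΩ : nonhorizontal n f = univ) {C : ℝ} (hC : ∀ x, profilePrimitive d k r
      (logit (‖(f x).1‖ ^ 2)) = C + Real.log (1 + profileSlope n c f x ^ 2)) :
    ∃ t, range f = rotMap (fun v => √(profileSq d k r C v))
      (fun v => profileHeight c d k r C v + t) '' {0}ᶜ := by
  have hx : ∀ x, x ∈ nonhorizontal n f := fun x => hΩ ▸ mem_univ x
  have hsc : 0 < √c := Real.sqrt_pos.2 hc
  obtain ⟨x₀⟩ := (inferInstance : Nonempty N)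
  have hv : ContMDiff (𝓡 n) 𝓘(ℝ, ℝ) ∞ (profileSlope n c f) := fun x =>
    hf.contMDiffAt_slope hn hc (hx x)
  have hq : ∀ x, ‖(f x).1‖ ^ 2 = profileSq d k r C (profileSlope n c f x) := fun x =>
    (eq_profileSq_iff hr (hf.normSq_mem (hf.ne_zero hn (hx x)))).2 (hC x)
  have hρ : ∀ x, ‖(f x).1‖ = √(profileSq d k r C (profileSlope n c f x)) := fun x => by
    rw [← hq, Real.sqrt_sq (norm_nonneg _)]
  have hT := contDiff_profileHeight c d hr C
  have hconst : ∀ x, (f x).2 - profileHeight c d k r C (profileSlope n c f x) =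
      (f x₀).2 - profileHeight c d k r C (profileSlope n c f x₀) := fun x => by
    refine eq_of_hasFDerivAt_zero (n := n)
      (g := fun x => (f x).2 - profileHeight c d k r C (profileSlope n c f x))
      (hf.contMDiff_snd.continuous.sub (hT.continuous.comp hv.continuous)) (fun y => ?_) x x₀
    have hys : y ∈ (chartE n y).source := mem_chart_source _ y
    have h1 := hasFDerivAt_comp_chart_symm (hf.contMDiff_snd.mdifferentiableAt (x := y) (by simp))
    have h2 := hf.hasFDerivAt_slope hB hn hc hk hnk (by omega) (hx y)
    have hv0 : (profileSlope n c f ∘ (chartE n y).symm) (chartE n y y) = profileSlope n c f y := by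
      simp [(chartE n y).left_inv hys]
    have h3 := (hasDerivAt_profileHeight c (d := d) hr C (profileSlope n c f y))
    have h4 := (hv0 ▸ h3).comp_hasFDerivAt (chartE n y y) h2
    refine (h1.sub h4).congr_fderiv ?_
    ext u
    have h5 := profileQ_pos (d := d) (r := r) hr (sq_nonneg ‖(f y).1‖)
    have h6 : 0 < ‖(f y).1‖ := norm_pos_iff.2 (hf.ne_zero hn (hx y))
    have h7 : (0 : ℝ) < 1 + profileSlope n c f y ^ 2 := by positivity
    simp only [sub_apply, hf.tangentMapAt_snd, smul_apply, ContinuousLinearMap.comp_apply,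
      ContinuousLinearMap.coe_snd', smul_eq_mul, hv0, ← hq, Real.sqrt_sq h6.le, zero_apply]
    field_simp
    ring
  refine ⟨(f x₀).2 - profileHeight c d k r C (profileSlope n c f x₀),
    hf.range_eq_image_rotMap hn (hk.trans hnk.symm)
    ((contDiff_profileSq d hr C).sqrt fun v => (profileSq_mem d k r C v).1.ne')
    (hT.add contDiff_const) (fun v => ?_) hv hρ fun y => ?_⟩
  · have h1 := profileSq_mem d k r C v
    exact ⟨Real.sqrt_pos.2 h1.1, by rw [Real.sqrt_lt' one_pos]; simpa using h1.2⟩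
  · rw [← hconst y]; ring

/-- If `r = n` the slope is constant. If it is zero, the hypersurface is a cylinder; otherwise it is a
piece of a cone, which is not complete. -/
theorem range_of_eq (hf : IsRadialRMinimal n c B (k + 1) f) (hB : IsLineForm d B) (hn : 2 ≤ n)
    (hc : 0 < c) (hk : Module.finrank ℝ E = k + 1) (hnk : n = k + 1)
    (hΩ : nonhorizontal n f = univ) :
    ∃ a ∈ Ioo (0 : ℝ) 1, range f = rotMap (fun _ => a) id '' {0}ᶜ := by
  have hx : ∀ x, x ∈ nonhorizontal n f := fun x => hΩ ▸ mem_univ x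
  have hsc : 0 < √c := Real.sqrt_pos.2 hc
  obtain ⟨x₀⟩ := (inferInstance : Nonempty N)
  have hv : ∀ x, profileSlope n c f x = profileSlope n c f x₀ := fun x => by
    refine eq_of_hasFDerivAt_zero (n := n) (continuous_iff_continuousAt.2 fun y =>
      hf.continuousAt_slope hn hc (hx y)) (fun y => ?_) x x₀
    have h2 := hf.hasFDerivAt_slope hB hn hc hk hnk le_rfl (hx y)
    simpa [profileQ_eq_zero] using h2
  have hz : ∀ x, (f x).1 ≠ 0 := fun x => hf.ne_zero hn (hx x)
  set v₀ := profileSlope n c f x₀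
  have hslope : ∀ x u, inner ℝ (f x).1 (tangentMapAt n f x u).1 =
      ‖(f x).1‖ * (1 - ‖(f x).1‖ ^ 2) / √c * v₀ * (tangentMapAt n f x u).2 := fun x u => by
    rw [hf.profileSlope_spec hn hc (hx x) u, hv x]
  by_cases hv0 : v₀ = 0
  · have hconst : ∀ x, ‖(f x).1‖ ^ 2 = ‖(f x₀).1‖ ^ 2 := fun x => by
      refine eq_of_hasFDerivAt_zero (n := n) (g := fun x => ‖(f x).1‖ ^ 2)
        (hf.contMDiff_fst.continuous.norm.pow 2) (fun y => ?_) x x₀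
      refine (hf.hasFDerivAt_normSq y).congr_fderiv ?_
      ext u
      have h1 := hslope y u
      rw [hv0] at h1
      simp [h1]
    have hmem : ‖(f x₀).1‖ ∈ Ioo (0 : ℝ) 1 := ⟨norm_pos_iff.2 (hz x₀), hf.norm_lt_one x₀⟩
    refine ⟨_, hmem, hf.range_eq_image_rotMap hn (hk.trans hnk.symm) contDiff_const contDiff_id
      (fun _ => hmem) hf.contMDiff_snd (fun y => ?_) fun y => rfl⟩
    have := hconst y
    rwa [sq_eq_sq₀ (norm_nonneg _) (norm_nonneg _)] at this
  · exfalso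
    -- the profile is a cone, whose vertex lies at a finite distance
    set G₂ : ℝ → ℝ := fun ρ => √c / (2 * v₀) * (Real.log (1 + ρ) - Real.log (1 - ρ)) with hG₂
    have hG₂d : ∀ ρ ∈ Ico (0 : ℝ) 1, HasDerivAt G₂ (√c / (v₀ * (1 - ρ ^ 2))) ρ := fun ρ hρ => by
      have h1 : 0 < 1 - ρ := by linarith [hρ.2]
      have h2 : 0 < 1 + ρ := by linarith [hρ.1]
      have h3 : (1 - ρ ^ 2) ≠ 0 := by nlinarith
      have h4 := (((hasDerivAt_id ρ).const_add 1).log h2.ne').sub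
        (((hasDerivAt_id ρ).const_sub 1).log h1.ne')
      refine (h4.const_mul (√c / (2 * v₀))).congr_deriv ?_
      simp only [id]
      field_simp
      ring
    have hconst : ∀ x, (f x).2 - G₂ ‖(f x).1‖ = (f x₀).2 - G₂ ‖(f x₀).1‖ := fun x => by
      have hG₂c : ∀ y, ContinuousAt (fun x => G₂ ‖(f x).1‖) y := fun y =>
        ContinuousAt.comp (f := fun x => ‖(f x).1‖)
          (hG₂d _ ⟨norm_nonneg _, hf.norm_lt_one y⟩).continuousAt
          hf.contMDiff_fst.continuous.norm.continuousAt
      refine eq_of_hasFDerivAt_zero (n := n) (g := fun x => (f x).2 - G₂ ‖(f x).1‖)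
        (hf.contMDiff_snd.continuous.sub (continuous_iff_continuousAt.2 hG₂c)) (fun y => ?_) x x₀
      have hys : y ∈ (chartE n y).source := mem_chart_source _ y
      have h1 := hasFDerivAt_comp_chart_symm
        (hf.contMDiff_snd.mdifferentiableAt (x := y) (by simp))
      have h2 := hasFDerivAt_comp_chart_symm
        (hf.contMDiff_fst.mdifferentiableAt (x := y) (by simp))
      have hz0 : ((fun y => (f y).1) ∘ (chartE n y).symm) (chartE n y y) = (f y).1 := by
        simp [(chartE n y).left_inv hys]
      have h3 : DifferentiableAt ℝ
          (fun w => ‖((fun y => (f y).1) ∘ (chartE n y).symm) w‖) (chartE n y y) :=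
        h2.differentiableAt.norm ℝ (by rw [hz0]; exact hz y)
      have h4 := (hz0 ▸ hG₂d _ ⟨norm_nonneg _, hf.norm_lt_one y⟩).comp_hasFDerivAt
        (f := fun w => ‖((fun y => (f y).1) ∘ (chartE n y).symm) w‖) (chartE n y y) h3.hasFDerivAt
      refine (h1.sub h4).congr_fderiv ?_
      ext u
      have h5 := fderiv_norm_apply h2.differentiableAt (by rw [hz0]; exact hz y) u
      rw [h2.fderiv, hz0, hf.tangentMapAt_fst, hslope] at h5
      have h6 : 0 < ‖(f y).1‖ := norm_pos_iff.2 (hz y)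
      have h7 := one_sub_norm_sq_pos (hf.norm_lt_one y)
      rw [sub_apply, smul_apply, h5, hf.tangentMapAt_snd, hz0, zero_apply, smul_eq_mul]
      field_simp
      ring
    set t := (f x₀).2 - G₂ ‖(f x₀).1‖
    have hfG : ∀ y, f y = ((f y).1, G₂ ‖(f y).1‖ + t) := fun y =>
      Prod.ext rfl (by rw [← hconst y]; ring)
    have hinj : ∀ y, Function.Injective (tangentMapAt n (fun y => (f y).1) y) := fun y =>
      injective_tangentMapAt_of_comp (G := fun z : E => (z, G₂ ‖z‖ + t)) hfG
        (differentiableAt_id.prodMk (DifferentiableAt.add_const _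
          ((hG₂d _ ⟨norm_nonneg _, hf.norm_lt_one y⟩).differentiableAt.comp (f := fun z : E => ‖z‖) _
            (differentiableAt_id.norm ℝ (hz y)))))
        (hf.contMDiff_fst.mdifferentiableAt (by simp)) (hf.immersion.immersive y)
    set z₀ := (f x₀).1
    have hρ : ∀ τ ∈ Icc (0 : ℝ) 1, (1 - τ) * ‖z₀‖ ∈ Ico (0 : ℝ) 1 := fun τ hτ =>
      ⟨mul_nonneg (by linarith [hτ.2]) (norm_nonneg _), (mul_le_of_le_one_left (norm_nonneg _)
        (by linarith [hτ.1])).trans_lt (hf.norm_lt_one x₀)⟩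
    have hl : ∀ τ : ℝ, z₀ + τ • (0 - z₀) = (1 - τ) • z₀ := fun τ => by module
    have hnl : ∀ τ ∈ Icc (0 : ℝ) 1, ‖z₀ + τ • (0 - z₀)‖ = (1 - τ) * ‖z₀‖ := fun τ hτ => by
      rw [hl, norm_smul, Real.norm_of_nonneg (by linarith [hτ.2])]
    have hin : ∀ τ : ℝ, HasDerivAt (fun τ => (1 - τ) * ‖z₀‖) (-1 * ‖z₀‖) τ := fun τ =>
      ((hasDerivAt_id τ).const_sub 1).mul_const ‖z₀‖
    have hPd : ∀ τ ∈ Icc (0 : ℝ) 1, HasDerivAt (fun τ => G₂ ((1 - τ) * ‖z₀‖) + t)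
        (√c / (v₀ * (1 - ((1 - τ) * ‖z₀‖) ^ 2)) * (-1 * ‖z₀‖)) τ := fun τ hτ =>
      (HasDerivAt.comp (h₂ := G₂) τ (hG₂d _ (hρ τ hτ)) (hin τ)).add_const t
    obtain ⟨M, hM, hb⟩ := exists_speed_bound (c := c) (B := B)
      (P := fun τ : ℝ => (z₀ + τ • (0 - z₀), G₂ ((1 - τ) * ‖z₀‖) + t))
      (D := fun τ => (0 - z₀, √c / (v₀ * (1 - ((1 - τ) * ‖z₀‖) ^ 2)) * (-1 * ‖z₀‖)))
      (ContinuousOn.prodMk (by fun_prop)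
        fun τ hτ => (hPd τ hτ).continuousAt.continuousWithinAt)
      (continuousOn_const.prodMk (ContinuousOn.mul (continuousOn_const.div (by fun_prop)
        fun τ hτ => mul_ne_zero hv0 (by
          have := hρ τ hτ
          nlinarith [this.1, this.2])) continuousOn_const))
      (fun τ hτ => by
        simp only
        rw [hnl τ hτ]
        exact (hρ τ hτ).2)
    obtain ⟨y, hy⟩ := mem_range_of_segment (hk.trans hnk.symm) hf.complete
      (G := fun z : E => (z, G₂ ‖z‖ + t)) hfG hf.contMDiff_fst hinj x₀ 0
      (D := fun τ => (0 - z₀, √c / (v₀ * (1 - ((1 - τ) * ‖z₀‖) ^ 2)) * (-1 * ‖z₀‖))) hM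
      (fun τ hτ => by
        have hline : HasDerivAt (fun τ : ℝ => z₀ + τ • (0 - z₀)) (0 - z₀) τ := by
          simpa using ((hasDerivAt_id τ).smul_const (0 - z₀)).const_add z₀
        refine (hline.prodMk (hPd τ (Ico_subset_Icc_self hτ))).congr_of_eventuallyEq ?_
        filter_upwards [Iio_mem_nhds hτ.2] with s hs
        rw [hl, norm_smul, Real.norm_of_nonneg (by linarith [mem_Iio.1 hs])])
      (fun τ hτ s => by
        have h1 := hb τ (Ico_subset_Icc_self hτ) s
        rwa [hnl τ (Ico_subset_Icc_self hτ)])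
    exact hz y hy

end IsRadialRMinimal

end Classification

/-! ### Existence of shape operators, and their behaviour under isometries -/

section MetricForm

variable {P : Type*} [NormedAddCommGroup P] [NormedSpace ℝ P]

/-- `G` is a smooth Riemannian metric on the set `U`. -/
structure IsMetricForm (U : Set P) (G : P → P →L[ℝ] P →L[ℝ] ℝ) : Prop where
  contDiffAt : ∀ p ∈ U, ContDiffAt ℝ ∞ G p
  symm : ∀ p X Y, G p X Y = G p Y X
  pos : ∀ p ∈ U, ∀ X, X ≠ 0 → 0 < G p X X

namespace IsMetricForm

variable {U : Set P} {G : P → P →L[ℝ] P →L[ℝ] ℝ}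

theorem differentiableAt (hG : IsMetricForm U G) {p : P} (hp : p ∈ U) : DifferentiableAt ℝ G p :=
  (hG.contDiffAt p hp).differentiableAt (by simp)

theorem eq_of_forall (hG : IsMetricForm U G) {p : P} (hp : p ∈ U) {X Y : P}
    (h : ∀ Z, G p X Z = G p Y Z) : X = Y := by
  by_contra hne
  have h1 := hG.pos p hp (X - Y) (sub_ne_zero.2 hne)
  have h2 : G p (X - Y) = 0 := by
    ext Z
    rw [map_sub, sub_apply, h, sub_self, zero_apply]
  rw [h2, zero_apply] at h1
  exact lt_irrefl _ h1

theorem fderiv_apply (hG : IsMetricForm U G) {p : P} (hp : p ∈ U) (X Y Z : P) :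
    fderiv ℝ (fun q => G q Y Z) p X = fderiv ℝ G p X Y Z := by
  have h := ((hG.differentiableAt hp).hasFDerivAt.clm_apply
    (hasFDerivAt_const Y p)).clm_apply (hasFDerivAt_const Z p)
  rw [h.fderiv]
  simp

theorem christoffel_eq (hG : IsMetricForm U G) {p : P} (hp : p ∈ U) (X Y Z : P) :
    christoffel (fun q X Y => G q X Y) p X Y Z =
      (fderiv ℝ G p X Y Z + fderiv ℝ G p Y X Z - fderiv ℝ G p Z X Y) / 2 := by
  rw [christoffel, hG.fderiv_apply hp, hG.fderiv_apply hp, hG.fderiv_apply hp]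

/-- The derivative of the inner product of two vector fields along a map. -/
theorem hasFDerivAt_comp {V : Type*} [NormedAddCommGroup V] [NormedSpace ℝ V]
    (hG : IsMetricForm U G) {F Y Z : V → P} {F' Y' Z' : V →L[ℝ] P} {y : V} (hp : F y ∈ U)
    (hF : HasFDerivAt F F' y) (hY : HasFDerivAt Y Y' y) (hZ : HasFDerivAt Z Z' y) :
    ∃ L : V →L[ℝ] ℝ, HasFDerivAt (fun w => G (F w) (Y w) (Z w)) L y ∧ ∀ u, L u =
      fderiv ℝ G (F y) (F' u) (Y y) (Z y) + G (F y) (Y' u) (Z y) + G (F y) (Y y) (Z' u) := by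
  have h1 : HasFDerivAt (fun w => G (F w)) ((fderiv ℝ G (F y)).comp F') y :=
    HasFDerivAt.comp (g := G) y (hG.differentiableAt hp).hasFDerivAt hF
  have h := (h1.clm_apply hY).clm_apply hZ
  refine ⟨_, h, fun u => ?_⟩
  simp
  ring

/-- Existence of the shape operator of a hypersurface of `U`. -/
theorem exists_shapeOperator {V : Type*} [NormedAddCommGroup V] [NormedSpace ℝ V]
    [FiniteDimensional ℝ V] [FiniteDimensional ℝ P]
    (hdim : Module.finrank ℝ P = Module.finrank ℝ V + 1) (hG : IsMetricForm U G) {F ν : V → P}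
    {F' ν' : V →L[ℝ] P} {y : V} (hp : F y ∈ U) (hF : HasFDerivAt F F' y)
    (hν : HasFDerivAt ν ν' y) (hinj : Function.Injective F')
    (hunit : ∀ᶠ w in 𝓝 y, G (F w) (ν w) (ν w) = 1) (hnormal : ∀ u, G (F y) (F' u) (ν y) = 0) :
    ∃ A : Module.End ℝ V, ∀ u Z, G (F y) (F' (A u)) Z =
      -(G (F y) (ν' u) Z + christoffel (fun q X Y => G q X Y) (F y) (F' u) (ν y) Z) := by
  have hνy := hunit.self_of_nhds
  have hν0 : ν y ≠ 0 := fun h => by rw [h] at hνy; simp at hνy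
  let g : LinearMap.BilinForm ℝ P := LinearMap.mk₂ ℝ (fun X Y => G (F y) X Y)
    (fun X X' Y => by simp) (fun t X Y => by simp) (fun X Y Y' => by simp) fun t X Y => by simp
  have hg : ∀ X Y, g X Y = G (F y) X Y := fun _ _ => rfl
  have hnd : g.Nondegenerate := by
    constructor
    · intro X h
      exact hG.eq_of_forall hp fun Z => by rw [map_zero]; exact h Z
    · intro X h
      refine hG.eq_of_forall hp fun Z => ?_
      rw [hG.symm, map_zero]
      exact h Z
  -- `-∇_u ν` as a linear function of `u`
  let w : V → P →ₗ[ℝ] ℝ := fun u =>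
    { toFun := fun Z => -(G (F y) (ν' u) Z + (fderiv ℝ G (F y) (F' u) (ν y) Z +
        fderiv ℝ G (F y) (ν y) (F' u) Z - fderiv ℝ G (F y) Z (F' u) (ν y)) / 2)
      map_add' := fun Z Z' => by simp only [map_add, add_apply]; ring
      map_smul' := fun s Z => by
        simp only [map_smul, smul_apply, smul_eq_mul, RingHom.id_apply]; ring }
  have hw : ∀ u Z, w u Z = -(G (F y) (ν' u) Z +
      christoffel (fun q X Y => G q X Y) (F y) (F' u) (ν y) Z) := fun u Z => by
    rw [hG.christoffel_eq hp]; rfl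
  have hwν : ∀ u, w u (ν y) = 0 := by
    intro u
    obtain ⟨L, hL, hLu⟩ := hG.hasFDerivAt_comp hp hF hν hν
    have h1 : HasFDerivAt (fun w => G (F w) (ν w) (ν w)) (0 : V →L[ℝ] ℝ) y :=
      (hasFDerivAt_const (1 : ℝ) y).congr_of_eventuallyEq hunit
    have h2 := hLu u
    rw [hL.unique h1, hG.symm _ (ν y) (ν' u)] at h2
    simp only [zero_apply] at h2
    change -(G (F y) (ν' u) (ν y) + (fderiv ℝ G (F y) (F' u) (ν y) (ν y) +
        fderiv ℝ G (F y) (ν y) (F' u) (ν y) - fderiv ℝ G (F y) (ν y) (F' u) (ν y)) / 2) = 0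
    linarith
  let s : V →ₗ[ℝ] P :=
    { toFun := fun u => (g.toDual hnd).symm (w u)
      map_add' := fun u u' => by
        refine (congrArg (g.toDual hnd).symm ?_).trans ((g.toDual hnd).symm.map_add _ _)
        ext Z
        rw [LinearMap.add_apply]
        simp only [w, LinearMap.coe_mk, AddHom.coe_mk, map_add, add_apply]
        ring
      map_smul' := fun t u => by
        refine (congrArg (g.toDual hnd).symm ?_).trans ((g.toDual hnd).symm.map_smul _ _)
        ext Z
        rw [RingHom.id_apply, LinearMap.smul_apply]
        simp only [w, LinearMap.coe_mk, AddHom.coe_mk, map_smul, smul_apply, smul_eq_mul]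
        ring }
  have hs : ∀ u Z, G (F y) (s u) Z = w u Z := fun u Z => by
    have := LinearMap.BilinForm.apply_toDual_symm_apply (hB := hnd) (w u) Z
    exact this
  -- the range of the differential is the orthogonal complement of the normal
  have hrange : LinearMap.range (F' : V →ₗ[ℝ] P) =
      LinearMap.ker (((G (F y)).flip (ν y) : P →L[ℝ] ℝ) : P →ₗ[ℝ] ℝ) := by
    refine Submodule.eq_of_le_of_finrank_eq ?_ ?_
    · rintro _ ⟨u, rfl⟩
      exact hnormal u
    · rw [LinearMap.finrank_range_of_inj hinj]
      have h1 := (((G (F y)).flip (ν y) : P →L[ℝ] ℝ) : P →ₗ[ℝ] ℝ).finrank_range_add_finrank_ker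
      have h2 : LinearMap.range (((G (F y)).flip (ν y) : P →L[ℝ] ℝ) : P →ₗ[ℝ] ℝ) = ⊤ := by
        refine LinearMap.range_eq_top.2 fun t => ⟨t • ν y, ?_⟩
        change G (F y) (t • ν y) (ν y) = t
        rw [map_smul, smul_apply, hνy, smul_eq_mul, mul_one]
      rw [h2, finrank_top, Module.finrank_self] at h1
      omega
  have hmem : ∀ u, s u ∈ LinearMap.range (F' : V →ₗ[ℝ] P) := fun u => by
    rw [hrange]
    change G (F y) (s u) (ν y) = 0
    rw [hs, hwν]
  let e := LinearEquiv.ofInjective (F' : V →ₗ[ℝ] P) hinj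
  refine ⟨e.symm.toLinearMap.comp (s.codRestrict _ hmem), fun u Z => ?_⟩
  have h3 : F' (e.symm ⟨s u, hmem u⟩) = s u := by
    have := congrArg Subtype.val (e.apply_symm_apply ⟨s u, hmem u⟩)
    exact this
  change G (F y) (F' (e.symm ⟨s u, hmem u⟩)) Z = _
  rw [h3, hs, hw]

end IsMetricForm

/-- Transformation of the Christoffel symbols under an isometry. -/
theorem christoffel_isometry {U : Set P} {G : P → P →L[ℝ] P →L[ℝ] ℝ} (hU : IsOpen U)
    (hG : IsMetricForm U G) {Φ : P → P} (hΦ : IsIsometryOf U (fun q X Y => G q X Y) Φ) {p : P}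
    (hp : p ∈ U) (X Y Z : P) :
    christoffel (fun q X Y => G q X Y) p X Y Z =
      christoffel (fun q X Y => G q X Y) (Φ p) (fderiv ℝ Φ p X) (fderiv ℝ Φ p Y) (fderiv ℝ Φ p Z) +
        G (Φ p) (fderiv ℝ (fderiv ℝ Φ) p X Y) (fderiv ℝ Φ p Z) := by
  have hΦc : ContDiffAt ℝ ∞ Φ p := hΦ.smooth.contDiffAt (hU.mem_nhds hp)
  have hΦd := hΦc.differentiableAt (by simp)
  have hΦ2 : DifferentiableAt ℝ (fderiv ℝ Φ) p := (hΦc.fderiv_right (m := 1)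
    (by rw [one_add_one_eq_two]; exact ENat.LEInfty.out)).differentiableAt (by simp)
  have hΦp : Φ p ∈ U := hΦ.bijOn.mapsTo hp
  have hsymm : ∀ X Y, fderiv ℝ (fderiv ℝ Φ) p X Y = fderiv ℝ (fderiv ℝ Φ) p Y X := fun X Y =>
    (hΦc.isSymmSndFDerivAt (by simpa using ENat.LEInfty.out)) X Y
  have key : ∀ X Y Z, fderiv ℝ G p X Y Z =
      fderiv ℝ G (Φ p) (fderiv ℝ Φ p X) (fderiv ℝ Φ p Y) (fderiv ℝ Φ p Z) +
        G (Φ p) (fderiv ℝ (fderiv ℝ Φ) p X Y) (fderiv ℝ Φ p Z) +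
        G (Φ p) (fderiv ℝ Φ p Y) (fderiv ℝ (fderiv ℝ Φ) p X Z) := by
    intro X Y Z
    have hd : ∀ Y, HasFDerivAt (fun q => fderiv ℝ Φ q Y)
        ((fderiv ℝ (fderiv ℝ Φ) p).flip Y) p := fun Y => by
      have := hΦ2.hasFDerivAt.clm_apply (hasFDerivAt_const Y p)
      refine this.congr_fderiv ?_
      ext; simp
    obtain ⟨L, hL, hLu⟩ := hG.hasFDerivAt_comp hΦp hΦd.hasFDerivAt (hd Y) (hd Z)
    have h1 : (fun q => G q Y Z) =ᶠ[𝓝 p]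
        fun q => G (Φ q) (fderiv ℝ Φ q Y) (fderiv ℝ Φ q Z) := by
      filter_upwards [hU.mem_nhds hp] with q hq
      exact (hΦ.pullback q hq Y Z).symm
    rw [← hG.fderiv_apply hp, h1.fderiv_eq, hL.fderiv, hLu]
    rfl
  rw [hG.christoffel_eq hp, hG.christoffel_eq hΦp, key, key, key, hsymm Y X, hsymm Z X, hsymm Z Y,
    hG.symm (Φ p) (fderiv ℝ Φ p Y), hG.symm (Φ p) (fderiv ℝ (fderiv ℝ Φ) p X Z)]
  ring

end MetricForm

/-! ### The ball metrics as fields of bilinear forms -/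

section CylForm

variable {E : Type*} [NormedAddCommGroup E] [InnerProductSpace ℝ E] {d : ℕ}

/-- The real inner product as a continuous bilinear map. -/
def innerCLM (E : Type*) [NormedAddCommGroup E] [InnerProductSpace ℝ E] : E →L[ℝ] E →L[ℝ] ℝ :=
  LinearMap.mkContinuous₂ (innerₗ E) 1 fun x y => by simpa using abs_real_inner_le_norm x y

@[simp]
theorem innerCLM_apply (x y : E) : innerCLM E x y = inner ℝ x y := rfl

/-- The metric `cylMetric` as a field of bilinear forms. -/
def cylForm (c : ℝ) (B : E →L[ℝ] E →L[ℝ] E →L[ℝ] E) (p : E × ℝ) :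
    (E × ℝ) →L[ℝ] (E × ℝ) →L[ℝ] ℝ :=
  c • ((1 - ‖p.1‖ ^ 2)⁻¹ • (innerCLM E).bilinearComp (ContinuousLinearMap.fst ℝ E ℝ)
      (ContinuousLinearMap.fst ℝ E ℝ) +
    ((1 - ‖p.1‖ ^ 2) ^ 2)⁻¹ • ((innerCLM E).bilinearComp (ContinuousLinearMap.id ℝ E)
      (ContinuousLinearMap.fst ℝ E ℝ)).comp ((B p.1 p.1).comp (ContinuousLinearMap.fst ℝ E ℝ))) +
  (ContinuousLinearMap.mul ℝ ℝ).bilinearComp (ContinuousLinearMap.snd ℝ E ℝ)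
    (ContinuousLinearMap.snd ℝ E ℝ)

variable {c : ℝ} {B : E →L[ℝ] E →L[ℝ] E →L[ℝ] E}

theorem cylForm_apply (p X Y : E × ℝ) : cylForm c B p X Y = cylMetric c B p X Y := by
  simp [cylForm, cylMetric, ballMetric, div_eq_inv_mul, mul_add]

theorem cylForm_eq : (fun p X Y => cylForm c B p X Y) = cylMetric c B :=
  funext fun p => funext fun X => funext fun Y => cylForm_apply p X Y

set_option maxSynthPendingDepth 3 in
theorem isMetricForm_cylForm (hc : 0 < c) (hB : IsLineForm d B) :
    IsMetricForm (Metric.ball (0 : E) 1 ×ˢ univ) (cylForm c B) := by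
  refine ⟨fun p hp => ?_, fun p X Y => ?_, fun p hp X hX => ?_⟩
  · have h1 := one_sub_norm_sq_pos (mem_ball_zero_iff.1 hp.1)
    have h2 : ContDiffAt ℝ ∞ (fun p : E × ℝ => 1 - ‖p.1‖ ^ 2) p :=
      contDiffAt_const.sub (contDiffAt_fst.norm_sq ℝ)
    have h3 : ContDiffAt ℝ ∞ (fun p : E × ℝ => B p.1 p.1) p :=
      (B.contDiff.contDiffAt.comp p contDiffAt_fst).clm_apply contDiffAt_fst
    have h4 : ContDiffAt ℝ ∞ (fun p : E × ℝ => (1 - ‖p.1‖ ^ 2)⁻¹) p := h2.inv h1.ne'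
    have h5 : ContDiffAt ℝ ∞ (fun p : E × ℝ => ((1 - ‖p.1‖ ^ 2) ^ 2)⁻¹) p :=
      (h2.pow 2).inv (by positivity)
    have h6 : ContDiffAt ℝ ∞ (fun p : E × ℝ => ((innerCLM E).bilinearComp
        (ContinuousLinearMap.id ℝ E) (ContinuousLinearMap.fst ℝ E ℝ)).comp
        ((B p.1 p.1).comp (ContinuousLinearMap.fst ℝ E ℝ))) p :=
      contDiffAt_const.clm_comp (h3.clm_comp contDiffAt_const)
    exact (((h4.smul contDiffAt_const).add (h5.smul h6)).const_smul c).add contDiffAt_const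
  · rw [cylForm_apply, cylForm_apply, cylMetric_symm hB]
  · rw [cylForm_apply, cylMetric]
    have h1 := ballMetric_self_ge hc hB (mem_ball_zero_iff.1 hp.1) X.1
    rcases eq_or_ne X.1 0 with h2 | h2
    · have h3 : X.2 ≠ 0 := fun h => hX (Prod.ext h2 h)
      have h4 : 0 < X.2 * X.2 := mul_self_pos.2 h3
      have : 0 ≤ c * ‖X.1‖ ^ 2 := by positivity
      linarith
    · have : 0 < c * ‖X.1‖ ^ 2 := by positivity
      linarith [mul_self_nonneg X.2]

end CylForm

/-! ### Lengths, and a criterion of completeness -/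

section Length

/-- A map whose differential does not increase the norm does not increase lengths. -/
theorem enorm_sub_le_curveLength {P Q : Type*} [NormedAddCommGroup P] [NormedSpace ℝ P]
    [NormedAddCommGroup Q] [NormedSpace ℝ Q] [CompleteSpace Q] {U : Set P} {g : MetricTensor P}
    {ψ : P → Q} (hψ : ∀ p ∈ U, ContDiffAt ℝ 1 ψ p)
    (hle : ∀ p ∈ U, ∀ X, ‖fderiv ℝ ψ p X‖ ≤ √(g p X X)) {η : ℝ → P}
    (hη : ContDiffOn ℝ 1 η (Icc 0 1)) (hηU : MapsTo η (Icc 0 1) U) :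
    ‖ψ (η 1) - ψ (η 0)‖ₑ ≤ curveLength g η := by
  have h1 : ContDiffOn ℝ 1 (ψ ∘ η) (Icc 0 1) := fun τ hτ =>
    (hψ _ (hηU hτ)).comp_contDiffWithinAt τ (hη τ hτ)
  refine (enorm_sub_le_lintegral_derivWithin_Icc_of_contDiffOn_Icc h1 zero_le_one).trans ?_
  refine setLIntegral_mono' measurableSet_Icc fun τ hτ => ?_
  have h2 := (hη.differentiableOn one_ne_zero τ hτ).hasDerivWithinAt
  have h3 := ((hψ _ (hηU hτ)).differentiableAt one_ne_zero).hasFDerivAt.comp_hasDerivWithinAt τ h2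
  rw [h3.derivWithin (uniqueDiffOn_Icc_zero_one τ hτ), ← ofReal_norm]
  exact ENNReal.ofReal_le_ofReal (hle _ (hηU hτ) _)

variable {n : ℕ} {N : Type*} [TopologicalSpace N] [ChartedSpace (EuclideanSpace ℝ (Fin n)) N]

theorem enorm_sub_le_inducedDist {P Q : Type*} [NormedAddCommGroup P] [NormedSpace ℝ P]
    [NormedAddCommGroup Q] [NormedSpace ℝ Q] [CompleteSpace Q] {U : Set P} {g : MetricTensor P}
    {f : N → P} (hf : ContMDiff (𝓡 n) 𝓘(ℝ, P) ∞ f) (hfU : ∀ x, f x ∈ U)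
    {ψ : P → Q} (hψ : ∀ p ∈ U, ContDiffAt ℝ 1 ψ p)
    (hle : ∀ p ∈ U, ∀ X, ‖fderiv ℝ ψ p X‖ ≤ √(g p X X)) (x y : N) :
    ‖ψ (f y) - ψ (f x)‖ₑ ≤ inducedDist n g f x y := by
  refine le_iInf₂ fun γ hγ => ?_
  obtain ⟨h1, rfl, rfl⟩ := hγ
  have h2 : ContDiffOn ℝ 1 (f ∘ γ) (Icc 0 1) := by
    rw [← contMDiffOn_iff_contDiffOn]
    exact (hf.of_le (by simp)).comp_contMDiffOn h1
  exact enorm_sub_le_curveLength hψ hle h2 fun τ _ => hfU _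

/-- A `1`-Lipschitz map sends the sequences which are Cauchy for the induced distance to Cauchy
sequences. -/
theorem cauchySeq_of_inducedDist {P Q : Type*} [NormedAddCommGroup P] [NormedSpace ℝ P]
    [NormedAddCommGroup Q] [NormedSpace ℝ Q] [CompleteSpace Q] {U : Set P} {g : MetricTensor P}
    {f : N → P} (hf : ContMDiff (𝓡 n) 𝓘(ℝ, P) ∞ f) (hfU : ∀ x, f x ∈ U)
    {ψ : P → Q} (hψ : ∀ p ∈ U, ContDiffAt ℝ 1 ψ p)
    (hle : ∀ p ∈ U, ∀ X, ‖fderiv ℝ ψ p X‖ ≤ √(g p X X)) {x : ℕ → N}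
    (hx : ∀ ε : ℝ≥0∞, 0 < ε → ∃ K, ∀ i ≥ K, ∀ j ≥ K, inducedDist n g f (x i) (x j) < ε) :
    CauchySeq fun i => ψ (f (x i)) := by
  rw [EMetric.cauchySeq_iff]
  intro ε hε
  obtain ⟨K, hK⟩ := hx ε hε
  refine ⟨K, fun i hi j hj => ?_⟩
  rw [edist_eq_enorm_sub]
  exact (enorm_sub_le_inducedDist hf hfU hψ hle _ _).trans_lt (hK j hj i hi)

variable {E : Type*} [NormedAddCommGroup E] [InnerProductSpace ℝ E] [FiniteDimensional ℝ E]
  {d k r : ℕ} {B : E →L[ℝ] E →L[ℝ] E →L[ℝ] E} {c : ℝ}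

omit [FiniteDimensional ℝ E] in
theorem ballMetric_le_cylMetric (p X : E × ℝ) :
    ballMetric c B p.1 X.1 X.1 ≤ cylMetric c B p X X := by
  rw [cylMetric]
  linarith [mul_self_nonneg X.2]

/-- The logarithmic growth of the distance at the boundary of the ball. -/
def ballExhaustion (c : ℝ) (z : E) : ℝ := -(√c / 2) * Real.log (1 - ‖z‖ ^ 2)

omit [FiniteDimensional ℝ E] in
theorem hasFDerivAt_ballExhaustion {z : E} (hz : ‖z‖ < 1) :
    HasFDerivAt (ballExhaustion c) ((√c / (1 - ‖z‖ ^ 2)) • innerSL ℝ z) z := by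
  have h1 := one_sub_norm_sq_pos hz
  have h2 := (((hasStrictFDerivAt_norm_sq z).hasFDerivAt.const_sub 1).log h1.ne').const_mul
    (-(√c / 2))
  refine h2.congr_fderiv ?_
  ext X
  simp
  field_simp

/-- An immersion is complete if the sequences whose images converge in the product of the ball and
the line converge themselves. -/
theorem isCompleteImmersion_of_tendsto (hc : 0 < c) (hB : IsLineForm d B) {f : N → E × ℝ}
    (hf : ContMDiff (𝓡 n) 𝓘(ℝ, E × ℝ) ∞ f) (hball : ∀ x, ‖(f x).1‖ < 1)
    (h : ∀ (x : ℕ → N) (p : E × ℝ), ‖p.1‖ < 1 → Tendsto (fun i => f (x i)) atTop (𝓝 p) →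
      ∃ y, Tendsto x atTop (𝓝 y)) :
    IsCompleteImmersion n (cylMetric c B) f := by
  intro x hx
  have hsc : 0 < √c := Real.sqrt_pos.2 hc
  have hfU : ∀ x, f x ∈ (Metric.ball (0 : E) 1 ×ˢ univ : Set (E × ℝ)) := fun x => by
    simpa using hball x
  have hz : CauchySeq fun i => √c • (f (x i)).1 := by
    refine cauchySeq_of_inducedDist (ψ := fun p : E × ℝ => √c • p.1) hf hfU
      (fun p _ => contDiffAt_fst.const_smul √c) (fun p hp X => ?_) hx
    have h1 : HasFDerivAt (fun p : E × ℝ => √c • p.1) (√c • ContinuousLinearMap.fst ℝ E ℝ) p :=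
      hasFDerivAt_fst.const_smul √c
    rw [h1.fderiv]
    refine Real.le_sqrt_of_sq_le ((le_trans (le_of_eq ?_)
      (ballMetric_self_ge hc hB (mem_ball_zero_iff.1 hp.1) X.1)).trans
        (ballMetric_le_cylMetric p X))
    rw [smul_apply, norm_smul, mul_pow, Real.norm_of_nonneg hsc.le, Real.sq_sqrt hc.le]
    rfl
  have ht : CauchySeq fun i => (f (x i)).2 := by
    refine cauchySeq_of_inducedDist (ψ := fun p : E × ℝ => p.2) hf hfU
      (fun p _ => contDiffAt_snd) (fun p hp X => ?_) hx
    rw [fderiv_snd]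
    refine Real.le_sqrt_of_sq_le ?_
    have h1 := ballMetric_self_ge hc hB (mem_ball_zero_iff.1 hp.1) X.1
    have h2 : 0 ≤ c * ‖X.1‖ ^ 2 := by positivity
    rw [cylMetric, ContinuousLinearMap.coe_snd', Real.norm_eq_abs, sq_abs, pow_two]
    linarith
  have hΘ : CauchySeq fun i => ballExhaustion c (f (x i)).1 := by
    refine cauchySeq_of_inducedDist (ψ := fun p : E × ℝ => ballExhaustion c p.1) hf hfU
      (fun p hp => ?_) (fun p hp X => ?_) hx
    · have h1 := one_sub_norm_sq_pos (mem_ball_zero_iff.1 hp.1)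
      exact contDiffAt_const.mul
        ((contDiffAt_const.sub (contDiffAt_fst.norm_sq ℝ)).log h1.ne')
    · have h1 := one_sub_norm_sq_pos (mem_ball_zero_iff.1 hp.1)
      have h2 : HasFDerivAt (fun p : E × ℝ => ballExhaustion c p.1) _ p :=
        (hasFDerivAt_ballExhaustion (mem_ball_zero_iff.1 hp.1)).comp p hasFDerivAt_fst
      rw [h2.fderiv]
      refine Real.le_sqrt_of_sq_le ((le_trans (le_of_eq ?_)
        (ballMetric_self_ge_radial hc hB (mem_ball_zero_iff.1 hp.1) X.1)).trans
          (ballMetric_le_cylMetric p X))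
      simp only [ContinuousLinearMap.comp_apply, smul_apply, innerSL_apply_apply,
        ContinuousLinearMap.coe_fst', smul_eq_mul, Real.norm_eq_abs, sq_abs]
      rw [mul_pow, div_pow, div_pow, Real.sq_sqrt hc.le]
      ring
  obtain ⟨z, hz⟩ := cauchySeq_tendsto_of_complete hz
  obtain ⟨t, ht⟩ := cauchySeq_tendsto_of_complete ht
  obtain ⟨θ, hθ⟩ := cauchySeq_tendsto_of_complete hΘ
  have hz' : Tendsto (fun i => (f (x i)).1) atTop (𝓝 ((√c)⁻¹ • z)) := by
    have := hz.const_smul (√c)⁻¹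
    simpa [smul_smul, inv_mul_cancel₀ hsc.ne'] using this
  refine h x ((√c)⁻¹ • z, t) ?_ (hz'.prodMk_nhds ht)
  have h1 : Tendsto (fun i => Real.exp (-(2 / √c) * ballExhaustion c (f (x i)).1)) atTop
      (𝓝 (Real.exp (-(2 / √c) * θ))) := (Real.continuous_exp.tendsto _).comp (hθ.const_mul _)
  have h2 : ∀ i, Real.exp (-(2 / √c) * ballExhaustion c (f (x i)).1) = 1 - ‖(f (x i)).1‖ ^ 2 := by
    intro i
    rw [ballExhaustion, show -(2 / √c) * (-(√c / 2) * Real.log (1 - ‖(f (x i)).1‖ ^ 2)) =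
      Real.log (1 - ‖(f (x i)).1‖ ^ 2) by field_simp, Real.exp_log (one_sub_norm_sq_pos (hball _))]
  simp only [h2] at h1
  have h3 := tendsto_nhds_unique h1 ((hz'.norm.pow 2).const_sub 1)
  have h4 := Real.exp_pos (-(2 / √c) * θ)
  rw [h3] at h4
  simp only at h4 ⊢
  nlinarith [norm_nonneg ((√c)⁻¹ • z)]

end Length

/-! ### Hypersurfaces parametrized by open subsets of a Euclidean space -/

section Opens

variable {n : ℕ} {P : Type*} [NormedAddCommGroup P] [NormedSpace ℝ P]
  (U : TopologicalSpace.Opens (EuclideanSpace ℝ (Fin n)))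

theorem contMDiffAt_comp_val {F : EuclideanSpace ℝ (Fin n) → P} {x : U}
    (hF : ContDiffAt ℝ ∞ F x) : ContMDiffAt (𝓡 n) 𝓘(ℝ, P) ∞ (fun y : U => F y) x :=
  hF.contMDiffAt.comp x contMDiff_subtype_val.contMDiffAt

theorem tangentMapAt_comp_val {F : EuclideanSpace ℝ (Fin n) → P} {x : U}
    (hF : ContDiffAt ℝ ∞ F x) : tangentMapAt n (fun y : U => F y) x = fderiv ℝ F x := by
  have hxs : x ∈ (chartE n x).source := mem_chart_source _ x
  rw [tangentMapAt_eq_fderiv ((contMDiffAt_comp_val U hF).mdifferentiableAt (by simp))]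
  have hx : chartE n x x = (x : EuclideanSpace ℝ (Fin n)) := rfl
  rw [hx]
  refine Filter.EventuallyEq.fderiv_eq ?_
  have ht : (x : EuclideanSpace ℝ (Fin n)) ∈ (chartE n x).target := hx ▸ (chartE n x).map_source hxs
  filter_upwards [(chartE n x).open_target.mem_nhds ht] with w hw
  have h1 := OpenPartialHomeomorph.subtypeRestr_symm_eqOn
    (chartAt (EuclideanSpace ℝ (Fin n)) (x : EuclideanSpace ℝ (Fin n))) ⟨x⟩ hw
  exact congrArg F h1.symm

end Opens

/-! ### Existence of the hypersurfaces with vertical axis through the origin -/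

section Existence

variable {E : Type*} [NormedAddCommGroup E] [InnerProductSpace ℝ E] [FiniteDimensional ℝ E]
  {n d k r : ℕ} {B : E →L[ℝ] E →L[ℝ] E →L[ℝ] E} {c : ℝ}

/-- A profile curve `(R, H)`, parametrized by a regular parameter `s`, with slope `v`, which solves
the profile equation and is properly embedded: `R` is the Euclidean distance to the axis and `H` is
the height. -/
structure IsProfile (c : ℝ) (d k r : ℕ) (R H v : ℝ → ℝ) : Prop where
  smooth_R : ContDiff ℝ ∞ R
  smooth_H : ContDiff ℝ ∞ H
  smooth_v : ContDiff ℝ ∞ v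
  mem : ∀ s, R s ∈ Ioo (0 : ℝ) 1
  deriv_H_pos : ∀ s, 0 < deriv H s
  slope : ∀ s, √c * deriv R s = (1 - R s ^ 2) * v s * deriv H s
  eqn : ∀ s, deriv v s = profileQ d k r (R s ^ 2) * (1 + v s ^ 2) / (√c * R s) * deriv H s
  proper : ∀ x < 1, ∀ T, ∃ M, ∀ s, R s ≤ x → |H s| ≤ T → |s| ≤ M

/-- The slope is a global parameter of the profile of a catenoid. It is zero at the neck, where the
profile is vertical and the distance to the axis cannot be used as a parameter. -/
theorem isProfile_catenoid (hc : 0 < c) (hr : r + 1 ≤ k) (C : ℝ) :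
    IsProfile c d k r (fun v => √(profileSq d k r C v)) (profileHeight c d k r C) id := by
  have hsc : 0 < √c := Real.sqrt_pos.2 hc
  have hX := profileSq_mem d k r C
  have hmem : ∀ v, √(profileSq d k r C v) ∈ Ioo (0 : ℝ) 1 := fun v =>
    ⟨Real.sqrt_pos.2 (hX v).1, by rw [Real.sqrt_lt' one_pos]; simpa using (hX v).2⟩
  have hH : ∀ v, deriv (profileHeight c d k r C) v = _ := fun v =>
    (hasDerivAt_profileHeight c hr C v).deriv
  have hQ : ∀ v, 0 < profileQ d k r (profileSq d k r C v) := fun v =>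
    profileQ_pos hr (hX v).1.le
  refine ⟨(contDiff_profileSq d hr C).sqrt fun v => (hX v).1.ne', contDiff_profileHeight c d hr C,
    contDiff_id, hmem, fun v => ?_, fun v => ?_, fun v => ?_, fun x hx T => ?_⟩
  · rw [hH]; exact deriv_profileHeight_pos hc hr C v
  · have h1 := ((hasDerivAt_profileSq (d := d) hr C v).sqrt (hX v).1.ne').deriv
    rw [h1, hH, Real.sq_sqrt (hX v).1.le, id]
    have h2 := (hmem v).1
    have h3 := Real.sq_sqrt (hX v).1.le
    have h4 := hQ v
    set q := profileSq d k r C v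
    field_simp
    rw [h3]
    ring
  · rw [deriv_id, hH, Real.sq_sqrt (hX v).1.le, id]
    have h2 := (hmem v).1
    have h4 := hQ v
    have h5 : 0 < 1 + v ^ 2 := by positivity
    field_simp
  · -- the slope is bounded in terms of the distance to the axis
    set y := (max x (1 / 2)) with hy
    have hy0 : 0 < y := lt_max_of_lt_right (by norm_num)
    have hy1 : y < 1 := max_lt hx (by norm_num)
    have hy2 : y ^ 2 ∈ Ioo (0 : ℝ) 1 := ⟨by positivity, by nlinarith⟩
    refine ⟨√(Real.exp (profilePrimitive d k r (logit (y ^ 2)) - C)), fun v hv _ => ?_⟩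
    have h1 : profileSq d k r C v ≤ y ^ 2 :=
      (Real.sqrt_le_left hy0.le).1 (hv.trans (le_max_left _ _))
    rw [profileSq_le_iff hr hy2] at h1
    rw [← Real.sqrt_sq_eq_abs]
    refine Real.sqrt_le_sqrt ?_
    have h2 : Real.log (1 + v ^ 2) ≤ profilePrimitive d k r (logit (y ^ 2)) - C := by linarith
    rw [Real.log_le_iff_le_exp (by positivity)] at h2
    linarith

/-- The cylinders solve the profile equation for `r = n`, whose right-hand side is then zero. -/
theorem isProfile_cylinder {a : ℝ} (ha : a ∈ Ioo (0 : ℝ) 1) :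
    IsProfile c d k k (fun _ => a) id fun _ => 0 := by
  refine ⟨contDiff_const, contDiff_id, contDiff_const, fun _ => ha, fun s => by simp,
    fun s => by simp, fun s => by simp [profileQ_eq_zero], fun x _ T => ⟨T, fun s _ hs => hs⟩⟩

/-- A map is an embedding if it becomes one after composition with a map which is continuous along
its range. -/
theorem isEmbedding_of_comp {X Y Z : Type*} [TopologicalSpace X] [TopologicalSpace Y]
    [TopologicalSpace Z] {f : X → Y} {g : Y → Z} (hf : Continuous f)
    (hg : ∀ x, ContinuousAt g (f x)) (h : IsEmbedding (g ∘ f)) : IsEmbedding f := by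
  refine ⟨isInducing_iff_nhds.2 fun x => le_antisymm ?_ ?_, fun a b hab => h.injective ?_⟩
  · exact hf.continuousAt.tendsto.le_comap
  · rw [h.isInducing.nhds_eq_comap x, ← Filter.comap_comap]
    exact Filter.comap_mono (hg x).tendsto.le_comap
  · simp [hab]

variable (Ψ : EuclideanSpace ℝ (Fin n) ≃ₗᵢ[ℝ] E) {R H v : ℝ → ℝ}

theorem hasFDerivAt_log_norm {V : Type*} [NormedAddCommGroup V] [InnerProductSpace ℝ V] {y : V}
    (hy : y ≠ 0) : HasFDerivAt (fun w : V => Real.log ‖w‖) ((‖y‖ ^ 2)⁻¹ • innerSL ℝ y) y := by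
  have h0 : 0 < ‖y‖ := norm_pos_iff.2 hy
  have h1 := (((hasStrictFDerivAt_norm_sq y).hasFDerivAt).log (by positivity)).const_mul (1 / 2)
  refine (h1.congr_fderiv ?_).congr_of_eventuallyEq (Eventually.of_forall fun w => ?_)
  · ext X
    simp
    ring
  · simp only [Real.log_pow]
    push_cast
    ring

omit [FiniteDimensional ℝ E] in
/-- The differential of the parametrization of a rotational hypersurface. -/
theorem fderiv_rotMap (hR : ContDiff ℝ ∞ R) (hH : ContDiff ℝ ∞ H) {y : EuclideanSpace ℝ (Fin n)}
    (hy : y ≠ 0) (u : EuclideanSpace ℝ (Fin n)) :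
    fderiv ℝ (fun y => rotMap R H (Ψ y)) y u =
      (((deriv R (Real.log ‖y‖) - R (Real.log ‖y‖)) * ‖y‖⁻¹ * ((‖y‖ ^ 2)⁻¹ * inner ℝ y u)) • Ψ y +
        (R (Real.log ‖y‖) * ‖y‖⁻¹) • Ψ u, deriv H (Real.log ‖y‖) * ((‖y‖ ^ 2)⁻¹ * inner ℝ y u)) := by
  have h0 : 0 < ‖y‖ := norm_pos_iff.2 hy
  have hlog := hasFDerivAt_log_norm hy
  have h1 := ((hR.differentiable (by simp) _).hasDerivAt).comp_hasFDerivAt y hlog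
  have h2 := ((hH.differentiable (by simp) _).hasDerivAt).comp_hasFDerivAt y hlog
  have h3 : HasFDerivAt (fun w : EuclideanSpace ℝ (Fin n) => ‖w‖⁻¹)
      (-(‖y‖⁻¹ * (‖y‖ ^ 2)⁻¹) • innerSL ℝ y) y := by
    have h4 := (Real.hasDerivAt_exp (-Real.log ‖y‖)).comp_hasFDerivAt y hlog.neg
    have hexp : ∀ w : EuclideanSpace ℝ (Fin n), w ≠ 0 → Real.exp (-Real.log ‖w‖) = ‖w‖⁻¹ :=
      fun w hw => by rw [Real.exp_neg, Real.exp_log (norm_pos_iff.2 hw)]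
    refine (h4.congr_fderiv ?_).congr_of_eventuallyEq ?_
    · rw [hexp y hy]; ext; simp; ring
    · filter_upwards [isOpen_ne.mem_nhds hy] with w hw
      exact (hexp w hw).symm
  have h5 : HasFDerivAt (fun w => Ψ w) (Ψ : EuclideanSpace ℝ (Fin n) →L[ℝ] E) y :=
    Ψ.toContinuousLinearEquiv.hasFDerivAt
  have h6 : HasFDerivAt (fun y => rotMap R H (Ψ y)) _ y :=
    (((h1.mul h3).smul h5).prodMk h2).congr_of_eventuallyEq (Eventually.of_forall fun w => by
      simp [rotMap])
  rw [h6.fderiv]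
  refine Prod.ext ?_ ?_
  · simp
    module
  · simp

namespace IsProfile

variable {Ψ} (hP : IsProfile c d k r R H v)

include hP

omit [FiniteDimensional ℝ E] in
theorem contDiffAt {y : EuclideanSpace ℝ (Fin n)} (hy : y ≠ 0) :
    ContDiffAt ℝ ∞ (fun y => rotMap R H (Ψ y)) y :=
  (contDiffAt_rotMap hP.smooth_R hP.smooth_H (by simpa using hy)).comp y
    Ψ.toContinuousLinearEquiv.contDiff.contDiffAt

omit [FiniteDimensional ℝ E] in
theorem norm_fst {y : EuclideanSpace ℝ (Fin n)} (hy : y ≠ 0) :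
    ‖(rotMap R H (Ψ y)).1‖ = R (Real.log ‖y‖) := by
  rw [norm_rotMap_fst (hP.mem _).1.le (by simpa using hy), Ψ.norm_map]

theorem strictMono : StrictMono H := strictMono_of_deriv_pos hP.deriv_H_pos

omit [FiniteDimensional ℝ E] in
theorem injective_fderiv {y : EuclideanSpace ℝ (Fin n)} (hy : y ≠ 0) :
    Function.Injective (fderiv ℝ (fun y => rotMap R H (Ψ y)) y) := by
  have h0 : 0 < ‖y‖ := norm_pos_iff.2 hy
  rw [injective_iff_map_eq_zero]
  intro u hu
  rw [fderiv_rotMap Ψ hP.smooth_R hP.smooth_H hy, Prod.mk_eq_zero] at hu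
  obtain ⟨h1, h2⟩ := hu
  have h3 := (mul_eq_zero.1 h2).resolve_left (hP.deriv_H_pos _).ne'
  rw [h3, mul_zero, zero_smul, zero_add] at h1
  have h4 := (smul_eq_zero.1 h1).resolve_left
    (mul_ne_zero (hP.mem _).1.ne' (inv_ne_zero h0.ne'))
  simpa using h4

omit [FiniteDimensional ℝ E] in
theorem slope_fderiv (hc : 0 < c) {y : EuclideanSpace ℝ (Fin n)} (hy : y ≠ 0)
    (u : EuclideanSpace ℝ (Fin n)) :
    inner ℝ (rotMap R H (Ψ y)).1 (fderiv ℝ (fun y => rotMap R H (Ψ y)) y u).1 =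
      ‖(rotMap R H (Ψ y)).1‖ * (1 - ‖(rotMap R H (Ψ y)).1‖ ^ 2) / √c * v (Real.log ‖y‖) *
        (fderiv ℝ (fun y => rotMap R H (Ψ y)) y u).2 := by
  have h0 : 0 < ‖y‖ := norm_pos_iff.2 hy
  have hsc : 0 < √c := Real.sqrt_pos.2 hc
  rw [hP.norm_fst hy, fderiv_rotMap Ψ hP.smooth_R hP.smooth_H hy]
  have h1 := hP.slope (Real.log ‖y‖)
  simp only [rotMap, Ψ.norm_map, inner_add_right, real_inner_smul_left, real_inner_smul_right,
    Ψ.inner_map_map, real_inner_self_eq_norm_sq]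
  field_simp
  linear_combination R (Real.log ‖y‖) * inner ℝ y u * h1

/-- The rotational hypersurface generated by a profile is `(r + 1)`-minimal. -/
theorem exists_normal_shapeOperator (hc : 0 < c) (hB : IsLineForm d B)
    (hk : Module.finrank ℝ E = k + 1) (hnk : n = k + 1) (hr : r ≤ k) :
    ∃ ν : EuclideanSpace ℝ (Fin n) → E × ℝ, (∀ y ≠ 0, ContDiffAt ℝ ∞ ν y) ∧
      (∀ y ≠ 0, cylMetric c B (rotMap R H (Ψ y)) (ν y) (ν y) = 1) ∧
      (∀ y ≠ 0, ∀ u, cylMetric c B (rotMap R H (Ψ y))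
        (fderiv ℝ (fun y => rotMap R H (Ψ y)) y u) (ν y) = 0) ∧
      ∀ y ≠ 0, ∃ A : Module.End ℝ (EuclideanSpace ℝ (Fin n)),
        (∀ u Z, cylMetric c B (rotMap R H (Ψ y))
          (fderiv ℝ (fun y => rotMap R H (Ψ y)) y (A u)) Z =
          -(cylMetric c B (rotMap R H (Ψ y)) (fderiv ℝ ν y u) Z + christoffel (cylMetric c B)
            (rotMap R H (Ψ y)) (fderiv ℝ (fun y => rotMap R H (Ψ y)) y u) (ν y) Z)) ∧
        A.charpoly.roots.esymm (r + 1) = 0 := by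
  have hsc : 0 < √c := Real.sqrt_pos.2 hc
  have hcc : √c ^ 2 = c := Real.sq_sqrt hc.le
  set F : EuclideanSpace ℝ (Fin n) → E × ℝ := fun y => rotMap R H (Ψ y) with hF
  have hball : ∀ {y}, y ≠ 0 → ‖(F y).1‖ < 1 := fun hy => by
    rw [hF, hP.norm_fst hy]; exact (hP.mem _).2
  set p : ℝ → ℝ := fun s => (√(1 + v s ^ 2))⁻¹ with hp
  have hpos : ∀ s, 0 < 1 + v s ^ 2 := fun s => by positivity
  have hp2 : ∀ s, p s ^ 2 * (1 + v s ^ 2) = 1 := fun s => by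
    rw [hp, inv_pow, Real.sq_sqrt (hpos s).le, inv_mul_cancel₀ (hpos s).ne']
  have hpc : ContDiff ℝ ∞ p :=
    ((contDiff_const.add (hP.smooth_v.pow 2)).sqrt fun s => (hpos s).ne').inv
      fun s => (Real.sqrt_pos.2 (hpos s)).ne'
  set a : ℝ → ℝ := fun s => p s * (1 - R s ^ 2) / (√c * R s) with ha
  have hac : ContDiff ℝ ∞ a := (hpc.mul (contDiff_const.sub (hP.smooth_R.pow 2))).div
    (contDiff_const.mul hP.smooth_R) fun s => mul_ne_zero hsc.ne' (hP.mem s).1.ne'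
  set ν : EuclideanSpace ℝ (Fin n) → E × ℝ := fun y =>
    (a (Real.log ‖y‖) • (F y).1, -(v (Real.log ‖y‖) * p (Real.log ‖y‖))) with hν
  have hlog : ∀ {y : EuclideanSpace ℝ (Fin n)}, y ≠ 0 →
      ContDiffAt ℝ ∞ (fun y : EuclideanSpace ℝ (Fin n) => Real.log ‖y‖) y := fun hy =>
    (contDiffAt_norm ℝ hy).log (norm_ne_zero_iff.2 hy)
  have hνc : ∀ y ≠ 0, ContDiffAt ℝ ∞ ν y := fun y hy =>
    ((hac.contDiffAt.comp y (hlog hy)).smul (hP.contDiffAt hy).fst).prodMk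
      (((hP.smooth_v.mul hpc).contDiffAt.comp y (hlog hy)).neg)
  have hunit : ∀ y ≠ 0, cylMetric c B (F y) (ν y) (ν y) = 1 := fun y hy => by
    have h1 := (hP.mem (Real.log ‖y‖)).1
    have h2 : 0 < 1 - R (Real.log ‖y‖) ^ 2 := by nlinarith [(hP.mem (Real.log ‖y‖)).2]
    have h3 := hp2 (Real.log ‖y‖)
    have h4 : ‖(F y).1‖ = R (Real.log ‖y‖) := hP.norm_fst hy
    rw [cylMetric, ballMetric_radial hB (hball hy), hν]
    simp only
    rw [real_inner_smul_right, real_inner_self_eq_norm_sq, h4]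
    have h5 : c * a (Real.log ‖y‖) * (a (Real.log ‖y‖) * R (Real.log ‖y‖) ^ 2) /
        (1 - R (Real.log ‖y‖) ^ 2) ^ 2 = p (Real.log ‖y‖) ^ 2 := by
      rw [← hcc]
      simp only [ha]
      field_simp
    rw [h5]
    linear_combination h3
  have hnormal : ∀ y ≠ 0, ∀ u, cylMetric c B (F y) (fderiv ℝ F y u) (ν y) = 0 := fun y hy u => by
    have h1 := (hP.mem (Real.log ‖y‖)).1
    have h2 : 0 < 1 - R (Real.log ‖y‖) ^ 2 := by nlinarith [(hP.mem (Real.log ‖y‖)).2]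
    have h4 : ‖(F y).1‖ = R (Real.log ‖y‖) := hP.norm_fst hy
    have h6 := hP.slope_fderiv (Ψ := Ψ) hc hy u
    rw [cylMetric, ballMetric_radial hB (hball hy)]
    rw [hF] at h4 ⊢
    rw [h6, h4]
    simp only [hν, ha]
    nth_rw 1 [← hcc]
    field_simp
    ring
  refine ⟨ν, hνc, hunit, hnormal, fun y hy => ?_⟩
  have hmem : F y ∈ (Metric.ball (0 : E) 1 ×ˢ univ : Set (E × ℝ)) := by simpa using hball hy
  have hFd := ((hP.contDiffAt (Ψ := Ψ) hy).differentiableAt (by simp)).hasFDerivAt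
  have hnhds : ∀ᶠ w in 𝓝 y, w ≠ 0 := isOpen_ne.mem_nhds hy
  obtain ⟨A, hA⟩ := (isMetricForm_cylForm hc hB).exists_shapeOperator
    (by rw [Module.finrank_prod, hk, finrank_euclideanSpace_fin, hnk, Module.finrank_self])
    hmem hFd ((hνc y hy).differentiableAt (by simp)).hasFDerivAt (hP.injective_fderiv hy)
    (by filter_upwards [hnhds] with w hw; rw [cylForm_apply]; exact hunit w hw)
    (fun u => by rw [cylForm_apply]; exact hnormal y hy u)
  simp only [cylForm_apply] at hA
  refine ⟨A, hA, ?_⟩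
  obtain ⟨e, he⟩ : ∃ e, (fderiv ℝ F y e).2 ≠ 0 := by
    refine ⟨y, ?_⟩
    rw [hF, fderiv_rotMap Ψ hP.smooth_R hP.smooth_H hy]
    have h0 : 0 < ‖y‖ := norm_pos_iff.2 hy
    have := hP.deriv_H_pos (Real.log ‖y‖)
    rw [real_inner_self_eq_norm_sq]
    positivity
  have hvd : HasFDerivAt (fun y : EuclideanSpace ℝ (Fin n) => v (Real.log ‖y‖)) _ y :=
    ((hP.smooth_v.differentiable (by simp) _).hasDerivAt).comp_hasFDerivAt y
      (hasFDerivAt_log_norm hy)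
  refine (esymm_shape_eq_zero_iff hc hB hk (by rw [finrank_euclideanSpace_fin, hnk, hk])
    (hP.contDiffAt (Ψ := Ψ) hy) (hball hy) ?_
    (by filter_upwards [hnhds] with w hw using hP.injective_fderiv hw) he hvd.differentiableAt
    (by filter_upwards [hnhds] with w hw using hP.slope_fderiv hc hw)
    ((hνc y hy).differentiableAt (by simp))
    (by filter_upwards [hnhds] with w hw using hunit w hw)
    (by filter_upwards [hnhds] with w hw using hnormal w hw) hA r
    (sphereSymm_pos hr (sq_nonneg _)).ne').2 fun u => ?_
  · rw [← norm_pos_iff, hP.norm_fst hy]; exact (hP.mem _).1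
  · rw [hvd.fderiv, hP.norm_fst hy, fderiv_rotMap Ψ hP.smooth_R hP.smooth_H hy]
    have := hP.eqn (Real.log ‖y‖)
    rw [profileQ] at this
    simp only [smul_apply, innerSL_apply_apply, smul_eq_mul, this]
    ring

omit [FiniteDimensional ℝ E] in
/-- Since the height is injective along the profile, the direction of the horizontal component and the
height determine the point of a rotational hypersurface. -/
theorem isEmbedding_rotMap {X : Type*} [TopologicalSpace X] {ι : X → E} (hι : IsEmbedding ι)
    (h0 : ∀ x, ι x ≠ 0) : IsEmbedding fun x => rotMap R H (ι x) := by
  have hn0 : ∀ x, 0 < ‖ι x‖ := fun x => norm_pos_iff.2 (h0 x)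
  have hc1 : Continuous fun x => Real.log ‖ι x‖ :=
    hι.continuous.norm.log fun x => (hn0 x).ne'
  have hc2 : Continuous fun x => ‖ι x‖⁻¹ • ι x :=
    (hι.continuous.norm.inv₀ fun x => (hn0 x).ne').smul hι.continuous
  have h1 : IsEmbedding fun x => (‖ι x‖⁻¹ • ι x, Real.log ‖ι x‖) := by
    refine isEmbedding_of_comp (hc2.prodMk hc1) (g := fun q : E × ℝ => Real.exp q.2 • q.1)
      (fun x => by fun_prop) ?_
    convert hι using 1
    funext x
    simp only [Function.comp_apply]
    rw [Real.exp_log (hn0 x), smul_smul, mul_inv_cancel₀ (hn0 x).ne', one_smul]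
  have hH : IsEmbedding H := hP.strictMono.isEmbedding_of_ordConnected
    (isPreconnected_range hP.smooth_H.continuous).ordConnected
  have h2 := (IsEmbedding.id.prodMap hH).comp h1
  have hcont : Continuous fun x => rotMap R H (ι x) :=
    (((hP.smooth_R.continuous.comp hc1).mul
      (hι.continuous.norm.inv₀ fun x => (hn0 x).ne')).smul hι.continuous).prodMk
        (hP.smooth_H.continuous.comp hc1)
  refine isEmbedding_of_comp hcont (g := fun q : E × ℝ => (‖q.1‖⁻¹ • q.1, q.2)) (fun x => ?_) ?_
  · have h3 : (rotMap R H (ι x)).1 ≠ 0 := by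
      rw [← norm_pos_iff, norm_rotMap_fst (hP.mem _).1.le (h0 x)]; exact (hP.mem _).1
    exact ((continuousAt_fst.norm.inv₀ (norm_ne_zero_iff.2 h3)).smul continuousAt_fst).prodMk
      continuousAt_snd
  · convert h2 using 1
    funext x
    simp only [Function.comp_apply, Prod.map_apply, id]
    rw [norm_rotMap_fst (hP.mem _).1.le (h0 x), rotMap, smul_smul]
    have := (hP.mem (Real.log ‖ι x‖)).1
    congr 2
    field_simp

omit [FiniteDimensional ℝ E] in
/-- Points of a rotational hypersurface whose images converge are convergent. -/
theorem exists_tendsto {y : ℕ → E} (h0 : ∀ i, y i ≠ 0) {q : E × ℝ} (hq : ‖q.1‖ < 1)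
    (hlim : Tendsto (fun i => rotMap R H (y i)) atTop (𝓝 q)) :
    ∃ w, w ≠ 0 ∧ Tendsto y atTop (𝓝 w) := by
  have hn0 : ∀ i, 0 < ‖y i‖ := fun i => norm_pos_iff.2 (h0 i)
  have hz := (continuous_fst.tendsto q).comp hlim
  have ht := (continuous_snd.tendsto q).comp hlim
  set s : ℕ → ℝ := fun i => Real.log ‖y i‖ with hs
  have hR : Tendsto (fun i => R (s i)) atTop (𝓝 ‖q.1‖) := by
    refine hz.norm.congr fun i => ?_
    exact norm_rotMap_fst (hP.mem _).1.le (h0 i)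
  replace ht : Tendsto (fun i => H (s i)) atTop (𝓝 q.2) := ht
  obtain ⟨x, hx1, hx2⟩ := exists_between hq
  obtain ⟨M, hM⟩ := hP.proper x hx2 (|q.2| + 1)
  have hbd : ∀ᶠ i in atTop, s i ∈ Icc (-M) M := by
    filter_upwards [hR.eventually_le_const hx1, ht.abs.eventually_le_const (lt_add_one |q.2|)]
      with i h1 h2
    exact abs_le.1 (hM _ h1 h2)
  obtain ⟨s₀, -, hs₀⟩ := (isCompact_Icc.image hP.smooth_H.continuous).isClosed.mem_of_tendsto ht
    (hbd.mono fun i hi => mem_image_of_mem H hi)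
  have hH : IsEmbedding H := hP.strictMono.isEmbedding_of_ordConnected
    (isPreconnected_range hP.smooth_H.continuous).ordConnected
  have hslim : Tendsto s atTop (𝓝 s₀) := by
    rw [hH.tendsto_nhds_iff, hs₀]; exact ht
  have hy : ∀ i, y i = (Real.exp (s i) * (R (s i))⁻¹) • (rotMap R H (y i)).1 := fun i => by
    rw [rotMap, smul_smul, hs, Real.exp_log (hn0 i)]
    have h1 := (hP.mem (Real.log ‖y i‖)).1
    have h2 := hn0 i
    rw [show ‖y i‖ * (R (Real.log ‖y i‖))⁻¹ * (R (Real.log ‖y i‖) * ‖y i‖⁻¹) = 1 by field_simp,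
      one_smul]
  have hRs : Tendsto (fun i => R (s i)) atTop (𝓝 (R s₀)) :=
    (hP.smooth_R.continuous.tendsto _).comp hslim
  have hqR : ‖q.1‖ = R s₀ := tendsto_nhds_unique hR hRs
  refine ⟨(Real.exp s₀ * (R s₀)⁻¹) • q.1, smul_ne_zero (mul_ne_zero (Real.exp_ne_zero _)
    (inv_ne_zero (hP.mem s₀).1.ne')) ?_, ?_⟩
  · rw [← norm_pos_iff, hqR]; exact (hP.mem _).1
  · have h3 := ((((Real.continuous_exp.tendsto _).comp hslim).mul
      (hRs.inv₀ (hP.mem s₀).1.ne')).smul hz)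
    exact h3.congr fun i => (hy i).symm

end IsProfile

end Existence

/-! ### Rotational hypersurfaces and hyperplanes as parametrized manifolds -/

section ExistenceManifold

variable {E : Type*} [NormedAddCommGroup E] [InnerProductSpace ℝ E] [FiniteDimensional ℝ E]
  {n d k r : ℕ} {B : E →L[ℝ] E →L[ℝ] E →L[ℝ] E} {c : ℝ} {R H v : ℝ → ℝ}

/-- The punctured Euclidean space, as an open set. -/
def puncturedSpace (n : ℕ) : TopologicalSpace.Opens (EuclideanSpace ℝ (Fin n)) :=
  ⟨{0}ᶜ, isOpen_compl_singleton⟩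

theorem ne_zero_of_puncturedSpace (y : puncturedSpace n) : (y : EuclideanSpace ℝ (Fin n)) ≠ 0 := y.2

theorem nonempty_homeomorph_annulus (n : ℕ) : Nonempty (puncturedSpace n ≃ₜ Annulus n) :=
  ⟨(homeomorphUnitSphereProd (EuclideanSpace ℝ (Fin n))).trans
    ((Homeomorph.refl _).prodCongr Real.expOrderIso.toHomeomorph.symm)⟩

/-- The unit ball of the Euclidean space, as an open set. -/
def openUnitBall (n : ℕ) : TopologicalSpace.Opens (EuclideanSpace ℝ (Fin n)) :=
  ⟨Metric.ball 0 1, Metric.isOpen_ball⟩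

theorem nonempty_homeomorph_euclideanSpace (n : ℕ) :
    Nonempty (openUnitBall n ≃ₜ EuclideanSpace ℝ (Fin n)) :=
  ⟨(Homeomorph.unitBall (E := EuclideanSpace ℝ (Fin n))).symm⟩

variable (Ψ : EuclideanSpace ℝ (Fin n) ≃ₗᵢ[ℝ] E)

/-- The parametrization of the rotational hypersurface with profile `(R, H)`. -/
def rotParam (R H : ℝ → ℝ) (y : puncturedSpace n) : E × ℝ := rotMap R H (Ψ y)

namespace IsProfile

omit [FiniteDimensional ℝ E] in
theorem range_rotParam : range (rotParam Ψ R H) = rotMap R H '' {0}ᶜ := by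
  ext q
  constructor
  · rintro ⟨y, rfl⟩
    exact ⟨Ψ y, by simpa using ne_zero_of_puncturedSpace y, rfl⟩
  · rintro ⟨w, hw, rfl⟩
    exact ⟨⟨Ψ.symm w, by simpa [puncturedSpace] using hw⟩, by simp [rotParam]⟩

variable (hP : IsProfile c d k r R H v)

include hP

omit [FiniteDimensional ℝ E] in
theorem isEmbedding_rotParam : IsEmbedding (rotParam Ψ R H) :=
  hP.isEmbedding_rotMap (ι := fun y : puncturedSpace n => Ψ y)
    (Ψ.toHomeomorph.isEmbedding.comp IsEmbedding.subtypeVal) fun y => by simpa using ne_zero_of_puncturedSpace y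

omit [FiniteDimensional ℝ E] in
theorem isImmersionInto_rotParam :
    IsImmersionInto n (Metric.ball (0 : E) 1 ×ˢ univ) (rotParam Ψ R H) := by
  refine ⟨fun y => ?_, fun y => contMDiffAt_comp_val _ (hP.contDiffAt y.2), fun y => ?_⟩
  · have h1 := hP.norm_fst (Ψ := Ψ) y.2
    have h2 := (hP.mem (Real.log ‖(y : EuclideanSpace ℝ (Fin n))‖)).2
    simpa [rotParam, h1] using h2
  · have h1 := tangentMapAt_comp_val (puncturedSpace n) (hP.contDiffAt (Ψ := Ψ) y.2)
    rw [show rotParam Ψ R H = fun y : puncturedSpace n => rotMap R H (Ψ y) from rfl, h1]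
    exact hP.injective_fderiv y.2

theorem isCompleteImmersion_rotParam (hc : 0 < c) (hB : IsLineForm d B) :
    IsCompleteImmersion n (cylMetric c B) (rotParam Ψ R H) := by
  have him := hP.isImmersionInto_rotParam Ψ
  refine isCompleteImmersion_of_tendsto hc hB him.smooth (fun x => by simpa using (him.mem x).1)
    fun x p hp hlim => ?_
  obtain ⟨w, hw0, hw⟩ := hP.exists_tendsto (y := fun i => Ψ (x i))
    (fun i => by simpa using ne_zero_of_puncturedSpace (x i)) hp hlim
  refine ⟨⟨Ψ.symm w, by simpa [puncturedSpace] using hw0⟩, ?_⟩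
  rw [tendsto_subtype_rng]
  have := (Ψ.symm.continuous.tendsto w).comp hw
  simpa [Function.comp_def] using this

theorem isRMinimal_rotParam (hc : 0 < c) (hB : IsLineForm d B)
    (hk : Module.finrank ℝ E = k + 1) (hnk : n = k + 1) (hr : r ≤ k) :
    IsRMinimal n (cylMetric c B) (rotParam Ψ R H) (r + 1) := by
  obtain ⟨ν, h1, h2, h3, h4⟩ := hP.exists_normal_shapeOperator (Ψ := Ψ) hc hB hk hnk hr
  intro x
  obtain ⟨A, hA, hA0⟩ := h4 x x.2
  have ht : ∀ y, tangentMapAt n (rotParam Ψ R H) y = fderiv ℝ (fun y => rotMap R H (Ψ y)) y :=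
    fun y => tangentMapAt_comp_val (puncturedSpace n) (hP.contDiffAt (Ψ := Ψ) y.2)
  refine ⟨univ, fun y => ν y, A, isOpen_univ, mem_univ x,
    ⟨fun y _ => (contMDiffAt_comp_val _ (h1 y y.2)).contMDiffWithinAt, fun y _ => h2 y y.2,
      fun y _ u => ?_⟩, fun u Z => ?_, hA0⟩
  · rw [ht]; exact h3 y y.2 u
  · rw [ht, tangentMapAt_comp_val _ (h1 x x.2)]
    exact hA u Z

omit [FiniteDimensional ℝ E] in
theorem norm_eq_of_snd_eq {x y : puncturedSpace n}
    (h : (rotParam Ψ R H x).2 = (rotParam Ψ R H y).2) :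
    ‖(rotParam Ψ R H x).1‖ = ‖(rotParam Ψ R H y).1‖ := by
  have h1 : Real.log ‖Ψ x‖ = Real.log ‖Ψ y‖ := hP.strictMono.injective h
  rw [rotParam, rotParam, norm_rotMap_fst (hP.mem _).1.le (by simpa using ne_zero_of_puncturedSpace x),
    norm_rotMap_fst (hP.mem _).1.le (by simpa using ne_zero_of_puncturedSpace y), h1]

omit [FiniteDimensional ℝ E] in
theorem rotParam_fst_ne_zero (x : puncturedSpace n) : (rotParam Ψ R H x).1 ≠ 0 := by
  rw [← norm_pos_iff, rotParam, norm_rotMap_fst (hP.mem _).1.le (by simpa using ne_zero_of_puncturedSpace x)]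
  exact (hP.mem _).1

end IsProfile

/-- The parametrization of a horizontal hyperplane. -/
def hyperplaneParam (t : ℝ) (y : openUnitBall n) : E × ℝ := (Ψ y, t)

omit [FiniteDimensional ℝ E] in
theorem range_hyperplaneParam (t : ℝ) : range (hyperplaneParam Ψ t) = Metric.ball 0 1 ×ˢ {t} := by
  ext ⟨z, s⟩
  constructor
  · rintro ⟨y, hy⟩
    have hy2 : (y : EuclideanSpace ℝ (Fin n)) ∈ Metric.ball 0 1 := y.2
    cases hy
    exact ⟨by simpa using hy2, rfl⟩
  · rintro ⟨hz, hs⟩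
    refine ⟨⟨Ψ.symm z, by simpa [openUnitBall] using hz⟩, ?_⟩
    simpa [hyperplaneParam] using hs.symm

omit [FiniteDimensional ℝ E] in
theorem contDiff_hyperplane (t : ℝ) :
    ContDiff ℝ ∞ fun y : EuclideanSpace ℝ (Fin n) => ((Ψ y, t) : E × ℝ) :=
  Ψ.toContinuousLinearEquiv.contDiff.prodMk contDiff_const

omit [FiniteDimensional ℝ E] in
theorem tangentMapAt_hyperplaneParam (t : ℝ) (y : openUnitBall n)
    (u : EuclideanSpace ℝ (Fin n)) : tangentMapAt n (hyperplaneParam Ψ t) y u = (Ψ u, 0) := by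
  have h1 := tangentMapAt_comp_val (openUnitBall n) (x := y) (contDiff_hyperplane Ψ t).contDiffAt
  rw [show hyperplaneParam Ψ t = fun y : openUnitBall n => ((Ψ y, t) : E × ℝ) from rfl, h1]
  have h2 : HasFDerivAt (fun w => Ψ w) (Ψ : EuclideanSpace ℝ (Fin n) →L[ℝ] E) y.1 :=
    Ψ.toContinuousLinearEquiv.hasFDerivAt
  rw [(h2.prodMk (hasFDerivAt_const t y.1)).fderiv]
  rfl

omit [FiniteDimensional ℝ E] in
theorem isEmbedding_hyperplaneParam (t : ℝ) :
    IsEmbedding (hyperplaneParam Ψ t) := by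
  refine isEmbedding_of_comp (g := Prod.fst) ?_ (fun _ => continuousAt_fst)
    (Ψ.toHomeomorph.isEmbedding.comp IsEmbedding.subtypeVal)
  exact (contDiff_hyperplane Ψ t).continuous.comp continuous_subtype_val

omit [FiniteDimensional ℝ E] in
theorem isImmersionInto_hyperplaneParam (t : ℝ) :
    IsImmersionInto n (Metric.ball (0 : E) 1 ×ˢ univ) (hyperplaneParam Ψ t) := by
  refine ⟨fun y => ?_, fun y => contMDiffAt_comp_val _ (contDiff_hyperplane Ψ t).contDiffAt,
    fun y u w h => ?_⟩
  · have := mem_range_self (f := hyperplaneParam Ψ t) y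
    rw [range_hyperplaneParam] at this
    exact ⟨this.1, mem_univ _⟩
  · rw [tangentMapAt_hyperplaneParam, tangentMapAt_hyperplaneParam] at h
    exact Ψ.injective (Prod.mk.inj h).1

theorem isCompleteImmersion_hyperplaneParam (hc : 0 < c) (hB : IsLineForm d B) (t : ℝ) :
    IsCompleteImmersion n (cylMetric c B) (hyperplaneParam Ψ t) := by
  have him := isImmersionInto_hyperplaneParam Ψ t
  refine isCompleteImmersion_of_tendsto hc hB him.smooth (fun x => by simpa using (him.mem x).1)
    fun x p hp hlim => ?_
  refine ⟨⟨Ψ.symm p.1, by simpa [openUnitBall] using hp⟩, ?_⟩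
  rw [tendsto_subtype_rng]
  have := (Ψ.symm.continuous.tendsto p.1).comp ((continuous_fst.tendsto p).comp hlim)
  simpa [Function.comp_def, hyperplaneParam] using this

/-- Totally geodesic hypersurfaces are `r`-minimal for all `r ≥ 1`. -/
theorem rMeanCurvature_zero (r : ℕ) :
    rMeanCurvature (0 : Module.End ℝ (EuclideanSpace ℝ (Fin n))) (r + 1) = 0 := by
  have h1 : (0 : Module.End ℝ (EuclideanSpace ℝ (Fin n))).charpoly = Polynomial.X ^ n := by
    rw [(LinearMap.charpoly_eq_X_pow_iff _).2 fun m => ⟨1, by simp⟩, finrank_euclideanSpace_fin]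
  rw [rMeanCurvature, h1, Polynomial.roots_X_pow, Multiset.esymm]
  refine Multiset.sum_eq_zero fun x hx => ?_
  obtain ⟨s, hs, rfl⟩ := Multiset.mem_map.1 hx
  rw [Multiset.mem_powersetCard] at hs
  obtain ⟨a, ha⟩ := Multiset.card_pos_iff_exists_mem.1 (by rw [hs.2]; exact Nat.succ_pos r)
  have h0 : a = 0 := by
    have := Multiset.mem_of_le hs.1 ha
    exact Multiset.mem_singleton.1 (Multiset.mem_of_mem_nsmul this)
  exact Multiset.prod_eq_zero (h0 ▸ ha)

omit [FiniteDimensional ℝ E] in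
/-- The normal `(0, 1)` of a hyperplane is parallel, so that the shape operator is zero. -/
theorem isRMinimal_hyperplaneParam (t : ℝ) (r : ℕ) :
    IsRMinimal n (cylMetric c B) (hyperplaneParam Ψ t) (r + 1) := by
  intro x
  have hx : ‖(hyperplaneParam Ψ t x).1‖ < 1 := by
    simpa using ((isImmersionInto_hyperplaneParam Ψ t).mem x).1
  have hν : ContDiff ℝ ∞ fun _ : EuclideanSpace ℝ (Fin n) => ((0, 1) : E × ℝ) := contDiff_const
  refine ⟨univ, fun _ => (0, 1), 0, isOpen_univ, mem_univ x, ⟨contMDiffOn_const, fun y _ => ?_,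
    fun y _ u => ?_⟩, fun u Z => ?_, rMeanCurvature_zero r⟩
  · simp [cylMetric, ballMetric]
  · rw [tangentMapAt_hyperplaneParam]; simp [cylMetric, ballMetric]
  · have h1 : tangentMapAt n (fun _ : openUnitBall n => ((0, 1) : E × ℝ)) x u = 0 := by
      have := tangentMapAt_comp_val (openUnitBall n) (x := x) hν.contDiffAt
      rw [this, fderiv_const_apply, zero_apply]
    have h2 : tangentMapAt n (hyperplaneParam Ψ t) x
        ((0 : Module.End ℝ (EuclideanSpace ℝ (Fin n))) u) = 0 := by
      rw [LinearMap.zero_apply, map_zero]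
    have h3 : christoffel (cylMetric c B) (hyperplaneParam Ψ t x)
        (tangentMapAt n (hyperplaneParam Ψ t) x u) (0, 1) Z = 0 := by
      rw [tangentMapAt_hyperplaneParam]
      simp [christoffel, fderiv_cylMetric hx]
    rw [h1, h2, h3]
    simp [cylMetric, ballMetric]

end ExistenceManifold

/-! ### Distance to the origin -/

section Distance

variable {E : Type*} [NormedAddCommGroup E] [InnerProductSpace ℝ E] {d : ℕ}
  {B : E →L[ℝ] E →L[ℝ] E →L[ℝ] E} {c : ℝ}

/-- The hyperbolic distance to the origin, as a function of the Euclidean one. -/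
def radialDist (c ρ : ℝ) : ℝ := √c / 2 * logit ((1 + ρ) / 2)

/-- The Euclidean distance to the origin, as a function of the hyperbolic one. -/
def radialNorm (c s : ℝ) : ℝ := 2 * Real.sigmoid (2 / √c * s) - 1

theorem half_add_mem {ρ : ℝ} (h : |ρ| < 1) : (1 + ρ) / 2 ∈ Ioo (0 : ℝ) 1 := by
  rw [abs_lt] at h
  constructor <;> linarith

theorem hasDerivAt_radialDist {ρ : ℝ} (h : |ρ| < 1) :
    HasDerivAt (radialDist c) (√c / (1 - ρ ^ 2)) ρ := by
  have h1 : HasDerivAt (fun ρ : ℝ => (1 + ρ) / 2) (1 / 2) ρ :=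
    ((hasDerivAt_id ρ).const_add 1).div_const 2
  have h2 := ((hasDerivAt_logit (half_add_mem h)).comp ρ h1).const_mul (√c / 2)
  refine h2.congr_deriv ?_
  rw [abs_lt] at h
  have h3 : 0 < 1 + ρ := by linarith
  have h4 : 0 < 1 - ρ := by linarith
  have h5 : 1 - ρ ^ 2 = (1 + ρ) * (1 - ρ) := by ring
  have h6 : 1 - (1 + ρ) / 2 = (1 - ρ) / 2 := by ring
  rw [h5, h6]
  field_simp

theorem radialDist_zero : radialDist c 0 = 0 := by
  simp [radialDist, logit]; norm_num

theorem radialNorm_radialDist (hc : 0 < c) {ρ : ℝ} (h : |ρ| < 1) :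
    radialNorm c (radialDist c ρ) = ρ := by
  have hsc : 0 < √c := Real.sqrt_pos.2 hc
  rw [radialNorm, radialDist, ← mul_assoc, show 2 / √c * (√c / 2) = 1 by field_simp, one_mul,
    sigmoid_logit (half_add_mem h)]
  ring

theorem radialDist_radialNorm (hc : 0 < c) (s : ℝ) : radialDist c (radialNorm c s) = s := by
  have hsc : 0 < √c := Real.sqrt_pos.2 hc
  rw [radialNorm, radialDist, show (1 + (2 * Real.sigmoid (2 / √c * s) - 1)) / 2 =
    Real.sigmoid (2 / √c * s) by ring, logit_sigmoid]
  field_simp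

theorem radialNorm_mem (hc : 0 < c) {s : ℝ} (hs : 0 < s) : radialNorm c s ∈ Ioo (0 : ℝ) 1 := by
  have hsc : 0 < √c := Real.sqrt_pos.2 hc
  have h1 := (sigmoid_mem (2 / √c * s)).2
  have h2 : Real.sigmoid 0 < Real.sigmoid (2 / √c * s) := Real.sigmoid_strictMono (by positivity)
  rw [Real.sigmoid_zero] at h2
  constructor <;> rw [radialNorm] <;> linarith

theorem strictMonoOn_radialDist (hc : 0 < c) : StrictMonoOn (radialDist c) (Ico 0 1) := by
  intro a ha b hb hab
  by_contra h
  have h1 : radialNorm c (radialDist c b) ≤ radialNorm c (radialDist c a) := by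
    have hsc : 0 < √c := Real.sqrt_pos.2 hc
    have : 2 / √c * radialDist c b ≤ 2 / √c * radialDist c a :=
      mul_le_mul_of_nonneg_left (not_lt.1 h) (by positivity)
    have := Real.sigmoid_strictMono.monotone this
    rw [radialNorm, radialNorm]
    linarith
  rw [radialNorm_radialDist hc (by rw [abs_of_nonneg hb.1]; exact hb.2),
    radialNorm_radialDist hc (by rw [abs_of_nonneg ha.1]; exact ha.2)] at h1
  linarith

theorem radialDist_nonneg (hc : 0 < c) {ρ : ℝ} (h : ρ ∈ Ico (0 : ℝ) 1) : 0 ≤ radialDist c ρ := by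
  rw [← radialDist_zero (c := c)]
  exact (strictMonoOn_radialDist hc).monotoneOn ⟨le_rfl, one_pos⟩ h h.1

/-- The functions `radialDist c ⟪z, e⟫` are `1`-Lipschitz. -/
theorem inner_sq_le_ballMetric (hc : 0 < c) (hB : IsLineForm d B) {z e : E} (hz : ‖z‖ < 1)
    (he : ‖e‖ = 1) (X : E) :
    c * (inner ℝ X e / (1 - inner ℝ z e ^ 2)) ^ 2 ≤ ballMetric c B z X X := by
  have h1 := one_sub_norm_sq_pos hz
  have hs : inner ℝ z e ^ 2 ≤ ‖z‖ ^ 2 := by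
    rw [sq_le_sq]
    have := abs_real_inner_le_norm z e
    rwa [he, mul_one, ← abs_of_nonneg (norm_nonneg z)] at this
  have h2 : 0 < 1 - inner ℝ z e ^ 2 := by linarith
  have h3 := hB.inner_sq_le z X
  set s := inner ℝ z e
  set α := inner ℝ X e with hα
  set b := inner ℝ z X with hb
  set q := ‖z‖ ^ 2 with hq
  -- positivity of the metric of the real hyperbolic space at the component `w` of `X` orthogonal to
  -- the gradient of `⟪·, e⟫`
  set τ := α / (1 - s ^ 2) with hτ
  set w := X - τ • (e - s • z) with hw
  have hw1 : inner ℝ z w = b - τ * (s - s * q) := by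
    rw [hw, inner_sub_right, inner_smul_right, inner_sub_right, inner_smul_right,
      real_inner_self_eq_norm_sq]
  have hw2 : ‖w‖ ^ 2 = ‖X‖ ^ 2 - 2 * τ * (α - s * b) + τ ^ 2 * (1 - 2 * s ^ 2 + s ^ 2 * q) := by
    rw [hw, norm_sub_sq_real, norm_smul, mul_pow, norm_sub_sq_real, inner_smul_right,
      inner_sub_right, inner_smul_right, inner_smul_right, norm_smul, mul_pow, he,
      Real.norm_eq_abs, Real.norm_eq_abs, sq_abs, sq_abs, real_inner_comm z X, real_inner_comm z e]
    ring
  have hτs : τ * (1 - s ^ 2) = α := by rw [hτ]; field_simp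
  have hnn : 0 ≤ ‖w‖ ^ 2 / (1 - q) + (inner ℝ z w) ^ 2 / (1 - q) ^ 2 := by positivity
  have hid : ‖w‖ ^ 2 / (1 - q) + (inner ℝ z w) ^ 2 / (1 - q) ^ 2 =
      ‖X‖ ^ 2 / (1 - q) + b ^ 2 / (1 - q) ^ 2 - τ * α / (1 - q) := by
    rw [hw1, hw2]
    field_simp
    linear_combination ((1 - q) * τ) * hτs
  have hfin : τ ^ 2 ≤ τ * α / (1 - q) := by
    rw [le_div_iff₀ h1, ← hτs]
    nlinarith [sq_nonneg τ]
  have h4 : inner ℝ (B z z X) X / (1 - q) ^ 2 ≥ b ^ 2 / (1 - q) ^ 2 := by gcongr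
  rw [ballMetric, real_inner_self_eq_norm_sq]
  gcongr
  linarith

/-- Lower bound of the distance, by a `1`-Lipschitz function which attains it. -/
theorem le_riemannDist_zero (hc : 0 < c) (hB : IsLineForm d B) {p : E} (hp : ‖p‖ < 1) :
    ENNReal.ofReal (radialDist c ‖p‖) ≤ riemannDist (Metric.ball 0 1) (ballMetric c B) 0 p := by
  rcases eq_or_ne p 0 with rfl | hp0
  · simp [radialDist_zero]
  have hn : 0 < ‖p‖ := norm_pos_iff.2 hp0
  set e := ‖p‖⁻¹ • p with he
  have he1 : ‖e‖ = 1 := by rw [he, norm_smul, norm_inv, norm_norm, inv_mul_cancel₀ hn.ne']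
  have habs : ∀ z : E, ‖z‖ < 1 → |inner ℝ z e| < 1 := fun z hz => by
    have := abs_real_inner_le_norm z e
    rw [he1, mul_one] at this
    exact this.trans_lt hz
  refine le_iInf₂ fun γ hγ => ?_
  obtain ⟨h1, h2, h3, h4⟩ := hγ
  have hd : ∀ z : E, ‖z‖ < 1 → HasFDerivAt (fun z : E => radialDist c (inner ℝ z e))
      ((√c / (1 - inner ℝ z e ^ 2)) • innerSL ℝ e) z := fun z hz => by
    have h5 : HasFDerivAt (fun z : E => inner ℝ z e) (innerSL ℝ e) z := by
      refine (innerSL ℝ e).hasFDerivAt.congr_of_eventuallyEq (Eventually.of_forall fun w => ?_)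
      simp [real_inner_comm]
    exact HasDerivAt.comp_hasFDerivAt (h₂ := radialDist c) z (hasDerivAt_radialDist (habs z hz)) h5
  have h6 := enorm_sub_le_curveLength (U := Metric.ball (0 : E) 1) (g := ballMetric c B)
    (ψ := fun z : E => radialDist c (inner ℝ z e)) (fun z hz => ?_) (fun z hz X => ?_) h1 h2
  · rw [h3, h4, inner_zero_left, radialDist_zero, sub_zero] at h6
    have h7 : inner ℝ p e = ‖p‖ := by
      rw [he, real_inner_smul_right, real_inner_self_eq_norm_sq]; field_simp
    rw [h7, ← ofReal_norm, Real.norm_of_nonneg (radialDist_nonneg hc ⟨hn.le, hp⟩)] at h6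
    exact h6
  · have hz' := habs z (mem_ball_zero_iff.1 hz)
    have h8 := half_add_mem hz'
    have h9 : 0 < 1 - (1 + inner ℝ z e) / 2 := by linarith [h8.2]
    have h10 : ContDiffAt ℝ 1 (fun z : E => (1 + inner ℝ z e) / 2) z :=
      (contDiffAt_const.add (contDiffAt_id.inner ℝ contDiffAt_const)).div_const 2
    exact contDiffAt_const.mul ((h10.div (contDiffAt_const.sub h10) h9.ne').log
      (div_pos h8.1 h9).ne')
  · have hz' := mem_ball_zero_iff.1 hz
    rw [(hd z hz').fderiv]
    refine Real.le_sqrt_of_sq_le (le_trans (le_of_eq ?_) (inner_sq_le_ballMetric hc hB hz' he1 X))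
    rw [smul_apply, innerSL_apply_apply, Real.norm_eq_abs, sq_abs, smul_eq_mul, mul_pow, div_pow,
      div_pow, Real.sq_sqrt hc.le, real_inner_comm X e]
    ring

/-- Upper bound of the distance, by the length of the radius. -/
theorem riemannDist_zero_le (hc : 0 < c) (hB : IsLineForm d B) {p : E} (hp : ‖p‖ < 1) :
    riemannDist (Metric.ball 0 1) (ballMetric c B) 0 p ≤ ENNReal.ofReal (radialDist c ‖p‖) := by
  have hmem : ∀ τ ∈ Icc (0 : ℝ) 1, |τ * ‖p‖| < 1 := fun τ hτ => by
    rw [abs_of_nonneg (mul_nonneg hτ.1 (norm_nonneg p))]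
    exact (mul_le_of_le_one_left (norm_nonneg p) hτ.2).trans_lt hp
  have hlin : ContDiff ℝ 1 fun τ : ℝ => τ • p := contDiff_id.smul contDiff_const
  have hmaps : MapsTo (fun τ : ℝ => τ • p) (Icc 0 1) (Metric.ball 0 1) := fun τ hτ => by
    rw [mem_ball_zero_iff, norm_smul, Real.norm_of_nonneg hτ.1]
    exact (le_abs_self _).trans_lt (hmem τ hτ)
  refine (iInf₂_le (fun τ : ℝ => τ • p) ⟨hlin.contDiffOn, hmaps, by simp, by simp⟩).trans ?_
  · have hpos : ∀ τ ∈ Icc (0 : ℝ) 1, 0 < 1 - (τ * ‖p‖) ^ 2 := fun τ hτ => by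
      have := hmem τ hτ
      rw [← sq_lt_one_iff_abs_lt_one] at this
      linarith
    have hd : ∀ τ ∈ Icc (0 : ℝ) 1, HasDerivAt (fun τ => radialDist c (τ * ‖p‖))
        (√c / (1 - (τ * ‖p‖) ^ 2) * ‖p‖) τ := fun τ hτ => by
      have h1 : HasDerivAt (fun τ : ℝ => τ * ‖p‖) ‖p‖ τ := by
        simpa using (hasDerivAt_id τ).mul_const ‖p‖
      exact HasDerivAt.comp (h₂ := radialDist c) τ (hasDerivAt_radialDist (hmem τ hτ)) h1
    have hcont : ContinuousOn (fun τ => √c / (1 - (τ * ‖p‖) ^ 2) * ‖p‖) (Icc 0 1) :=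
      (continuousOn_const.div (by fun_prop) fun τ hτ => (hpos τ hτ).ne').mul continuousOn_const
    have hint : ∫ τ in Icc (0 : ℝ) 1, √c / (1 - (τ * ‖p‖) ^ 2) * ‖p‖ = radialDist c ‖p‖ := by
      rw [integral_Icc_eq_integral_Ioc, ← intervalIntegral.integral_of_le zero_le_one,
        intervalIntegral.integral_eq_sub_of_hasDerivAt (f := fun τ => radialDist c (τ * ‖p‖))]
      · simp [radialDist_zero]
      · intro τ hτ
        rw [uIcc_of_le zero_le_one] at hτ
        exact hd τ hτ
      · exact (hcont.mono (by rw [uIcc_of_le zero_le_one])).intervalIntegrable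
    rw [← hint, ofReal_integral_eq_lintegral_ofReal hcont.integrableOn_Icc
      ((ae_restrict_iff' measurableSet_Icc).2 (Eventually.of_forall fun τ hτ => by
        have := hpos τ hτ
        positivity))]
    refine le_of_eq (setLIntegral_congr_fun measurableSet_Icc fun τ hτ => ?_)
    have hder : derivWithin (fun τ : ℝ => τ • p) (Icc 0 1) τ = p := by
      have h1 : HasDerivAt (fun τ : ℝ => τ • p) p τ := by
        simpa using (hasDerivAt_id τ).smul_const p
      exact h1.hasDerivWithinAt.derivWithin (uniqueDiffOn_Icc_zero_one τ hτ)
    simp only [hder]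
    congr 1
    have h2 := hpos τ hτ
    have h3 : ballMetric c B (τ • p) p p = (√c / (1 - (τ * ‖p‖) ^ 2) * ‖p‖) ^ 2 := by
      rw [ballMetric, norm_smul, mul_pow, Real.norm_eq_abs, sq_abs, map_smul, map_smul, smul_apply,
        smul_apply, smul_apply, hB.self, real_inner_self_eq_norm_sq, smul_smul, smul_smul,
        real_inner_smul_left, real_inner_self_eq_norm_sq, mul_pow, div_pow, Real.sq_sqrt hc.le,
        mul_pow]
      rw [mul_pow] at h2
      field_simp
      ring
    rw [h3, Real.sqrt_sq (by positivity)]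

theorem riemannDist_zero (hc : 0 < c) (hB : IsLineForm d B) {p : E} (hp : ‖p‖ < 1) :
    riemannDist (Metric.ball 0 1) (ballMetric c B) 0 p = ENNReal.ofReal (radialDist c ‖p‖) :=
  le_antisymm (riemannDist_zero_le hc hB hp) (le_riemannDist_zero hc hB hp)

end Distance

/-! ### Composition algebras -/

section Composition

variable {K : Type*} [NormedAddCommGroup K] [InnerProductSpace ℝ K] [Mul K] [Star K]

/-- `K` is a real normed division algebra, not necessarily associative, with unit `e` and
conjugation `star`. -/
structure IsCompositionAlgebra (e : K) : Prop where
  add_mul : ∀ a b x : K, (a + b) * x = a * x + b * x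
  mul_add : ∀ a x y : K, a * (x + y) = a * x + a * y
  smul_mul : ∀ (t : ℝ) (a x : K), (t • a) * x = t • (a * x)
  mul_smul : ∀ (t : ℝ) (a x : K), a * (t • x) = t • (a * x)
  one_mul : ∀ x : K, e * x = x
  mul_one : ∀ x : K, x * e = x
  norm_mul : ∀ x y : K, ‖x * y‖ = ‖x‖ * ‖y‖
  norm_one : ‖e‖ = 1
  star_eq : ∀ x : K, star x = (2 * inner ℝ x e) • e - x

namespace IsCompositionAlgebra

variable {e : K} (hK : IsCompositionAlgebra e)

include hK

theorem neg_mul (a x : K) : -a * x = -(a * x) := by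
  have := hK.smul_mul (-1) a x
  simpa using this

theorem mul_neg (a x : K) : a * -x = -(a * x) := by
  have := hK.mul_smul (-1) a x
  simpa using this

theorem sub_mul (a b x : K) : (a - b) * x = a * x - b * x := by
  rw [sub_eq_add_neg, hK.add_mul, hK.neg_mul, sub_eq_add_neg]

theorem mul_sub (a x y : K) : a * (x - y) = a * x - a * y := by
  rw [sub_eq_add_neg, hK.mul_add, hK.mul_neg, sub_eq_add_neg]

theorem zero_mul (x : K) : 0 * x = 0 := by
  have := hK.smul_mul 0 0 x
  simpa using this

theorem mul_zero (x : K) : x * 0 = 0 := by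
  have := hK.mul_smul 0 x 0
  simpa using this

theorem star_add (x y : K) : star (x + y) = star x + star y := by
  simp only [hK.star_eq, inner_add_left]
  module

theorem star_smul (t : ℝ) (x : K) : star (t • x) = t • star x := by
  simp only [hK.star_eq, real_inner_smul_left]
  module

theorem star_sub (x y : K) : star (x - y) = star x - star y := by
  simp only [hK.star_eq, inner_sub_left]
  module

theorem inner_self_one : inner ℝ e e = (1 : ℝ) := by
  rw [real_inner_self_eq_norm_sq, hK.norm_one, one_pow]

theorem star_one : star e = e := by
  rw [hK.star_eq, hK.inner_self_one]
  module

theorem inner_star_left (x y : K) : inner ℝ (star x) y = inner ℝ x (star y) := by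
  simp only [hK.star_eq, inner_sub_left, inner_sub_right, real_inner_smul_left,
    real_inner_smul_right, real_inner_comm e x, real_inner_comm y e]
  ring

theorem star_star (x : K) : star (star x) = x := by
  rw [hK.star_eq (star x), hK.inner_star_left, hK.star_one, hK.star_eq x]
  module

theorem norm_star (x : K) : ‖star x‖ = ‖x‖ := by
  have h : ‖star x‖ ^ 2 = ‖x‖ ^ 2 := by
    rw [← real_inner_self_eq_norm_sq, ← real_inner_self_eq_norm_sq, hK.inner_star_left,
      hK.star_star]
  exact (sq_eq_sq₀ (norm_nonneg _) (norm_nonneg _)).1 h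

theorem inner_mul_left_mul_left (a x y : K) :
    inner ℝ (a * x) (a * y) = ‖a‖ ^ 2 * inner ℝ x y := by
  have h := hK.norm_mul a (x + y)
  have h2 : ‖a * (x + y)‖ ^ 2 = ‖a‖ ^ 2 * ‖x + y‖ ^ 2 := by rw [h, mul_pow]
  rw [hK.mul_add, norm_add_sq_real, norm_add_sq_real, hK.norm_mul, hK.norm_mul] at h2
  linarith

theorem inner_mul_mul_add (a b x y : K) :
    inner ℝ (a * x) (b * y) + inner ℝ (b * x) (a * y) = 2 * inner ℝ a b * inner ℝ x y := by
  have h := hK.inner_mul_left_mul_left (a + b) x y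
  rw [hK.add_mul, hK.add_mul, norm_add_sq_real, inner_add_left, inner_add_right, inner_add_right,
    hK.inner_mul_left_mul_left, hK.inner_mul_left_mul_left] at h
  linarith

theorem inner_mul_right_mul_right (a x y : K) :
    inner ℝ (x * a) (y * a) = ‖a‖ ^ 2 * inner ℝ x y := by
  have h := hK.norm_mul (x + y) a
  have h2 : ‖(x + y) * a‖ ^ 2 = ‖x + y‖ ^ 2 * ‖a‖ ^ 2 := by rw [h, mul_pow]
  rw [hK.add_mul, norm_add_sq_real, norm_add_sq_real, hK.norm_mul, hK.norm_mul] at h2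
  linarith

theorem inner_mul_left (a x y : K) : inner ℝ (a * x) y = inner ℝ x (star a * y) := by
  have h := hK.inner_mul_mul_add a e x y
  rw [hK.one_mul, hK.one_mul] at h
  rw [hK.star_eq, hK.sub_mul, hK.smul_mul, hK.one_mul, inner_sub_right, real_inner_smul_right]
  linarith

theorem inner_mul_right (a x y : K) : inner ℝ (x * a) y = inner ℝ x (y * star a) := by
  have h := hK.inner_mul_mul_add x y a e
  rw [hK.mul_one, hK.mul_one] at h
  rw [hK.star_eq, hK.mul_sub, hK.mul_smul, hK.mul_one, inner_sub_right, real_inner_smul_right]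
  have h2 := real_inner_comm (y * a) x
  linarith

theorem star_mul (x y : K) : star (x * y) = star y * star x := by
  refine ext_inner_right ℝ fun z => ?_
  rw [hK.inner_star_left, hK.inner_mul_left, hK.inner_mul_left, hK.star_star,
    real_inner_comm, hK.inner_mul_right, hK.star_star]

theorem star_mul_cancel_left (a x : K) : star a * (a * x) = ‖a‖ ^ 2 • x := by
  refine ext_inner_right ℝ fun y => ?_
  rw [hK.inner_mul_left, hK.star_star, hK.inner_mul_left_mul_left, real_inner_smul_left]

theorem mul_star_cancel_left (a x : K) : a * (star a * x) = ‖a‖ ^ 2 • x := by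
  have := hK.star_mul_cancel_left (star a) x
  rwa [hK.star_star, hK.norm_star] at this

theorem mul_star_cancel_right (a x : K) : (x * a) * star a = ‖a‖ ^ 2 • x := by
  refine ext_inner_right ℝ fun y => ?_
  rw [hK.inner_mul_right, hK.star_star, hK.inner_mul_right_mul_right, real_inner_smul_left]

theorem star_mul_cancel_right (a x : K) : (x * star a) * a = ‖a‖ ^ 2 • x := by
  have := hK.mul_star_cancel_right (star a) x
  rwa [hK.star_star, hK.norm_star] at this

theorem mul_star_self (a : K) : a * star a = ‖a‖ ^ 2 • e := by
  have := hK.mul_star_cancel_left a e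
  rwa [hK.mul_one] at this

theorem star_mul_self (a : K) : star a * a = ‖a‖ ^ 2 • e := by
  have := hK.star_mul_cancel_left a e
  rwa [hK.mul_one] at this

theorem mul_add_star (a b : K) : a * b + star b * star a = (2 * inner ℝ a (star b)) • e := by
  have h := hK.star_eq (a * b)
  rw [hK.star_mul, hK.inner_mul_right, hK.one_mul] at h
  rw [h]
  abel

theorem mul_mul_self (a b : K) : (a * b) * a = (2 * inner ℝ a (star b)) • a - ‖a‖ ^ 2 • star b := by
  rw [eq_sub_of_add_eq (hK.mul_add_star a b), hK.sub_mul, hK.smul_mul, hK.one_mul,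
    hK.star_mul_cancel_right]

theorem mul_self_mul (a b : K) : a * (b * a) = (2 * inner ℝ a (star b)) • a - ‖a‖ ^ 2 • star b := by
  have h := hK.mul_add_star b a
  rw [eq_sub_of_add_eq h, hK.mul_sub, hK.mul_smul, hK.mul_one, hK.mul_star_cancel_left,
    ← hK.inner_star_left, real_inner_comm]

/-- A Moufang identity. -/
theorem moufang_left (a b x : K) : a * (b * (a * x)) = ((a * b) * a) * x := by
  refine ext_inner_right ℝ fun y => ?_
  have h := hK.inner_mul_mul_add b (star a) (a * x) y
  rw [hK.star_mul_cancel_left, real_inner_smul_left] at h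
  rw [hK.mul_mul_self, hK.sub_mul, hK.smul_mul, hK.smul_mul, inner_sub_left, real_inner_smul_left,
    real_inner_smul_left, hK.inner_mul_left a, hK.inner_mul_left (star b), hK.star_star,
    ← hK.inner_star_left a b, real_inner_comm b]
  linarith

/-- A Moufang identity. -/
theorem moufang_right (a b x : K) : ((x * a) * b) * a = x * ((a * b) * a) := by
  have h := congrArg star (hK.moufang_left (star a) (star b) (star x))
  simp only [hK.star_mul, hK.star_star] at h
  rw [h, hK.mul_mul_self, hK.mul_self_mul]

/-- A Moufang identity. -/
theorem moufang_middle (a x y : K) : (a * x) * (y * a) = (a * (x * y)) * a := by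
  refine ext_inner_right ℝ fun z => ?_
  have h := hK.inner_mul_mul_add a z x (star a * star y)
  rw [hK.mul_star_cancel_left, real_inner_smul_right] at h
  rw [hK.inner_mul_right, hK.star_mul, hK.mul_mul_self, inner_sub_left, real_inner_smul_left,
    real_inner_smul_left, hK.star_mul, hK.inner_mul_left]
  have h2 : inner ℝ x (star a * star y) = inner ℝ a (star y * star x) := by
    rw [← hK.inner_mul_left, hK.inner_mul_right]
  have h3 : inner ℝ (z * x) (star y) = inner ℝ (star y * star x) z := by
    rw [hK.inner_mul_right, real_inner_comm]
  rw [h2, h3] at h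
  rw [← hK.inner_mul_left]
  linarith

end IsCompositionAlgebra

end Composition

/-! ### The four division algebras -/

namespace Octonion

theorem mk_fst_snd (x : Octonion) : mk x.fst x.snd = x := rfl

theorem norm_sq_eq (x : Octonion) : ‖x‖ ^ 2 = ‖x.fst‖ ^ 2 + ‖x.snd‖ ^ 2 :=
  WithLp.prod_norm_sq_eq_of_L2 (α := ℍ[ℝ]) (β := ℍ[ℝ]) x

theorem inner_eq (x y : Octonion) :
    inner ℝ x y = inner ℝ x.fst y.fst + inner ℝ x.snd y.snd :=
  WithLp.prod_inner_apply (𝕜 := ℝ) (E := ℍ[ℝ]) (F := ℍ[ℝ]) x y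

@[ext]
theorem ext {x y : Octonion} (h1 : x.fst = y.fst) (h2 : x.snd = y.snd) : x = y := by
  rw [← mk_fst_snd x, ← mk_fst_snd y, h1, h2]

@[simp] theorem fst_mk (a b : ℍ[ℝ]) : (mk a b).fst = a := rfl
@[simp] theorem snd_mk (a b : ℍ[ℝ]) : (mk a b).snd = b := rfl
@[simp] theorem fst_add (x y : Octonion) : (x + y).fst = x.fst + y.fst := rfl
@[simp] theorem snd_add (x y : Octonion) : (x + y).snd = x.snd + y.snd := rfl
@[simp] theorem fst_sub (x y : Octonion) : (x - y).fst = x.fst - y.fst := rfl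
@[simp] theorem snd_sub (x y : Octonion) : (x - y).snd = x.snd - y.snd := rfl
@[simp] theorem fst_smul (t : ℝ) (x : Octonion) : (t • x).fst = t • x.fst := rfl
@[simp] theorem snd_smul (t : ℝ) (x : Octonion) : (t • x).snd = t • x.snd := rfl
@[simp] theorem fst_mul (x y : Octonion) :
    (x * y).fst = x.fst * y.fst - star y.snd * x.snd := rfl
@[simp] theorem snd_mul (x y : Octonion) :
    (x * y).snd = y.snd * x.fst + x.snd * star y.fst := rfl
@[simp] theorem fst_star (x : Octonion) : (star x).fst = star x.fst := rfl
@[simp] theorem snd_star (x : Octonion) : (star x).snd = -x.snd := rfl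

theorem quaternion_norm_sq (a : ℍ[ℝ]) :
    ‖a‖ ^ 2 = a.re ^ 2 + a.imI ^ 2 + a.imJ ^ 2 + a.imK ^ 2 := by
  rw [← Quaternion.normSq_def', Quaternion.normSq_eq_norm_mul_self, pow_two]

theorem norm_mul (x y : Octonion) : ‖x * y‖ = ‖x‖ * ‖y‖ := by
  have h : ‖x * y‖ ^ 2 = (‖x‖ * ‖y‖) ^ 2 := by
    rw [mul_pow, norm_sq_eq, norm_sq_eq, norm_sq_eq]
    simp only [quaternion_norm_sq, fst_mul, snd_mul, Quaternion.re_sub, Quaternion.imI_sub,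
      Quaternion.imJ_sub, Quaternion.imK_sub, Quaternion.re_add, Quaternion.imI_add,
      Quaternion.imJ_add, Quaternion.imK_add, Quaternion.re_mul, Quaternion.imI_mul,
      Quaternion.imJ_mul, Quaternion.imK_mul, Quaternion.re_star, Quaternion.imI_star,
      Quaternion.imJ_star, Quaternion.imK_star]
    ring
  exact (sq_eq_sq₀ (norm_nonneg _) (by positivity)).1 h

end Octonion

theorem quaternion_star_eq (x : ℍ[ℝ]) : star x = (2 * inner ℝ x (1 : ℍ[ℝ])) • (1 : ℍ[ℝ]) - x := by
  rw [Quaternion.inner_def]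
  ext <;> simp
  ring

/-- The octonions, by the Cayley-Dickson formulas for pairs of quaternions. -/
theorem isCompositionAlgebra_octonion : IsCompositionAlgebra (Octonion.mk 1 0) where
  add_mul a b x := by ext1 <;> simp [add_mul, mul_add] <;> abel
  mul_add a x y := by ext1 <;> simp [add_mul, mul_add] <;> abel
  smul_mul t a x := by ext1 <;> simp [smul_sub]
  mul_smul t a x := by ext1 <;> simp [smul_sub]
  one_mul x := by ext1 <;> simp
  mul_one x := by ext1 <;> simp
  norm_mul := Octonion.norm_mul
  norm_one := by
    have h := Octonion.norm_sq_eq (Octonion.mk 1 0)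
    simp only [Octonion.fst_mk, Octonion.snd_mk, norm_one, norm_zero] at h
    nlinarith [norm_nonneg (Octonion.mk 1 0)]
  star_eq x := by
    rw [Octonion.inner_eq]
    ext1
    · simp [quaternion_star_eq x.fst]
    · simp

theorem isCompositionAlgebra_real : IsCompositionAlgebra (1 : ℝ) where
  add_mul := add_mul
  mul_add := mul_add
  smul_mul := smul_mul_assoc
  mul_smul t a x := mul_smul_comm t a x
  one_mul := one_mul
  mul_one := mul_one
  norm_mul := norm_mul
  norm_one := norm_one
  star_eq x := by simp; ring

theorem isCompositionAlgebra_complex : IsCompositionAlgebra (1 : ℂ) where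
  add_mul := add_mul
  mul_add := mul_add
  smul_mul := smul_mul_assoc
  mul_smul t a x := mul_smul_comm t a x
  one_mul := one_mul
  mul_one := mul_one
  norm_mul := norm_mul
  norm_one := norm_one
  star_eq x := by
    rw [Complex.inner]
    apply Complex.ext <;> simp
    ring

theorem isCompositionAlgebra_quaternion : IsCompositionAlgebra (1 : ℍ[ℝ]) where
  add_mul := add_mul
  mul_add := mul_add
  smul_mul := smul_mul_assoc
  mul_smul t a x := mul_smul_comm t a x
  one_mul := one_mul
  mul_one := mul_one
  norm_mul := norm_mul
  norm_one := norm_one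
  star_eq := quaternion_star_eq

namespace DivAlg

/-- The unit of the algebra. -/
def unit : (F : DivAlg) → F.Carrier
  | real => (1 : ℝ)
  | complex => (1 : ℂ)
  | quaternion => (1 : ℍ[ℝ])
  | octonion => Octonion.mk 1 0

theorem isCompositionAlgebra : (F : DivAlg) → IsCompositionAlgebra F.unit
  | real => isCompositionAlgebra_real
  | complex => isCompositionAlgebra_complex
  | quaternion => isCompositionAlgebra_quaternion
  | octonion => isCompositionAlgebra_octonion

theorem mul_assoc : (F : DivAlg) → F ≠ octonion → ∀ x y z : F.Carrier, (x * y) * z = x * (y * z)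
  | real, _ => (_root_.mul_assoc : ∀ x y z : ℝ, (x * y) * z = x * (y * z))
  | complex, _ => (_root_.mul_assoc : ∀ x y z : ℂ, (x * y) * z = x * (y * z))
  | quaternion, _ => (_root_.mul_assoc : ∀ x y z : ℍ[ℝ], (x * y) * z = x * (y * z))
  | octonion, h => absurd rfl h

theorem finrank_octonion : Module.finrank ℝ Octonion = 8 := by
  have h : Module.finrank ℝ (WithLp 2 (ℍ[ℝ] × ℍ[ℝ])) = 8 := by
    rw [(WithLp.linearEquiv 2 ℝ (ℍ[ℝ] × ℍ[ℝ])).finrank_eq, Module.finrank_prod,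
      Quaternion.finrank_eq_four]
  exact h

instance finiteDimensional : (F : DivAlg) → FiniteDimensional ℝ F.Carrier
  | real => inferInstanceAs (FiniteDimensional ℝ ℝ)
  | complex => inferInstanceAs (FiniteDimensional ℝ ℂ)
  | quaternion => inferInstanceAs (FiniteDimensional ℝ ℍ[ℝ])
  | octonion => FiniteDimensional.of_finrank_pos (K := ℝ) (V := Octonion)
      (by rw [finrank_octonion]; norm_num)

theorem finrank_carrier : (F : DivAlg) → Module.finrank ℝ F.Carrier = F.dim
  | real => (Module.finrank_self ℝ :)
  | complex => (Complex.finrank_real_complex :)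
  | quaternion => (Quaternion.finrank_eq_four (R := ℝ) :)
  | octonion => finrank_octonion

theorem finrank_fSpace (F : DivAlg) (m : ℕ) : Module.finrank ℝ (FSpace F m) = m * F.dim := by
  rw [(WithLp.linearEquiv 2 ℝ (Fin m → F.Carrier)).finrank_eq, Module.finrank_pi_fintype]
  simp [finrank_carrier]

end DivAlg

/-! ### The Hermitian line form -/

section LineForm

variable {K : Type*} [NormedAddCommGroup K] [InnerProductSpace ℝ K] [FiniteDimensional ℝ K]
  [Mul K] [Star K] {e : K}

namespace IsCompositionAlgebra

variable (hK : IsCompositionAlgebra e)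

/-- Multiplication as a continuous bilinear map. -/
def mulCLM : K →L[ℝ] K →L[ℝ] K :=
  (LinearMap.mk₂ ℝ (fun a b : K => a * b) hK.add_mul hK.smul_mul hK.mul_add
    hK.mul_smul).toContinuousBilinearMap

@[simp]
theorem mulCLM_apply (a b : K) : hK.mulCLM a b = a * b := rfl

/-- Conjugation as a continuous linear map. -/
def starCLM : K →L[ℝ] K :=
  LinearMap.toContinuousLinearMap
    { toFun := star, map_add' := hK.star_add, map_smul' := hK.star_smul }

@[simp]
theorem starCLM_apply (a : K) : hK.starCLM a = star a := rfl

variable {m : ℕ}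

/-- The map `u ↦ (∑ⱼ (zᵢ w̄ⱼ) uⱼ)ᵢ`. -/
def lineMap (z w : PiLp 2 fun _ : Fin m => K) :
    (PiLp 2 fun _ : Fin m => K) →ₗ[ℝ] PiLp 2 fun _ : Fin m => K where
  toFun u := WithLp.toLp 2 fun i => ∑ j, (z i * star (w j)) * u j
  map_add' u v := by
    ext i
    simp [hK.mul_add, Finset.sum_add_distrib]
  map_smul' t u := by
    ext i
    simp [hK.mul_smul, Finset.smul_sum]

/-- The line form `(z, w, u) ↦ (∑ⱼ (zᵢ w̄ⱼ) uⱼ)ᵢ` of `Kᵐ`, which, for `w = z`, is `|z|²`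
times the orthogonal projection to the line spanned by `z` if `K` is associative or `m = 2`. -/
def lineForm : (PiLp 2 fun _ : Fin m => K) →L[ℝ] (PiLp 2 fun _ : Fin m => K) →L[ℝ]
    (PiLp 2 fun _ : Fin m => K) →L[ℝ] (PiLp 2 fun _ : Fin m => K) :=
  (LinearMap.mk₂ ℝ
    (fun z w : PiLp 2 fun _ : Fin m => K => LinearMap.toContinuousLinearMap (hK.lineMap z w))
    (fun z z' w => by
      ext u i
      simp [lineMap, hK.add_mul, Finset.sum_add_distrib])
    (fun t z w => by
      ext u i
      simp [lineMap, hK.smul_mul, Finset.smul_sum])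
    (fun z w w' => by
      ext u i
      simp [lineMap, hK.star_add, hK.mul_add, hK.add_mul, Finset.sum_add_distrib])
    (fun t z w => by
      ext u i
      simp [lineMap, hK.star_smul, hK.mul_smul, hK.smul_mul,
        Finset.smul_sum])).toContinuousBilinearMap

@[simp]
theorem lineForm_apply (z w u : PiLp 2 fun _ : Fin m => K) (i : Fin m) :
    hK.lineForm z w u i = ∑ j, (z i * star (w j)) * u j := rfl

theorem inner_lineForm (z u v : PiLp 2 fun _ : Fin m => K) :
    inner ℝ (hK.lineForm z z u) v = ∑ i, ∑ j, inner ℝ ((z i * star (z j)) * u j) (v i) := by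
  simp only [PiLp.inner_apply, lineForm_apply, sum_inner]

theorem inner_lineForm' (z u v : PiLp 2 fun _ : Fin m => K) :
    inner ℝ (hK.lineForm z z u) v = ∑ i, ∑ j, inner ℝ (z i * star (z j)) (v i * star (u j)) := by
  simp only [inner_lineForm, hK.inner_mul_right]

theorem lineForm_symm (z u v : PiLp 2 fun _ : Fin m => K) :
    inner ℝ (hK.lineForm z z u) v = inner ℝ u (hK.lineForm z z v) := by
  rw [real_inner_comm (hK.lineForm z z v), inner_lineForm, inner_lineForm, Finset.sum_comm]
  refine Finset.sum_congr rfl fun i _ => Finset.sum_congr rfl fun j _ => ?_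
  rw [hK.inner_mul_left, hK.star_mul, hK.star_star, real_inner_comm]

omit [FiniteDimensional ℝ K] in
include hK in
/-- The coordinates of the vectors of `Kᵐ` associate as far as the line form is concerned: either
`K` is associative or `m ≤ 2`. -/
theorem mul_star_mul_mul (h : (∀ a b c : K, a * b * c = a * (b * c)) ∨ m = 2) (z : Fin m → K)
    (l i j : Fin m) (κ : K) :
    (z l * star (z i)) * ((z i * star (z j)) * κ) = ‖z i‖ ^ 2 • ((z l * star (z j)) * κ) := by
  rcases h with h | rfl
  · rw [h (z l), h (z i), hK.star_mul_cancel_left, hK.mul_smul, h]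
  · have h3 : l = i ∨ i = j ∨ l = j := by omega
    rcases h3 with rfl | rfl | rfl
    · rw [hK.mul_star_self, hK.smul_mul, hK.one_mul]
    · rw [hK.mul_star_self, hK.smul_mul, hK.one_mul, hK.mul_smul]
    · have h4 : z i * star (z l) = star (z l * star (z i)) := by
        rw [hK.star_mul, hK.star_star]
      rw [h4, hK.mul_star_cancel_left, hK.norm_mul, hK.norm_star, hK.mul_star_self, hK.smul_mul,
        hK.one_mul, smul_smul]
      congr 1
      ring

/-- The form of `Kᵐ` is a line form. The range of `B z z` is the line `{((zₗ z̄ᵢ) κ)ₗ}` for any index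
`i` with `zᵢ ≠ 0`. -/
theorem isLineForm (h : (∀ a b c : K, a * b * c = a * (b * c)) ∨ m = 2) :
    IsLineForm (Module.finrank ℝ K) (hK.lineForm (m := m)) where
  symm := hK.lineForm_symm
  self z := by
    ext i
    rw [lineForm_apply, PiLp.smul_apply, PiLp.norm_sq_eq_of_L2, Finset.sum_smul]
    exact Finset.sum_congr rfl fun j _ => hK.star_mul_cancel_right _ _
  idem z u := by
    ext i
    have h1 : ∀ l, (z i * star (z l)) * hK.lineForm z z u l = ‖z l‖ ^ 2 • hK.lineForm z z u i := by
      intro l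
      rw [lineForm_apply, lineForm_apply, Finset.smul_sum, ← hK.mulCLM_apply, map_sum]
      exact Finset.sum_congr rfl fun j _ => hK.mul_star_mul_mul h z i l j (u j)
    rw [lineForm_apply, PiLp.smul_apply, PiLp.norm_sq_eq_of_L2, Finset.sum_smul]
    exact Finset.sum_congr rfl fun l _ => h1 l
  rank z hz := by
    obtain ⟨i, hi⟩ : ∃ i, z i ≠ 0 := by
      by_contra! h0
      exact hz (PiLp.ext h0)
    let ψ : K →ₗ[ℝ] PiLp 2 fun _ : Fin m => K :=
      { toFun := fun κ => WithLp.toLp 2 fun l => (z l * star (z i)) * κ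
        map_add' := fun a b => by ext l; simp [hK.mul_add]
        map_smul' := fun t a => by ext l; simp [hK.mul_smul] }
    have hψ : Function.Injective ψ := by
      rw [injective_iff_map_eq_zero]
      intro κ hκ
      have h1 : (z i * star (z i)) * κ = 0 := congrArg (fun v : PiLp 2 fun _ : Fin m => K => v i) hκ
      rw [hK.mul_star_self, hK.smul_mul, hK.one_mul] at h1
      exact (smul_eq_zero.1 h1).resolve_left (by positivity)
    have hi2 : ‖z i‖ ^ 2 ≠ 0 := by positivity
    have hr : (hK.lineForm z z).range = LinearMap.range ψ := by
      apply le_antisymm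
      · rintro _ ⟨u, rfl⟩
        refine ⟨(‖z i‖ ^ 2)⁻¹ • hK.lineForm z z u i, ?_⟩
        ext l
        change (z l * star (z i)) * ((‖z i‖ ^ 2)⁻¹ • ∑ j, (z i * star (z j)) * u j) =
          ∑ j, (z l * star (z j)) * u j
        rw [hK.mul_smul, inv_smul_eq_iff₀ hi2, Finset.smul_sum, ← hK.mulCLM_apply, map_sum]
        exact Finset.sum_congr rfl fun j _ => hK.mul_star_mul_mul h z l i j (u j)
      · rintro _ ⟨κ, rfl⟩
        refine ⟨WithLp.toLp 2 (Pi.single i κ), ?_⟩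
        ext l
        change ∑ j, (z l * star (z j)) * (Pi.single i κ : Fin m → K) j = (z l * star (z i)) * κ
        rw [Finset.sum_eq_single i]
        · simp
        · intro j _ hj
          simp [hj, hK.mul_zero]
        · simp
    rw [hr, LinearMap.finrank_range_of_inj hψ]

end IsCompositionAlgebra

end LineForm

/-! ### The metrics of the hyperbolic spaces -/

namespace DivAlg

variable (F : DivAlg) (m : ℕ)

/-- The line form of `𝔽ᵐ`. -/
def lineForm : FSpace F m →L[ℝ] FSpace F m →L[ℝ] FSpace F m →L[ℝ] FSpace F m :=
  F.isCompositionAlgebra.lineForm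

theorem assoc_or (hO : F = octonion → m = 2) :
    (∀ a b c : F.Carrier, a * b * c = a * (b * c)) ∨ m = 2 := by
  by_cases h : F = octonion
  · exact Or.inr (hO h)
  · exact Or.inl (F.mul_assoc h)

variable {F m}

theorem isLineForm (hO : F = octonion → m = 2) : IsLineForm F.dim (F.lineForm m) := by
  have := F.isCompositionAlgebra.isLineForm (F.assoc_or m hO)
  rwa [F.finrank_carrier] at this

theorem hypMetric_eq (c : ℝ) : hypMetric F m c = ballMetric c (F.lineForm m) := by
  funext z u v
  rw [ballMetric, lineForm, F.isCompositionAlgebra.inner_lineForm]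
  rfl

theorem prodMetric_eq (c : ℝ) : prodMetric F m c = cylMetric c (F.lineForm m) := by
  funext p X Y
  rw [prodMetric, hypMetric_eq]
  rfl

end DivAlg

/-! ### Pairs of inverse isometries -/

section IsometryPair

variable {P : Type*} [NormedAddCommGroup P] [NormedSpace ℝ P]

/-- `Φ` and `Ψ` restrict to isometries of `(U, g)` which are inverse to each other. -/
structure IsIsometryPair (U : Set P) (g : MetricTensor P) (Φ Ψ : P → P) : Prop where
  isometry : IsIsometryOf U g Φ
  isometry_inv : IsIsometryOf U g Ψ
  left_inv : ∀ p ∈ U, Ψ (Φ p) = p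
  right_inv : ∀ p ∈ U, Φ (Ψ p) = p

namespace IsIsometryPair

variable {U : Set P} {g : MetricTensor P} {Φ Ψ Φ₂ Ψ₂ : P → P}

theorem symm (h : IsIsometryPair U g Φ Ψ) : IsIsometryPair U g Ψ Φ :=
  ⟨h.isometry_inv, h.isometry, h.right_inv, h.left_inv⟩

theorem fderiv_comp_fderiv (hU : IsOpen U) (hΦ : ContDiffOn ℝ ∞ Φ U) (hΨ : ContDiffOn ℝ ∞ Ψ U)
    (mΨ : MapsTo Ψ U U) (hinv : ∀ p ∈ U, Φ (Ψ p) = p) {p : P} (hp : p ∈ U) (X : P) :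
    fderiv ℝ Φ (Ψ p) (fderiv ℝ Ψ p X) = X := by
  have h1 := ((hΦ.contDiffAt (hU.mem_nhds (mΨ hp))).differentiableAt (by simp)).hasFDerivAt
  have h2 := ((hΨ.contDiffAt (hU.mem_nhds hp)).differentiableAt (by simp)).hasFDerivAt
  have h3 := (h1.comp p h2).fderiv
  have h4 : Φ ∘ Ψ =ᶠ[𝓝 p] id := by
    filter_upwards [hU.mem_nhds hp] with q hq using hinv q hq
  rw [h4.fderiv_eq, fderiv_id] at h3
  exact (congrArg (fun L => L X) h3).symm

theorem of_pullback (hU : IsOpen U) (hΦ : ContDiffOn ℝ ∞ Φ U) (hΨ : ContDiffOn ℝ ∞ Ψ U)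
    (mΦ : MapsTo Φ U U) (mΨ : MapsTo Ψ U U) (h1 : ∀ p ∈ U, Ψ (Φ p) = p)
    (h2 : ∀ p ∈ U, Φ (Ψ p) = p)
    (hg : ∀ p ∈ U, ∀ X Y, g (Φ p) (fderiv ℝ Φ p X) (fderiv ℝ Φ p Y) = g p X Y) :
    IsIsometryPair U g Φ Ψ where
  isometry := ⟨(show InvOn Ψ Φ U U from ⟨h1, h2⟩).bijOn mΦ mΨ, hΦ, hg⟩
  isometry_inv := by
    refine ⟨(show InvOn Φ Ψ U U from ⟨h2, h1⟩).bijOn mΨ mΦ, hΨ, fun p hp X Y => ?_⟩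
    rw [← hg _ (mΨ hp), h2 p hp, fderiv_comp_fderiv hU hΦ hΨ mΨ h2 hp,
      fderiv_comp_fderiv hU hΦ hΨ mΨ h2 hp]
  left_inv := h1
  right_inv := h2

theorem comp (hU : IsOpen U) (h : IsIsometryPair U g Φ Ψ) (h₂ : IsIsometryPair U g Φ₂ Ψ₂) :
    IsIsometryPair U g (Φ₂ ∘ Φ) (Ψ ∘ Ψ₂) := by
  have m1 := h.isometry.bijOn.mapsTo
  have m2 := h₂.isometry_inv.bijOn.mapsTo
  refine of_pullback hU (h₂.isometry.smooth.comp h.isometry.smooth m1)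
    (h.isometry_inv.smooth.comp h₂.isometry_inv.smooth m2)
    (h₂.isometry.bijOn.mapsTo.comp m1) (h.isometry_inv.bijOn.mapsTo.comp m2)
    (fun p hp => ?_) (fun p hp => ?_) (fun p hp X Y => ?_)
  · simp only [Function.comp_apply, h₂.left_inv _ (m1 hp), h.left_inv p hp]
  · simp only [Function.comp_apply, h.right_inv _ (m2 hp), h₂.right_inv p hp]
  · have d1 := (h.isometry.smooth.contDiffAt (hU.mem_nhds hp)).differentiableAt (by simp)
    have d2 := (h₂.isometry.smooth.contDiffAt (hU.mem_nhds (m1 hp))).differentiableAt (by simp)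
    rw [fderiv_comp p d2 d1]
    exact (h₂.isometry.pullback _ (m1 hp) _ _).trans (h.isometry.pullback p hp X Y)

end IsIsometryPair

end IsometryPair

/-! ### Linear isometries of the ball -/

section BallIsometries

variable {E : Type*} [NormedAddCommGroup E] [InnerProductSpace ℝ E] {d : ℕ}
  {B : E →L[ℝ] E →L[ℝ] E →L[ℝ] E} {c : ℝ}

/-- An isometry condition need only be checked on the diagonal. -/
theorem ballMetric_polarize (hB : IsLineForm d B) {z z' : E} {L : E →L[ℝ] E}
    (h : ∀ u, ballMetric c B z' (L u) (L u) = ballMetric c B z u u) (u v : E) :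
    ballMetric c B z' (L u) (L v) = ballMetric c B z u v := by
  have h1 := h (u + v)
  have h2 := h u
  have h3 := h v
  have e1 := ballMetric_symm hB (c := c) z' (L u) (L v)
  have e2 := ballMetric_symm hB (c := c) z u v
  simp only [ballMetric, map_add, inner_add_left, inner_add_right] at h1 h2 h3 e1 e2 ⊢
  have a1 := real_inner_comm (L u) (L v)
  have a2 := real_inner_comm u v
  simp only [a1, a2] at h1 e1 e2
  linear_combination (h1 - h2 - h3 + e1 - e2) / 2

/-- A linear isometry which preserves the line form is an isometry of the ball. -/
theorem isIsometryPair_linear (hB : IsLineForm d B) (L : E ≃ₗᵢ[ℝ] E)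
    (hL : ∀ z u, inner ℝ (B (L z) (L z) (L u)) (L u) = inner ℝ (B z z u) u) :
    IsIsometryPair (Metric.ball 0 1) (ballMetric c B) L L.symm := by
  refine IsIsometryPair.of_pullback Metric.isOpen_ball
    L.toContinuousLinearEquiv.contDiff.contDiffOn
    L.symm.toContinuousLinearEquiv.contDiff.contDiffOn (fun z hz => ?_) (fun z hz => ?_)
    (fun z _ => L.symm_apply_apply z) (fun z _ => L.apply_symm_apply z) (fun z _ => ?_)
  · simpa using hz
  · simpa using hz
  · have h1 : fderiv ℝ L z = (L.toContinuousLinearEquiv : E →L[ℝ] E) :=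
      L.toContinuousLinearEquiv.fderiv
    rw [h1]
    refine ballMetric_polarize hB fun u => ?_
    change ballMetric c B (L z) (L u) (L u) = _
    simp only [ballMetric, hL, LinearIsometryEquiv.norm_map, LinearIsometryEquiv.inner_map_map]

end BallIsometries

/-! ### Boosts -/

section Boost

variable {K : Type*} [NormedAddCommGroup K] [InnerProductSpace ℝ K] [FiniteDimensional ℝ K]
  [Mul K] [Star K] {e : K}

/-- The inverse of an element of a composition algebra. -/
def compInv (D : K) : K := (‖D‖ ^ 2)⁻¹ • star D

namespace IsCompositionAlgebra

variable (hK : IsCompositionAlgebra e)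

include hK

omit [FiniteDimensional ℝ K] in
theorem norm_compInv (D : K) : ‖compInv D‖ = ‖D‖⁻¹ := by
  rw [compInv, norm_smul, hK.norm_star, norm_inv, norm_pow, norm_norm]
  by_cases h : ‖D‖ = 0
  · simp [h]
  · field_simp

omit [FiniteDimensional ℝ K] in
theorem mul_compInv {D : K} (hD : D ≠ 0) : D * compInv D = e := by
  rw [compInv, hK.mul_smul, hK.mul_star_self, smul_smul, inv_mul_cancel₀ (by positivity), one_smul]

omit [FiniteDimensional ℝ K] in
theorem compInv_mul_cancel {D : K} (hD : D ≠ 0) (y : K) : (y * compInv D) * D = y := by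
  rw [compInv, hK.mul_smul, hK.smul_mul, hK.star_mul_cancel_right, smul_smul,
    inv_mul_cancel₀ (by positivity), one_smul]

omit [FiniteDimensional ℝ K] in
theorem star_compInv (D : K) : star (compInv D) = (‖D‖ ^ 2)⁻¹ • D := by
  rw [compInv, hK.star_smul, hK.star_star]

theorem contDiffAt_compInv {D : K} (hD : D ≠ 0) : ContDiffAt ℝ ∞ (compInv : K → K) D := by
  have h1 : ContDiffAt ℝ ∞ (fun D : K => (‖D‖ ^ 2)⁻¹) D :=
    (contDiff_norm_sq ℝ).contDiffAt.inv (by positivity)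
  exact h1.smul hK.starCLM.contDiff.contDiffAt

/-- The differential of the inverse is `v ↦ -D⁻¹ v D⁻¹`, for any composition algebra; the middle
factors associate. -/
theorem fderiv_compInv {D : K} (hD : D ≠ 0) (v : K) :
    fderiv ℝ (compInv : K → K) D v = -((compInv D * v) * compInv D) := by
  have h0 : ‖D‖ ^ 2 ≠ 0 := by positivity
  have h1 := (hasStrictFDerivAt_norm_sq D).hasFDerivAt
  have h2 := (hasDerivAt_inv h0).comp_hasFDerivAt D h1
  have h3 := (h2.smul (hK.starCLM.hasFDerivAt (x := D))).fderiv
  have h4 : fderiv ℝ (compInv : K → K) D = _ := h3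
  rw [h4, hK.mul_mul_self, hK.norm_compInv]
  simp only [compInv, real_inner_smul_left, hK.inner_star_left, hK.star_star]
  simp
  have h5 : ((‖D‖ ^ 2) ^ 2)⁻¹ * (2 * inner ℝ D v) =
      2 * ((‖D‖ ^ 2)⁻¹ * inner ℝ D v) * (‖D‖ ^ 2)⁻¹ := by
    field_simp
  rw [h5, sub_eq_add_neg, smul_smul _ (‖D‖ ^ 2)⁻¹]

end IsCompositionAlgebra

/-- The denominator `1 + r z₀` of the boost. -/
def boostDen {k : ℕ} (e : K) (r : ℝ) (z : PiLp 2 fun _ : Fin (k + 1) => K) : K := e + r • z 0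

/-- The boost `(x, y) ↦ ((x + r) (1 + r x)⁻¹, √(1 - r²) y (1 + r x)⁻¹)`. The first coordinate is
written in a form which is affine in `(1 + r x)⁻¹`. -/
def boost {k : ℕ} (e : K) (r : ℝ) (z : PiLp 2 fun _ : Fin (k + 1) => K) :
    PiLp 2 fun _ : Fin (k + 1) => K :=
  WithLp.toLp 2 (Fin.cons (α := fun _ => K)
    (r⁻¹ • (e - (1 - r ^ 2) • compInv (boostDen e r z)))
    fun j => √(1 - r ^ 2) • (z j.succ * compInv (boostDen e r z)))

variable {k : ℕ} {r : ℝ} {z : PiLp 2 fun _ : Fin (k + 1) => K}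

omit [FiniteDimensional ℝ K] in
theorem boost_zero' : boost e r z 0 = r⁻¹ • (e - (1 - r ^ 2) • compInv (boostDen e r z)) := rfl

omit [FiniteDimensional ℝ K] in
theorem boost_succ (j : Fin k) :
    boost e r z j.succ = √(1 - r ^ 2) • (z j.succ * compInv (boostDen e r z)) := rfl

omit [InnerProductSpace ℝ K] [FiniteDimensional ℝ K] [Mul K] [Star K] in
theorem norm_sq_succ (z : PiLp 2 fun _ : Fin (k + 1) => K) :
    ‖z‖ ^ 2 = ‖z 0‖ ^ 2 + ∑ j : Fin k, ‖z j.succ‖ ^ 2 := by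
  rw [PiLp.norm_sq_eq_of_L2, Fin.sum_univ_succ]

namespace IsCompositionAlgebra

variable (hK : IsCompositionAlgebra e)

include hK

omit [FiniteDimensional ℝ K] in
theorem boostDen_ne_zero (hr : |r| < 1) (hz : ‖z‖ < 1) : boostDen e r z ≠ 0 := by
  intro h
  have h1 : e = -(r • z 0) := eq_neg_of_add_eq_zero_left h
  have h2 : ‖e‖ = |r| * ‖z 0‖ := by rw [h1, norm_neg, norm_smul, Real.norm_eq_abs]
  rw [hK.norm_one] at h2
  have h3 : ‖z 0‖ ≤ ‖z‖ := PiLp.norm_apply_le z 0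
  nlinarith [norm_nonneg (z 0), abs_nonneg r]

omit [FiniteDimensional ℝ K] in
theorem norm_boostDen_sq :
    ‖boostDen e r z‖ ^ 2 = 1 + 2 * r * inner ℝ (z 0) e + r ^ 2 * ‖z 0‖ ^ 2 := by
  rw [boostDen, norm_add_sq_real, hK.norm_one, real_inner_smul_right, norm_smul, mul_pow,
    Real.norm_eq_abs, sq_abs, real_inner_comm]
  ring

omit [FiniteDimensional ℝ K] in
theorem boost_zero_eq (hr0 : r ≠ 0) (hD : boostDen e r z ≠ 0) :
    boost e r z 0 = (z 0 + r • e) * compInv (boostDen e r z) := by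
  have h1 := hK.mul_compInv hD
  rw [boost_zero', inv_smul_eq_iff₀ hr0]
  nth_rw 1 [← h1]
  conv_rhs => rw [← hK.smul_mul, smul_add, smul_smul]
  conv_lhs => rw [← hK.one_mul (compInv (boostDen e r z)), ← hK.smul_mul, hK.one_mul,
    ← hK.sub_mul]
  congr 1
  rw [boostDen]
  module

omit [FiniteDimensional ℝ K] in
/-- The conformal factor of a boost. -/
theorem one_sub_norm_boost_sq (hr0 : r ≠ 0) (hr : |r| < 1) (hD : boostDen e r z ≠ 0) :
    1 - ‖boost e r z‖ ^ 2 = (1 - r ^ 2) * (1 - ‖z‖ ^ 2) * (‖boostDen e r z‖ ^ 2)⁻¹ := by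
  have hs : 0 ≤ 1 - r ^ 2 := by nlinarith [abs_lt.1 hr]
  have hD2 : ‖boostDen e r z‖ ^ 2 ≠ 0 := by positivity
  have h1 : ‖z 0 + r • e‖ ^ 2 = ‖z 0‖ ^ 2 + 2 * r * inner ℝ (z 0) e + r ^ 2 := by
    rw [norm_add_sq_real, real_inner_smul_right, norm_smul, mul_pow,
      Real.norm_eq_abs, sq_abs, hK.norm_one]
    ring
  rw [norm_sq_succ, hK.boost_zero_eq hr0 hD, norm_sq_succ z]
  simp only [boost_succ, norm_smul, hK.norm_mul, hK.norm_compInv, mul_pow, Real.norm_eq_abs, sq_abs,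
    Real.sq_sqrt hs, inv_pow]
  rw [← Finset.mul_sum, ← Finset.sum_mul, h1]
  field_simp
  rw [hK.norm_boostDen_sq]
  ring

omit [FiniteDimensional ℝ K] in
theorem mapsTo_boost (hr0 : r ≠ 0) (hr : |r| < 1) :
    MapsTo (boost (k := k) e r) (Metric.ball 0 1) (Metric.ball 0 1) := by
  intro z hz
  rw [mem_ball_zero_iff] at hz ⊢
  have hD := hK.boostDen_ne_zero hr hz
  have h1 := hK.one_sub_norm_boost_sq hr0 hr hD
  have h2 : 0 < (1 - r ^ 2) * (1 - ‖z‖ ^ 2) * (‖boostDen e r z‖ ^ 2)⁻¹ := by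
    have : 0 < 1 - r ^ 2 := by nlinarith [abs_lt.1 hr]
    have : 0 < 1 - ‖z‖ ^ 2 := by nlinarith [norm_nonneg z]
    positivity
  nlinarith [norm_nonneg (boost e r z)]

omit [FiniteDimensional ℝ K] in
theorem boost_neg_boost (hr0 : r ≠ 0) (hr : |r| < 1) (hz : ‖z‖ < 1) :
    boost e (-r) (boost e r z) = z := by
  have hD := hK.boostDen_ne_zero hr hz
  have hs : 0 < 1 - r ^ 2 := by nlinarith [abs_lt.1 hr]
  set P := compInv (boostDen e r z) with hP
  have hden : boostDen e (-r) (boost e r z) = (1 - r ^ 2) • P := by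
    rw [boostDen, boost_zero', smul_smul, _root_.neg_mul, mul_inv_cancel₀ hr0]
    module
  have hinv : compInv (boostDen e (-r) (boost e r z)) = (1 - r ^ 2)⁻¹ • boostDen e r z := by
    have hD2 : ‖boostDen e r z‖ ≠ 0 := by positivity
    rw [hden, compInv, hK.star_smul, hP, hK.star_compInv, norm_smul, hK.norm_compInv, smul_smul,
      smul_smul, Real.norm_of_nonneg hs.le]
    congr 1
    field_simp
  ext i
  refine Fin.cases ?_ (fun j => ?_) i
  · rw [boost_zero', hinv, neg_sq, smul_smul, mul_inv_cancel₀ hs.ne', one_smul, boostDen,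
      inv_neg, sub_add_cancel_left, smul_neg, neg_smul, neg_neg, smul_smul, inv_mul_cancel₀ hr0,
      one_smul]
  · rw [boost_succ, hinv, boost_succ, neg_sq, hK.mul_smul, hK.smul_mul,
      hK.compInv_mul_cancel hD, smul_smul, smul_smul]
    have : √(1 - r ^ 2) * (1 - r ^ 2)⁻¹ * √(1 - r ^ 2) = 1 := by
      rw [mul_assoc, mul_left_comm, Real.mul_self_sqrt hs.le, inv_mul_cancel₀ hs.ne']
    rw [this, one_smul]

omit [FiniteDimensional ℝ K] in
theorem boost_origin (hr0 : r ≠ 0) :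
    boost (k := k) e r 0 = WithLp.toLp 2 (Pi.single 0 (r • e)) := by
  have hD : boostDen (k := k) e r 0 = e := by simp [boostDen]
  have hP : compInv (boostDen (k := k) e r 0) = e := by
    rw [hD, compInv, hK.norm_one, hK.star_one]
    simp
  ext i
  refine Fin.cases ?_ (fun j => ?_) i
  · rw [boost_zero', hP]
    simp only [Pi.single_eq_same]
    rw [inv_smul_eq_iff₀ hr0]
    module
  · rw [boost_succ, hP]
    simp [hK.zero_mul]

theorem contDiffOn_boost (hr : |r| < 1) :
    ContDiffOn ℝ ∞ (boost (k := k) e r) (Metric.ball 0 1) := by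
  intro z hz
  rw [mem_ball_zero_iff] at hz
  have hD := hK.boostDen_ne_zero hr hz
  have hp : ∀ i, ContDiffAt ℝ ∞ (fun z : PiLp 2 fun _ : Fin (k + 1) => K => z i) z := fun i =>
    (PiLp.proj (𝕜 := ℝ) 2 (fun _ : Fin (k + 1) => K) i).contDiff.contDiffAt
  have h1 : ContDiffAt ℝ ∞ (fun z : PiLp 2 fun _ : Fin (k + 1) => K =>
      compInv (boostDen e r z)) z :=
    ContDiffAt.comp (g := compInv) z (hK.contDiffAt_compInv hD)
      (contDiffAt_const.add ((hp 0).const_smul r))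
  refine ContDiffAt.contDiffWithinAt ((contDiffAt_piLp 2).2 fun i => ?_)
  refine Fin.cases ?_ (fun j => ?_) i
  · exact (contDiffAt_const.sub (h1.const_smul _)).const_smul _
  · exact ContDiffAt.const_smul _ ((hK.mulCLM.contDiff.contDiffAt.comp z (hp j.succ)).clm_apply h1)

/-- The differential of a boost, in terms of `P = (1 + r z₀)⁻¹`. -/
theorem fderiv_boost (hr0 : r ≠ 0) (hr : |r| < 1) (hz : ‖z‖ < 1)
    (u : PiLp 2 fun _ : Fin (k + 1) => K) :
    fderiv ℝ (boost e r) z u 0 = (1 - r ^ 2) •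
      ((compInv (boostDen e r z) * u 0) * compInv (boostDen e r z)) ∧
    ∀ j : Fin k, fderiv ℝ (boost e r) z u j.succ = √(1 - r ^ 2) •
      (u j.succ * compInv (boostDen e r z) - r • (z j.succ *
        ((compInv (boostDen e r z) * u 0) * compInv (boostDen e r z)))) := by
  have hD := hK.boostDen_ne_zero hr hz
  have hb := (((hK.contDiffOn_boost (k := k) hr).contDiffAt (Metric.isOpen_ball.mem_nhds
    (mem_ball_zero_iff.2 hz))).differentiableAt (by simp)).hasFDerivAt
  have hp : ∀ i, HasFDerivAt (fun z : PiLp 2 fun _ : Fin (k + 1) => K => z i)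
      (PiLp.proj (𝕜 := ℝ) 2 (fun _ : Fin (k + 1) => K) i) z := fun i =>
    (PiLp.proj (𝕜 := ℝ) 2 (fun _ : Fin (k + 1) => K) i).hasFDerivAt
  have hc : ∀ i, HasFDerivAt (fun z => boost (k := k) e r z i) _ z := fun i =>
    ((PiLp.proj (𝕜 := ℝ) 2 (fun _ : Fin (k + 1) => K) i).hasFDerivAt).comp z hb
  have h1 : HasFDerivAt (fun z : PiLp 2 fun _ : Fin (k + 1) => K => compInv (boostDen e r z)) _ z :=
    HasFDerivAt.comp (g := compInv) z
      ((hK.contDiffAt_compInv hD).differentiableAt (by simp)).hasFDerivAt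
      (((hp 0).const_smul r).const_add e)
  constructor
  · have h2 := congrArg (fun L => L u) ((hc 0).unique
      (((h1.const_smul (1 - r ^ 2)).const_sub e).const_smul r⁻¹))
    refine h2.trans ?_
    simp only [smul_apply, neg_apply, ContinuousLinearMap.comp_apply, PiLp.proj_apply, hK.fderiv_compInv hD, hK.mul_smul, hK.smul_mul]
    rw [smul_neg, smul_neg, smul_neg, neg_neg, smul_smul, smul_smul]
    congr 1
    field_simp
  · intro j
    have h2 := congrArg (fun L => L u) ((hc j.succ).unique
      (HasFDerivAt.const_smul ((hK.mulCLM.hasFDerivAt.comp z (hp j.succ)).clm_apply h1)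
        √(1 - r ^ 2)))
    refine h2.trans ?_
    simp only [smul_apply, add_apply, ContinuousLinearMap.comp_apply, PiLp.proj_apply,
      ContinuousLinearMap.flip_apply, Function.comp_apply,
      hK.fderiv_compInv hD, hK.mul_smul, hK.smul_mul, hK.mulCLM_apply, hK.mul_neg]
    congr 1
    module

end IsCompositionAlgebra

end Boost

/-! ### Boosts are isometries -/

section BoostIsometry

variable {K : Type*} [NormedAddCommGroup K] [InnerProductSpace ℝ K] [FiniteDimensional ℝ K]
  [Mul K] [Star K] {e : K}

/-- The part of the Hermitian metric which couples the coordinates `x`, `y` of the point, with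
velocities `a`, `u`. -/
def crossForm (x y a u : K) : ℝ :=
  -(‖a‖ ^ 2 * ‖y‖ ^ 2) + (1 - ‖x‖ ^ 2) * ‖u‖ ^ 2 + 2 * inner ℝ (x * star y) (a * star u)

/-- The part of the Hermitian metric which couples two coordinates `y`, `y'` both orthogonal to the
direction of the boost. -/
def transverseForm (y y' u u' : K) : ℝ :=
  inner ℝ (y * star y') (u * star u') - (‖u‖ ^ 2 * ‖y'‖ ^ 2 + ‖u'‖ ^ 2 * ‖y‖ ^ 2) / 2

namespace IsCompositionAlgebra

variable (hK : IsCompositionAlgebra e)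

include hK

omit [FiniteDimensional ℝ K] in
theorem mul_mul_left (x y : K) : x * (x * y) = (2 * inner ℝ x e) • (x * y) - ‖x‖ ^ 2 • y := by
  have h := hK.star_mul_cancel_left x y
  rw [hK.star_eq, hK.sub_mul, hK.smul_mul, hK.one_mul] at h
  rw [← h]
  abel

omit [FiniteDimensional ℝ K] in
theorem norm_sq_compInv (D : K) : ‖compInv D‖ ^ 2 = (‖D‖ ^ 2)⁻¹ := by
  rw [hK.norm_compInv, inv_pow]

variable {r : ℝ} {x : K}

omit [FiniteDimensional ℝ K] in
theorem norm_one_add_smul_sq (r : ℝ) (x : K) :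
    ‖e + r • x‖ ^ 2 = 1 + 2 * r * inner ℝ x e + r ^ 2 * ‖x‖ ^ 2 := by
  rw [norm_add_sq_real, hK.norm_one, real_inner_smul_right, norm_smul, mul_pow,
    Real.norm_eq_abs, sq_abs, real_inner_comm]
  ring

omit [FiniteDimensional ℝ K] in
/-- The boost scales the cross terms of the metric. Only two elements and the Moufang identities
enter, so that associativity is not needed. -/
theorem crossForm_boost (hr0 : r ≠ 0) (hr : r ^ 2 ≤ 1) (hD : e + r • x ≠ 0) (y a u : K) :
    crossForm (r⁻¹ • (e - (1 - r ^ 2) • compInv (e + r • x)))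
      (√(1 - r ^ 2) • (y * compInv (e + r • x)))
      ((1 - r ^ 2) • ((compInv (e + r • x) * a) * compInv (e + r • x)))
      (√(1 - r ^ 2) • (u * compInv (e + r • x) -
        r • (y * ((compInv (e + r • x) * a) * compInv (e + r • x))))) =
    ((1 - r ^ 2) * (‖e + r • x‖ ^ 2)⁻¹) ^ 2 * crossForm x y a u := by
  have hs : 0 ≤ 1 - r ^ 2 := by linarith
  set D := e + r • x with hDdef
  set P := compInv D with hP
  set π := (‖D‖ ^ 2)⁻¹ with hπ
  set q := (P * a) * P with hq
  set α : ℝ := inner ℝ (star y) (a * star u) with hα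
  set β : ℝ := inner ℝ (x * star y) (a * star u) with hβ
  have hPn : ‖P‖ ^ 2 = π := hK.norm_sq_compInv D
  have hPs : star P = π • D := hK.star_compInv D
  have hπD : π * (1 + 2 * r * inner ℝ x e + r ^ 2 * ‖x‖ ^ 2) = 1 := by
    rw [← hK.norm_one_add_smul_sq, hπ, inv_mul_cancel₀]
    positivity
  have hqn : ‖q‖ ^ 2 = π ^ 2 * ‖a‖ ^ 2 := by
    rw [hq, hK.norm_mul, hK.norm_mul, ← hPn]
    ring
  have hY : star P * star y = π • (star y + r • (x * star y)) := by
    rw [hPs, hDdef, hK.smul_mul, hK.add_mul, hK.one_mul, hK.smul_mul]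
  -- each term is expressed by `|x|`, `|y|`, `|a|`, `|u|`, the real part of `x`, `α` and `β`
  have hx' : ‖r⁻¹ • (e - (1 - r ^ 2) • P)‖ ^ 2 = 1 - (1 - r ^ 2) * (1 - ‖x‖ ^ 2) * π := by
    have h1 : inner ℝ e P = π * (1 + r * inner ℝ x e) := by
      rw [← hK.star_star P, hPs, ← hK.inner_star_left, hK.star_one, hDdef, real_inner_smul_right,
        inner_add_right, real_inner_smul_right, hK.inner_self_one, real_inner_comm]
    rw [norm_smul, mul_pow, norm_sub_sq_real, hK.norm_one, real_inner_smul_right, norm_smul, mul_pow,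
      hPn, h1, norm_inv, Real.norm_eq_abs, Real.norm_eq_abs, sq_abs, inv_pow, sq_abs]
    field_simp
    linear_combination -(1 - r ^ 2) * hπD
  have hu' : ‖u * P - r • (y * q)‖ ^ 2 =
      ‖u‖ ^ 2 * π - 2 * r * (π ^ 2 * (α + r * β)) + r ^ 2 * (‖y‖ ^ 2 * (π ^ 2 * ‖a‖ ^ 2)) := by
    have h1 : inner ℝ (u * P) (y * q) = π ^ 2 * (α + r * β) := by
      rw [hq, ← hK.moufang_right, hK.inner_mul_right_mul_right, hPn, real_inner_comm,
        hK.inner_mul_left, real_inner_comm, hK.inner_mul_right, hK.star_mul, hY,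
        real_inner_smul_left, inner_add_left, real_inner_smul_left]
      ring
    rw [norm_sub_sq_real, real_inner_smul_right, h1, norm_smul, mul_pow, hK.norm_mul, hK.norm_mul,
      mul_pow, mul_pow, hqn, hPn, Real.norm_eq_abs, sq_abs]
    ring
  have hxY : (r⁻¹ • (e - (1 - r ^ 2) • P)) * (star P * star y) =
      π • (x * star y + r • star y) := by
    rw [hK.smul_mul, hK.sub_mul, hK.one_mul, hK.smul_mul, hK.mul_star_cancel_left, hPn, hY,
      inv_smul_eq_iff₀ hr0]
    module
  have hin : inner ℝ ((r⁻¹ • (e - (1 - r ^ 2) • P)) * (star P * star y))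
      (q * star (u * P - r • (y * q))) =
      π ^ 3 * ((1 + r ^ 2 + 2 * r * inner ℝ x e) * β + r * (1 - ‖x‖ ^ 2) * α) -
        r * (π ^ 3 * ‖a‖ ^ 2 * ‖y‖ ^ 2 * (inner ℝ x e + r)) := by
    have h1 : q * star (u * P) = π • (P * (a * star u)) := by
      rw [hK.star_mul, hq, ← hK.moufang_left, hK.mul_star_cancel_left, hPn, hK.mul_smul,
        hK.mul_smul]
    have h2 : q * star (y * q) = (π ^ 2 * ‖a‖ ^ 2) • star y := by
      rw [hK.star_mul, hK.mul_star_cancel_left, hqn]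
    have h3 : star P * (x * star y + r • star y) =
        π • ((1 + r ^ 2 + 2 * r * inner ℝ x e) • (x * star y) +
          (r * (1 - ‖x‖ ^ 2)) • star y) := by
      rw [hPs, hDdef, hK.smul_mul, hK.add_mul, hK.one_mul, hK.mul_add, hK.smul_mul, hK.smul_mul,
        hK.mul_smul, hK.mul_mul_left]
      module
    have h4 : inner ℝ (x * star y) (star y) = ‖y‖ ^ 2 * inner ℝ x e := by
      rw [hK.inner_mul_right, hK.star_star, hK.star_mul_self, real_inner_smul_right]
    have h5 : inner ℝ (star y) (star y) = ‖y‖ ^ 2 := by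
      rw [real_inner_self_eq_norm_sq, hK.norm_star]
    rw [hxY, hK.star_sub, hK.star_smul, hK.mul_sub, hK.mul_smul, h1, h2, inner_sub_right,
      real_inner_smul_right, real_inner_smul_left, real_inner_comm, hK.inner_mul_left,
      real_inner_comm, h3, real_inner_smul_left, inner_add_left, real_inner_smul_left,
      real_inner_smul_left, real_inner_smul_right, real_inner_smul_right, real_inner_smul_left,
      inner_add_left, real_inner_smul_left, h4, h5]
    ring
  set X := r⁻¹ • (e - (1 - r ^ 2) • P)
  rw [crossForm, crossForm, hx', hK.star_smul, hK.star_smul, hK.star_mul y P, hK.mul_smul,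
    hK.mul_smul, hK.smul_mul (1 - r ^ 2) q, real_inner_smul_left, real_inner_smul_right, real_inner_smul_right, hin, norm_smul, norm_smul,
    norm_smul, mul_pow, mul_pow, mul_pow, hu', hqn, hK.norm_mul, mul_pow, hPn, ← hβ]
  simp only [Real.norm_eq_abs, sq_abs, Real.sq_sqrt hs]
  have hsq : √(1 - r ^ 2) * √(1 - r ^ 2) = 1 - r ^ 2 := Real.mul_self_sqrt hs
  linear_combination (1 - r ^ 2) ^ 2 * π ^ 2 * (2 * β - ‖a‖ ^ 2 * ‖y‖ ^ 2) * hπD +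
    2 * (1 - r ^ 2) * (π ^ 3 * ((1 + r ^ 2 + 2 * r * inner ℝ x e) * β + r * (1 - ‖x‖ ^ 2) * α) -
        r * (π ^ 3 * ‖a‖ ^ 2 * ‖y‖ ^ 2 * (inner ℝ x e + r))) * hsq

omit [FiniteDimensional ℝ K] in
theorem transverseForm_self (y u : K) : transverseForm y y u u = 0 := by
  rw [transverseForm, hK.mul_star_self, hK.mul_star_self, real_inner_smul_left,
    real_inner_smul_right, hK.inner_self_one]
  ring

omit [FiniteDimensional ℝ K] in
theorem inner_mul_star_mul_star (h : ∀ a b c : K, a * b * c = a * (b * c)) (y y' u u' : K) :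
    inner ℝ (y * star y') (u * star u') = inner ℝ (star u * y) (star u' * y') := by
  rw [hK.inner_mul_right, hK.star_star, hK.inner_mul_left, hK.star_star, h]

omit [FiniteDimensional ℝ K] in
/-- In the associative case, the boost scales the coupling of two transverse coordinates. There is
nothing to prove in `𝕆²`, which has a single transverse coordinate. -/
theorem transverseForm_boost (h : ∀ a b c : K, a * b * c = a * (b * c)) {P q : K} {r s : ℝ}
    (y y' u u' : K) :
    transverseForm (s • (y * P)) (s • (y' * P)) (s • (u * P - r • (y * q)))
      (s • (u' * P - r • (y' * q))) = (s ^ 2 * ‖P‖ ^ 2) ^ 2 * transverseForm y y' u u' := by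
  have key := hK.inner_mul_star_mul_star h
  have hn : ∀ u y : K, ‖u * P - r • (y * q)‖ ^ 2 = ‖u‖ ^ 2 * ‖P‖ ^ 2 -
      2 * r * inner ℝ (star P * (star u * y)) (star q) + r ^ 2 * (‖y‖ ^ 2 * ‖q‖ ^ 2) := by
    intro u y
    have h1 : inner ℝ (u * P) (y * q) = inner ℝ (star P * (star u * y)) (star q) := by
      rw [hK.inner_mul_left u, ← h, hK.inner_mul_left (star P), hK.star_star,
        ← hK.inner_mul_right, real_inner_comm]
    rw [norm_sub_sq_real, real_inner_smul_right, h1, norm_smul, mul_pow, hK.norm_mul, hK.norm_mul,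
      mul_pow, mul_pow, Real.norm_eq_abs, sq_abs]
    ring
  have hm : ∀ u y : K, star (u * P - r • (y * q)) * (y * P) =
      (star P * (star u * y) - (r * ‖y‖ ^ 2) • star q) * P := by
    intro u y
    rw [← h, hK.star_sub, hK.star_smul, hK.star_mul, hK.star_mul, hK.sub_mul, hK.smul_mul, h,
      hK.star_mul_cancel_right, smul_smul]
  rw [transverseForm, transverseForm, key y y' u u']
  simp only [hK.star_smul, hK.mul_smul, hK.smul_mul, real_inner_smul_left, real_inner_smul_right]
  rw [key, hm, hm, hK.inner_mul_right_mul_right, inner_sub_left, inner_sub_right, inner_sub_right,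
    hK.inner_mul_left_mul_left, hK.norm_star]
  simp only [norm_smul, mul_pow, hn, hK.norm_mul, Real.norm_eq_abs, sq_abs, real_inner_smul_left,
    real_inner_smul_right, real_inner_self_eq_norm_sq, hK.norm_star]
  rw [real_inner_comm (star P * (star u' * y')) (star q)]
  ring

variable {k : ℕ}

/-- Decomposition of the numerator of the Hermitian metric into contributions of at most two
coordinates, each of which is scaled by boosts. -/
theorem hermitian_eq_sum (z u : PiLp 2 fun _ : Fin (k + 1) => K) :
    (1 - ‖z‖ ^ 2) * ‖u‖ ^ 2 + inner ℝ (hK.lineForm z z u) u =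
      ‖u 0‖ ^ 2 + (∑ j : Fin k, crossForm (z 0) (z j.succ) (u 0) (u j.succ)) +
        ∑ i : Fin k, ∑ j : Fin k,
          transverseForm (z i.succ) (z j.succ) (u i.succ) (u j.succ) := by
  have h1 : ∀ j : Fin k, inner ℝ (z j.succ * star (z 0)) (u j.succ * star (u 0)) =
      inner ℝ (z 0 * star (z j.succ)) (u 0 * star (u j.succ)) := fun j => by
    rw [← hK.star_star (z j.succ), ← hK.star_mul, hK.inner_star_left, hK.star_mul, hK.star_star,
      hK.star_star]
  rw [hK.inner_lineForm', Fin.sum_univ_succ, Fin.sum_univ_succ]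
  simp only [Fin.sum_univ_succ (n := k), h1, crossForm, transverseForm, Finset.sum_add_distrib,
    Finset.sum_sub_distrib, Finset.sum_neg_distrib, ← Finset.mul_sum, ← Finset.sum_mul,
    ← Finset.sum_div, norm_sq_succ z, norm_sq_succ u, hK.mul_star_self, real_inner_smul_left,
    real_inner_smul_right, hK.inner_self_one]
  ring

/-- Boosts are isometries. In the octonionic plane this uses the Moufang identities only. -/
theorem isIsometryPair_boost {d : ℕ} {c r : ℝ} (h : (∀ a b c : K, a * b * c = a * (b * c)) ∨ k + 1 = 2)
    (hB : IsLineForm d (hK.lineForm (m := k + 1))) (hr0 : r ≠ 0) (hr : |r| < 1) :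
    IsIsometryPair (Metric.ball 0 1) (ballMetric c (hK.lineForm (m := k + 1)))
      (boost e r) (boost e (-r)) := by
  have hr' : |-r| < 1 := by rwa [abs_neg]
  have hr0' : -r ≠ 0 := neg_ne_zero.2 hr0
  have hs : 0 < 1 - r ^ 2 := by nlinarith [abs_lt.1 hr]
  refine IsIsometryPair.of_pullback Metric.isOpen_ball (hK.contDiffOn_boost hr)
    (hK.contDiffOn_boost hr') (hK.mapsTo_boost hr0 hr) (hK.mapsTo_boost hr0' hr')
    (fun z hz => hK.boost_neg_boost hr0 hr (mem_ball_zero_iff.1 hz)) (fun z hz => ?_)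
    (fun z hz => ballMetric_polarize hB fun u => ?_)
  · simpa using hK.boost_neg_boost hr0' hr' (mem_ball_zero_iff.1 hz)
  · rw [mem_ball_zero_iff] at hz
    have hD := hK.boostDen_ne_zero hr hz
    obtain ⟨hf0, hfs⟩ := hK.fderiv_boost hr0 hr hz u
    set P := compInv (boostDen e r z) with hP
    set w := fderiv ℝ (boost e r) z u
    have hPn : ‖P‖ ^ 2 = (‖boostDen e r z‖ ^ 2)⁻¹ := hK.norm_sq_compInv _
    have key : (1 - ‖boost e r z‖ ^ 2) * ‖w‖ ^ 2 +
        inner ℝ (hK.lineForm (boost e r z) (boost e r z) w) w =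
        ((1 - r ^ 2) * (‖boostDen e r z‖ ^ 2)⁻¹) ^ 2 *
          ((1 - ‖z‖ ^ 2) * ‖u‖ ^ 2 + inner ℝ (hK.lineForm z z u) u) := by
      rw [hK.hermitian_eq_sum, hK.hermitian_eq_sum, _root_.mul_add, _root_.mul_add, Finset.mul_sum,
        Finset.mul_sum]
      simp only [Finset.mul_sum]
      congr 1
      · congr 1
        · rw [hf0, norm_smul, hK.norm_mul, hK.norm_mul, ← hPn, Real.norm_of_nonneg hs.le]
          ring
        · refine Finset.sum_congr rfl fun j _ => ?_
          rw [hf0, hfs, boost_zero', boost_succ]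
          exact hK.crossForm_boost hr0 (by linarith) hD _ _ _
      · refine Finset.sum_congr rfl fun i _ => Finset.sum_congr rfl fun j _ => ?_
        rcases h with h | h
        · rw [hfs, hfs, boost_succ, boost_succ, hK.transverseForm_boost h, Real.sq_sqrt hs.le, hPn]
        · obtain rfl : i = j := by omega
          rw [hK.transverseForm_self, hK.transverseForm_self, MulZeroClass.mul_zero]
    have h1 := hK.one_sub_norm_boost_sq hr0 hr hD
    have h2 : 1 - ‖z‖ ^ 2 ≠ 0 := by nlinarith [norm_nonneg z]
    have h3 : ‖boostDen e r z‖ ^ 2 ≠ 0 := by positivity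
    have h4 : 1 - ‖boost e r z‖ ^ 2 ≠ 0 := by
      rw [h1]
      positivity
    have e1 : ∀ {z u : PiLp 2 fun _ : Fin (k + 1) => K}, 1 - ‖z‖ ^ 2 ≠ 0 →
        ballMetric c (hK.lineForm (m := k + 1)) z u u =
        c * ((1 - ‖z‖ ^ 2) * ‖u‖ ^ 2 + inner ℝ (hK.lineForm z z u) u) / (1 - ‖z‖ ^ 2) ^ 2 := by
      intro z u hz
      rw [ballMetric, real_inner_self_eq_norm_sq]
      field_simp
    rw [e1 h4, e1 h2, key, h1]
    field_simp

end IsCompositionAlgebra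

end BoostIsometry

/-! ### Unitary maps and homogeneity -/

section Unitary

variable {K : Type*} [NormedAddCommGroup K] [InnerProductSpace ℝ K] [FiniteDimensional ℝ K]
  [Mul K] [Star K] {e : K}

namespace IsCompositionAlgebra

variable (hK : IsCompositionAlgebra e)

/-- The linear isometry `L` preserves the Hermitian line form. -/
def IsUnitary {m : ℕ} (L : (PiLp 2 fun _ : Fin m => K) ≃ₗᵢ[ℝ] PiLp 2 fun _ : Fin m => K) : Prop :=
  ∀ z u, inner ℝ (hK.lineForm (L z) (L z) (L u)) (L u) = inner ℝ (hK.lineForm z z u) u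

variable {hK} in
theorem IsUnitary.trans {m : ℕ}
    {L L' : (PiLp 2 fun _ : Fin m => K) ≃ₗᵢ[ℝ] PiLp 2 fun _ : Fin m => K}
    (h : hK.IsUnitary L) (h' : hK.IsUnitary L') : hK.IsUnitary (L.trans L') := fun z u =>
  (h' (L z) (L u)).trans (h z u)

include hK

omit [FiniteDimensional ℝ K] in
/-- Every element is made real by the multiplication with a unit. -/
theorem exists_unit_mul (x : K) : ∃ w : K, ‖w‖ = 1 ∧ star w * x = ‖x‖ • e := by
  by_cases hx : x = 0
  · exact ⟨e, hK.norm_one, by simp [hx, hK.mul_zero]⟩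
  · have h : ‖x‖ ≠ 0 := norm_ne_zero_iff.2 hx
    refine ⟨‖x‖⁻¹ • x, by rw [norm_smul, norm_inv, norm_norm, inv_mul_cancel₀ h], ?_⟩
    rw [hK.star_smul, hK.smul_mul, hK.star_mul_self, smul_smul]
    congr 1
    field_simp

section Associative

variable {m : ℕ}

/-- The Hermitian product `∑ⱼ z̄ⱼ uⱼ` of `Kᵐ`. -/
def hermitian (z u : PiLp 2 fun _ : Fin m => K) : K := ∑ j, star (z j) * u j

theorem inner_lineForm_eq_norm_hermitian (h : ∀ a b c : K, a * b * c = a * (b * c))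
    (z u : PiLp 2 fun _ : Fin m => K) :
    inner ℝ (hK.lineForm z z u) u = ‖hermitian u z‖ ^ 2 := by
  rw [hK.inner_lineForm', ← real_inner_self_eq_norm_sq, hermitian, sum_inner]
  refine Finset.sum_congr rfl fun i _ => ?_
  rw [inner_sum]
  exact Finset.sum_congr rfl fun j _ => hK.inner_mul_star_mul_star h _ _ _ _

omit [FiniteDimensional ℝ K] in
theorem hermitian_self (z : PiLp 2 fun _ : Fin m => K) : hermitian z z = ‖z‖ ^ 2 • e := by
  simp only [hermitian, hK.star_mul_self, PiLp.norm_sq_eq_of_L2, Finset.sum_smul]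

/-- A linear map preserving the Hermitian product is unitary. -/
theorem exists_isUnitary_of_hermitian (h : ∀ a b c : K, a * b * c = a * (b * c))
    (L : (PiLp 2 fun _ : Fin m => K) →ₗ[ℝ] PiLp 2 fun _ : Fin m => K)
    (hL : ∀ z u, hermitian (L z) (L u) = hermitian z u) :
    ∃ L', hK.IsUnitary L' ∧ ∀ z, L' z = L z := by
  have hn : ∀ z, ‖L z‖ = ‖z‖ := fun z => by
    have h1 := congrArg (inner ℝ e) (hL z z)
    rw [hK.hermitian_self, hK.hermitian_self, real_inner_smul_right, real_inner_smul_right,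
      hK.inner_self_one, _root_.mul_one, _root_.mul_one] at h1
    exact (sq_eq_sq₀ (norm_nonneg _) (norm_nonneg _)).1 h1
  refine ⟨LinearIsometry.toLinearIsometryEquiv ⟨L, hn⟩ rfl, fun z u => ?_, fun z => rfl⟩
  rw [hK.inner_lineForm_eq_norm_hermitian h, hK.inner_lineForm_eq_norm_hermitian h]
  exact congrArg (fun x => ‖x‖ ^ 2) (hL u z)

theorem exists_isUnitary_mul_left (h : ∀ a b c : K, a * b * c = a * (b * c)) {w : K}
    (hw : ‖w‖ = 1) :
    ∃ L : (PiLp 2 fun _ : Fin m => K) ≃ₗᵢ[ℝ] PiLp 2 fun _ : Fin m => K,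
      hK.IsUnitary L ∧ ∀ z i, L z i = star w * z i := by
  obtain ⟨L, hL, hLz⟩ := hK.exists_isUnitary_of_hermitian h (m := m)
    { toFun := fun z => WithLp.toLp 2 fun i => star w * z i
      map_add' := fun z u => by ext i; simp [hK.mul_add]
      map_smul' := fun t z => by ext i; simp [hK.mul_smul] }
    (fun z u => by
      refine Finset.sum_congr rfl fun j _ => ?_
      change star (star w * z j) * (star w * u j) = _
      rw [hK.star_mul, hK.star_star, h, hK.mul_star_cancel_left, hw, one_pow, one_smul])
  exact ⟨L, hL, fun z i => by rw [hLz]; rfl⟩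

/-- Reflections in Hermitian hyperplanes. -/
theorem exists_isUnitary_reflection (h : ∀ a b c : K, a * b * c = a * (b * c))
    {v : PiLp 2 fun _ : Fin m => K} (hv : v ≠ 0) :
    ∃ L : (PiLp 2 fun _ : Fin m => K) ≃ₗᵢ[ℝ] PiLp 2 fun _ : Fin m => K,
      hK.IsUnitary L ∧ ∀ z i, L z i = z i - v i * ((2 / ‖v‖ ^ 2) • hermitian v z) := by
  have hv2 : ‖v‖ ^ 2 ≠ 0 := by positivity
  have hadd : ∀ z u, hermitian v (z + u) = hermitian v z + hermitian v u := fun z u => by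
    simp [hermitian, hK.mul_add, Finset.sum_add_distrib]
  have hsmul : ∀ (t : ℝ) z, hermitian v (t • z) = t • hermitian v z := fun t z => by
    simp [hermitian, hK.mul_smul, Finset.smul_sum]
  obtain ⟨L, hL, hLz⟩ := hK.exists_isUnitary_of_hermitian h (m := m)
    { toFun := fun z => WithLp.toLp 2 fun i => z i - v i * ((2 / ‖v‖ ^ 2) • hermitian v z)
      map_add' := fun z u => by
        ext i
        simp only [hadd, smul_add, hK.mul_add, PiLp.add_apply]
        abel
      map_smul' := fun t z => by
        ext i
        simp only [hsmul, smul_comm _ t, hK.mul_smul, PiLp.smul_apply, smul_sub, RingHom.id_apply] }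
    (fun z u => by
      set a := (2 / ‖v‖ ^ 2) • hermitian v z with ha
      set b := (2 / ‖v‖ ^ 2) • hermitian v u with hb
      change ∑ j, star (z j - v j * a) * (u j - v j * b) = ∑ j, star (z j) * u j
      have h1 : ∀ j, star (z j - v j * a) * (u j - v j * b) = star (z j) * u j -
          hK.mulCLM.flip b (star (z j) * v j) - star a * (star (v j) * u j)
            + star a * (‖v j‖ ^ 2 • b) := fun j => by
        rw [hK.star_sub, hK.sub_mul, hK.mul_sub, hK.mul_sub, hK.star_mul, ContinuousLinearMap.flip_apply,
          hK.mulCLM_apply, h (star (z j)), h (star a), h (star a), hK.star_mul_cancel_left]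
        abel
      have h2 : ∑ j, star (z j) * v j = star (hermitian v z) := by
        rw [hermitian, ← hK.starCLM_apply, map_sum]
        refine Finset.sum_congr rfl fun j _ => ?_
        rw [hK.starCLM_apply, hK.star_mul, hK.star_star]
      simp only [h1, Finset.sum_add_distrib, Finset.sum_sub_distrib]
      simp only [← hK.mulCLM_apply (star a), ← map_sum, ← Finset.sum_smul, h2,
        ← PiLp.norm_sq_eq_of_L2]
      change _ - star (hermitian v z) * b - star a * hermitian v u + star a * (‖v‖ ^ 2 • b) = _
      rw [ha, hb, hK.star_smul]
      simp only [hK.smul_mul, hK.mul_smul, smul_smul]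
      have h3 : 2 / ‖v‖ ^ 2 * (‖v‖ ^ 2 * (2 / ‖v‖ ^ 2)) = 2 / ‖v‖ ^ 2 + 2 / ‖v‖ ^ 2 := by
        field_simp
        norm_num
      rw [h3, add_smul]
      abel)
  exact ⟨L, hL, fun z i => by rw [hLz]; rfl⟩

end Associative

/-- The linear isometries `(u, v) ↦ (ρ u + w v, w̄ u - ρ v)` of `K²` are unitary; this does not use
associativity. -/
theorem exists_isUnitary_two {ρ : ℝ} {w : K} (hw : ρ ^ 2 + ‖w‖ ^ 2 = 1) :
    ∃ L : (PiLp 2 fun _ : Fin 2 => K) ≃ₗᵢ[ℝ] PiLp 2 fun _ : Fin 2 => K,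
      hK.IsUnitary L ∧ ∀ z, L z 0 = ρ • z 0 + w * z 1 ∧ L z 1 = star w * z 0 - ρ • z 1 := by
  let L : (PiLp 2 fun _ : Fin 2 => K) →ₗ[ℝ] PiLp 2 fun _ : Fin 2 => K :=
    { toFun := fun z => WithLp.toLp 2 ![ρ • z 0 + w * z 1, star w * z 0 - ρ • z 1]
      map_add' := fun z u => by
        ext i
        fin_cases i <;> simp [hK.mul_add] <;> abel
      map_smul' := fun t z => by
        ext i
        fin_cases i <;> simp [hK.mul_smul, smul_sub, smul_comm _ t] }
  have L0 : ∀ z, L z 0 = ρ • z 0 + w * z 1 := fun z => rfl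
  have L1 : ∀ z, L z 1 = star w * z 0 - ρ • z 1 := fun z => rfl
  have hA : ∀ z : PiLp 2 fun _ : Fin 2 => K, inner ℝ (z 0) (w * z 1) = inner ℝ w (z 0 * star (z 1)) :=
    fun z => by rw [real_inner_comm, hK.inner_mul_right]
  have hB : ∀ z : PiLp 2 fun _ : Fin 2 => K, inner ℝ (star w * z 0) (z 1) = inner ℝ w (z 0 * star (z 1)) :=
    fun z => by rw [hK.inner_mul_left, hK.star_star, hA]
  have n0 : ∀ z, ‖L z 0‖ ^ 2 = ρ ^ 2 * ‖z 0‖ ^ 2 + 2 * ρ * inner ℝ w (z 0 * star (z 1)) +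
      ‖w‖ ^ 2 * ‖z 1‖ ^ 2 := fun z => by
    rw [L0, norm_add_sq_real, real_inner_smul_left, hA, norm_smul, hK.norm_mul, mul_pow, mul_pow,
      Real.norm_eq_abs, sq_abs]
    ring
  have n1 : ∀ z, ‖L z 1‖ ^ 2 = ‖w‖ ^ 2 * ‖z 0‖ ^ 2 - 2 * ρ * inner ℝ w (z 0 * star (z 1)) +
      ρ ^ 2 * ‖z 1‖ ^ 2 := fun z => by
    rw [L1, norm_sub_sq_real, real_inner_smul_right, hB, norm_smul, hK.norm_mul, mul_pow, mul_pow,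
      Real.norm_eq_abs, sq_abs, hK.norm_star]
    ring
  have nz : ∀ z : PiLp 2 fun _ : Fin 2 => K, ‖z‖ ^ 2 = ‖z 0‖ ^ 2 + ‖z 1‖ ^ 2 := fun z => by
    rw [PiLp.norm_sq_eq_of_L2, Fin.sum_univ_two]
  have hn : ∀ z, ‖L z‖ = ‖z‖ := fun z => by
    refine (sq_eq_sq₀ (norm_nonneg _) (norm_nonneg _)).1 ?_
    rw [nz, nz, n0, n1]
    linear_combination (‖z 0‖ ^ 2 + ‖z 1‖ ^ 2) * hw
  -- the action of `L` on `u v̄`, which together with `|u|` and `|v|` determines the line form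
  have hh : ∀ z, L z 0 * star (L z 1) =
      (ρ * (‖z 0‖ ^ 2 - ‖z 1‖ ^ 2) + 2 * inner ℝ w (z 0 * star (z 1))) • w -
        z 0 * star (z 1) := fun z => by
    have h1 : (w * z 1) * (star (z 0) * w) =
        (2 * inner ℝ w (z 0 * star (z 1))) • w - ‖w‖ ^ 2 • (z 0 * star (z 1)) := by
      rw [hK.moufang_middle, hK.mul_mul_self, hK.star_mul, hK.star_star]
    rw [L0, L1, hK.star_sub, hK.star_mul, hK.star_star, hK.star_smul, hK.add_mul, hK.mul_sub,
      hK.mul_sub, hK.smul_mul, hK.smul_mul, hK.mul_smul, hK.mul_smul, hK.mul_star_cancel_left, h1,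
      hK.mul_star_cancel_right, eq_sub_of_add_eq' hw]
    module
  have hQ : ∀ z u : PiLp 2 fun _ : Fin 2 => K, inner ℝ (hK.lineForm z z u) u =
      ‖z 0‖ ^ 2 * ‖u 0‖ ^ 2 + ‖z 1‖ ^ 2 * ‖u 1‖ ^ 2 +
        2 * inner ℝ (z 0 * star (z 1)) (u 0 * star (u 1)) := fun z u => by
    have h1 : inner ℝ (z 1 * star (z 0)) (u 1 * star (u 0)) =
        inner ℝ (z 0 * star (z 1)) (u 0 * star (u 1)) := by
      rw [← hK.star_star (z 1), ← hK.star_mul, hK.inner_star_left, hK.star_mul, hK.star_star,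
        hK.star_star]
    rw [hK.inner_lineForm', Fin.sum_univ_two, Fin.sum_univ_two, Fin.sum_univ_two, h1,
      hK.mul_star_self, hK.mul_star_self, hK.mul_star_self, hK.mul_star_self]
    simp only [real_inner_smul_left, real_inner_smul_right, hK.inner_self_one]
    ring
  refine ⟨LinearIsometry.toLinearIsometryEquiv ⟨L, hn⟩ rfl, fun z u => ?_,
    fun z => ⟨L0 z, L1 z⟩⟩
  change inner ℝ (hK.lineForm (L z) (L z) (L u)) (L u) = _
  rw [hQ, hQ, hh, hh, n0, n0, n1, n1, inner_sub_left, inner_sub_right, inner_sub_right,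
    real_inner_smul_left, real_inner_smul_right, real_inner_smul_left, real_inner_smul_right,
    real_inner_self_eq_norm_sq, real_inner_comm w (z 0 * star (z 1)), eq_sub_of_add_eq' hw]
  ring

/-- Every vector can be moved to the real positive half-line of the first coordinate by a unitary
map. -/
theorem exists_isUnitary_eq_single {k : ℕ}
    (h : (∀ a b c : K, a * b * c = a * (b * c)) ∨ k + 1 = 2)
    (a : PiLp 2 fun _ : Fin (k + 1) => K) :
    ∃ L, hK.IsUnitary L ∧ L a = WithLp.toLp 2 (Pi.single 0 (‖a‖ • e)) := by
  rcases h with h | h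
  · obtain ⟨w, hw, hwa⟩ := hK.exists_unit_mul (a 0)
    obtain ⟨L, hL, hLz⟩ := hK.exists_isUnitary_mul_left h (m := k + 1) hw
    set a' := L a with ha'
    have hna : ‖a'‖ = ‖a‖ := L.norm_map a
    have ha0 : a' 0 = ‖a 0‖ • e := by rw [ha', hLz, hwa]
    -- as `⟨a', b⟩` is real, the reflection in the hyperplane orthogonal to `a' - b` maps `a'` to `b`
    set b : PiLp 2 fun _ : Fin (k + 1) => K := WithLp.toLp 2 (Pi.single 0 (‖a‖ • e)) with hb
    by_cases hv : a' = b
    · exact ⟨L, hL, hv⟩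
    have hv0 : a' - b ≠ 0 := sub_ne_zero.2 hv
    obtain ⟨L', hL', hLz'⟩ := hK.exists_isUnitary_reflection h hv0
    refine ⟨L.trans L', hL.trans hL', ?_⟩
    have hbn : ‖b‖ = ‖a‖ := by
      rw [hb, PiLp.toLp_single, PiLp.norm_single, norm_smul, hK.norm_one, norm_norm, _root_.mul_one]
    have h1 : hermitian (a' - b) a' = (‖a‖ ^ 2 - ‖a‖ * ‖a 0‖) • e := by
      have h2 : hermitian (a' - b) a' = hermitian a' a' - hermitian b a' := by
        simp [hermitian, hK.star_sub, hK.sub_mul]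
      have h3 : hermitian b a' = (‖a‖ * ‖a 0‖) • e := by
        rw [hermitian, Finset.sum_eq_single 0]
        · rw [ha0, hb]
          simp only [Pi.single_eq_same]
          rw [hK.star_smul, hK.star_one, hK.smul_mul, hK.one_mul, smul_smul]
        · intro j _ hj
          have : star (0 : K) = 0 := by rw [← hK.starCLM_apply, map_zero]
          simp [hb, hj, this, hK.zero_mul]
        · simp
      rw [h2, h3, hK.hermitian_self, hna, sub_smul]
    have h4 : ‖a' - b‖ ^ 2 = 2 * (‖a‖ ^ 2 - ‖a‖ * ‖a 0‖) := by
      have h5 := congrArg (inner ℝ e) (hK.hermitian_self (a' - b))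
      have h6 : inner ℝ a' b = ‖a‖ * ‖a 0‖ := by
        rw [PiLp.inner_apply, Finset.sum_eq_single 0]
        · rw [ha0, hb]
          simp only [Pi.single_eq_same]
          rw [real_inner_smul_left, real_inner_smul_right, hK.inner_self_one]
          ring
        · intro j _ hj
          simp [hb, hj]
        · simp
      rw [norm_sub_sq_real, h6, hna, hbn]
      ring
    have h7 : (2 / ‖a' - b‖ ^ 2) • hermitian (a' - b) a' = e := by
      have h8 : ‖a' - b‖ ^ 2 ≠ 0 := by positivity
      rw [h1, smul_smul]
      have h9 : 2 / ‖a' - b‖ ^ 2 * (‖a‖ ^ 2 - ‖a‖ * ‖a 0‖) = 1 := by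
        field_simp
        linarith
      rw [h9, one_smul]
    ext i
    change L' a' i = b i
    rw [hLz', h7, hK.mul_one, PiLp.sub_apply, sub_sub_cancel]
  · obtain rfl : k = 1 := by omega
    by_cases ha : a = 0
    · refine ⟨LinearIsometryEquiv.refl ℝ _, fun z u => rfl, ?_⟩
      rw [ha]
      ext i
      simp
    -- `L` makes the first coordinate real and exchanges the coordinates, `S` exchanges them again,
    -- and `T` cancels the second one
    obtain ⟨w, hw, hwa⟩ := hK.exists_unit_mul (a 0)
    obtain ⟨L, hL, hLz⟩ := hK.exists_isUnitary_two (ρ := 0) (w := w) (by rw [hw]; norm_num)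
    obtain ⟨S, hS, hSz⟩ := hK.exists_isUnitary_two (ρ := 0) (w := e)
      (by rw [hK.norm_one]; norm_num)
    set a' := S (L a) with ha'
    have hna : ‖a'‖ = ‖a‖ := by rw [ha', S.norm_map, L.norm_map]
    have ha0 : a' 0 = ‖a 0‖ • e := by
      rw [ha', (hSz _).1, (hLz _).2, hwa, hK.one_mul, zero_smul, zero_smul, sub_zero, zero_add]
    have hn0 : ‖a‖ ≠ 0 := norm_ne_zero_iff.2 ha
    have hsum : ‖a 0‖ ^ 2 + ‖a' 1‖ ^ 2 = ‖a‖ ^ 2 := by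
      rw [← hna, PiLp.norm_sq_eq_of_L2, Fin.sum_univ_two, ha0, norm_smul, hK.norm_one, norm_norm,
        _root_.mul_one]
    obtain ⟨T, hT, hTz⟩ := hK.exists_isUnitary_two (ρ := ‖a‖⁻¹ * ‖a 0‖)
      (w := ‖a‖⁻¹ • star (a' 1)) (by
        rw [norm_smul, norm_inv, norm_norm, hK.norm_star]
        field_simp
        exact hsum)
    refine ⟨(L.trans S).trans T, (hL.trans hS).trans hT, ?_⟩
    change T a' = _
    ext i
    fin_cases i
    · change T a' 0 = ‖a‖ • e
      rw [(hTz a').1, ha0, hK.smul_mul, hK.star_mul_self, smul_smul, smul_smul, ← add_smul]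
      congr 1
      field_simp
      exact hsum
    · change T a' 1 = 0
      rw [(hTz a').2, ha0, hK.star_smul, hK.star_star, hK.smul_mul, hK.mul_smul, hK.mul_one,
        smul_smul, sub_self]

/-- The unit ball with its Hermitian metric is homogeneous. -/
theorem exists_isIsometryPair {k d : ℕ} {c : ℝ}
    (h : (∀ a b c : K, a * b * c = a * (b * c)) ∨ k + 1 = 2)
    (hB : IsLineForm d (hK.lineForm (m := k + 1)))
    {a : PiLp 2 fun _ : Fin (k + 1) => K} (ha : ‖a‖ < 1) :
    ∃ Φ Ψ, IsIsometryPair (Metric.ball 0 1) (ballMetric c (hK.lineForm (m := k + 1))) Φ Ψ ∧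
      Φ 0 = a := by
  obtain ⟨L, hL, hLa⟩ := hK.exists_isUnitary_eq_single h a
  have h1 := (isIsometryPair_linear (c := c) hB L hL).symm
  by_cases h0 : a = 0
  · exact ⟨_, _, h1, by rw [h0]; exact map_zero L.symm⟩
  · have hr0 : ‖a‖ ≠ 0 := norm_ne_zero_iff.2 h0
    have hr : |‖a‖| < 1 := by rwa [abs_norm]
    refine ⟨_, _, (hK.isIsometryPair_boost h hB hr0 hr).comp Metric.isOpen_ball h1, ?_⟩
    rw [Function.comp_apply, hK.boost_origin hr0, ← hLa, L.symm_apply_apply]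

end IsCompositionAlgebra

end Unitary

namespace DivAlg

variable {F : DivAlg} {m : ℕ}

/-- The hyperbolic space is homogeneous. -/
theorem exists_isIsometryPair (hO : F = octonion → m = 2) (hm : m ≠ 0) (c : ℝ) {o : FSpace F m}
    (ho : o ∈ hypBall F m) :
    ∃ Φ Ψ, IsIsometryPair (hypBall F m) (hypMetric F m c) Φ Ψ ∧ Φ 0 = o := by
  obtain ⟨k, rfl⟩ := Nat.exists_eq_succ_of_ne_zero hm
  rw [hypMetric_eq]
  exact F.isCompositionAlgebra.exists_isIsometryPair (F.assoc_or _ hO) (isLineForm hO)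
    (mem_ball_zero_iff.1 ho)

end DivAlg

/-! ### Transport of hypersurfaces by isometries -/

section Transport

variable {P : Type*} [NormedAddCommGroup P] [NormedSpace ℝ P] {U : Set P} {g : MetricTensor P}
  {Φ Ψ : P → P} {n : ℕ} {N : Type*} [TopologicalSpace N]
  [ChartedSpace (EuclideanSpace ℝ (Fin n)) N] {f ν : N → P} {x : N} {r : ℕ}

theorem IsIsometryOf.contDiffAt (h : IsIsometryOf U g Φ) (hU : IsOpen U) {p : P} (hp : p ∈ U) :
    ContDiffAt ℝ ∞ Φ p := h.smooth.contDiffAt (hU.mem_nhds hp)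

theorem IsIsometryOf.hasFDerivAt (h : IsIsometryOf U g Φ) (hU : IsOpen U) {p : P} (hp : p ∈ U) :
    HasFDerivAt Φ (fderiv ℝ Φ p) p :=
  ((h.contDiffAt hU hp).differentiableAt (by simp)).hasFDerivAt

theorem curveLength_comp (h : IsIsometryOf U g Φ) (hU : IsOpen U) {γ : ℝ → P}
    (hγ : MapsTo γ (Icc 0 1) U) (hd : DifferentiableOn ℝ γ (Icc 0 1)) :
    curveLength g (Φ ∘ γ) = curveLength g γ := by
  refine setLIntegral_congr_fun measurableSet_Icc fun t ht => ?_
  have h1 := (h.hasFDerivAt hU (hγ ht)).comp_hasDerivWithinAt t (hd t ht).hasDerivWithinAt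
  rw [Function.comp_apply, h1.derivWithin (uniqueDiffOn_Icc_zero_one t ht),
    h.pullback _ (hγ ht)]

/-- An isometry of `U` maps the curves of `U` to curves of `U` of the same length. -/
theorem riemannDist_isometry_le (h : IsIsometryOf U g Φ) (hU : IsOpen U) (p q : P) :
    riemannDist U g (Φ p) (Φ q) ≤ riemannDist U g p q := by
  refine le_iInf₂ fun γ hγ => ?_
  obtain ⟨hγ1, hγ2, h0, h1⟩ := hγ
  rw [← curveLength_comp h hU hγ2 (hγ1.differentiableOn (by simp))]
  refine iInf₂_le (Φ ∘ γ) ⟨?_, h.bijOn.mapsTo.comp hγ2, by simp [h0], by simp [h1]⟩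
  exact (h.smooth.of_le (by exact_mod_cast le_top)).comp hγ1 hγ2

theorem IsIsometryPair.riemannDist_eq (h : IsIsometryPair U g Φ Ψ) (hU : IsOpen U) {p q : P}
    (hp : p ∈ U) (hq : q ∈ U) : riemannDist U g (Φ p) (Φ q) = riemannDist U g p q := by
  refine le_antisymm (riemannDist_isometry_le h.isometry hU p q) ?_
  have h1 := riemannDist_isometry_le h.isometry_inv hU (Φ p) (Φ q)
  rwa [h.left_inv p hp, h.left_inv q hq] at h1

theorem IsIsometryPair.fderiv_inv_fderiv (h : IsIsometryPair U g Φ Ψ) (hU : IsOpen U) {p : P}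
    (hp : p ∈ U) (X : P) : fderiv ℝ Ψ (Φ p) (fderiv ℝ Φ p X) = X :=
  IsIsometryPair.fderiv_comp_fderiv hU h.isometry_inv.smooth h.isometry.smooth
    h.isometry.bijOn.mapsTo h.left_inv hp X

theorem IsIsometryPair.fderiv_fderiv_inv (h : IsIsometryPair U g Φ Ψ) (hU : IsOpen U) {p : P}
    (hp : p ∈ U) (X : P) : fderiv ℝ Φ p (fderiv ℝ Ψ (Φ p) X) = X := by
  have h1 := h.symm.fderiv_inv_fderiv hU (h.isometry.bijOn.mapsTo hp) X
  rwa [h.left_inv p hp] at h1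

namespace IsImmersionInto

variable (hf : IsImmersionInto n U f)

include hf

theorem mdifferentiableAt (x : N) : MDifferentiableAt (𝓡 n) 𝓘(ℝ, P) f x :=
  (hf.smooth x).mdifferentiableAt (by simp)

theorem tangentMapAt_isometry (h : IsIsometryOf U g Φ) (hU : IsOpen U) (x : N) :
    tangentMapAt n (Φ ∘ f) x = (fderiv ℝ Φ (f x)).comp (tangentMapAt n f x) :=
  tangentMapAt_comp (h.hasFDerivAt hU (hf.mem x)) (hf.mdifferentiableAt x)

theorem comp_isometry (h : IsIsometryPair U g Φ Ψ) (hU : IsOpen U) :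
    IsImmersionInto n U (Φ ∘ f) where
  mem x := h.isometry.bijOn.mapsTo (hf.mem x)
  smooth x := (h.isometry.contDiffAt hU (hf.mem x)).contMDiffAt.comp x (hf.smooth x)
  immersive x := by
    rw [hf.tangentMapAt_isometry h.isometry hU]
    intro u v huv
    have h1 := congrArg (fderiv ℝ Ψ (Φ (f x))) huv
    simp only [ContinuousLinearMap.comp_apply, h.fderiv_inv_fderiv hU (hf.mem x)] at h1
    exact hf.immersive x h1

theorem inducedDist_isometry (h : IsIsometryOf U g Φ) (hU : IsOpen U) (x y : N) :
    inducedDist n g (Φ ∘ f) x y = inducedDist n g f x y := by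
  refine iInf_congr fun γ => iInf_congr fun hγ => ?_
  refine curveLength_comp (γ := f ∘ γ) h hU (fun t _ => hf.mem _) ?_
  have h1 : ContMDiffOn 𝓘(ℝ, ℝ) 𝓘(ℝ, P) 1 (f ∘ γ) (Icc 0 1) :=
    (hf.smooth.of_le (by exact_mod_cast le_top)).comp_contMDiffOn hγ.1
  exact h1.contDiffOn.differentiableOn (by simp)

theorem isCompleteImmersion_comp_isometry (h : IsIsometryOf U g Φ) (hU : IsOpen U)
    (hc : IsCompleteImmersion n g f) : IsCompleteImmersion n g (Φ ∘ f) := by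
  intro s hs
  simp only [hf.inducedDist_isometry h hU] at hs
  exact hc s hs

end IsImmersionInto

/-- The image of a hypersurface by an isometry has the same shape operators. -/
theorem IsRMinimal.comp_isometry {G : P → P →L[ℝ] P →L[ℝ] ℝ} (hG : IsMetricForm U G)
    (hU : IsOpen U) (h : IsIsometryPair U (fun p X Y => G p X Y) Φ Ψ) (hf : IsImmersionInto n U f)
    (hr : IsRMinimal n (fun p X Y => G p X Y) f r) :
    IsRMinimal n (fun p X Y => G p X Y) (Φ ∘ f) r := by
  intro x
  obtain ⟨W, ν, A, hW, hxW, hν, hA, hAr⟩ := hr x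
  refine ⟨W, fun y => fderiv ℝ Φ (f y) (ν y), A, hW, hxW, ⟨fun y hy => ?_, fun y hy => ?_,
    fun y hy u => ?_⟩, fun u Z => ?_, hAr⟩
  · have h1 : ContDiffAt ℝ ∞ (fderiv ℝ Φ) (f y) :=
      (h.isometry.contDiffAt hU (hf.mem y)).fderiv_right (m := ∞) (by simp)
    have h2 : ContMDiffWithinAt (𝓡 n) 𝓘(ℝ, P →L[ℝ] P) ∞ (fun y => fderiv ℝ Φ (f y)) W y :=
      (h1.contMDiffAt.comp y (hf.smooth y)).contMDiffWithinAt
    exact h2.clm_apply (hν.smooth y hy)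
  · exact (h.isometry.pullback _ (hf.mem y) _ _).trans (hν.unit y hy)
  · rw [hf.tangentMapAt_isometry h.isometry hU]
    exact (h.isometry.pullback _ (hf.mem y) _ _).trans (hν.normal y hy u)
  · have hp := hf.mem x
    have hνd : MDifferentiableAt (𝓡 n) 𝓘(ℝ, P) ν x :=
      ((hν.smooth x hxW).contMDiffAt (hW.mem_nhds hxW)).mdifferentiableAt (by simp)
    have h1 : HasFDerivAt (fderiv ℝ Φ) (fderiv ℝ (fderiv ℝ Φ) (f x)) (f x) :=
      (((h.isometry.contDiffAt hU hp).fderiv_right (m := ∞) (by simp)).differentiableAt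
        (by simp)).hasFDerivAt
    have h2 : HasFDerivAt (fun q : P × P => fderiv ℝ Φ q.1 q.2) _ (f x, ν x) :=
      (HasFDerivAt.comp (g := fderiv ℝ Φ) (f x, ν x) h1 hasFDerivAt_fst).clm_apply
        hasFDerivAt_snd
    have h3 : HasMFDerivAt (𝓡 n) 𝓘(ℝ, P × P) (fun y => (f y, ν y)) x
        ((tangentMapAt n f x).prod (tangentMapAt n ν x)) :=
      ⟨(hf.mdifferentiableAt x).continuousAt.prodMk hνd.continuousAt,
        (hasMFDerivAt_tangentMapAt (hf.mdifferentiableAt x)).2.prodMk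
          (hasMFDerivAt_tangentMapAt hνd).2⟩
    have h4 := tangentMapAt_comp (g := fun y => (f y, ν y)) h2 h3.mdifferentiableAt
    rw [h3.tangentMapAt_eq] at h4
    have h5 : tangentMapAt n (fun y => fderiv ℝ Φ (f y) (ν y)) x u =
        fderiv ℝ Φ (f x) (tangentMapAt n ν x u) +
          fderiv ℝ (fderiv ℝ Φ) (f x) (tangentMapAt n f x u) (ν x) := by
      rw [h4]
      simp
    obtain ⟨Z, rfl⟩ : ∃ Z', fderiv ℝ Φ (f x) Z' = Z := ⟨_, h.fderiv_fderiv_inv hU hp Z⟩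
    have h6 := christoffel_isometry hU hG h.isometry hp (tangentMapAt n f x u) (ν x) Z
    have h7 := hA u Z
    have h8 := h.isometry.pullback _ hp (tangentMapAt n f x (A u)) Z
    have h9 := h.isometry.pullback _ hp (tangentMapAt n ν x u) Z
    rw [h5, hf.tangentMapAt_isometry h.isometry hU]
    simp only [map_add, add_apply, ContinuousLinearMap.comp_apply, Function.comp_apply] at *
    linarith

end Transport

/-! ### Isometries of the product -/

section Product

variable {F : DivAlg} {m n : ℕ} {c : ℝ} {τ σ : FSpace F m → FSpace F m}

theorem isOpen_hypBall : IsOpen (hypBall F m) := Metric.isOpen_ball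

theorem isOpen_hypProd : IsOpen (hypProd F m) := isOpen_hypBall.prod isOpen_univ

/-- The product of an isometry and a vertical translation. -/
def cylIsometry (τ : FSpace F m → FSpace F m) (t : ℝ) (q : FSpace F m × ℝ) : FSpace F m × ℝ :=
  (τ q.1, q.2 + t)

theorem hasFDerivAt_cylIsometry (h : IsIsometryOf (hypBall F m) (hypMetric F m c) τ) (t : ℝ)
    {q : FSpace F m × ℝ} (hq : q ∈ hypProd F m) :
    HasFDerivAt (cylIsometry τ t) ((fderiv ℝ τ q.1).prodMap (ContinuousLinearMap.id ℝ ℝ)) q :=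
  ((h.hasFDerivAt isOpen_hypBall hq.1).comp q hasFDerivAt_fst).prodMk
    (hasFDerivAt_snd.add_const t)

theorem isIsometryPair_cylIsometry (h : IsIsometryPair (hypBall F m) (hypMetric F m c) τ σ)
    (t : ℝ) : IsIsometryPair (hypProd F m) (prodMetric F m c) (cylIsometry τ t)
      (cylIsometry σ (-t)) := by
  refine IsIsometryPair.of_pullback isOpen_hypProd (fun q hq => ?_) (fun q hq => ?_)
    (fun q hq => ⟨h.isometry.bijOn.mapsTo hq.1, mem_univ _⟩)
    (fun q hq => ⟨h.isometry_inv.bijOn.mapsTo hq.1, mem_univ _⟩) (fun q hq => ?_) (fun q hq => ?_)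
    (fun q hq X Y => ?_)
  · exact (((h.isometry.contDiffAt isOpen_hypBall hq.1).comp q contDiffAt_fst).prodMk
      (contDiffAt_snd.add contDiffAt_const)).contDiffWithinAt
  · exact (((h.isometry_inv.contDiffAt isOpen_hypBall hq.1).comp q contDiffAt_fst).prodMk
      (contDiffAt_snd.add contDiffAt_const)).contDiffWithinAt
  · simp [cylIsometry, h.left_inv _ hq.1]
  · simp [cylIsometry, h.right_inv _ hq.1]
  · rw [(hasFDerivAt_cylIsometry h.isometry t hq).fderiv]
    exact congrArg (· + X.2 * Y.2) (h.isometry.pullback _ hq.1 X.1 Y.1)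

theorem mem_hypSphere_isometry (h : IsIsometryPair (hypBall F m) (hypMetric F m c) τ σ)
    {o p : FSpace F m} {s : ℝ} (ho : o ∈ hypBall F m) (hp : p ∈ hypBall F m) :
    τ p ∈ hypSphere F m c (τ o) s ↔ p ∈ hypSphere F m c o s := by
  have h1 : τ p ∈ hypBall F m := h.isometry.bijOn.mapsTo hp
  simp only [hypSphere, mem_ofPred_eq, hypDist, h1, hp, true_and,
    h.riemannDist_eq isOpen_hypBall ho hp]

theorem isMetricForm_prodMetric (hO : F = DivAlg.octonion → m = 2) (hc : 0 < c) :
    ∃ G, IsMetricForm (hypProd F m) G ∧ prodMetric F m c = fun p X Y => G p X Y :=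
  ⟨_, isMetricForm_cylForm hc (DivAlg.isLineForm hO), by
    rw [cylForm_eq, DivAlg.prodMetric_eq]⟩

variable {N : Type*} [TopologicalSpace N] [ChartedSpace (EuclideanSpace ℝ (Fin n)) N]
  {f : N → FSpace F m × ℝ} {o : FSpace F m} {r : ℕ}

/-- A product isometry maps the hypersurfaces with axis through `o` to those with axis through `τ o`;
it preserves the horizontal sections. -/
theorem IsCompleteRotationalRMinimal.comp_cylIsometry (hO : F = DivAlg.octonion → m = 2)
    (hc : 0 < c) (hf : IsCompleteRotationalRMinimal n c o r f) (ho : o ∈ hypBall F m)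
    (h : IsIsometryPair (hypBall F m) (hypMetric F m c) τ σ) (t : ℝ) :
    IsCompleteRotationalRMinimal n c (τ o) r (cylIsometry τ t ∘ f) := by
  have hp := isIsometryPair_cylIsometry h t
  have hT : ∀ x u, (tangentMapAt n (cylIsometry τ t ∘ f) x u).2 = (tangentMapAt n f x u).2 :=
    fun x u => by
      rw [hf.immersion.tangentMapAt_isometry hp.isometry isOpen_hypProd,
        (hasFDerivAt_cylIsometry h.isometry t (hf.immersion.mem x)).fderiv]
      rfl
  refine ⟨hf.immersion.comp_isometry hp isOpen_hypProd,
    hf.immersion.isCompleteImmersion_comp_isometry hp.isometry isOpen_hypProd hf.complete,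
    fun t' ht' x hx => ?_, ?_⟩
  · have e1 : ∀ y, (cylIsometry τ t (f y)).2 = t' ↔ (f y).2 = t' - t := fun y =>
      eq_sub_iff_add_eq.symm
    simp only [hT, Function.comp_apply, e1] at ht' hx ⊢
    obtain ⟨s, hs, hy⟩ := hf.rotational (t' - t) ht' x hx
    exact ⟨s, hs, fun y hyc => (mem_hypSphere_isometry h ho (hf.immersion.mem y).1).2 (hy y hyc)⟩
  · obtain ⟨G, hG, hGe⟩ := isMetricForm_prodMetric (F := F) (m := m) hO hc
    have hr := hf.rMinimal
    rw [hGe] at hr hp ⊢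
    exact hr.comp_isometry hG isOpen_hypProd hp hf.immersion

theorem IsEmbeddedCompleteRotationalRMinimal.image_cylIsometry {T : Type} [TopologicalSpace T]
    {S : Set (FSpace F m × ℝ)} (hO : F = DivAlg.octonion → m = 2) (hc : 0 < c)
    (hS : IsEmbeddedCompleteRotationalRMinimal T n c o r S) (ho : o ∈ hypBall F m)
    (h : IsIsometryPair (hypBall F m) (hypMetric F m c) τ σ) (t : ℝ) :
    IsEmbeddedCompleteRotationalRMinimal T n c (τ o) r (cylIsometry τ t '' S) := by
  obtain ⟨N, i1, i2, i3, f, hT, he, hf, rfl⟩ := hS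
  have hp := isIsometryPair_cylIsometry h t
  have hf' := hf.comp_cylIsometry hO hc ho h t
  refine ⟨N, i1, i2, i3, cylIsometry τ t ∘ f, hT, ?_, hf', range_comp _ _⟩
  refine isEmbedding_of_comp hf'.immersion.smooth.continuous (g := cylIsometry σ (-t))
    (fun x => (hp.isometry_inv.contDiffAt isOpen_hypProd (hf'.immersion.mem x)).continuousAt) ?_
  have e1 : cylIsometry σ (-t) ∘ (cylIsometry τ t ∘ f) = f :=
    funext fun x => hp.left_inv _ (hf.immersion.mem x)
  rw [e1]
  exact he

theorem IsIsometryPair.mem_image_iff {P : Type*} [NormedAddCommGroup P] [NormedSpace ℝ P]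
    {U S : Set P} {g : MetricTensor P} {Φ Ψ : P → P} (h : IsIsometryPair U g Φ Ψ) (hS : S ⊆ U)
    {q : P} : q ∈ Φ '' S ↔ q ∈ U ∧ Ψ q ∈ S := by
  constructor
  · rintro ⟨p, hp, rfl⟩
    exact ⟨h.isometry.bijOn.mapsTo (hS hp), by rwa [h.left_inv p (hS hp)]⟩
  · rintro ⟨hq, hp⟩
    exact ⟨_, hp, h.right_inv q hq⟩

theorem IsCatenoidType.image_cylIsometry {S : Set (FSpace F m × ℝ)} {l : ℝ}
    (hS : IsCatenoidType c o l S) (hSU : S ⊆ hypProd F m) (ho : o ∈ hypBall F m)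
    (h : IsIsometryPair (hypBall F m) (hypMetric F m c) τ σ) :
    IsCatenoidType c (τ o) l (cylIsometry τ 0 '' S) := by
  have hp := isIsometryPair_cylIsometry h 0
  have hm : ∀ q : FSpace F m × ℝ, q ∈ cylIsometry τ 0 '' S ↔ q.1 ∈ hypBall F m ∧ (σ q.1, q.2) ∈ S :=
    fun q => by
      rw [hp.mem_image_iff hSU]
      simp [cylIsometry, hypProd]
  have hσ : ∀ p ∈ hypBall F m, σ p ∈ hypBall F m := fun p hp => h.isometry_inv.bijOn.mapsTo hp
  have hd : ∀ p ∈ hypBall F m, hypDist F m c (τ o) p = hypDist F m c o (σ p) := fun p hp => by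
    have h1 := h.riemannDist_eq isOpen_hypBall ho (hσ p hp)
    rwa [h.right_inv p hp] at h1
  obtain ⟨hsymm, hneck, φ, h1, h2, h3, h4, h5, h6⟩ := hS
  refine ⟨fun p t => ?_, ?_, φ, h1, h2, h3, h4, ?_, ?_⟩
  · rw [hm, hm, hsymm]
  · ext ⟨p, t⟩
    have e1 := congrArg (fun A : Set (FSpace F m × ℝ) => (σ p, t) ∈ A) hneck
    simp only [horizontalHyperplane, hypSphere, mem_inter_iff, mem_prod, mem_singleton_iff,
      mem_ofPred_eq, eq_iff_iff] at e1 ⊢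
    rw [hm]
    by_cases hpb : p ∈ hypBall F m
    · simp only [hpb, hσ p hpb, true_and, hd p hpb] at e1 ⊢
      exact e1
    · simp [hpb]
  · ext ⟨p, t⟩
    have e1 := congrArg (fun A : Set (FSpace F m × ℝ) => (σ p, t) ∈ A) h5
    simp only [mem_ofPred_eq, eq_iff_iff] at e1 ⊢
    rw [hm]
    by_cases hpb : p ∈ hypBall F m
    · simp only [hpb, hσ p hpb, true_and, hd p hpb] at e1 ⊢
      exact e1
    · simp [hpb]
  · ext ⟨p, t⟩
    have e1 := congrArg (fun A : Set (FSpace F m × ℝ) => (σ p, t) ∈ A) h6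
    simp only [mem_ofPred_eq, eq_iff_iff] at e1 ⊢
    rw [hm]
    by_cases hpb : p ∈ hypBall F m
    · simp only [hpb, hσ p hpb, true_and, hd p hpb] at e1 ⊢
      exact e1
    · simp [hpb]

end Product

/-! ### The slope of a catenoid as a function of the distance to the axis -/

section CatenoidProfile

variable {c : ℝ} {d k r : ℕ} {l s : ℝ}

/-- The first integral of the profile equation, as a function of the distance to the axis. -/
def profileEnergyAt (c : ℝ) (d k r : ℕ) (s : ℝ) : ℝ :=
  profilePrimitive d k r (logit (radialNorm c s ^ 2))

/-- The slope, at distance `s` from the axis, of the catenoid with neck of radius `l`. -/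
def catenoidSlope (c : ℝ) (d k r : ℕ) (l s : ℝ) : ℝ :=
  √(Real.exp (profileEnergyAt c d k r s - profileEnergyAt c d k r l) - 1)

theorem radialNorm_sq_mem (hc : 0 < c) (hs : 0 < s) : radialNorm c s ^ 2 ∈ Ioo (0 : ℝ) 1 := by
  obtain ⟨h0, h1⟩ := radialNorm_mem hc hs
  exact ⟨by positivity, by nlinarith⟩

theorem contDiff_radialNorm (c : ℝ) : ContDiff ℝ ∞ (radialNorm c) := by
  have h : ContDiff ℝ ∞ Real.sigmoid := contDiff_sigmoid.of_le le_top
  exact (contDiff_const.mul (h.comp (contDiff_const.mul contDiff_id))).sub contDiff_const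

theorem hasDerivAt_profileEnergyAt (hc : 0 < c) (hr : r + 1 ≤ k) (hs : 0 < s) :
    ∃ D > 0, HasDerivAt (profileEnergyAt c d k r) D s := by
  have hm := radialNorm_sq_mem hc hs
  have hsc : 0 < √c := Real.sqrt_pos.2 hc
  have h1 : HasDerivAt (radialNorm c) _ s :=
    (((Real.hasDerivAt_sigmoid (2 / √c * s)).comp s
      ((hasDerivAt_id s).const_mul (2 / √c))).const_mul 2).sub_const 1
  have h2 := (hasDerivAt_profilePrimitive (d := d) (k := k) (r := r) (by omega)
    (logit (radialNorm c s ^ 2))).comp s ((hasDerivAt_logit hm).comp s (h1.pow 2))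
  refine ⟨_, ?_, h2⟩
  have p1 := profileQ_pos (d := d) hr (sigmoid_mem (logit (radialNorm c s ^ 2))).1.le
  have p2 : 0 < radialNorm c s ^ 2 * (1 - radialNorm c s ^ 2) :=
    mul_pos hm.1 (by linarith [hm.2])
  have p3 := (radialNorm_mem hc hs).1
  have p4 := (sigmoid_mem (2 / √c * s)).1
  have p5 : 0 < 1 - Real.sigmoid (2 / √c * s) := by linarith [(sigmoid_mem (2 / √c * s)).2]
  simp only [pow_one, Nat.add_one_sub_one, mul_one]
  positivity

theorem contDiffAt_profileEnergyAt (hc : 0 < c) (hr : r + 1 ≤ k) (hs : 0 < s) :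
    ContDiffAt ℝ ∞ (profileEnergyAt c d k r) s := by
  obtain ⟨h0, h1⟩ := radialNorm_sq_mem hc hs
  have h2 : 0 < 1 - radialNorm c s ^ 2 := by linarith
  have h3 : ContDiffAt ℝ ∞ (fun s => radialNorm c s ^ 2) s :=
    ((contDiff_radialNorm c).pow 2).contDiffAt
  have h4 : ContDiffAt ℝ ∞ (fun s => logit (radialNorm c s ^ 2)) s :=
    (h3.div (contDiffAt_const.sub h3) h2.ne').log (div_pos h0 h2).ne'
  exact (contDiff_profilePrimitive (d := d) (k := k) (r := r) (by omega)).contDiffAt.comp s h4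

theorem strictMonoOn_profileEnergyAt (hc : 0 < c) (hr : r + 1 ≤ k) :
    StrictMonoOn (profileEnergyAt c d k r) (Ioi 0) := by
  refine strictMonoOn_of_deriv_pos (convex_Ioi 0) (fun s hs => ?_) fun s hs => ?_
  · exact (contDiffAt_profileEnergyAt hc hr hs).continuousAt.continuousWithinAt
  · rw [interior_Ioi] at hs
    obtain ⟨D, hD, h⟩ := hasDerivAt_profileEnergyAt (d := d) hc hr hs
    rwa [h.deriv]

theorem catenoidSlope_nonneg : 0 ≤ catenoidSlope c d k r l s := Real.sqrt_nonneg _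

theorem exp_profileEnergyAt_sub_nonneg (hc : 0 < c) (hr : r + 1 ≤ k) (hl : 0 < l) (hs : l ≤ s) :
    0 ≤ Real.exp (profileEnergyAt c d k r s - profileEnergyAt c d k r l) - 1 := by
  have h := (strictMonoOn_profileEnergyAt (d := d) hc hr).monotoneOn hl (hl.trans_le hs) hs
  have := Real.one_le_exp (sub_nonneg.2 h)
  linarith

theorem profileSq_catenoidSlope (hc : 0 < c) (hr : r + 1 ≤ k) (hl : 0 < l) (hs : l ≤ s) :
    profileSq d k r (profileEnergyAt c d k r l) (catenoidSlope c d k r l s) =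
      radialNorm c s ^ 2 := by
  symm
  rw [eq_profileSq_iff hr (radialNorm_sq_mem hc (hl.trans_le hs)), catenoidSlope,
    Real.sq_sqrt (exp_profileEnergyAt_sub_nonneg hc hr hl hs), add_sub_cancel, Real.log_exp,
    add_sub_cancel]
  rfl

theorem catenoidSlope_self : catenoidSlope c d k r l l = 0 := by simp [catenoidSlope]

theorem continuousOn_catenoidSlope (hc : 0 < c) (hr : r + 1 ≤ k) (hl : 0 < l) :
    ContinuousOn (catenoidSlope c d k r l) (Ici l) := fun s hs => by
  have h := (contDiffAt_profileEnergyAt (d := d) hc hr (hl.trans_le hs)).continuousAt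
  exact ((((h.sub continuousAt_const).rexp).sub continuousAt_const).sqrt).continuousWithinAt

theorem catenoidSlope_smooth (hc : 0 < c) (hr : r + 1 ≤ k) (hl : 0 < l) (hs : l < s) :
    ContDiffAt ℝ ∞ (catenoidSlope c d k r l) s ∧
      ∃ D > 0, HasDerivAt (catenoidSlope c d k r l) D s := by
  have h0 : 0 < Real.exp (profileEnergyAt c d k r s - profileEnergyAt c d k r l) - 1 := by
    have h := strictMonoOn_profileEnergyAt (d := d) hc hr hl (hl.trans hs) hs
    have := Real.one_lt_exp_iff.2 (sub_pos.2 h)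
    linarith
  refine ⟨?_, ?_⟩
  · exact ((((contDiffAt_profileEnergyAt (d := d) hc hr (hl.trans hs)).sub
      contDiffAt_const).exp).sub contDiffAt_const).sqrt h0.ne'
  · obtain ⟨D, hD, h⟩ := hasDerivAt_profileEnergyAt (d := d) hc hr (hl.trans hs)
    refine ⟨_, ?_, (((h.sub_const _).exp).sub_const 1).sqrt h0.ne'⟩
    have := Real.sqrt_pos.2 h0
    positivity

end CatenoidProfile

/-! ### The hypersurfaces centred at the origin -/

section Center

variable {F : DivAlg} {m n k r : ℕ} {c l : ℝ}

theorem zero_mem_hypBall : (0 : FSpace F m) ∈ hypBall F m := Metric.mem_ball_self one_pos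

theorem hypDist_zero (hO : F = DivAlg.octonion → m = 2) (hc : 0 < c) {p : FSpace F m}
    (hp : p ∈ hypBall F m) : hypDist F m c 0 p = ENNReal.ofReal (radialDist c ‖p‖) := by
  rw [hypDist, DivAlg.hypMetric_eq]
  exact riemannDist_zero hc (DivAlg.isLineForm hO) (mem_ball_zero_iff.1 hp)

theorem norm_mem_Ico {p : FSpace F m} (hp : p ∈ hypBall F m) : ‖p‖ ∈ Ico (0 : ℝ) 1 :=
  ⟨norm_nonneg p, mem_ball_zero_iff.1 hp⟩

theorem abs_norm_lt_one {p : FSpace F m} (hp : p ∈ hypBall F m) : |‖p‖| < 1 := by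
  rw [abs_norm]
  exact mem_ball_zero_iff.1 hp

theorem mem_hypSphere_zero (hO : F = DivAlg.octonion → m = 2) (hc : 0 < c) (hl : 0 < l)
    {p : FSpace F m} : p ∈ hypSphere F m c 0 l ↔ ‖p‖ = radialNorm c l := by
  constructor
  · rintro ⟨hp, h⟩
    rw [hypDist_zero hO hc hp, ENNReal.ofReal_eq_ofReal_iff (radialDist_nonneg hc (norm_mem_Ico hp))
      hl.le] at h
    rw [← h, radialNorm_radialDist hc (abs_norm_lt_one hp)]
  · intro h
    have hp : p ∈ hypBall F m := mem_ball_zero_iff.2 (h ▸ (radialNorm_mem hc hl).2)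
    exact ⟨hp, by rw [hypDist_zero hO hc hp, h, radialDist_radialNorm hc]⟩

/-- A rotational hypersurface is determined by its profile curve. -/
theorem mem_image_rotMap {E : Type*} [NormedAddCommGroup E] [InnerProductSpace ℝ E] {R H : ℝ → ℝ}
    (hR : ∀ v, 0 < R v) {p : E} {t : ℝ} :
    (p, t) ∈ rotMap R H '' {0}ᶜ ↔ ∃ v, ‖p‖ = R v ∧ t = H v := by
  constructor
  · rintro ⟨y, hy, h⟩
    refine ⟨Real.log ‖y‖, ?_, ?_⟩
    · rw [← norm_rotMap_fst (H := H) (hR _).le hy, h]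
    · exact (congrArg Prod.snd h).symm
  · rintro ⟨v, hp, ht⟩
    have h0 : ‖p‖ ≠ 0 := by rw [hp]; exact (hR v).ne'
    have h1 : ‖(Real.exp v * ‖p‖⁻¹) • p‖ = Real.exp v := by
      rw [norm_smul, norm_mul, norm_inv, norm_norm, Real.norm_of_nonneg (Real.exp_pos v).le,
        mul_assoc, inv_mul_cancel₀ h0, mul_one]
    refine ⟨(Real.exp v * ‖p‖⁻¹) • p, ?_, ?_⟩
    · rw [mem_compl_singleton_iff, ← norm_ne_zero_iff, h1]
      positivity
    · rw [rotMap, h1, Real.log_exp, smul_smul, ← hp, ← ht]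
      congr 1
      have : ‖p‖ * (Real.exp v)⁻¹ * (Real.exp v * ‖p‖⁻¹) = 1 := by field_simp
      rw [this, one_smul]

/-- Around the origin, rotational hypersurfaces are those on whose transversal sections the
Euclidean distance to the axis is locally constant. -/
theorem IsCompleteRotationalRMinimal.isRadialRMinimal {N : Type*} [TopologicalSpace N]
    [ChartedSpace (EuclideanSpace ℝ (Fin n)) N] {f : N → FSpace F m × ℝ}
    (hO : F = DivAlg.octonion → m = 2) (hc : 0 < c)
    (hf : IsCompleteRotationalRMinimal n c (0 : FSpace F m) r f) :
    IsRadialRMinimal n c (F.lineForm m) r f where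
  immersion := hf.immersion
  complete := DivAlg.prodMetric_eq (F := F) (m := m) c ▸ hf.complete
  radial t ht x hx y hy := by
    obtain ⟨s, hs, h⟩ := hf.rotational t ht x hx
    rw [(mem_hypSphere_zero hO hc hs).1 (h y hy),
      (mem_hypSphere_zero hO hc hs).1 (h x (mem_connectedComponentIn hx))]
  rMinimal := DivAlg.prodMetric_eq (F := F) (m := m) c ▸ hf.rMinimal

/-- Isometric coordinates of `𝔽ᵐ`. -/
def fSpaceCoord (hn : n = m * F.dim) : EuclideanSpace ℝ (Fin n) ≃ₗᵢ[ℝ] FSpace F m :=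
  ((stdOrthonormalBasis ℝ (FSpace F m)).reindex
    (finCongr ((DivAlg.finrank_fSpace F m).trans hn.symm))).repr.symm

/-- The hypersurface generated by a solution of the profile equation has all the properties required
of the members of the family. -/
theorem isEmbeddedCompleteRotationalRMinimal_rotMap {R H v : ℝ → ℝ}
    (hP : IsProfile c F.dim k r R H v) (hO : F = DivAlg.octonion → m = 2) (hn : n = m * F.dim)
    (hc : 0 < c) (hnk : n = k + 1) (hr : r ≤ k) :
    IsEmbeddedCompleteRotationalRMinimal (Annulus n) n c (0 : FSpace F m) (r + 1)
      (rotMap R H '' {0}ᶜ) := by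
  have hB := DivAlg.isLineForm (F := F) (m := m) hO
  have hk : Module.finrank ℝ (FSpace F m) = k + 1 := by
    rw [DivAlg.finrank_fSpace, ← hn, hnk]
  let Ψ := fSpaceCoord (F := F) hn
  have him := hP.isImmersionInto_rotParam Ψ
  refine ⟨puncturedSpace n, inferInstance, inferInstance, inferInstance, rotParam Ψ R H,
    nonempty_homeomorph_annulus n, hP.isEmbedding_rotParam Ψ, ⟨him, ?_, ?_, ?_⟩,
    IsProfile.range_rotParam Ψ⟩
  · rw [DivAlg.prodMetric_eq]
    exact hP.isCompleteImmersion_rotParam Ψ hc hB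
  · intro t _ x hx
    have h0 : 0 < ‖(rotParam Ψ R H x).1‖ := norm_pos_iff.2 (hP.rotParam_fst_ne_zero Ψ x)
    have hxb : (rotParam Ψ R H x).1 ∈ hypBall F m := (him.mem x).1
    have hs : 0 < radialDist c ‖(rotParam Ψ R H x).1‖ := by
      have := strictMonoOn_radialDist hc ⟨le_rfl, one_pos⟩ (norm_mem_Ico hxb) h0
      rwa [radialDist_zero] at this
    refine ⟨_, hs, fun y hy => (mem_hypSphere_zero hO hc hs).2 ?_⟩
    have hy2 : y ∈ {y | (rotParam Ψ R H y).2 = t} := connectedComponentIn_subset _ _ hy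
    rw [radialNorm_radialDist hc (abs_norm_lt_one hxb)]
    exact hP.norm_eq_of_snd_eq Ψ (hy2.trans hx.symm)
  · rw [DivAlg.prodMetric_eq]
    exact hP.isRMinimal_rotParam Ψ hc hB hk hnk hr

theorem isEmbeddedCompleteRotationalRMinimal_hyperplane (hO : F = DivAlg.octonion → m = 2)
    (hn : n = m * F.dim) (hc : 0 < c) (o : FSpace F m) (r : ℕ) (t : ℝ) :
    IsEmbeddedCompleteRotationalRMinimal (EuclideanSpace ℝ (Fin n)) n c o (r + 1)
      (horizontalHyperplane F m t) := by
  have hB := DivAlg.isLineForm (F := F) (m := m) hO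
  let Ψ := fSpaceCoord (F := F) hn
  refine ⟨openUnitBall n, inferInstance, inferInstance, inferInstance, hyperplaneParam Ψ t,
    nonempty_homeomorph_euclideanSpace n, isEmbedding_hyperplaneParam Ψ t,
    ⟨isImmersionInto_hyperplaneParam Ψ t, ?_, ?_, ?_⟩, range_hyperplaneParam Ψ t⟩
  · rw [DivAlg.prodMetric_eq]
    exact isCompleteImmersion_hyperplaneParam Ψ hc hB t
  · intro t' ht' x hx
    obtain ⟨u, hu⟩ := ht' x hx
    rw [tangentMapAt_hyperplaneParam] at hu
    exact absurd rfl hu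
  · rw [DivAlg.prodMetric_eq]
    exact isRMinimal_hyperplaneParam Ψ t r

theorem rotMap_cylinder (hO : F = DivAlg.octonion → m = 2) (hc : 0 < c) (hl : 0 < l) :
    rotMap (fun _ => radialNorm c l) id '' {0}ᶜ = hypSphere F m c 0 l ×ˢ (univ : Set ℝ) := by
  ext ⟨p, t⟩
  rw [mem_image_rotMap fun _ => (radialNorm_mem hc hl).1, mem_prod, mem_hypSphere_zero hO hc hl]
  simp

/-- The catenoid with vertical axis through the origin and neck of radius `l`. -/
def catenoid (F : DivAlg) (m : ℕ) (c : ℝ) (k r : ℕ) (l : ℝ) : Set (FSpace F m × ℝ) :=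
  rotMap (fun v => √(profileSq F.dim k r (profileEnergyAt c F.dim k r l) v))
    (profileHeight c F.dim k r (profileEnergyAt c F.dim k r l)) '' {0}ᶜ

theorem mem_catenoid {p : FSpace F m} {t : ℝ} : (p, t) ∈ catenoid F m c k r l ↔
    ∃ v, ‖p‖ ^ 2 = profileSq F.dim k r (profileEnergyAt c F.dim k r l) v ∧
      t = profileHeight c F.dim k r (profileEnergyAt c F.dim k r l) v := by
  rw [catenoid, mem_image_rotMap fun v => Real.sqrt_pos.2 (profileSq_mem _ _ _ _ _).1]
  refine exists_congr fun v => and_congr_left fun _ => ?_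
  rw [eq_comm, Real.sqrt_eq_iff_eq_sq (profileSq_mem _ _ _ _ _).1.le (norm_nonneg p), eq_comm]

theorem mem_hypBall_of_mem_catenoid {q : FSpace F m × ℝ} (hq : q ∈ catenoid F m c k r l) :
    q.1 ∈ hypBall F m := by
  obtain ⟨v, hv, -⟩ := mem_catenoid.1 hq
  have := (profileSq_mem F.dim k r (profileEnergyAt c F.dim k r l) v).2
  rw [← hv] at this
  exact mem_ball_zero_iff.2 (by nlinarith [norm_nonneg q.1])

theorem catenoid_neg {p : FSpace F m} {t : ℝ} (h : (p, t) ∈ catenoid F m c k r l) :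
    (p, -t) ∈ catenoid F m c k r l := by
  obtain ⟨v, hv, rfl⟩ := mem_catenoid.1 h
  exact mem_catenoid.2 ⟨-v, by rw [profileSq_neg, hv], by rw [profileHeight_neg]⟩

/-- The upper half of the catenoid, where the slope is the nonnegative function `catenoidSlope` of the
distance to the axis, is a graph over the complement of the ball. -/
theorem catenoid_upper_iff (hO : F = DivAlg.octonion → m = 2) (hc : 0 < c) (hr : r + 1 ≤ k)
    (hl : 0 < l) {p : FSpace F m} {t : ℝ} :
    (p, t) ∈ catenoid F m c k r l ∧ 0 ≤ t ↔
      p ∈ hypBall F m ∧ ENNReal.ofReal l ≤ hypDist F m c 0 p ∧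
        t = profileHeight c F.dim k r (profileEnergyAt c F.dim k r l)
          (catenoidSlope c F.dim k r l (hypDist F m c 0 p).toReal) := by
  set C := profileEnergyAt c F.dim k r l with hC
  have hmono := strictMono_profileHeight hc F.dim hr C
  have hsq0 : profileSq F.dim k r C 0 = radialNorm c l ^ 2 := by
    rw [← catenoidSlope_self (c := c) (d := F.dim) (k := k) (r := r) (l := l)]
    exact profileSq_catenoidSlope hc hr hl le_rfl
  constructor
  · rintro ⟨h, ht⟩
    have hp := mem_hypBall_of_mem_catenoid h
    obtain ⟨v, hv, rfl⟩ := mem_catenoid.1 h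
    have hv0 : 0 ≤ v := by
      rw [← hmono.le_iff_le, profileHeight_zero]
      exact ht
    have hmem : ‖p‖ ^ 2 ∈ Ioo (0 : ℝ) 1 := hv ▸ profileSq_mem _ _ _ _ _
    have hen := (eq_profileSq_iff hr hmem).1 hv
    have hln : radialNorm c l ≤ ‖p‖ := by
      refine (sq_le_sq₀ (radialNorm_mem hc hl).1.le (norm_nonneg p)).1 ?_
      rw [← hsq0, profileSq_le_iff hr hmem, hen]
      have h1 := Real.log_nonneg (x := 1 + v ^ 2) (by nlinarith)
      rw [← hC]
      simpa using h1
    have hls : l ≤ radialDist c ‖p‖ := by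
      have h1 := (strictMonoOn_radialDist hc).monotoneOn
        ⟨(radialNorm_mem hc hl).1.le, (radialNorm_mem hc hl).2⟩ (norm_mem_Ico hp) hln
      rwa [radialDist_radialNorm hc] at h1
    rw [hypDist_zero hO hc hp, ENNReal.toReal_ofReal (hl.le.trans hls)]
    refine ⟨hp, ENNReal.ofReal_le_ofReal hls, ?_⟩
    have h2 : profileEnergyAt c F.dim k r (radialDist c ‖p‖) = C + Real.log (1 + v ^ 2) := by
      rw [profileEnergyAt, radialNorm_radialDist hc (abs_norm_lt_one hp), hen]
    rw [catenoidSlope, h2, ← hC, add_sub_cancel_left, Real.exp_log (by positivity),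
      add_sub_cancel_left, Real.sqrt_sq hv0]
  · rintro ⟨hp, hd, rfl⟩
    rw [hypDist_zero hO hc hp, ENNReal.ofReal_le_ofReal_iff (radialDist_nonneg hc
      (norm_mem_Ico hp))] at hd
    rw [hypDist_zero hO hc hp, ENNReal.toReal_ofReal (hl.le.trans hd)]
    refine ⟨mem_catenoid.2 ⟨_, ?_, rfl⟩, ?_⟩
    · rw [profileSq_catenoidSlope hc hr hl hd, radialNorm_radialDist hc (abs_norm_lt_one hp)]
    · rw [← profileHeight_zero (c := c) (d := F.dim) (k := k) (r := r) C, hmono.le_iff_le]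
      exact catenoidSlope_nonneg

theorem isCatenoidType_catenoid (hO : F = DivAlg.octonion → m = 2) (hc : 0 < c) (hr : r + 1 ≤ k)
    (hl : 0 < l) : IsCatenoidType c (0 : FSpace F m) l (catenoid F m c k r l) := by
  set C := profileEnergyAt c F.dim k r l with hC
  have hmono := strictMono_profileHeight hc F.dim hr C
  have hsymm : ∀ (p : FSpace F m) t, (p, t) ∈ catenoid F m c k r l ↔
      (p, -t) ∈ catenoid F m c k r l := fun p t =>
    ⟨catenoid_neg, fun h => by simpa using catenoid_neg h⟩
  have hsq0 : profileSq F.dim k r C 0 = radialNorm c l ^ 2 := by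
    rw [← catenoidSlope_self (c := c) (d := F.dim) (k := k) (r := r) (l := l)]
    exact profileSq_catenoidSlope hc hr hl le_rfl
  refine ⟨hsymm, ?_, fun s => profileHeight c F.dim k r C (catenoidSlope c F.dim k r l s),
    ?_, ?_, fun s hs => ?_, ?_, ?_, ?_⟩
  · ext ⟨p, t⟩
    simp only [horizontalHyperplane, mem_inter_iff, mem_prod, mem_singleton_iff,
      mem_hypSphere_zero hO hc hl]
    constructor
    · rintro ⟨h, -, rfl⟩
      obtain ⟨v, hv, h0⟩ := mem_catenoid.1 h
      obtain rfl : 0 = v := hmono.injective (by rw [profileHeight_zero]; exact h0)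
      rw [← hC, hsq0] at hv
      exact ⟨(sq_eq_sq₀ (norm_nonneg p) (radialNorm_mem hc hl).1.le).1 hv, rfl⟩
    · rintro ⟨h, rfl⟩
      have h1 : ‖p‖ ^ 2 = profileSq F.dim k r (profileEnergyAt c F.dim k r l) 0 := by
        rw [h]
        exact hsq0.symm
      have h2 : (0 : ℝ) = profileHeight c F.dim k r (profileEnergyAt c F.dim k r l) 0 :=
        (profileHeight_zero _).symm
      have hq : (p, (0 : ℝ)) ∈ catenoid F m c k r l :=
        mem_catenoid.2 ⟨0, h1, h2⟩
      have hp := mem_hypBall_of_mem_catenoid hq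
      exact ⟨hq, hp, rfl⟩
  · exact (contDiff_profileHeight c F.dim hr C).continuous.comp_continuousOn
      (continuousOn_catenoidSlope hc hr hl)
  · exact fun s hs => (ContDiffAt.comp (g := profileHeight c F.dim k r C) s
      (contDiff_profileHeight c F.dim hr C).contDiffAt
      (catenoidSlope_smooth hc hr hl hs).1).contDiffWithinAt
  · obtain ⟨D, hD, h⟩ := (catenoidSlope_smooth (d := F.dim) hc hr hl hs).2
    have h1 := HasDerivAt.comp (h₂ := profileHeight c F.dim k r C) s
      (hasDerivAt_profileHeight c hr C (catenoidSlope c F.dim k r l s)) h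
    have h2 : deriv (fun s => profileHeight c F.dim k r C (catenoidSlope c F.dim k r l s)) s = _ :=
      h1.deriv
    rw [h2]
    exact mul_pos (deriv_profileHeight_pos hc hr C _) hD
  · beta_reduce
    rw [catenoidSlope_self, profileHeight_zero]
  · ext ⟨p, t⟩
    exact catenoid_upper_iff hO hc hr hl
  · ext ⟨p, t⟩
    simp only [mem_ofPred_eq]
    rw [hsymm, ← neg_nonneg, catenoid_upper_iff hO hc hr hl, neg_eq_iff_eq_neg]

/-- A catenoid is determined by the constant value of the first integral. -/
theorem exists_catenoid_eq (F : DivAlg) (m : ℕ) (hc : 0 < c) (hr : r + 1 ≤ k) (C : ℝ) :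
    ∃ l > 0, catenoid F m c k r l =
      rotMap (fun v => √(profileSq F.dim k r C v)) (profileHeight c F.dim k r C) '' {0}ᶜ := by
  have hm := profileSq_mem F.dim k r C 0
  have h0 : 0 < √(profileSq F.dim k r C 0) := Real.sqrt_pos.2 hm.1
  have h1 : √(profileSq F.dim k r C 0) < 1 := by
    rw [Real.sqrt_lt' one_pos, one_pow]
    exact hm.2
  have hl : 0 < radialDist c √(profileSq F.dim k r C 0) := by
    have := strictMonoOn_radialDist hc ⟨le_rfl, one_pos⟩ ⟨h0.le, h1⟩ h0
    rwa [radialDist_zero] at this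
  refine ⟨_, hl, ?_⟩
  have h2 : profileEnergyAt c F.dim k r (radialDist c √(profileSq F.dim k r C 0)) = C := by
    rw [profileEnergyAt, radialNorm_radialDist hc (by rwa [abs_of_pos h0]), Real.sq_sqrt hm.1.le,
      logit_profileSq hr]
    simp
  rw [catenoid, h2]

end Center

/-! ### Classification -/

section Final

variable {F : DivAlg} {m n k r : ℕ} {c : ℝ}

/-- The hypersurfaces `S l` around `o`, given those around the origin, and the classification. -/
theorem classification_of_center (hO : F = DivAlg.octonion → m = 2) (hn : n = m * F.dim)
    (hn2 : 2 ≤ n) (hc : 0 < c) (hnk : n = k + 1) (hr : r ≤ k) {S₀ : ℝ → Set (FSpace F m × ℝ)}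
    (hcyl : r = k → ∀ l, 0 < l → S₀ l = hypSphere F m c 0 l ×ˢ univ)
    (hcat : r < k → ∀ l, S₀ l = catenoid F m c k r l)
    {τ σ : FSpace F m → FSpace F m}
    (h : IsIsometryPair (hypBall F m) (hypMetric F m c) τ σ) {N : Type*} [TopologicalSpace N]
    [T2Space N] [SecondCountableTopology N] [ConnectedSpace N]
    [ChartedSpace (EuclideanSpace ℝ (Fin n)) N] [IsManifold (𝓡 n) ∞ N]
    {f : N → FSpace F m × ℝ} {o' : FSpace F m} (ho' : o' ∈ hypBall F m)
    (hf : IsCompleteRotationalRMinimal n c o' (r + 1) f) :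
    (∃ t : ℝ, range f = horizontalHyperplane F m t) ∨
      ∃ (l : ℝ) (Φ : FSpace F m × ℝ → FSpace F m × ℝ), 0 < l ∧
        IsIsometryOf (hypProd F m) (prodMetric F m c) Φ ∧
          Φ '' range f = cylIsometry τ 0 '' S₀ l := by
  have hB := DivAlg.isLineForm (F := F) (m := m) hO
  have hm0 : m ≠ 0 := by
    rintro rfl
    omega
  have hk : Module.finrank ℝ (FSpace F m) = k + 1 := by
    rw [DivAlg.finrank_fSpace, ← hn, hnk]
  obtain ⟨τ', σ', h', rfl⟩ := DivAlg.exists_isIsometryPair hO hm0 c ho'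
  have hf₀ := hf.comp_cylIsometry hO hc ho' h'.symm 0
  rw [h'.left_inv 0 zero_mem_hypBall] at hf₀
  have hrad := hf₀.isRadialRMinimal hO hc
  have hsep : ∀ t, cylIsometry (τ ∘ σ') t '' range f =
      cylIsometry τ t '' range (cylIsometry σ' 0 ∘ f) := fun t => by
    rw [range_comp (cylIsometry σ' 0), image_image]
    refine image_congr fun q _ => ?_
    simp [cylIsometry]
  have hiso : ∀ t, IsIsometryOf (hypProd F m) (prodMetric F m c) (cylIsometry (τ ∘ σ') t) :=
    fun t => (isIsometryPair_cylIsometry (h'.symm.comp isOpen_hypBall h) t).isometry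
  rcases hrad.horizontal_or_first_integral hB hn2 hc hk hnk hr with hΩ | ⟨hΩ, C, hC⟩
  · left
    obtain ⟨t, ht⟩ := hrad.range_of_horizontal (hk.trans hnk.symm) hΩ
    refine ⟨t, ?_⟩
    have h1 : range f = cylIsometry τ' 0 '' range (cylIsometry σ' 0 ∘ f) := by
      rw [← range_comp]
      congr 1
      funext x
      exact ((isIsometryPair_cylIsometry h' 0).right_inv _ (hf.immersion.mem x) |>.symm.trans
        (by simp [cylIsometry]))
    rw [h1, ht]
    ext ⟨p, s⟩
    constructor
    · rintro ⟨⟨p', s'⟩, ⟨hp', hs'⟩, hq⟩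
      simp only [cylIsometry, Prod.mk.injEq] at hq
      exact ⟨hq.1 ▸ h'.isometry.bijOn.mapsTo hp', by rw [mem_singleton_iff] at hs' ⊢; simp only at hs' ⊢; linarith [hq.2]⟩
    · rintro ⟨hp, hs⟩
      exact ⟨(σ' p, s), ⟨h'.isometry_inv.bijOn.mapsTo hp, hs⟩,
        by simp [cylIsometry, h'.right_inv p hp]⟩
  · right
    rcases hr.eq_or_lt with rfl | hlt
    · obtain ⟨a, ha, hra⟩ := hrad.range_of_eq hB hn2 hc hk hnk hΩ
      have hpos : 0 < radialDist c a := by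
        have := strictMonoOn_radialDist hc ⟨le_rfl, one_pos⟩ ⟨ha.1.le, ha.2⟩ ha.1
        rwa [radialDist_zero] at this
      refine ⟨radialDist c a, _, hpos, hiso 0, ?_⟩
      rw [hsep, hra, hcyl rfl _ hpos, ← rotMap_cylinder hO hc hpos,
        radialNorm_radialDist hc (by rw [abs_of_pos ha.1]; exact ha.2)]
    · obtain ⟨t, ht⟩ := hrad.range_of_lt hB hn2 hc hk hnk hlt hΩ hC
      obtain ⟨l, hl, hcatl⟩ := exists_catenoid_eq F m hc hlt C
      refine ⟨l, _, hl, hiso (-t), ?_⟩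
      rw [hsep, ht, hcat hlt, hcatl, image_image, image_image]
      refine image_congr fun y _ => ?_
      simp [cylIsometry, rotMap]

end Final

end

theorem mainTheorem9 (F : DivAlg) (m : ℕ) (hO : F = DivAlg.octonion → m = 2)
    (n : ℕ) (hn : n = m * F.dim) (hn2 : 2 ≤ n) (c : ℝ) (hc : 0 < c)
    (r : ℕ) (hr : 1 ≤ r) (hrn : r ≤ n) (o : FSpace F m) (ho : o ∈ hypBall F m) :
    ∃ S : ℝ → Set (FSpace F m × ℝ),
      (∀ l : ℝ, 0 < l → IsEmbeddedCompleteRotationalRMinimal (Annulus n) n c o r (S l)) ∧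
      (r = n → ∀ l : ℝ, 0 < l → S l = hypSphere F m c o l ×ˢ univ) ∧
      (r < n → ∀ l : ℝ, 0 < l → IsCatenoidType c o l (S l)) ∧
      (∀ t : ℝ, IsEmbeddedCompleteRotationalRMinimal (EuclideanSpace ℝ (Fin n)) n c o r
        (horizontalHyperplane F m t)) ∧
      (∀ (N : Type*) [TopologicalSpace N] [T2Space N] [SecondCountableTopology N]
        [ConnectedSpace N] [ChartedSpace (EuclideanSpace ℝ (Fin n)) N] [IsManifold (𝓡 n) ∞ N]
        (f : N → FSpace F m × ℝ) (o' : FSpace F m), o' ∈ hypBall F m →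
        IsCompleteRotationalRMinimal n c o' r f →
          (∃ t : ℝ, range f = horizontalHyperplane F m t) ∨
          ∃ (l : ℝ) (Φ : FSpace F m × ℝ → FSpace F m × ℝ), 0 < l ∧
            IsIsometryOf (hypProd F m) (prodMetric F m c) Φ ∧ Φ '' range f = S l) := by
  have hm0 : m ≠ 0 := by
    rintro rfl
    omega
  obtain ⟨k, rfl⟩ : ∃ k, n = k + 1 := ⟨n - 1, by omega⟩
  obtain ⟨r, rfl⟩ : ∃ r', r = r' + 1 := ⟨r - 1, by omega⟩
  have hrk : r ≤ k := by omega
  obtain ⟨τ, σ, h, rfl⟩ := DivAlg.exists_isIsometryPair hO hm0 c ho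
  rcases hrk.eq_or_lt with rfl | hlt
  · refine ⟨fun l => cylIsometry τ 0 '' (hypSphere F m c 0 l ×ˢ univ), fun l hl => ?_,
      fun _ l hl => ?_, fun hlt => absurd hlt (lt_irrefl _),
      isEmbeddedCompleteRotationalRMinimal_hyperplane hO hn hc _ _, ?_⟩
    · beta_reduce
      rw [← rotMap_cylinder hO hc hl]
      exact (isEmbeddedCompleteRotationalRMinimal_rotMap
        (isProfile_cylinder (radialNorm_mem hc hl)) hO hn hc rfl le_rfl).image_cylIsometry hO hc
          zero_mem_hypBall h 0
    · ext ⟨p, t⟩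
      rw [(isIsometryPair_cylIsometry h 0).mem_image_iff
        (prod_mono (fun p hp => hp.1) (subset_univ _))]
      simp only [hypProd, cylIsometry, mem_prod, mem_univ, and_true]
      constructor
      · rintro ⟨hp, hσ⟩
        have := (mem_hypSphere_isometry h zero_mem_hypBall hσ.1).2 hσ
        rwa [h.right_inv p hp] at this
      · intro hp
        have hσ : σ p ∈ hypBall F m := h.isometry_inv.bijOn.mapsTo hp.1
        refine ⟨hp.1, (mem_hypSphere_isometry h zero_mem_hypBall hσ).1 ?_⟩
        rwa [h.right_inv p hp.1]
    · intro N _ _ _ _ _ _ f o' ho' hf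
      exact classification_of_center hO hn hn2 hc rfl le_rfl (fun _ _ _ => rfl)
        (fun hlt => absurd hlt (lt_irrefl _)) h ho' hf
  · refine ⟨fun l => cylIsometry τ 0 '' catenoid F m c k r l, fun l hl => ?_,
      fun heq => absurd heq (by omega), fun _ l hl => ?_,
      isEmbeddedCompleteRotationalRMinimal_hyperplane hO hn hc _ _, ?_⟩
    · exact (isEmbeddedCompleteRotationalRMinimal_rotMap
        (isProfile_catenoid hc hlt _) hO hn hc rfl hrk).image_cylIsometry hO hc
          zero_mem_hypBall h 0
    · exact (isCatenoidType_catenoid hO hc hlt hl).image_cylIsometry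
        (fun q hq => ⟨mem_hypBall_of_mem_catenoid hq, mem_univ _⟩) zero_mem_hypBall h
    · intro N _ _ _ _ _ _ f o' ho' hf
      exact classification_of_center hO hn hn2 hc rfl hrk (fun heq => absurd heq hlt.ne)
        (fun _ _ => rfl) h ho' hf
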